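/- **Setting.** Let $k$ be a field and $A$ a finite dimensional Frobenius $k$-algebra: it carries a non-degenerate bilinear form with $\langle ab,c\rangle=\langle a,bc\rangle$. Let $\nu$ be its Nakayama automorphism, $\langle a,b\rangle=\langle b,\nu(a)\rangle$, and assume that $\nu$ is diagonalizable. Let $(u_j)$ be a basis of $A$ and $(v_j)$ the dual basis, $\langle v_i,u_j\rangle=\delta_{ij}$. Put $\overline A=A/k\cdot 1$, write $\overline a_{i,j}=\overline a_i\otimes\cdots\otimes\overline a_j$, let $\mathrm{Bar}_p(A)=A\otimes\overline A^{\otimes p}\otimes A$ be the normalized bar resolution with differentials $d_p:\mathrm{Bar}_p(A)\to\mathrm{Bar}_{p-1}(A)$, and $\overline\Omega^p(A)=\mathrm{Im}\,d_p$ for $p\ge1$. Write $d$ for any $d_p$. **Ext and the bracket $[\ ,\ ]_{\rm sg}$.** For $p\ge 1$ let $C^m(A,\overline\Omega^p(A))=\mathrm{Hom}_k(\overline A^{\otimes m},\overline\Omega^p(A))$ be the normalized Hochschild complex, with differential $$\delta f(\overline a_{1,m+1})=a_1f(\overline a_{2,m+1})+\sum_{i=1}^m(-1)^if(\overline a_{1,i-1}\otimes\overline{a_ia_{i+1}}\otimes\overline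 a_{i+2,m+1})+(-1)^{m+1}f(\overline a_{1,m})a_{m+1};$$ its cohomology is $\mathrm{Ext}^m_{A^{\rm e}}(A,\overline\Omega^p(A))$. For a cochain $f$ with values in $\overline\Omega^p(A)\subset A\otimes\overline A^{\otimes (p-1)}\otimes A$ let $f^{(r)}$ and $f^{(b)}$ be its compositions with the projections to $A\otimes\overline A^{\otimes p}$ and to $\overline A^{\otimes(p+1)}$. For $m,p,n,q\ge1$, $f\in C^m(A,\overline\Omega^p(A))$ and $g\in C^n(A,\overline\Omega^q(A))$ put $$f\bullet_i g=d\big((f^{(r)}\otimes\mathrm{id}^{\otimes q})(\mathrm{id}^{\otimes i-1}\otimes g^{(b)}\otimes\mathrm{id}^{\otimes m-i})\otimes1\big)\quad(1\le i\le m),$$ $$f\bullet_{-i} g=d\big((\mathrm{id}_A\otimes\mathrm{id}^{\otimes i-1}\otimes f^{(b)}\otimes\mathrm{id}^{\otimes q-i})(g^{(r)}\otimes\mathrm{id}^{\otimes m-1})\otimes1\big)\quad(1\le i\le q),$$ $$f\bullet g=\sum_{i=1}^m(-1)^{p+q+(i-1)(q-n-1)}f\bullet_ig+\sum_{i=1}^q(-1)^{p+q+i(m-p-1)}f\bullet_{-i}g,$$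 $$[f,g]_{\rm sg}=f\bullet g-(-1)^{(m-p-1)(n-q-1)}g\bullet f\in C^{m+n-1}(A,\overline\Omega^{p+q}(A)).$$ **Tate–Hochschild cohomology in negative degrees.** For $m\ge1$, $\underline{\mathrm{Ext}}^{-m}_{A^{\rm e}}(A,A)$ is the colimit over $l\ge0$ of $\mathrm{Ext}^l_{A^{\rm e}}(A,\overline\Omega^{m+l}(A))$ along the maps $\varphi$, where $\varphi=\theta$ for $l=0$ and $\varphi=(-1)^m\theta$ for $l>0$, and $\theta$ is the connecting homomorphism, on cochains $\theta(f)(\overline b_{1,l+1})=(-1)^l d(f(\overline b_{1,l})\otimes\overline b_{l+1}\otimes1)$. **Complete cohomology in negative degrees.** $A_{\nu^{-1}}$ is $A$ with the right action twisted by $\nu^{-1}$, and $C_r(A,A_{\nu^{-1}})=A\otimes\overline A^{\otimes r}$ with $$\partial_{r+1}(a_0\otimes\overline a_{1,r+1})=a_0\nu^{-1}(a_1)\otimes\overline a_{2,r+1}+\sum_{i=1}^{r}(-1)^ia_0\otimes\overline a_{1,i-1}\otimes\overline{a_ia_{i+1}}\otimes\overline a_{i+2,r+1}+(-1)^{r+1}a_{r+1}a_0\otimes\overline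 a_{1,r}.$$ The complete complex $\mathcal D^\bullet(A,A)$ is $\cdots\to C_1(A,A_{\nu^{-1}})\to A_{\nu^{-1}}\xrightarrow{\ \mu\ }A\to\cdots$ with $C_r(A,A_{\nu^{-1}})$ in degree $-(r+1)$ and $\mu(x)=\sum_ju_jxv_j$. So $\widehat{\mathrm{HH}}^{-m}(A)=\mathrm{Tor}^{A^{\rm e}}_{m-1}(A,A_{\nu^{-1}})$ for $m\ge2$, and $\widehat{\mathrm{HH}}^{-1}(A)$ is the kernel of the map induced by $\mu$ on $\mathrm{Tor}_0^{A^{\rm e}}(A,A_{\nu^{-1}})$. The weight-one subcomplex $\mathcal D_{(1)}$ is spanned in degree $-(r+1)$ by the $a_0\otimes\overline a_{1,r}$ with $a_i$ an eigenvector of $\nu$ for an eigenvalue $\mu_i$ and $\mu_0\mu_1\cdots\mu_r=1$; its cohomology is $\widehat{\mathrm{HH}}_{(1)}^{-m}(A)$. On chains let $$B^{\nu^{-1}}(a_0\otimes\overline a_{1,r})=\sum_{i=1}^{r+1}(-1)^{ir}\,1\otimes\overline a_{i,r}\otimes\overline a_0\otimes\overline{\nu^{-1}(a_1)}\otimes\cdots\otimes\overline{\nu^{-1}(a_{i-1})},$$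 $$(a_0\otimes\overline a_{1,p})\star(b_0\otimes\overline b_{1,q})=\sum_jv_jb_0\otimes\overline b_{1,q}\otimes\overline{u_j\nu(a_0)}\otimes\overline a_{1,p},$$ $$\{w,z\}=(-1)^{|w||z|+|w|+|z|}\big((-1)^{|z|+1}B^{\nu^{-1}}(w\star z)+B^{\nu^{-1}}(w)\star z+(-1)^{|z|}w\star B^{\nu^{-1}}(z)\big),$$ $$\kappa_{r,1}(a_0\otimes\overline a_{1,r})(\overline b_1)=\sum_jd(u_j\nu(a_0)\otimes\overline a_{1,r}\otimes\overline v_j\otimes\overline b_1\otimes1),$$ where $|w|=-(r+1)$ for $w\in C_r(A,A_{\nu^{-1}})$. **Proposition.** For all $m,n\ge1$: 1. the inclusion of chains, $\kappa_{m-1,1}$, and the canonical map into the colimit induce well-defined isomorphisms $$\widehat{\mathrm{HH}}_{(1)}^{-m}(A)\xrightarrow{\cong}\widehat{\mathrm{HH}}^{-m}(A)\xrightarrow[\kappa_{m-1,1}]{\cong}\mathrm{Ext}^1_{A^{\rm e}}(A,\overline\Omega^{m+1}(A))\xrightarrow{\cong}\underline{\mathrm{Ext}}^{-m}_{A^{\rm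 e}}(A,A);$$ 2. $\{\ ,\ \}$ induces a well-defined bilinear map $\widehat{\mathrm{HH}}_{(1)}^{-m}(A)\otimes\widehat{\mathrm{HH}}_{(1)}^{-n}(A)\to\widehat{\mathrm{HH}}_{(1)}^{-m-n-1}(A)$; $[\ ,\ ]_{\rm sg}$ induces a well-defined bilinear map $\mathrm{Ext}^1_{A^{\rm e}}(A,\overline\Omega^{m+1}(A))\otimes\mathrm{Ext}^1_{A^{\rm e}}(A,\overline\Omega^{n+1}(A))\to\mathrm{Ext}^1_{A^{\rm e}}(A,\overline\Omega^{m+n+2}(A))$ and, through cocycles of all positive levels $l,l'\ge1$ of the colimits, a well-defined bilinear map $\underline{\mathrm{Ext}}^{-m}_{A^{\rm e}}(A,A)\otimes\underline{\mathrm{Ext}}^{-n}_{A^{\rm e}}(A,A)\to\underline{\mathrm{Ext}}^{-m-n-1}_{A^{\rm e}}(A,A)$; 3. the isomorphisms of (1) transform these brackets into each other, that is, both squares of the diagram $$\begin{array}{ccc} \widehat{\mathrm{HH}}_{(1)}^{-m}(A)\otimes\widehat{\mathrm{HH}}_{(1)}^{-n}(A)&\xrightarrow{\{\ ,\ \}}&\widehat{\mathrm{HH}}_{(1)}^{-m-n-1}(A)\\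 \downarrow{\scriptstyle\cong}&&\downarrow{\scriptstyle\cong}\\ \mathrm{Ext}^1_{A^{\rm e}}(A,\overline\Omega^{m+1}(A))\otimes\mathrm{Ext}^1_{A^{\rm e}}(A,\overline\Omega^{n+1}(A))&\xrightarrow{[\ ,\ ]_{\rm sg}}&\mathrm{Ext}^1_{A^{\rm e}}(A,\overline\Omega^{m+n+2}(A))\\ \downarrow{\scriptstyle\cong}&&\downarrow{\scriptstyle\cong}\\ \underline{\mathrm{Ext}}^{-m}_{A^{\rm e}}(A,A)\otimes\underline{\mathrm{Ext}}^{-n}_{A^{\rm e}}(A,A)&\xrightarrow{[\ ,\ ]_{\rm sg}}&\underline{\mathrm{Ext}}^{-m-n-1}_{A^{\rm e}}(A,A) \end{array}$$ commute. -/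

import Mathlib

open scoped TensorProduct

noncomputable section

namespace TateHochschild

universe u v

/-! ### Tensor powers of `Ā = A / k·1` -/

section Words

variable (k : Type u) (A : Type v) [Field k] [Ring A] [Algebra k A]

/-- The quotient space `Ā = A / k·1`. -/
abbrev ABar : Type v := A ⧸ Submodule.span k {(1 : A)}

/-- The canonical projection `π : A → Ā`. -/
abbrev proj : A →ₗ[k] ABar k A := Submodule.mkQ _

/-- A `k`-linear section of `π`. It is used to write down the (normalized) differentials below: the
individual summands of these differentials depend on representatives in `A` of elements of `Ā`, the
alternating sums do not. -/
def sec : ABar k A →ₗ[k] A :=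
  Classical.choose ((proj k A).exists_rightInverse_of_surjective (Submodule.range_mkQ _))

theorem proj_comp_sec : proj k A ∘ₗ sec k A = LinearMap.id :=
  Classical.choose_spec ((proj k A).exists_rightInverse_of_surjective (Submodule.range_mkQ _))

/-- The tensor power `Ā^{⊗n}`. -/
abbrev TP (n : ℕ) : Type (max u v) := TensorPower k n (ABar k A)

variable {k A}

/-- Concatenation `Ā^{⊗a} ⊗ Ā^{⊗b} ≅ Ā^{⊗n}` for `a + b = n`. -/
def conc {a b n : ℕ} (h : a + b = n) : TP k A a ⊗[k] TP k A b ≃ₗ[k] TP k A n :=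
  TensorPower.mulEquiv.trans (TensorPower.cast k (ABar k A) h)

/-- `Ā ≅ Ā^{⊗1}`. -/
def letter : ABar k A ≃ₗ[k] TP k A 1 :=
  (PiTensorProduct.subsingletonEquiv (s := fun _ : Fin 1 => ABar k A) (0 : Fin 1)).symm

/-- `Ā ⊗ Ā^{⊗r} ≅ Ā^{⊗(r+1)}`, splitting off the first letter. -/
def cons (r : ℕ) : ABar k A ⊗[k] TP k A r ≃ₗ[k] TP k A (r + 1) :=
  (TensorProduct.congr letter (LinearEquiv.refl k _)).trans (conc (Nat.add_comm 1 r))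

/-- `Ā^{⊗r} ⊗ Ā ≅ Ā^{⊗(r+1)}`, splitting off the last letter. -/
def snoc (r : ℕ) : TP k A r ⊗[k] ABar k A ≃ₗ[k] TP k A (r + 1) :=
  (TensorProduct.congr (LinearEquiv.refl k _) letter).trans (conc rfl)

/-- The map `id^{⊗i} ⊗ g ⊗ id^{⊗j} : Ā^{⊗N} → Ā^{⊗M}` for `g : Ā^{⊗a} → Ā^{⊗b}`. -/
def mid {a b N M : ℕ} (g : TP k A a →ₗ[k] TP k A b) (i j : ℕ)
    (hN : i + a + j = N) (hM : i + b + j = M) : TP k A N →ₗ[k] TP k A M :=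
  (conc hM).toLinearMap ∘ₗ
    LinearMap.rTensor (TP k A j)
      ((conc rfl).toLinearMap ∘ₗ LinearMap.lTensor (TP k A i) g ∘ₗ (conc rfl).symm.toLinearMap) ∘ₗ
    (conc hN).symm.toLinearMap

/-- For `F : Ā^{⊗m} → A ⊗ Ā^{⊗p}`, the map `F ⊗ id^{⊗q} : Ā^{⊗N} → A ⊗ Ā^{⊗M}`. -/
def extR {m p N M : ℕ} (F : TP k A m →ₗ[k] A ⊗[k] TP k A p) (q : ℕ)
    (hN : m + q = N) (hM : p + q = M) : TP k A N →ₗ[k] A ⊗[k] TP k A M :=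
  LinearMap.lTensor A (conc hM).toLinearMap ∘ₗ
    (TensorProduct.assoc k A (TP k A p) (TP k A q)).toLinearMap ∘ₗ
    LinearMap.rTensor (TP k A q) F ∘ₗ (conc hN).symm.toLinearMap

/-- For `y ∈ A ⊗ Ā^{⊗a}`, the map `Ā^{⊗b} → A ⊗ Ā^{⊗n}`, `x ↦ y ⊗ x`. -/
def appendR {a b n : ℕ} (h : a + b = n) (y : A ⊗[k] TP k A a) : TP k A b →ₗ[k] A ⊗[k] TP k A n :=
  LinearMap.lTensor A (conc h).toLinearMap ∘ₗ
    (TensorProduct.assoc k A (TP k A a) (TP k A b)).toLinearMap ∘ₗ TensorProduct.mk k _ _ y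

variable (k A)

/-- The multiplication `A ⊗ Ā → A`, through the chosen section. -/
def mulL : A ⊗[k] ABar k A →ₗ[k] A := LinearMap.mul' k A ∘ₗ LinearMap.lTensor A (sec k A)

/-- The multiplication `Ā ⊗ A → A`, through the chosen section. -/
def mulR : ABar k A ⊗[k] A →ₗ[k] A := LinearMap.mul' k A ∘ₗ LinearMap.rTensor A (sec k A)

/-- `ā ⊗ b̄ ↦ \overline{ab}`, through the chosen section. -/
def mulBar : TP k A 2 →ₗ[k] TP k A 1 :=
  letter.toLinearMap ∘ₗ proj k A ∘ₗ mulL k A ∘ₗ LinearMap.rTensor (ABar k A) (sec k A) ∘ₗ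
    (TensorProduct.congr letter letter).symm.toLinearMap ∘ₗ
    (conc (show 1 + 1 = 2 from rfl)).symm.toLinearMap

/-- `ā₁ ⊗ ⋯ ⊗ ā_{r+1} ↦ ∑_{i=1}^{r} (-1)^i ā₁ ⊗ ⋯ ⊗ \overline{a_i a_{i+1}} ⊗ ⋯ ⊗ ā_{r+1}`. -/
def inner (r : ℕ) : TP k A (r + 1) →ₗ[k] TP k A r :=
  ∑ i : Fin r, (-1 : k) ^ ((i : ℕ) + 1) •
    mid (mulBar k A) i (r - 1 - i) (by have := i.isLt; omega) (by have := i.isLt; omega)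

/-! ### The normalized bar resolution and the bimodules `Ω̄^p(A)` -/

/-- `Bar_r(A) = A ⊗ Ā^{⊗r} ⊗ A`. -/
abbrev Bar (r : ℕ) : Type (max u v) := A ⊗[k] (TP k A r ⊗[k] A)

/-- The differential `d_{r+1} : Bar_{r+1}(A) → Bar_r(A)`. -/
def d (r : ℕ) : Bar k A (r + 1) →ₗ[k] Bar k A r :=
  LinearMap.rTensor (TP k A r ⊗[k] A) (mulL k A) ∘ₗ
      (TensorProduct.assoc k A (ABar k A) (TP k A r ⊗[k] A)).symm.toLinearMap ∘ₗ
      LinearMap.lTensor A ((TensorProduct.assoc k (ABar k A) (TP k A r) A).toLinearMap ∘ₗ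
        LinearMap.rTensor A (cons r).symm.toLinearMap)
    + LinearMap.lTensor A (LinearMap.rTensor A (inner k A r))
    + (-1 : k) ^ (r + 1) •
      LinearMap.lTensor A (LinearMap.lTensor (TP k A r) (mulR k A) ∘ₗ
        (TensorProduct.assoc k (TP k A r) (ABar k A) A).toLinearMap ∘ₗ
        LinearMap.rTensor A (snoc r).symm.toLinearMap)

/-- `Omega r` is the sub-bimodule `Ω̄^{r+1}(A) = Im d_{r+1}` of `Bar_r(A)`. -/
def Omega (r : ℕ) : Submodule k (Bar k A r) := LinearMap.range (d k A r)

/-- `A ⊗ Ā^{⊗r} → Bar_r(A)`, `x ↦ x ⊗ 1`. -/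
def close (r : ℕ) : A ⊗[k] TP k A r →ₗ[k] Bar k A r :=
  LinearMap.lTensor A ((TensorProduct.mk k (TP k A r) A).flip 1)

/-- The left action `a ⊗ x ↦ a x` of `A` on `Bar_p(A)`. -/
def lAct (p : ℕ) : A ⊗[k] Bar k A p →ₗ[k] Bar k A p :=
  LinearMap.rTensor (TP k A p ⊗[k] A) (LinearMap.mul' k A) ∘ₗ
    (TensorProduct.assoc k A A (TP k A p ⊗[k] A)).symm.toLinearMap

/-- The right action `x ⊗ a ↦ x a` of `A` on `Bar_p(A)`. -/
def rAct (p : ℕ) : Bar k A p ⊗[k] A →ₗ[k] Bar k A p :=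
  LinearMap.lTensor A (LinearMap.lTensor (TP k A p) (LinearMap.mul' k A) ∘ₗ
      (TensorProduct.assoc k (TP k A p) A A).toLinearMap) ∘ₗ
    (TensorProduct.assoc k A (TP k A p ⊗[k] A) A).toLinearMap

/-! ### Hochschild cohomology with coefficients in `Ω̄^{p+1}(A)` -/

/-- The Hochschild cochains `C^m(A, Bar_p(A)) = Hom(Ā^{⊗m}, Bar_p(A))`. -/
abbrev Cochain (m p : ℕ) : Type (max u v) := TP k A m →ₗ[k] Bar k A p

/-- The Hochschild differential
`δ(f)(ā_{1,m+1}) = a₁ f(ā_{2,m+1}) + ∑_{i=1}^m (-1)^i f(… \overline{a_i a_{i+1}} …)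
  + (-1)^{m+1} f(ā_{1,m}) a_{m+1}`. -/
def delta (m p : ℕ) : Cochain k A m p →ₗ[k] Cochain k A (m + 1) p where
  toFun f :=
    lAct k A p ∘ₗ TensorProduct.map (sec k A) f ∘ₗ (cons m).symm.toLinearMap
      + f ∘ₗ inner k A m
      + (-1 : k) ^ (m + 1) •
        (rAct k A p ∘ₗ TensorProduct.map f (sec k A) ∘ₗ (snoc m).symm.toLinearMap)
  map_add' f g := by
    simp only [TensorProduct.map_add_right, TensorProduct.map_add_left, LinearMap.add_comp,
      LinearMap.comp_add, smul_add]
    abel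
  map_smul' c f := by
    simp only [TensorProduct.map_smul_right, TensorProduct.map_smul_left, LinearMap.smul_comp,
      LinearMap.comp_smul, smul_add, RingHom.id_apply, smul_comm c]

/-- `C^m(A, Ω̄^{p+1}(A))`: the cochains with values in `Ω̄^{p+1}(A)`. -/
def omegaCochains (m p : ℕ) : Submodule k (Cochain k A m p) where
  carrier := {f | ∀ x, f x ∈ Omega k A p}
  add_mem' hf hg x := add_mem (hf x) (hg x)
  zero_mem' _ := zero_mem _
  smul_mem' c _ hf x := Submodule.smul_mem _ c (hf x)

/-- The `m`-cocycles of `C^•(A, Ω̄^{p+1}(A))`. -/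
def extZ (m p : ℕ) : Submodule k (Cochain k A m p) :=
  omegaCochains k A m p ⊓ LinearMap.ker (delta k A m p)

/-- The `m`-coboundaries of `C^•(A, Ω̄^{p+1}(A))`. -/
def extB : (m p : ℕ) → Submodule k (Cochain k A m p)
  | 0, _ => ⊥
  | m + 1, p => (omegaCochains k A m p).map (delta k A m p)

end Words

/-! ### Subquotients and induced maps -/

section Subquotients

variable {k : Type u} [Field k]
  {V : Type*} [AddCommGroup V] [Module k V] {V' : Type*} [AddCommGroup V'] [Module k V']
  {W : Type*} [AddCommGroup W] [Module k W]

/-- The quotient of the space `Z` of cycles by the space `B` of boundaries. -/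
def Subquot (Z B : Submodule k V) : Type _ := Z ⧸ B.submoduleOf Z

instance (Z B : Submodule k V) : AddCommGroup (Subquot Z B) :=
  inferInstanceAs (AddCommGroup (Z ⧸ B.submoduleOf Z))

instance (Z B : Submodule k V) : Module k (Subquot Z B) :=
  inferInstanceAs (Module k (Z ⧸ B.submoduleOf Z))

/-- The class of a cycle. -/
def cls {Z B : Submodule k V} (z : V) (hz : z ∈ Z) : Subquot Z B := 
  Submodule.Quotient.mk (p := B.submoduleOf Z) ⟨z, hz⟩

/-- `φ` is induced by the map `f` on cycles. -/
def Induces {Z B : Submodule k V} {Z' B' : Submodule k W} (φ : Subquot Z B →ₗ[k] Subquot Z' B')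
    (f : V → W) : Prop :=
  ∀ z (hz : z ∈ Z), ∃ h : f z ∈ Z', φ (cls z hz) = cls (f z) h

/-- `φ` is induced by the operation `f` on cycles. -/
def Induces₂ {Z₁ B₁ : Submodule k V} {Z₂ B₂ : Submodule k V'} {Z' B' : Submodule k W}
    (φ : Subquot Z₁ B₁ →ₗ[k] Subquot Z₂ B₂ →ₗ[k] Subquot Z' B') (f : V → V' → W) : Prop :=
  ∀ x (hx : x ∈ Z₁) y (hy : y ∈ Z₂), ∃ h : f x y ∈ Z', φ (cls x hx) (cls y hy) = cls (f x y) h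

end Subquotients

section Ext

variable (k : Type u) (A : Type v) [Field k] [Ring A] [Algebra k A]

/-- `Ext^m_{A^e}(A, Ω̄^{p+1}(A))`, computed as Hochschild cohomology `H^m(A, Ω̄^{p+1}(A))`. -/
abbrev ExtOmega (m p : ℕ) : Type _ := Subquot (V := Cochain k A m p) (extZ k A m p) (extB k A m p)

/-! ### The bracket `[ , ]_sg` -/

variable {k A}

/-- The projection `π^{(r)} : A ⊗ Ā^{⊗p} ⊗ A → A ⊗ Ā^{⊗(p+1)}`. -/
def piR (p : ℕ) : Bar k A p →ₗ[k] A ⊗[k] TP k A (p + 1) :=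
  LinearMap.lTensor A ((snoc p).toLinearMap ∘ₗ LinearMap.lTensor (TP k A p) (proj k A))

/-- The projection `π^{(b)} : A ⊗ Ā^{⊗p} ⊗ A → Ā^{⊗(p+2)}`. -/
def piB (p : ℕ) : Bar k A p →ₗ[k] TP k A (p + 2) :=
  (cons (p + 1)).toLinearMap ∘ₗ LinearMap.rTensor (TP k A (p + 1)) (proj k A) ∘ₗ piR p

/-- `f ∙_i g`, `1 ≤ i ≤ m+1`, for `f ∈ C^{m+1}(A, Ω̄^{p+1}(A))` and `g ∈ C^{n+1}(A, Ω̄^{q+1}(A))`: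
`d((f^{(r)} ⊗ id^{⊗(q+1)})(id^{⊗(i-1)} ⊗ g^{(b)} ⊗ id^{⊗(m+1-i)}) ⊗ 1)`. The argument `i : Fin (m+1)`
is the index `i - 1`. -/
def bulletPos {m p n q L N : ℕ} (hL : m + n + 1 = L) (hN : p + q + 1 = N)
    (f : Cochain k A (m + 1) p) (g : Cochain k A (n + 1) q) (i : Fin (m + 1)) : Cochain k A L N :=
  d k A N ∘ₗ close k A (N + 1) ∘ₗ
    extR (N := m + 1 + (q + 1)) (piR p ∘ₗ f) (q + 1) rfl (by omega) ∘ₗ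
    mid (piB q ∘ₗ g) i (m - i) (by have := i.isLt; omega) (by have := i.isLt; omega)

/-- `f ∙_{-i} g`, `1 ≤ i ≤ q+1`, for `f ∈ C^{m+1}(A, Ω̄^{p+1}(A))` and
`g ∈ C^{n+1}(A, Ω̄^{q+1}(A))`:
`d((id_A ⊗ id^{⊗(i-1)} ⊗ f^{(b)} ⊗ id^{⊗(q+1-i)})(g^{(r)} ⊗ id^{⊗m}) ⊗ 1)`. The argument
`i : Fin (q+1)` is the index `i - 1`. -/
def bulletNeg {m p n q L N : ℕ} (hL : m + n + 1 = L) (hN : p + q + 1 = N)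
    (f : Cochain k A (m + 1) p) (g : Cochain k A (n + 1) q) (i : Fin (q + 1)) : Cochain k A L N :=
  d k A N ∘ₗ close k A (N + 1) ∘ₗ
    LinearMap.lTensor A (mid (N := q + 1 + m) (piB p ∘ₗ f) i (q - i)
      (by have := i.isLt; omega) (by have := i.isLt; omega)) ∘ₗ
    extR (piR q ∘ₗ g) m (by omega) rfl

/-- `f ∙ g` for `f ∈ C^{m'}(A, Ω̄^{p'}(A))`, `g ∈ C^{n'}(A, Ω̄^{q'}(A))`, where `m' = m+1`, `p' = p+1`,
`n' = n+1`, `q' = q+1`: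
`∑_{i=1}^{m'} (-1)^{p'+q'+(i-1)(q'-n'-1)} f ∙_i g + ∑_{i=1}^{q'} (-1)^{p'+q'+i(m'-p'-1)} f ∙_{-i} g`.
-/
def bullet {m p n q L N : ℕ} (hL : m + n + 1 = L) (hN : p + q + 1 = N)
    (f : Cochain k A (m + 1) p) (g : Cochain k A (n + 1) q) : Cochain k A L N :=
  let m' : ℤ := m + 1
  let p' : ℤ := p + 1
  let n' : ℤ := n + 1
  let q' : ℤ := q + 1
  ∑ i : Fin (m + 1), (p' + q' + (i : ℕ) * (q' - n' - 1)).negOnePow • bulletPos hL hN f g i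
    + ∑ i : Fin (q + 1),
        (p' + q' + ((i : ℕ) + 1) * (m' - p' - 1)).negOnePow • bulletNeg hL hN f g i

/-- `[f, g]_sg = f ∙ g - (-1)^{(m'-p'-1)(n'-q'-1)} g ∙ f` in `C^{m'+n'-1}(A, Ω̄^{p'+q'}(A))`, for
`f ∈ C^{m'}(A, Ω̄^{p'}(A))` and `g ∈ C^{n'}(A, Ω̄^{q'}(A))`, where `m' = m+1`, `p' = p+1`,
`n' = n+1`, `q' = q+1`. -/
def bracketSg {m p n q L N : ℕ} (hL : m + n + 1 = L) (hN : p + q + 1 = N)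
    (f : Cochain k A (m + 1) p) (g : Cochain k A (n + 1) q) : Cochain k A L N :=
  let m' : ℤ := m + 1
  let p' : ℤ := p + 1
  let n' : ℤ := n + 1
  let q' : ℤ := q + 1
  bullet hL hN f g -
    ((m' - p' - 1) * (n' - q' - 1)).negOnePow • bullet (by omega) (by omega) g f

/-! ### Tate-Hochschild cohomology in negative degrees -/

/-- The connecting homomorphism `θ : Ext^l(A, Ω̄^{p+1}(A)) → Ext^{l+1}(A, Ω̄^{p+2}(A))` on cochains:
`θ(f)(b̄_{1,l+1}) = (-1)^l d(f(b̄_{1,l}) ⊗ b̄_{l+1} ⊗ 1)`. -/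
def theta (l p : ℕ) (f : Cochain k A l p) : Cochain k A (l + 1) (p + 1) :=
  (-1 : k) ^ l • (d k A (p + 1) ∘ₗ close k A (p + 2) ∘ₗ extR (piR p ∘ₗ f) 1 rfl rfl)

/-- The transition maps, in degree `-(r+1)`, from `Ext^l(A, Ω̄^{r+1+l}(A))` to
`Ext^{l+1}(A, Ω̄^{r+2+l}(A))`: the map `θ` for `l = 0` and `(-1)^{r+1} θ` for `l > 0`. -/
def phi (r l : ℕ) (f : Cochain k A l (r + l)) : Cochain k A (l + 1) (r + (l + 1)) :=
  (if l = 0 then 1 else (-1 : k) ^ (r + 1)) • theta l (r + l) f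

variable (k A)

/-- The direct sum over `l ≥ 0` of the spaces of cochains `C^l(A, Bar_{r+l}(A))`. -/
abbrev TateSum (r : ℕ) : Type _ := DirectSum ℕ fun l => Cochain k A l (r + l)

instance (r : ℕ) : AddCommGroup (TateSum k A r) :=
  DirectSum.instAddCommGroup (β := fun l => Cochain k A l (r + l))

variable {k A} in
/-- The inclusion of the `l`-th summand. -/
abbrev inc (r l : ℕ) : Cochain k A l (r + l) →ₗ[k] TateSum k A r :=
  DirectSum.lof k ℕ (fun l => Cochain k A l (r + l)) l

/-- The direct sum over `l ≥ 0` of the cocycles of `C^l(A, Ω̄^{r+1+l}(A))`. -/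
def tateZ (r : ℕ) : Submodule k (TateSum k A r) := ⨆ l, (extZ k A l (r + l)).map (inc r l)

/-- The relations of the colimit: coboundaries, and the identification of a cocycle `f` with its
image `φ(f)` under the transition map. -/
def tateB (r : ℕ) : Submodule k (TateSum k A r) :=
  (⨆ l, (extB k A l (r + l)).map (inc r l)) ⊔
    Submodule.span k {x | ∃ l, ∃ f ∈ extZ k A l (r + l), x = inc r l f - inc r (l + 1) (phi r l f)}

/-- The Tate-Hochschild cohomology group of `A` in degree `-(r+1)`, as the colimit of the groups
`Ext^l_{A^e}(A, Ω̄^{r+1+l}(A))`, `l ≥ 0`, along the maps `φ`. -/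
abbrev Tate (r : ℕ) : Type _ := Subquot (V := TateSum k A r) (tateZ k A r) (tateB k A r)

end Ext

/-! ### Frobenius algebras and complete cohomology in negative degrees -/

/-- An associative non-degenerate bilinear form on `A`. -/
structure FrobeniusForm (k : Type u) (A : Type v) [Field k] [Ring A] [Algebra k A] where
  /-- the form `⟨ , ⟩` -/
  form : LinearMap.BilinForm k A
  assoc : ∀ a b c, form (a * b) c = form a (b * c)
  nondegenerate : form.Nondegenerate

/-- `ν` is the Nakayama automorphism: `⟨a, b⟩ = ⟨b, ν(a)⟩`. -/
def IsNakayama {k : Type u} {A : Type v} [Field k] [Ring A] [Algebra k A]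
    (F : FrobeniusForm k A) (ν : A ≃ₐ[k] A) : Prop :=
  ∀ a b, F.form a b = F.form b (ν a)

section Chains

variable {k : Type u} {A : Type v} [Field k] [Ring A] [Algebra k A]

variable (k A) in
/-- The Hochschild chains `C_r(A, A_σ) = A ⊗ Ā^{⊗r}`. -/
abbrev Chain (r : ℕ) : Type (max u v) := A ⊗[k] TP k A r

/-- The Hochschild differential `∂_{r+1} : C_{r+1}(A, A_σ) → C_r(A, A_σ)`:
`a₀σ(a₁) ⊗ ā_{2,r+1} + ∑_{i=1}^r (-1)^i a₀ ⊗ … \overline{a_i a_{i+1}} … + (-1)^{r+1} a_{r+1}a₀ ⊗ ā_{1,r}`.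
-/
def bd (σ : A ≃ₐ[k] A) (r : ℕ) : Chain k A (r + 1) →ₗ[k] Chain k A r :=
  LinearMap.rTensor (TP k A r)
      (LinearMap.mul' k A ∘ₗ LinearMap.lTensor A (σ.toLinearMap ∘ₗ sec k A)) ∘ₗ
      (TensorProduct.assoc k A (ABar k A) (TP k A r)).symm.toLinearMap ∘ₗ
      LinearMap.lTensor A (cons r).symm.toLinearMap
    + LinearMap.lTensor A (inner k A r)
    + (-1 : k) ^ (r + 1) •
      (LinearMap.rTensor (TP k A r) (mulR k A) ∘ₗ
        (TensorProduct.assoc k (ABar k A) A (TP k A r)).symm.toLinearMap ∘ₗ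
        (TensorProduct.comm k (Chain k A r) (ABar k A)).toLinearMap ∘ₗ
        (TensorProduct.assoc k A (TP k A r) (ABar k A)).symm.toLinearMap ∘ₗ
        LinearMap.lTensor A (snoc r).symm.toLinearMap)

/-- The map `Ā → Ā` induced by `σ`. -/
def barMap (σ : A ≃ₐ[k] A) : ABar k A →ₗ[k] ABar k A :=
  Submodule.mapQ _ _ σ.toLinearMap <| by
    rw [Submodule.span_le]
    rintro x rfl
    simp

/-- The twisted Connes operator `B^σ_r(a₀ ⊗ ā_{1,r}) =
∑_{i=1}^{r+1} (-1)^{ir} 1 ⊗ ā_{i,r} ⊗ ā₀ ⊗ \overline{σ(a₁)} ⊗ ⋯ ⊗ \overline{σ(a_{i-1})}`; the summation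
index `j` below is `i - 1`. -/
def connes (σ : A ≃ₐ[k] A) (r : ℕ) : Chain k A r →ₗ[k] Chain k A (r + 1) :=
  TensorProduct.mk k A (TP k A (r + 1)) 1 ∘ₗ
    ∑ j : Fin (r + 1), (-1 : k) ^ (((j : ℕ) + 1) * r) •
      ((conc (a := r - j) (b := j + 1) (by have := j.isLt; omega)).toLinearMap ∘ₗ
        (TensorProduct.comm k (TP k A (j + 1)) (TP k A (r - j))).toLinearMap ∘ₗ
        LinearMap.rTensor (TP k A (r - j)) ((cons (j : ℕ)).toLinearMap ∘ₗ
          TensorProduct.map (proj k A) (PiTensorProduct.map fun _ => barMap σ)) ∘ₗ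
        (TensorProduct.assoc k A (TP k A j) (TP k A (r - j))).symm.toLinearMap ∘ₗ
        LinearMap.lTensor A
          (conc (a := j) (b := r - j) (by have := j.isLt; omega)).symm.toLinearMap)

/-- The weight-one subspace `C_r^{(1)}(A, A_{ν⁻¹}) = ⨁ A_{μ₀} ⊗ Ā_{μ₁} ⊗ ⋯ ⊗ Ā_{μ_r}`, the sum over
all eigenvalues `μ₀, …, μ_r` of `ν` with product `1`. -/
def weightOne (ν : A ≃ₐ[k] A) (r : ℕ) : Submodule k (Chain k A r) :=
  Submodule.span k {x | ∃ (c₀ : k) (c : Fin r → k) (a₀ : A) (a : Fin r → A),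
    a₀ ∈ Module.End.eigenspace ν.toLinearMap c₀ ∧
    (∀ i, a i ∈ Module.End.eigenspace ν.toLinearMap (c i)) ∧
    c₀ * ∏ i, c i = 1 ∧
    x = a₀ ⊗ₜ[k] PiTensorProduct.tprod k fun i => proj k A (a i)}

end Chains

section Frobenius

variable {k : Type u} {A : Type v} [Field k] [Ring A] [Algebra k A] [FiniteDimensional k A]
  (F : FrobeniusForm k A)

/-- A basis `(u_i)` of `A`. -/
def dualU (i : Fin (Module.finrank k A)) : A := Module.finBasis k A i

/-- The dual basis `(v_i)`: `⟨v_i, u_j⟩ = δ_{ij}`. -/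
def dualV (i : Fin (Module.finrank k A)) : A :=
  F.form.dualBasis F.nondegenerate (Module.finBasis k A) i

theorem form_dualV_dualU (i j : Fin (Module.finrank k A)) :
    F.form (dualV F i) (dualU (k := k) j) = if i = j then 1 else 0 := by
  simp only [dualU, dualV, LinearMap.BilinForm.apply_dualBasis_left, eq_comm]

/-- The differential `μ : A_{ν⁻¹} → A`, `μ(m) = ∑ u_i m v_i`, of the complete complex. -/
def mu : Chain k A 0 →ₗ[k] A :=
  (∑ i, LinearMap.mulLeftRight k (dualU (k := k) i, dualV F i)) ∘ₗ
    (TensorProduct.rid k A).toLinearMap ∘ₗ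
    LinearMap.lTensor A (PiTensorProduct.isEmptyEquiv (Fin 0)).toLinearMap

variable (ν : A ≃ₐ[k] A)

/-- The cocycles of degree `-(r+1)` of the complete complex `𝒟(A, A)`
`⋯ → C₂(A, A_{ν⁻¹}) → C₁(A, A_{ν⁻¹}) → A_{ν⁻¹} → A → ⋯`. -/
def hatZ : (r : ℕ) → Submodule k (Chain k A r)
  | 0 => LinearMap.ker (mu F)
  | r + 1 => LinearMap.ker (bd ν.symm r)

/-- The complete cohomology `ĤH^{-(r+1)}(A)`; for `r ≥ 1` this is
`Tor_r^{A^e}(A, A_{ν⁻¹}) = H_r(A, A_{ν⁻¹})`, for `r = 0` it is the kernel of the map induced by `μ`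
on `Tor_0`. -/
abbrev HatHH (r : ℕ) : Type _ := Subquot (hatZ F ν r) (LinearMap.range (bd ν.symm r))

/-- `ĤH^{-(r+1)}_{(1)}(A)`, the cohomology of the weight-one subcomplex. -/
abbrev HatHH1 (r : ℕ) : Type _ :=
  Subquot (weightOne ν r ⊓ hatZ F ν r) ((weightOne ν (r + 1)).map (bd ν.symm r))

/-- `∑_j u_j ν(a₀) ⊗ ā_{1,r} ⊗ v̄_j` for the chain `x = a₀ ⊗ ā_{1,r}`. -/
def casimir (r : ℕ) (x : Chain k A r) : A ⊗[k] TP k A (r + 1) :=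
  ∑ j, TensorProduct.map (LinearMap.mulLeft k (dualU (k := k) j) ∘ₗ ν.toLinearMap)
    ((snoc r).toLinearMap ∘ₗ (TensorProduct.mk k (TP k A r) (ABar k A)).flip (proj k A (dualV F j))) x

/-- `κ_{r,p}(a₀ ⊗ ā_{1,r})(b̄_{1,p}) = ∑_j d(u_j ν(a₀) ⊗ ā_{1,r} ⊗ v̄_j ⊗ b̄_{1,p} ⊗ 1)`, a cochain in
`C^p(A, Ω̄^{r+1+p}(A))`. -/
def kappa (r p : ℕ) (x : Chain k A r) : Cochain k A p (r + p) :=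
  d k A (r + p) ∘ₗ close k A (r + p + 1) ∘ₗ appendR (by omega) (casimir F ν r x)

/-- The `⋆`-product in negative degrees: for `α = a₀ ⊗ ā_{1,p}` and `β = b₀ ⊗ b̄_{1,q}`,
`α ⋆ β = ∑_i v_i b₀ ⊗ b̄_{1,q} ⊗ \overline{u_i ν(a₀)} ⊗ ā_{1,p}`. -/
def star {p q n : ℕ} (h : p + q + 1 = n) (α : Chain k A p) (β : Chain k A q) : Chain k A n :=
  ∑ i, appendR (a := q) (b := p + 1) (by omega)
    (LinearMap.rTensor (TP k A q) (LinearMap.mulLeft k (dualV F i)) β)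
    (cons p (LinearMap.rTensor (TP k A p)
      (proj k A ∘ₗ LinearMap.mulLeft k (dualU (k := k) i) ∘ₗ ν.toLinearMap) α))

/-- The bracket `{w, z} = (-1)^{|w||z|+|w|+|z|} ((-1)^{|z|+1} B(w ⋆ z) + B(w) ⋆ z + (-1)^{|z|} w ⋆ B(z))`
with `B = B^{ν⁻¹}`, for `w ∈ C_r(A, A_{ν⁻¹})` of degree `|w| = -(r+1)` and `z ∈ C_s(A, A_{ν⁻¹})` of
degree `|z| = -(s+1)`. -/
def bracketBV {r s : ℕ} (w : Chain k A r) (z : Chain k A s) : Chain k A (r + s + 2) :=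
  let dw : ℤ := -(r + 1)
  let dz : ℤ := -(s + 1)
  (dw * dz + dw + dz).negOnePow •
    ((dz + 1).negOnePow • connes ν.symm (r + s + 1) (star F ν rfl w z)
      + star F ν (by omega) (connes ν.symm r w) z
      + dz.negOnePow • star F ν (by omega) w (connes ν.symm s z))

/-- The operator `Δ̂ = (-1)^{|w|} B^{ν⁻¹}` on chains of degree `|w| = -(r+1)`. -/
def hatDelta (r : ℕ) : Chain k A r →ₗ[k] Chain k A (r + 1) :=
  (-(r + 1) : ℤ).negOnePow • connes ν.symm r

theorem star_smul_left {p q n : ℕ} (h : p + q + 1 = n) (e : ℤˣ) (α : Chain k A p)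
    (β : Chain k A q) : star F ν h (e • α) β = e • star F ν h α β := by
  rcases Int.units_eq_one_or e with rfl | rfl
  · simp
  · simp [star, map_neg]

theorem star_smul_right {p q n : ℕ} (h : p + q + 1 = n) (e : ℤˣ) (α : Chain k A p)
    (β : Chain k A q) : star F ν h α (e • β) = e • star F ν h α β := by
  rcases Int.units_eq_one_or e with rfl | rfl
  · simp
  · have h' : ∀ {a b n : ℕ} (h : a + b = n) (y : A ⊗[k] TP k A a) (x : TP k A b),
        appendR h (-y) x = -appendR h y x := fun h y x => by
      rw [← neg_one_smul k y, ← neg_one_smul k (appendR h y x)]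
      simp only [appendR, LinearMap.comp_apply, map_smul, LinearMap.smul_apply]
    simp [star, map_neg, h']

/-- The bracket expressed through `Δ̂`, as
`(-1)^{|w||z|+|w|+|z|} ((-1)^{|w|+1} Δ̂(w ⋆ z) + (-1)^{|w|} Δ̂(w) ⋆ z + w ⋆ Δ̂(z))`. -/
theorem bracketBV_eq {r s : ℕ} (w : Chain k A r) (z : Chain k A s) :
    bracketBV F ν w z =
      ((-(r + 1) : ℤ) * (-(s + 1) : ℤ) + (-(r + 1) : ℤ) + (-(s + 1) : ℤ)).negOnePow •
        (((-(r + 1) : ℤ) + 1).negOnePow • hatDelta ν (r + s + 1) (star F ν rfl w z)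
          + (-(r + 1) : ℤ).negOnePow • star F ν (by omega) (hatDelta ν r w) z
          + star F ν (by omega) w (hatDelta ν s z)) := by
  have h1 : ((-(r + 1) : ℤ) + 1).negOnePow * (-((r + s + 1 : ℕ) + 1) : ℤ).negOnePow =
      ((-(s + 1) : ℤ) + 1).negOnePow := by
    rw [← Int.negOnePow_add, Int.negOnePow_eq_iff]
    refine ⟨-(r + 1), by push_cast; ring⟩
  have h2 : (-(r + 1) : ℤ).negOnePow * (-(r + 1) : ℤ).negOnePow = 1 := by
    rw [← Int.negOnePow_add, Int.negOnePow_even]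
    exact ⟨_, rfl⟩
  simp only [bracketBV, hatDelta, LinearMap.smul_apply, star_smul_left, star_smul_right, smul_smul,
    h1, h2, one_smul]

end Frobenius

end TateHochschild

end

open scoped TensorProduct

noncomputable section

namespace TateHochschild

universe u v

/-! ### Shortcuts for instance search -/

section Shortcuts

variable {R M N : Type*} [Field R] [AddCommMonoid M] [AddCommMonoid N] [Module R M]
  [Module R N]

/-! The isomorphisms. The exact sequences 0 → Ω^{p+2} → Bar_{p+1} → Ω^{p+1} → 0 of bimodules have θ
as connecting homomorphism. Since A is Frobenius, Bar_p(A) is coinduced as a left module, so its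
Hochschild cohomology vanishes in positive degrees (`delta_contract`). Hence θ is bijective between
positive degrees, which gives the isomorphism from level one to the colimit; from degree 0 it is
onto Ext¹, and its kernel is the image under d of the invariants of Bar_{p+1}(A). The Casimir
element ∑ u_j ⊗ v_j identifies the chains C_r(A, A_{ν⁻¹}) with the invariants of Bar_r(A); it
carries ∂ to d and, up to ν, μ to the augmentation (`gam_gamInv`, `d_gam`, `aug_gam`). As κ = θ ∘
`gam` (`kappa_eq_theta`), κ is an isomorphism. For weight one, let T be the automorphism of the
chains induced by ν⁻¹. The twisted Connes operator satisfies ∂B + B∂ = T - 1 (`bd_connes_succ`), the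
weight-one chains are the fixed space of T (`weightOne_eq`), and a cycle in another eigenspace of T
is a multiple of ∂B of itself.

The bracket on Ext. An element of Ω is determined by its projection π^{(r)} (`Omega_ext`), so a
cochain f may be replaced by F = π^{(r)} f. The circle products then become compositions of two
operators on A ⊗ T(Ā) ⊗ A: `opM` applies F to the first letters, `opLam` sums its applications over
all positions. The graded commutator of `opM` with the bar differential is `opM` of δf. That of
`opLam` consists of `opM`, of `opLam` of δf, and of a defect supported at the right end of the word;
in the bracket, on words of the critical length, the defects cancel. This is the Leibniz rule
(`dF_brOp`, `delta_bracketSg`). The bracket also commutes with θ up to the sign built into φ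
(`bracketSg_theta`). This settles coboundaries in degree one, where the Leibniz rule would require
cochains of degree zero, and it makes the bracket on the colimit independent of the levels.

The comparison. Let Λ_x insert the Casimir element of the chain x at all positions of a chain. On
cochains κ(x), κ(y) the bracket is exactly κ of a signed commutator of Λ_x y and Λ_y x
(`bracketSg_kappa`). To compare this with {x, y}, consider the sum over all rotations of a chain,
with an operator Θ applied to the part that moves to the back (`clo_dF_rot`). For Θ = id this yields
∂B + B∂ = T - 1; for Θ = Λ_x it relates B(y) ⋆ x, a rotated insertion of x and Λ_x y. Moreover B(x ⋆
y) is a sum of two rotated insertions (`rot_id_star`), and Λ_x makes ⋆ graded commutative up to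
boundaries (`clo_dF_insL`). Added up, {x, y} and the commutator of insertions differ by a boundary
for cycles x, y with Ty = y (`bracketBV_sub_insBracket_mem`). -/

theorem linearMapZeroHomClass : ZeroHomClass (M →ₗ[R] N) M N := inferInstance

theorem linearEquivZeroHomClass : ZeroHomClass (M ≃ₗ[R] N) M N := inferInstance

theorem linearMapAddMonoidHomClass : AddMonoidHomClass (M →ₗ[R] N) M N := inferInstance

theorem linearEquivAddMonoidHomClass : AddMonoidHomClass (M ≃ₗ[R] N) M N := inferInstance

theorem linearMapAddHomClass : AddHomClass (M →ₗ[R] N) M N := inferInstance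

theorem linearEquivAddHomClass : AddHomClass (M ≃ₗ[R] N) M N := inferInstance

/-- The coercion of linear maps to functions. -/
@[reducible]
def linearMapCoeFun : CoeFun (M →ₗ[R] N) fun _ => M → N := ⟨fun f => f⟩

end Shortcuts

attribute [local instance] linearMapZeroHomClass linearEquivZeroHomClass
  linearMapAddMonoidHomClass linearEquivAddMonoidHomClass linearMapAddHomClass
  linearEquivAddHomClass linearMapCoeFun

/-! ### Words in Ā inside the tensor algebra -/

section WordAlgebra

variable {k : Type u} {A : Type v} [Field k] [Ring A] [Algebra k A]

variable (k A) in
/-- The tensor algebra of `Ā`, in which all tensor powers `Ā^{⊗n}` are embedded. -/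
abbrev WordAlg : Type (max u v) := TensorAlgebra k (ABar k A)

variable (k A) in
/-- A letter `ā` as an element of the tensor algebra. -/
abbrev lett : ABar k A →ₗ[k] WordAlg k A := TensorAlgebra.ι k

/-- The embedding of `Ā^{⊗n}` into the tensor algebra. -/
def toWord {n : ℕ} : TP k A n →ₗ[k] WordAlg k A := TensorPower.toTensorAlgebra

/-- The empty word. -/
def emptyWord : TP k A 0 := PiTensorProduct.tprod k Fin.elim0

/-- Followed by the map to the graded direct sum, the embedding becomes the inclusion of the n-th
summand. Identities between tensor powers, with their casts and splittings of lengths, are therefore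
checked after `toWord`, where concatenation is an associative product. -/
theorem toWord_injective {n : ℕ} : Function.Injective (toWord : TP k A n → WordAlg k A) := by
  have h : ∀ x : TP k A n, TensorAlgebra.toDirectSum (toWord x) =
      DirectSum.lof k ℕ (fun n => TP k A n) n x := by
    intro x
    induction x using PiTensorProduct.induction_on with
    | smul_tprod c a =>
      rw [map_smul, map_smul, map_smul]
      simp only [toWord, TensorPower.toTensorAlgebra_tprod,
        TensorAlgebra.toDirectSum_tensorPower_tprod, DirectSum.lof_eq_of]
    | add x y hx hy => rw [map_add, map_add, map_add, hx, hy]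
  intro x y hxy
  refine DirectSum.of_injective (β := fun n => TP k A n) n ?_
  rw [← DirectSum.lof_eq_of k, ← DirectSum.lof_eq_of k, ← h, ← h, hxy]

@[simp]
theorem toWord_cast {m n : ℕ} (h : m = n) (x : TP k A m) :
    toWord (TensorPower.cast k (ABar k A) h x) = toWord x := by
  subst h
  simp

@[simp]
theorem toWord_conc {a b n : ℕ} (h : a + b = n) (x : TP k A a) (y : TP k A b) :
    toWord (conc h (x ⊗ₜ y)) = toWord x * toWord y := by
  simp only [conc, LinearEquiv.trans_apply, toWord_cast]
  exact TensorPower.toTensorAlgebra_gMul x y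

@[simp]
theorem toWord_letter (a : ABar k A) : toWord (letter a) = lett k A a := by
  simp [letter, toWord, PiTensorProduct.subsingletonEquiv_symm_apply]

@[simp]
theorem toWord_cons {r : ℕ} (a : ABar k A) (w : TP k A r) :
    toWord (cons r (a ⊗ₜ w)) = lett k A a * toWord w := by
  simp [cons]

@[simp]
theorem toWord_snoc {r : ℕ} (w : TP k A r) (a : ABar k A) :
    toWord (snoc r (w ⊗ₜ a)) = toWord w * lett k A a := by
  simp [snoc]

@[simp]
theorem toWord_emptyWord : toWord (emptyWord : TP k A 0) = 1 := by
  simp [emptyWord, toWord]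

theorem exists_smul_emptyWord (w : TP k A 0) : ∃ c : k, w = c • emptyWord := by
  refine ⟨PiTensorProduct.isEmptyEquiv (Fin 0) w, ?_⟩
  apply (PiTensorProduct.isEmptyEquiv (R := k) (s := fun _ => ABar k A) (Fin 0)).injective
  simp [emptyWord]

theorem cons_snoc {r : ℕ} (a b : ABar k A) (w : TP k A r) :
    cons (r + 1) (a ⊗ₜ snoc r (w ⊗ₜ b)) = snoc (r + 1) (cons r (a ⊗ₜ w) ⊗ₜ b) :=
  toWord_injective (by simp [mul_assoc])

theorem cons_induction {r : ℕ} {p : TP k A (r + 1) → Prop} (h0 : p 0)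
    (hadd : ∀ x y, p x → p y → p (x + y)) (hc : ∀ a w, p (cons r (a ⊗ₜ w))) (x) : p x := by
  obtain ⟨y, rfl⟩ := (cons r).surjective x
  induction y with
  | zero => simpa using h0
  | tmul a w => exact hc a w
  | add x y hx hy => simpa using hadd _ _ hx hy

theorem snoc_induction {r : ℕ} {p : TP k A (r + 1) → Prop} (h0 : p 0)
    (hadd : ∀ x y, p x → p y → p (x + y)) (hc : ∀ w a, p (snoc r (w ⊗ₜ a))) (x) : p x := by
  obtain ⟨y, rfl⟩ := (snoc r).surjective x
  induction y with
  | zero => simpa using h0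
  | tmul w a => exact hc w a
  | add x y hx hy => simpa using hadd _ _ hx hy

theorem conc_induction {a b n : ℕ} (h : a + b = n) {p : TP k A n → Prop} (h0 : p 0)
    (hadd : ∀ x y, p x → p y → p (x + y)) (hc : ∀ x y, p (conc h (x ⊗ₜ y))) (x) : p x := by
  obtain ⟨y, rfl⟩ := (conc h).surjective x
  induction y with
  | zero => simpa using h0
  | tmul w a => exact hc w a
  | add x y hx hy => simpa using hadd _ _ hx hy

theorem mid_conc {a b N M : ℕ} (g : TP k A a →ₗ[k] TP k A b) (i j : ℕ)
    (hN : i + a + j = N) (hM : i + b + j = M) (x : TP k A i) (y : TP k A a) (z : TP k A j) :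
    mid g i j hN hM (conc hN (conc rfl (x ⊗ₜ y) ⊗ₜ z)) = conc hM (conc rfl (x ⊗ₜ g y) ⊗ₜ z) := by
  simp [mid]

/-- Applying `g` after the first letter. -/
theorem mid_succ_cons {a b N M : ℕ} (g : TP k A a →ₗ[k] TP k A b) (i j : ℕ)
    (hN : i + a + j = N) (hM : i + b + j = M) (hN' : i + 1 + a + j = N + 1)
    (hM' : i + 1 + b + j = M + 1) (c : ABar k A) (w : TP k A N) :
    mid g (i + 1) j hN' hM' (cons N (c ⊗ₜ w)) = cons M (c ⊗ₜ mid g i j hN hM w) := by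
  induction w using conc_induction hN with
  | h0 => simp
  | hadd x y hx hy => simp [TensorProduct.tmul_add, hx, hy]
  | hc w z =>
    induction w using conc_induction rfl with
    | h0 => simp
    | hadd x y hx hy => simp [TensorProduct.tmul_add, TensorProduct.add_tmul, hx, hy]
    | hc x y =>
      have : cons N (c ⊗ₜ conc hN (conc rfl (x ⊗ₜ y) ⊗ₜ z)) =
          conc hN' (conc rfl (cons i (c ⊗ₜ x) ⊗ₜ y) ⊗ₜ z) :=
        toWord_injective (by simp [mul_assoc])
      rw [this, mid_conc, mid_conc]
      exact toWord_injective (by simp [mul_assoc])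

theorem mid_zero_conc {a b N M : ℕ} (g : TP k A a →ₗ[k] TP k A b) (j : ℕ)
    (hN : 0 + a + j = N) (hM : 0 + b + j = M) (hN' : a + j = N) (hM' : b + j = M)
    (y : TP k A a) (z : TP k A j) :
    mid g 0 j hN hM (conc hN' (y ⊗ₜ z)) = conc hM' (g y ⊗ₜ z) := by
  have : conc hN' (y ⊗ₜ z) = conc hN (conc rfl (emptyWord ⊗ₜ y) ⊗ₜ z) :=
    toWord_injective (by simp)
  rw [this, mid_conc]
  exact toWord_injective (by simp)

theorem mulBar_cons (a b : ABar k A) :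
    mulBar k A (conc (show 1 + 1 = 2 from rfl) (letter a ⊗ₜ letter b)) =
      letter (proj k A (sec k A a * sec k A b)) := by
  simp [mulBar, mulL]

theorem inner_zero : inner k A 0 = 0 := by simp [inner]

/-- The merge of the first two letters is split off from the sum; all other merges leave `a` alone
and are merges of the shorter word, with the sign shifted by one. -/
theorem inner_cons_cons {r : ℕ} (a b : ABar k A) (w : TP k A r) :
    inner k A (r + 1) (cons (r + 1) (a ⊗ₜ cons r (b ⊗ₜ w))) =
      (-1 : k) • cons r (proj k A (sec k A a * sec k A b) ⊗ₜ w)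
        + (-1 : k) • cons r (a ⊗ₜ inner k A r (cons r (b ⊗ₜ w))) := by
  rw [inner, Fin.sum_univ_succ, LinearMap.add_apply]
  congr 1
  · have h1 : cons (r + 1) (a ⊗ₜ cons r (b ⊗ₜ w)) =
        conc (show 2 + r = r + 1 + 1 by omega)
          (conc (show 1 + 1 = 2 from rfl) (letter a ⊗ₜ letter b) ⊗ₜ w) :=
      toWord_injective (by simp [mul_assoc])
    have h2 : ∀ (j : ℕ) (hj : j = r) (hN : 0 + 2 + j = r + 1 + 1) (hM : 0 + 1 + j = r + 1),
        mid (mulBar k A) 0 j hN hM (cons (r + 1) (a ⊗ₜ cons r (b ⊗ₜ w))) =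
          cons r (proj k A (sec k A a * sec k A b) ⊗ₜ w) := by
      rintro j rfl hN hM
      rw [h1, mid_zero_conc _ _ _ _ _ (by omega), mulBar_cons]
      exact toWord_injective (by simp)
    rw [LinearMap.smul_apply]
    simp only [Fin.val_zero]
    rw [h2 _ (by simp), zero_add, pow_one]
  · cases r with
    | zero => simp [inner]
    | succ r =>
      rw [inner, LinearMap.sum_apply, LinearMap.sum_apply, TensorProduct.tmul_sum, map_sum,
        Finset.smul_sum]
      refine Finset.sum_congr rfl fun i _ => ?_
      have h2 : ∀ (j j' : ℕ) (hj : j = j') (hN : (i : ℕ) + 1 + 2 + j = r + 1 + 1 + 1)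
          (hM : (i : ℕ) + 1 + 1 + j = r + 1 + 1) (hN' : (i : ℕ) + 2 + j' = r + 1 + 1)
          (hM' : (i : ℕ) + 1 + j' = r + 1),
          mid (mulBar k A) (i + 1) j hN hM (cons (r + 1 + 1) (a ⊗ₜ cons (r + 1) (b ⊗ₜ w))) =
            cons (r + 1) (a ⊗ₜ mid (mulBar k A) i j' hN' hM' (cons (r + 1) (b ⊗ₜ w))) := by
        rintro j _ rfl hN hM hN' hM'
        rw [mid_succ_cons]
      rw [LinearMap.smul_apply, LinearMap.smul_apply]
      simp only [Fin.val_succ]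
      rw [h2 _ (r + 1 - 1 - i) (by omega)]
      rw [TensorProduct.tmul_smul, map_smul, smul_smul, ← pow_succ']

end WordAlgebra

/-! ### The bar complex: recursion for d, exactness, left and right homotopies -/

section BarResolution

variable {k : Type u} {A : Type v} [Field k] [Ring A] [Algebra k A]

@[simp]
theorem proj_sec (c : ABar k A) : proj k A (sec k A c) = c :=
  LinearMap.congr_fun (proj_comp_sec k A) c

@[simp]
theorem proj_one : proj k A 1 = 0 :=
  (Submodule.Quotient.mk_eq_zero _).2 (Submodule.mem_span_singleton_self 1)

@[simp]
theorem mk_sec (c : ABar k A) : (Submodule.Quotient.mk (sec k A c) : ABar k A) = c := proj_sec c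

@[simp]
theorem mk_one : (Submodule.Quotient.mk 1 : ABar k A) = 0 := proj_one

/-- Formulas written with `sec` become formulas about arbitrary representatives through this
decomposition: the multiple of 1 always cancels or is killed in Ā. -/
theorem exists_eq_sec_add (a : A) : ∃ c : k, a = sec k A (proj k A a) + c • (1 : A) := by
  have h : a - sec k A (proj k A a) ∈ Submodule.span k {(1 : A)} := by
    refine (Submodule.Quotient.mk_eq_zero _).1 ?_
    change proj k A (a - sec k A (proj k A a)) = 0
    rw [map_sub, proj_sec, sub_self]
  obtain ⟨c, hc⟩ := Submodule.mem_span_singleton.1 h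
  exact ⟨c, by rw [hc]; abel⟩

/-- Left multiplication by `a` on `Bar_r(A)`. -/
def lmul {r : ℕ} (a : A) : Bar k A r →ₗ[k] Bar k A r := LinearMap.rTensor _ (LinearMap.mulLeft k a)

/-- Right multiplication by `b` on `Ā^{⊗r} ⊗ A`. -/
def rmulTail {r : ℕ} (b : A) : TP k A r ⊗[k] A →ₗ[k] TP k A r ⊗[k] A :=
  LinearMap.lTensor _ (LinearMap.mulRight k b)

/-- Right multiplication by `b` on `Bar_r(A)`. -/
def rmul {r : ℕ} (b : A) : Bar k A r →ₗ[k] Bar k A r := LinearMap.lTensor A (rmulTail b)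

/-- The map `a ⊗ w ⊗ b ↦ ā ⊗ w ⊗ b`. -/
def barLeft (r : ℕ) : Bar k A r →ₗ[k] TP k A (r + 1) ⊗[k] A :=
  LinearMap.rTensor A ((cons r).toLinearMap ∘ₗ LinearMap.rTensor (TP k A r) (proj k A)) ∘ₗ
    (TensorProduct.assoc k A (TP k A r) A).symm.toLinearMap

/-- The augmentation `a ⊗ b ↦ ab`. -/
def aug : Bar k A 0 →ₗ[k] A :=
  LinearMap.mul' k A ∘ₗ LinearMap.lTensor A ((TensorProduct.lid k A).toLinearMap ∘ₗ
    LinearMap.rTensor A (PiTensorProduct.isEmptyEquiv (Fin 0)).toLinearMap)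

@[simp]
theorem lmul_tmul {r : ℕ} (a b : A) (t : TP k A r ⊗[k] A) :
    lmul a (b ⊗ₜ[k] t) = (a * b) ⊗ₜ[k] t := by simp [lmul]

@[simp]
theorem rmulTail_tmul {r : ℕ} (b c : A) (w : TP k A r) :
    rmulTail b (w ⊗ₜ[k] c) = w ⊗ₜ[k] (c * b) := by simp [rmulTail]

@[simp]
theorem rmul_tmul {r : ℕ} (a b : A) (t : TP k A r ⊗[k] A) :
    rmul b (a ⊗ₜ[k] t) = a ⊗ₜ[k] rmulTail b t := by simp [rmul]

@[simp]
theorem barLeft_tmul {r : ℕ} (a b : A) (w : TP k A r) :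
    barLeft r (a ⊗ₜ[k] (w ⊗ₜ[k] b)) = cons r (proj k A a ⊗ₜ w) ⊗ₜ b := by simp [barLeft]

@[simp]
theorem aug_tmul (a b : A) :
    aug (a ⊗ₜ[k] ((emptyWord : TP k A 0) ⊗ₜ[k] b)) = a * b := by simp [aug, emptyWord]

theorem bar_zero_induction {p : Bar k A 0 → Prop} (h0 : p 0)
    (hadd : ∀ x y, p x → p y → p (x + y))
    (hc : ∀ a b, p (a ⊗ₜ (emptyWord ⊗ₜ b))) (x) : p x := by
  induction x using TensorProduct.induction_on with
  | zero => exact h0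
  | add x y hx hy => exact hadd _ _ hx hy
  | tmul a t =>
    induction t using TensorProduct.induction_on with
    | zero => simpa using h0
    | add x y hx hy => simpa [TensorProduct.tmul_add] using hadd _ _ hx hy
    | tmul w b =>
      obtain ⟨c, rfl⟩ := exists_smul_emptyWord w
      rw [TensorProduct.smul_tmul]
      exact hc _ _

theorem bar_induction {r : ℕ} {p : Bar k A r → Prop} (h0 : p 0)
    (hadd : ∀ x y, p x → p y → p (x + y))
    (hc : ∀ a w b, p (a ⊗ₜ (w ⊗ₜ b))) (x) : p x := by
  induction x using TensorProduct.induction_on with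
  | zero => exact h0
  | add x y hx hy => exact hadd _ _ hx hy
  | tmul a t =>
    induction t using TensorProduct.induction_on with
    | zero => simpa using h0
    | add x y hx hy => simpa [TensorProduct.tmul_add] using hadd _ _ hx hy
    | tmul w b => exact hc a w b

theorem bar_succ_induction {r : ℕ} {p : Bar k A (r + 1) → Prop} (h0 : p 0)
    (hadd : ∀ x y, p x → p y → p (x + y))
    (hc : ∀ a y, p (a ⊗ₜ barLeft r y)) (x) : p x := by
  refine bar_induction h0 hadd (fun a w b => ?_) x
  induction w using cons_induction with
  | h0 => simpa using h0
  | hadd x y hx hy => simpa [TensorProduct.tmul_add, TensorProduct.add_tmul] using hadd _ _ hx hy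
  | hc c w => simpa using hc a (sec k A c ⊗ₜ (w ⊗ₜ b))

/-! The three parts of the bar differential. -/

variable (k A) in
/-- The first summand of the bar differential. -/
def dFirst (r : ℕ) : Bar k A (r + 1) →ₗ[k] Bar k A r :=
  LinearMap.rTensor (TP k A r ⊗[k] A) (mulL k A) ∘ₗ
      (TensorProduct.assoc k A (ABar k A) (TP k A r ⊗[k] A)).symm.toLinearMap ∘ₗ
      LinearMap.lTensor A ((TensorProduct.assoc k (ABar k A) (TP k A r) A).toLinearMap ∘ₗ
        LinearMap.rTensor A (cons r).symm.toLinearMap)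

variable (k A) in
/-- The last summand of the bar differential, without its sign. -/
def dLast (r : ℕ) : Bar k A (r + 1) →ₗ[k] Bar k A r :=
  LinearMap.lTensor A (LinearMap.lTensor (TP k A r) (mulR k A) ∘ₗ
        (TensorProduct.assoc k (TP k A r) (ABar k A) A).toLinearMap ∘ₗ
        LinearMap.rTensor A (snoc r).symm.toLinearMap)

@[simp]
theorem dFirst_tmul {r : ℕ} (a b : A) (c : ABar k A) (w : TP k A r) :
    dFirst k A r (a ⊗ₜ (cons r (c ⊗ₜ w) ⊗ₜ b)) = (a * sec k A c) ⊗ₜ (w ⊗ₜ b) := by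
  simp [dFirst, mulL]

@[simp]
theorem dLast_tmul {r : ℕ} (a b : A) (c : ABar k A) (w : TP k A r) :
    dLast k A r (a ⊗ₜ (snoc r (w ⊗ₜ c) ⊗ₜ b)) = a ⊗ₜ (w ⊗ₜ (sec k A c * b)) := by
  simp [dLast, mulR]

theorem d_tmul {r : ℕ} (a b : A) (w : TP k A (r + 1)) :
    d k A r (a ⊗ₜ (w ⊗ₜ b)) = dFirst k A r (a ⊗ₜ (w ⊗ₜ b)) + a ⊗ₜ (inner k A r w ⊗ₜ b)
      + (-1 : k) ^ (r + 1) • dLast k A r (a ⊗ₜ (w ⊗ₜ b)) := by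
  simp [d, dFirst, dLast]

theorem tmul_barLeft_sub {r : ℕ} (a : A) (x y : Bar k A r) :
    a ⊗ₜ[k] barLeft r (x - y) = a ⊗ₜ[k] barLeft r x - a ⊗ₜ[k] barLeft r y :=
  map_sub (TensorProduct.mk k A _ a ∘ₗ barLeft r) x y

theorem d_zero_barLeft (a : A) (y : Bar k A 0) :
    d k A 0 (a ⊗ₜ barLeft 0 y) = lmul a y - a ⊗ₜ (emptyWord ⊗ₜ aug y) := by
  induction y using bar_zero_induction with
  | h0 => simp
  | hadd x y hx hy =>
    simp only [map_add, TensorProduct.tmul_add, hx, hy]; abel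
  | hc a' b =>
    obtain ⟨c, hc⟩ := exists_eq_sec_add (k := k) a'
    have h1 : cons 0 (proj k A a' ⊗ₜ emptyWord) = snoc 0 (emptyWord ⊗ₜ proj k A a') :=
      toWord_injective (by simp)
    rw [barLeft_tmul, d_tmul, dFirst_tmul, inner_zero, h1, dLast_tmul, lmul_tmul, aug_tmul]
    conv_rhs => rw [hc]
    simp only [mul_add, add_mul, mul_smul_comm, smul_mul_assoc, mul_one, one_mul,
      TensorProduct.tmul_add, TensorProduct.add_tmul, TensorProduct.tmul_smul,
      ← TensorProduct.smul_tmul', LinearMap.zero_apply, TensorProduct.zero_tmul,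
      TensorProduct.tmul_zero, zero_add, pow_one]
    module

/-- All summands of d(1 ⊗ t) except the first keep the left factor 1, which vanishes in Ā; the first
one gives back t. -/
theorem barLeft_d_one {r : ℕ} (t : TP k A (r + 1) ⊗[k] A) :
    barLeft r (d k A r (1 ⊗ₜ t)) = t := by
  induction t with
  | zero => simp
  | add x y hx hy => rw [TensorProduct.tmul_add, map_add, map_add, hx, hy]
  | tmul w b =>
    have h2 : ∀ w : TP k A (r + 1), barLeft r (dLast k A r (1 ⊗ₜ (w ⊗ₜ b))) = 0 := by
      intro w
      induction w using snoc_induction with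
      | h0 => simp
      | hadd x y hx hy =>
        rw [TensorProduct.add_tmul, TensorProduct.tmul_add, map_add, map_add, hx, hy, add_zero]
      | hc w c => simp
    rw [d_tmul, map_add, map_add, map_smul, h2]
    induction w using cons_induction with
    | h0 => simp
    | hadd x y hx hy =>
      simp only [map_add, TensorProduct.tmul_add, TensorProduct.add_tmul, smul_zero,
        add_zero] at hx hy ⊢
      rw [add_add_add_comm, hx, hy]
    | hc c w => simp

/-- The relation ds + sd = 1 for the left contracting homotopy s, combined with left linearity. With
`bar_succ_induction` it determines d; bilinearity over A, d² = 0 and exactness all follow from it by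
induction on the degree. -/
theorem d_succ_barLeft {r : ℕ} (a : A) (y : Bar k A (r + 1)) :
    d k A (r + 1) (a ⊗ₜ barLeft (r + 1) y) = lmul a y - a ⊗ₜ barLeft r (d k A r y) := by
  induction y using bar_induction with
  | h0 => simp
  | hadd x y hx hy =>
    simp only [map_add, TensorProduct.tmul_add, hx, hy]; abel
  | hc a' w b =>
    obtain ⟨c, hc⟩ := exists_eq_sec_add (k := k) a'
    have h1 : ∀ e : ABar k A, d k A (r + 1) (a ⊗ₜ barLeft (r + 1) (sec k A e ⊗ₜ (w ⊗ₜ b))) =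
        lmul a (sec k A e ⊗ₜ (w ⊗ₜ b)) -
          a ⊗ₜ barLeft r (d k A r (sec k A e ⊗ₜ (w ⊗ₜ b))) := by
      intro e
      clear hc
      have h4 : a ⊗ₜ[k] (inner k A (r + 1) (cons (r + 1) (e ⊗ₜ w)) ⊗ₜ[k] b) =
          -(a ⊗ₜ[k] barLeft r (dFirst k A r (sec k A e ⊗ₜ[k] (w ⊗ₜ[k] b)))) -
            a ⊗ₜ[k] barLeft r (sec k A e ⊗ₜ[k] (inner k A r w ⊗ₜ[k] b)) := by
        induction w using cons_induction with
        | h0 => simp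
        | hadd x y hx hy =>
          simp only [map_add, TensorProduct.tmul_add, TensorProduct.add_tmul, hx, hy]; module
        | hc f w =>
          rw [inner_cons_cons]
          simp only [TensorProduct.add_tmul, ← TensorProduct.smul_tmul', TensorProduct.tmul_add,
            TensorProduct.tmul_smul, dFirst_tmul, barLeft_tmul, proj_sec]
          module
      have h3 : dLast k A (r + 1) (a ⊗ₜ (cons (r + 1) (e ⊗ₜ w) ⊗ₜ b)) =
          a ⊗ₜ barLeft r (dLast k A r (sec k A e ⊗ₜ (w ⊗ₜ b))) := by
        clear h4
        induction w using snoc_induction with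
        | h0 => simp
        | hadd x y hx hy =>
          simp only [map_add, TensorProduct.tmul_add, TensorProduct.add_tmul, hx, hy]
        | hc w f => rw [cons_snoc]; simp
      rw [barLeft_tmul, proj_sec, d_tmul, h3, h4, d_tmul, dFirst_tmul, lmul_tmul]
      simp only [map_add, TensorProduct.tmul_add, map_smul, TensorProduct.tmul_smul]
      module
    have h2 : a' ⊗ₜ[k] (w ⊗ₜ[k] b) =
        sec k A (proj k A a') ⊗ₜ[k] (w ⊗ₜ[k] b) + c • (1 : A) ⊗ₜ[k] (w ⊗ₜ[k] b) := by
      conv_lhs => rw [hc]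
      rw [TensorProduct.add_tmul, TensorProduct.smul_tmul']
    rw [h2]
    simp only [map_add, TensorProduct.tmul_add, map_smul, TensorProduct.tmul_smul, h1]
    -- On the scalar part of a' the left side vanishes, and `barLeft_d_one` makes the two terms on
    -- the right cancel.
    rw [barLeft_d_one, barLeft_tmul, proj_one]
    simp only [lmul_tmul, mul_one, TensorProduct.zero_tmul, map_zero, TensorProduct.tmul_zero,
      smul_zero]
    module

theorem barLeft_rmul {r : ℕ} (b : A) (y : Bar k A r) :
    barLeft r (rmul b y) = rmulTail b (barLeft r y) := by
  induction y using bar_induction with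
  | h0 => simp
  | hadd x y hx hy => simp [hx, hy]
  | hc a w c => simp

theorem lmul_one {r : ℕ} (x : Bar k A r) : lmul 1 x = x := by simp [lmul]

theorem rmul_one {r : ℕ} (x : Bar k A r) : rmul 1 x = x := by simp [rmul, rmulTail]

theorem lmul_mul {r : ℕ} (a b : A) (x : Bar k A r) : lmul (a * b) x = lmul a (lmul b x) := by
  simp [lmul, LinearMap.mulLeft_mul, LinearMap.rTensor_comp_apply]

theorem rmul_mul {r : ℕ} (a b : A) (x : Bar k A r) : rmul (a * b) x = rmul b (rmul a x) := by
  simp [rmul, rmulTail, LinearMap.mulRight_mul, LinearMap.lTensor_comp]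

theorem lmul_rmul {r : ℕ} (a b : A) (x : Bar k A r) : lmul a (rmul b x) = rmul b (lmul a x) := by
  induction x using bar_induction with
  | h0 => simp
  | hadd x y hx hy => simp [hx, hy]
  | hc c w e => simp

theorem aug_lmul (a : A) (x : Bar k A 0) : aug (lmul a x) = a * aug x := by
  induction x using bar_zero_induction with
  | h0 => simp
  | hadd x y hx hy => simp [hx, hy, mul_add]
  | hc b c => simp [mul_assoc]

theorem aug_rmul (a : A) (x : Bar k A 0) : aug (rmul a x) = aug x * a := by
  induction x using bar_zero_induction with
  | h0 => simp
  | hadd x y hx hy => simp [hx, hy, add_mul]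
  | hc b c => simp [mul_assoc]

theorem d_lmul {r : ℕ} (a : A) (x : Bar k A (r + 1)) :
    d k A r (lmul a x) = lmul a (d k A r x) := by
  induction x using bar_succ_induction with
  | h0 => simp
  | hadd x y hx hy => simp [hx, hy]
  | hc b y =>
    cases r with
    | zero => simp [d_zero_barLeft, lmul_mul]
    | succ r => simp [d_succ_barLeft, lmul_mul]

theorem d_rmul {r : ℕ} (a : A) (x : Bar k A (r + 1)) :
    d k A r (rmul a x) = rmul a (d k A r x) := by
  induction r with
  | zero =>
    induction x using bar_succ_induction with
    | h0 => simp
    | hadd x y hx hy => simp [hx, hy]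
    | hc b y =>
      rw [rmul_tmul, ← barLeft_rmul, d_zero_barLeft, d_zero_barLeft, lmul_rmul, map_sub, rmul_tmul,
        rmulTail_tmul, aug_rmul]
  | succ r ih =>
    induction x using bar_succ_induction with
    | h0 => simp
    | hadd x y hx hy => simp [hx, hy]
    | hc b y =>
      rw [rmul_tmul, ← barLeft_rmul, d_succ_barLeft, d_succ_barLeft, lmul_rmul, map_sub, rmul_tmul,
        ih, barLeft_rmul]

theorem aug_d (x : Bar k A 1) : aug (d k A 0 x) = 0 := by
  induction x using bar_succ_induction with
  | h0 => simp
  | hadd x y hx hy => simp [hx, hy]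
  | hc b y => rw [d_zero_barLeft, map_sub, aug_lmul, aug_tmul, sub_self]

theorem d_d {r : ℕ} (x : Bar k A (r + 2)) : d k A r (d k A (r + 1) x) = 0 := by
  induction r with
  | zero =>
    induction x using bar_succ_induction with
    | h0 => simp
    | hadd x y hx hy => simp [hx, hy]
    | hc b y => rw [d_succ_barLeft, map_sub, d_lmul, d_zero_barLeft, aug_d]; simp
  | succ r ih =>
    induction x using bar_succ_induction with
    | h0 => simp
    | hadd x y hx hy => simp [hx, hy]
    | hc b y => rw [d_succ_barLeft, map_sub, d_lmul, d_succ_barLeft, ih]; simp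

theorem mem_Omega_zero_iff (x : Bar k A 0) : x ∈ Omega k A 0 ↔ aug x = 0 := by
  constructor
  · rintro ⟨y, rfl⟩
    exact aug_d y
  · intro h
    exact ⟨1 ⊗ₜ barLeft 0 x, by rw [d_zero_barLeft, h, lmul_one]; simp⟩

theorem mem_Omega_succ_iff {r : ℕ} (x : Bar k A (r + 1)) :
    x ∈ Omega k A (r + 1) ↔ d k A r x = 0 := by
  constructor
  · rintro ⟨y, rfl⟩
    exact d_d y
  · intro h
    exact ⟨1 ⊗ₜ barLeft _ x, by rw [d_succ_barLeft, h, lmul_one]; simp⟩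

theorem d_mem_Omega {r : ℕ} (x : Bar k A (r + 1)) : d k A r x ∈ Omega k A r := ⟨x, rfl⟩

/-! The right contracting homotopy. -/

@[simp]
theorem piR_tmul {r : ℕ} (a b : A) (w : TP k A r) :
    piR r (a ⊗ₜ[k] (w ⊗ₜ[k] b)) = a ⊗ₜ snoc r (w ⊗ₜ proj k A b) := by simp [piR]

@[simp]
theorem close_tmul {r : ℕ} (a : A) (w : TP k A r) :
    close k A r (a ⊗ₜ[k] w) = a ⊗ₜ (w ⊗ₜ 1) := by simp [close]

theorem piR_close {r : ℕ} (y : A ⊗[k] TP k A r) : piR r (close k A r y) = 0 := by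
  induction y with
  | zero => simp
  | add x y hx hy => simp [hx, hy]
  | tmul a w => simp

theorem close_piR_barLeft {r : ℕ} (a : A) (y : Bar k A r) :
    close k A (r + 2) (piR (r + 1) (a ⊗ₜ barLeft r y)) =
      a ⊗ₜ barLeft (r + 1) (close k A (r + 1) (piR r y)) := by
  induction y using bar_induction with
  | h0 => simp
  | hadd x y hx hy => simp only [map_add, TensorProduct.tmul_add, hx, hy]
  | hc b w c => simp [cons_snoc]

theorem close_piR_lmul {r : ℕ} (a : A) (y : Bar k A r) :
    close k A (r + 1) (piR r (lmul a y)) = lmul a (close k A (r + 1) (piR r y)) := by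
  induction y using bar_induction with
  | h0 => simp
  | hadd x y hx hy => simp [hx, hy]
  | hc b w c => simp

theorem d_close_piR_zero (x : Bar k A 0) :
    d k A 0 (close k A 1 (piR 0 x)) = aug x ⊗ₜ (emptyWord ⊗ₜ 1) - x := by
  induction x using bar_zero_induction with
  | h0 => simp
  | hadd x y hx hy =>
    simp only [map_add, TensorProduct.add_tmul, hx, hy]; abel
  | hc a b =>
    have h : close k A 1 (piR 0 (a ⊗ₜ[k] (emptyWord ⊗ₜ[k] b))) =
        a ⊗ₜ barLeft 0 (b ⊗ₜ (emptyWord ⊗ₜ 1)) := by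
      have : snoc 0 ((emptyWord : TP k A 0) ⊗ₜ proj k A b) = cons 0 (proj k A b ⊗ₜ emptyWord) :=
        toWord_injective (by simp)
      rw [piR_tmul, close_tmul, this, barLeft_tmul]
    rw [h, d_zero_barLeft]
    simp

/-- The right homotopy a ⊗ w ⊗ b ↦ a ⊗ w ⊗ b̄ ⊗ 1 commutes with the left homotopy and with left
multiplication, so the recursion for d carries this relation from one degree to the next. -/
theorem d_close_piR_succ {r : ℕ} (x : Bar k A (r + 1)) :
    d k A (r + 1) (close k A (r + 2) (piR (r + 1) x)) =
      close k A (r + 1) (piR r (d k A r x)) + (-1 : k) ^ r • x := by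
  induction r with
  | zero =>
    induction x using bar_succ_induction with
    | h0 => simp
    | hadd x y hx hy =>
      simp only [map_add, hx, hy]; module
    | hc a y =>
      rw [close_piR_barLeft, d_succ_barLeft, d_close_piR_zero, d_zero_barLeft,
        tmul_barLeft_sub, map_sub (piR (k := k) (A := A) 0), map_sub (close k A _), close_piR_lmul]
      simp only [barLeft_tmul, piR_tmul, close_tmul]
      have : cons 0 (proj k A (aug y) ⊗ₜ emptyWord) = snoc 0 (emptyWord ⊗ₜ proj k A (aug y)) :=
        toWord_injective (by simp)
      rw [this]
      module
  | succ r ih =>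
    induction x using bar_succ_induction with
    | h0 => simp
    | hadd x y hx hy =>
      simp only [map_add, hx, hy]; module
    | hc a y =>
      rw [close_piR_barLeft, d_succ_barLeft, ih, d_succ_barLeft, map_sub, map_sub,
        close_piR_lmul, close_piR_barLeft]
      simp only [map_add, TensorProduct.tmul_add, map_smul, TensorProduct.tmul_smul, pow_succ]
      module

theorem d_close_piR {r : ℕ} {x : Bar k A r} (hx : x ∈ Omega k A r) :
    d k A r (close k A (r + 1) (piR r x)) = (-1 : k) ^ (r + 1) • x := by
  cases r with
  | zero => rw [d_close_piR_zero, (mem_Omega_zero_iff x).1 hx, TensorProduct.zero_tmul]; module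
  | succ r => rw [d_close_piR_succ, (mem_Omega_succ_iff x).1 hx, map_zero, map_zero]; module

theorem piR_surjective {r : ℕ} : Function.Surjective (piR (k := k) (A := A) r) := by
  intro y
  induction y with
  | zero => exact ⟨0, map_zero _⟩
  | add x y hx hy =>
    obtain ⟨x, rfl⟩ := hx
    obtain ⟨y, rfl⟩ := hy
    exact ⟨x + y, map_add _ _ _⟩
  | tmul a w =>
    induction w using snoc_induction with
    | h0 => exact ⟨0, by simp⟩
    | hadd x y hx hy =>
      obtain ⟨x', hx⟩ := hx
      obtain ⟨y', hy⟩ := hy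
      exact ⟨x' + y', by rw [map_add, hx, hy, TensorProduct.tmul_add]⟩
    | hc w c => exact ⟨a ⊗ₜ (w ⊗ₜ sec k A c), by simp⟩

/-- Lift y to the bar complex and apply the right homotopy relation: `piR` kills whatever ends in ⊗
1, and only the signed lift survives. Together with `d_close_piR`, this identifies Ω̄^{r+1}(A) with
A ⊗ Ā^{⊗(r+1)}. -/
theorem piR_d_close {r : ℕ} (y : A ⊗[k] TP k A (r + 1)) :
    piR r (d k A r (close k A (r + 1) y)) = (-1 : k) ^ (r + 1) • y := by
  obtain ⟨x, rfl⟩ := piR_surjective y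
  cases r with
  | zero =>
    rw [d_close_piR_zero, map_sub, ← close_tmul, piR_close]
    module
  | succ r => rw [d_close_piR_succ, map_add, piR_close, map_smul]; module

/-- By `d_close_piR` an element of Ω is recovered, up to sign, from its image under `piR`.
Identities between cochains with values in Ω are reduced to their π^{(r)}-parts in this way. -/
theorem Omega_ext {r : ℕ} {x y : Bar k A r} (hx : x ∈ Omega k A r) (hy : y ∈ Omega k A r)
    (h : piR r x = piR r y) : x = y := by
  have h1 : (-1 : k) ^ (r + 1) • x = (-1 : k) ^ (r + 1) • y := by
    rw [← d_close_piR hx, ← d_close_piR hy, h]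
  exact (IsUnit.smul_left_cancel ((isUnit_one.neg).pow _)).1 h1

end BarResolution

/-! ### Hochschild cochains as bimodule maps, and the connecting homomorphism -/

section Cochains

variable {k : Type u} {A : Type v} [Field k] [Ring A] [Algebra k A]

@[simp]
theorem lAct_tmul {p : ℕ} (a : A) (x : Bar k A p) : lAct k A p (a ⊗ₜ x) = lmul a x := by
  induction x using bar_induction with
  | h0 => simp
  | hadd x y hx hy => simp only [TensorProduct.tmul_add, map_add, hx, hy]
  | hc b w c => simp [lAct]

@[simp]
theorem rAct_tmul {p : ℕ} (a : A) (x : Bar k A p) : rAct k A p (x ⊗ₜ a) = rmul a x := by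
  induction x using bar_induction with
  | h0 => simp
  | hadd x y hx hy => simp only [TensorProduct.add_tmul, map_add, hx, hy]
  | hc b w c => simp [rAct]

/-- The bimodule map `Bar_m(A) → Bar_p(A)` given by a cochain. -/
def hat {m p : ℕ} (f : Cochain k A m p) : Bar k A m →ₗ[k] Bar k A p :=
  lAct k A p ∘ₗ LinearMap.lTensor A (rAct k A p ∘ₗ LinearMap.rTensor A f)

@[simp]
theorem hat_tmul {m p : ℕ} (f : Cochain k A m p) (a b : A) (w : TP k A m) :
    hat f (a ⊗ₜ (w ⊗ₜ b)) = lmul a (rmul b (f w)) := by simp [hat]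

variable (k A) in
/-- The first summand of the Hochschild differential. -/
def deltaFirst {m p : ℕ} (f : Cochain k A m p) : Cochain k A (m + 1) p :=
  lAct k A p ∘ₗ TensorProduct.map (sec k A) f ∘ₗ (cons m).symm.toLinearMap

variable (k A) in
/-- The last summand of the Hochschild differential, without its sign. -/
def deltaLast {m p : ℕ} (f : Cochain k A m p) : Cochain k A (m + 1) p :=
  rAct k A p ∘ₗ TensorProduct.map f (sec k A) ∘ₗ (snoc m).symm.toLinearMap

@[simp]
theorem deltaFirst_cons {m p : ℕ} (f : Cochain k A m p) (c : ABar k A) (w : TP k A m) :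
    deltaFirst k A f (cons m (c ⊗ₜ w)) = lmul (sec k A c) (f w) := by simp [deltaFirst]

@[simp]
theorem deltaLast_snoc {m p : ℕ} (f : Cochain k A m p) (c : ABar k A) (w : TP k A m) :
    deltaLast k A f (snoc m (w ⊗ₜ c)) = rmul (sec k A c) (f w) := by simp [deltaLast]

theorem delta_apply {m p : ℕ} (f : Cochain k A m p) (w : TP k A (m + 1)) :
    delta k A m p f w = deltaFirst k A f w + f (inner k A m w)
      + (-1 : k) ^ (m + 1) • deltaLast k A f w := rfl

/-- The summands of d(1 ⊗ w ⊗ 1) match those of δ one by one. Hence δ is precomposition with d, and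
δ² = 0 and δ(d ∘ f) = d ∘ δf come from the bar complex. -/
theorem delta_eq_hat {m p : ℕ} (f : Cochain k A m p) (w : TP k A (m + 1)) :
    delta k A m p f w = hat f (d k A m (1 ⊗ₜ (w ⊗ₜ 1))) := by
  rw [delta_apply, d_tmul, map_add, map_add, map_smul]
  congr 1
  · congr 1
    · induction w using cons_induction with
      | h0 => simp
      | hadd x y hx hy => simp only [map_add, TensorProduct.tmul_add, TensorProduct.add_tmul, hx, hy]
      | hc c w => simp [rmul_one]
    · simp [rmul_one, lmul_one]
  · congr 1
    induction w using snoc_induction with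
    | h0 => simp
    | hadd x y hx hy => simp only [map_add, TensorProduct.tmul_add, TensorProduct.add_tmul, hx, hy]
    | hc w c => simp [lmul_one]

theorem hat_lmul {m p : ℕ} (f : Cochain k A m p) (a : A) (x : Bar k A m) :
    hat f (lmul a x) = lmul a (hat f x) := by
  induction x using bar_induction with
  | h0 => simp
  | hadd x y hx hy => simp only [map_add, hx, hy]
  | hc b w c => simp [lmul_mul]

theorem hat_rmul {m p : ℕ} (f : Cochain k A m p) (a : A) (x : Bar k A m) :
    hat f (rmul a x) = rmul a (hat f x) := by
  induction x using bar_induction with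
  | h0 => simp
  | hadd x y hx hy => simp only [map_add, hx, hy]
  | hc b w c => simp [rmul_mul, lmul_rmul]

theorem hat_delta {m p : ℕ} (f : Cochain k A m p) (x : Bar k A (m + 1)) :
    hat (delta k A m p f) x = hat f (d k A m x) := by
  induction x using bar_induction with
  | h0 => simp
  | hadd x y hx hy => simp only [map_add, hx, hy]
  | hc a w b =>
    have h : a ⊗ₜ[k] (w ⊗ₜ[k] b) = lmul a (rmul b (1 ⊗ₜ[k] (w ⊗ₜ[k] 1))) := by simp
    rw [h, hat_lmul, hat_rmul, d_lmul, d_rmul, hat_lmul, hat_rmul, ← delta_eq_hat]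
    simp [lmul_one, rmul_one]

theorem delta_delta {m p : ℕ} (f : Cochain k A m p) :
    delta k A (m + 1) p (delta k A m p f) = 0 := by
  ext1
  ext1 w
  simp only [LinearMap.compMultilinearMap_apply]
  rw [delta_eq_hat, hat_delta, d_d, map_zero]
  rfl

theorem hat_d_comp {m p : ℕ} (f : Cochain k A m (p + 1)) (x : Bar k A m) :
    hat (d k A p ∘ₗ f) x = d k A p (hat f x) := by
  induction x using bar_induction with
  | h0 => simp
  | hadd x y hx hy => simp only [map_add, hx, hy]
  | hc b w c => simp [d_lmul, d_rmul]

theorem delta_d_comp {m p : ℕ} (f : Cochain k A m (p + 1)) :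
    delta k A m p (d k A p ∘ₗ f) = d k A p ∘ₗ delta k A m (p + 1) f :=
  LinearMap.ext fun w => by
    rw [delta_eq_hat, hat_d_comp, LinearMap.comp_apply, delta_eq_hat]

theorem d_comp_mem {m p : ℕ} (f : Cochain k A m (p + 1)) :
    d k A p ∘ₗ f ∈ omegaCochains k A m p := fun x => d_mem_Omega (f x)

theorem d_comp_eq_zero {m p : ℕ} {f : Cochain k A m (p + 1)}
    (hf : f ∈ omegaCochains k A m (p + 1)) : d k A p ∘ₗ f = 0 :=
  LinearMap.ext fun w => (mem_Omega_succ_iff _).1 (hf w)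

theorem mem_omegaCochains_of_d_comp {m p : ℕ} {f : Cochain k A m (p + 1)}
    (hf : d k A p ∘ₗ f = 0) : f ∈ omegaCochains k A m (p + 1) :=
  fun w => (mem_Omega_succ_iff _).2 (LinearMap.congr_fun hf w)

theorem mem_extZ {m p : ℕ} {f : Cochain k A m p} :
    f ∈ extZ k A m p ↔ f ∈ omegaCochains k A m p ∧ delta k A m p f = 0 := Iff.rfl

theorem delta_mem_omegaCochains {m p : ℕ} {f : Cochain k A m p}
    (hf : f ∈ omegaCochains k A m p) : delta k A m p f ∈ omegaCochains k A (m + 1) p := by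
  have hl : ∀ (a : A) (x : Bar k A p), x ∈ Omega k A p → lmul a x ∈ Omega k A p := by
    rintro a _ ⟨y, rfl⟩
    exact ⟨lmul a y, d_lmul a y⟩
  have hr : ∀ (a : A) (x : Bar k A p), x ∈ Omega k A p → rmul a x ∈ Omega k A p := by
    rintro a _ ⟨y, rfl⟩
    exact ⟨rmul a y, d_rmul a y⟩
  intro w
  rw [delta_eq_hat]
  generalize d k A m (1 ⊗ₜ (w ⊗ₜ 1)) = x
  induction x using bar_induction with
  | h0 => simp
  | hadd x y hx hy => rw [map_add]; exact add_mem hx hy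
  | hc b w c => rw [hat_tmul]; exact hl _ _ (hr _ _ (hf w))

theorem extB_le_extZ {m p : ℕ} : extB k A m p ≤ extZ k A m p := by
  cases m with
  | zero => exact bot_le
  | succ m =>
    rintro _ ⟨f, hf, rfl⟩
    exact ⟨delta_mem_omegaCochains hf, delta_delta f⟩

/-- The canonical lift of a cochain along `d : Bar_{p+1}(A) → Ω̄^{p+1}(A)`. -/
def barLift {m p : ℕ} (f : Cochain k A m p) : Cochain k A m (p + 1) :=
  (-1 : k) ^ (p + 1) • (close k A (p + 1) ∘ₗ piR p ∘ₗ f)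

theorem neg_one_pow_smul_smul {M : Type*} [AddCommGroup M] [Module k M] (n : ℕ) (x : M) :
    (-1 : k) ^ n • (-1 : k) ^ n • x = x := by
  rw [smul_smul, ← mul_pow]; simp

theorem d_comp_barLift {m p : ℕ} {f : Cochain k A m p} (hf : f ∈ omegaCochains k A m p) :
    d k A p ∘ₗ barLift f = f :=
  LinearMap.ext fun w => by
    simp only [barLift, LinearMap.comp_apply, LinearMap.smul_apply, map_smul]
    rw [d_close_piR (hf w)]
    exact neg_one_pow_smul_smul (k := k) (M := Bar k A p) _ _

theorem extR_snoc {m p : ℕ} (F : TP k A m →ₗ[k] A ⊗[k] TP k A p) (w : TP k A m) (c : ABar k A) :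
    extR F 1 rfl rfl (snoc m (w ⊗ₜ c)) =
      LinearMap.lTensor A ((snoc p).toLinearMap ∘ₗ (TensorProduct.mk k _ _).flip c) (F w) := by
  have h : snoc m (w ⊗ₜ c) = conc rfl (w ⊗ₜ letter c) := by simp [snoc]
  rw [h]
  simp only [extR, LinearMap.comp_apply, LinearEquiv.coe_coe, LinearEquiv.symm_apply_apply,
    LinearMap.rTensor_tmul]
  generalize F w = y
  induction y with
  | zero => simp
  | add x y hx hy => simp only [TensorProduct.add_tmul, map_add, hx, hy]
  | tmul a v => simp [snoc]

theorem dFirst_close {r : ℕ} (y : A ⊗[k] TP k A (r + 1)) :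
    ∃ z, dFirst k A r (close k A (r + 1) y) = close k A r z := by
  induction y with
  | zero => exact ⟨0, by simp⟩
  | add x y hx hy =>
    obtain ⟨x', hx⟩ := hx
    obtain ⟨y', hy⟩ := hy
    exact ⟨x' + y', by simp only [map_add, hx, hy]⟩
  | tmul a w =>
    induction w using cons_induction with
    | h0 => exact ⟨0, by simp⟩
    | hadd x y hx hy =>
      obtain ⟨x', hx⟩ := hx
      obtain ⟨y', hy⟩ := hy
      exact ⟨x' + y', by simp only [TensorProduct.tmul_add, map_add, hx, hy]⟩
    | hc c w => exact ⟨(a * sec k A c) ⊗ₜ w, by simp⟩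

theorem piR_lmul_rmul_close {p : ℕ} (a b : A) (y : A ⊗[k] TP k A p) :
    piR p (lmul a (rmul b (close k A p y))) =
      TensorProduct.map (LinearMap.mulLeft k a)
        ((snoc p).toLinearMap ∘ₗ (TensorProduct.mk k _ _).flip (proj k A b)) y := by
  induction y with
  | zero => simp
  | add x y hx hy => simp only [map_add, hx, hy]
  | tmul c w => simp

/-- The last factor is still 1 after such a cochain is applied to a chain ending in 1, and 1
vanishes in Ā. -/
theorem piR_hat_close {m p : ℕ} (G : TP k A m →ₗ[k] A ⊗[k] TP k A p) (z : A ⊗[k] TP k A m) :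
    piR p (hat (close k A p ∘ₗ G) (close k A m z)) = 0 := by
  induction z with
  | zero => simp
  | add x y hx hy => simp only [map_add, hx, hy, add_zero]
  | tmul a w =>
    rw [close_tmul, hat_tmul, LinearMap.comp_apply, piR_lmul_rmul_close, proj_one]
    simp

theorem hat_smul {m p : ℕ} (c : k) (f : Cochain k A m p) (x : Bar k A m) :
    hat (c • f) x = c • hat f x := by
  induction x using bar_induction with
  | h0 => simp
  | hadd x y hx hy => simp only [map_add, hx, hy, smul_add]
  | hc b w c => simp

theorem theta_mem_omegaCochains {l p : ℕ} (f : Cochain k A l p) :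
    theta l p f ∈ omegaCochains k A (l + 1) (p + 1) := fun w => by
  rw [theta, LinearMap.smul_apply]
  exact Submodule.smul_mem _ _ (d_mem_Omega _)

/-- The connecting homomorphism is computed by the canonical lift. -/
theorem delta_barLift {l p : ℕ} {f : Cochain k A l p} (hf : f ∈ extZ k A l p) :
    delta k A l (p + 1) (barLift f) = theta l p f := by
  -- The differential of the lift has values in Ω because d maps it to δf = 0; it then suffices to
  -- compare both sides after `piR`.
  have h1 : delta k A l (p + 1) (barLift f) ∈ omegaCochains k A (l + 1) (p + 1) := by
    refine mem_omegaCochains_of_d_comp ?_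
    rw [← delta_d_comp, d_comp_barLift hf.1]
    exact hf.2
  refine LinearMap.ext fun w => Omega_ext (h1 w) (theta_mem_omegaCochains f w) ?_
  rw [theta, LinearMap.smul_apply, map_smul, LinearMap.comp_apply, LinearMap.comp_apply,
    piR_d_close, delta_eq_hat, barLift, hat_smul, map_smul, d_tmul, map_add, map_add, map_add,
    map_add, ← close_tmul]
  -- Of the three parts of δ, only the last one multiplies the final 1 by an element of A; `piR`
  -- kills the other two.
  obtain ⟨z, hz⟩ := dFirst_close ((1 : A) ⊗ₜ[k] w)
  rw [hz, piR_hat_close, ← close_tmul, piR_hat_close, zero_add, zero_add, map_smul, map_smul]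
  induction w using snoc_induction with
  | h0 => simp
  | hadd x y hx hy =>
    -- The hypothesis on z concerns the whole sum x + y, so the remaining identity, which is
    -- additive in the word, is proved afresh without it.
    clear hz hx hy
    have key : ∀ w : TP k A (l + 1),
        (-1 : k) ^ (p + 1) • (-1 : k) ^ (l + 1) • piR (p + 1)
            (hat (close k A (p + 1) ∘ₗ piR p ∘ₗ f) (dLast k A l (close k A (l + 1) (1 ⊗ₜ w)))) =
          (-1 : k) ^ l • (-1 : k) ^ (p + 2) • extR (piR p ∘ₗ f) 1 rfl rfl w := by
      intro w
      induction w using snoc_induction with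
      | h0 => simp
      | hadd x y hx hy =>
        simp only [TensorProduct.tmul_add, map_add, smul_add, hx, hy]
      | hc w c =>
        rw [extR_snoc, close_tmul, dLast_tmul, hat_tmul, LinearMap.comp_apply, piR_lmul_rmul_close,
          LinearMap.mulLeft_one, mul_one, proj_sec, ← LinearMap.lTensor_def, LinearMap.comp_apply,
          smul_smul, smul_smul]
        congr 1
        ring
    exact key _
  | hc w c =>
    rw [extR_snoc, close_tmul, dLast_tmul, hat_tmul, LinearMap.comp_apply, piR_lmul_rmul_close,
      LinearMap.mulLeft_one, mul_one, proj_sec, ← LinearMap.lTensor_def, LinearMap.comp_apply,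
      smul_smul, smul_smul]
    congr 1
    ring

theorem theta_mem_extZ {l p : ℕ} {f : Cochain k A l p} (hf : f ∈ extZ k A l p) :
    theta l p f ∈ extZ k A (l + 1) (p + 1) :=
  ⟨theta_mem_omegaCochains f, by
    rw [← delta_barLift hf]
    exact delta_delta _⟩

/-- The connecting homomorphism may be computed with any lift. -/
theorem theta_sub_delta_mem {l p : ℕ} {f : Cochain k A l p} (hf : f ∈ extZ k A l p)
    {h : Cochain k A l (p + 1)} (hh : d k A p ∘ₗ h = f) :
    theta l p f - delta k A l (p + 1) h ∈ extB k A (l + 1) (p + 1) := by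
  rw [← delta_barLift hf]
  refine ⟨barLift f - h, mem_omegaCochains_of_d_comp ?_, map_sub (delta k A l (p + 1)) (barLift f) h⟩
  rw [LinearMap.comp_sub, d_comp_barLift hf.1, hh]
  exact sub_self f

/-- A coboundary δh has the lift δ(h') with h' a lift of h, and δδ = 0. In degree zero there are no
coboundaries to treat. -/
theorem theta_mem_extB {l p : ℕ} {f : Cochain k A l p} (hf : f ∈ extB k A l p) :
    theta l p f ∈ extB k A (l + 1) (p + 1) := by
  cases l with
  | zero =>
    rw [extB, Submodule.mem_bot] at hf
    subst hf
    have h := theta_sub_delta_mem (zero_mem (extZ k A 0 p)) (h := 0) (by simp)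
    have e : theta 0 p (0 : Cochain k A 0 p) - delta k A 0 (p + 1) 0 = theta 0 p 0 := by
      rw [map_zero]; module
    rwa [e] at h
  | succ l =>
    have hZ := extB_le_extZ hf
    obtain ⟨h, hh, rfl⟩ := hf
    have h1 := theta_sub_delta_mem hZ (h := delta k A l (p + 1) (barLift h)) (by
      rw [← delta_d_comp, d_comp_barLift hh])
    rw [delta_delta] at h1
    have e : theta (l + 1) p (delta k A l p h) - 0 = theta (l + 1) p (delta k A l p h) := by
      module
    rwa [e] at h1

end Cochains

/-! ### Identities for the Casimir element ∑ u_j ⊗ v_j -/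

section FrobeniusBasis

variable {k : Type u} {A : Type v} [Field k] [Ring A] [Algebra k A] [FiniteDimensional k A]
  (F : FrobeniusForm k A)

/-- The linear form `a ↦ ⟨a, 1⟩`. -/
def lam : A →ₗ[k] k := F.form.flip 1

omit [FiniteDimensional k A] in
theorem form_eq_lam (a b : A) : F.form a b = lam F (a * b) := by
  simp [lam, F.assoc]

theorem sum_lam_smul_dualV (a : A) :
    ∑ j, lam F (a * dualU (k := k) j) • dualV F j = a := by
  conv_rhs => rw [← (F.form.dualBasis F.nondegenerate (Module.finBasis k A)).sum_repr a]
  refine Finset.sum_congr rfl fun j _ => ?_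
  rw [LinearMap.BilinForm.dualBasis_repr_apply, form_eq_lam]
  rfl

theorem sum_lam_smul_dualU (a : A) :
    ∑ j, lam F (dualV F j * a) • dualU (k := k) j = a := by
  conv_rhs => rw [← (Module.finBasis k A).sum_repr a]
  refine Finset.sum_congr rfl fun j _ => ?_
  rw [← form_eq_lam]
  conv_lhs => rw [← (Module.finBasis k A).sum_repr a]
  rw [map_sum]
  have h : ∀ i, F.form (dualV F j) ((Module.finBasis k A).repr a i • (Module.finBasis k A) i) =
      if j = i then (Module.finBasis k A).repr a i else 0 := by
    intro i
    have := form_dualV_dualU F j i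
    rw [dualU] at this
    rw [map_smul, this]
    simp
  simp_rw [h]
  simp [dualU]

variable {M : Type*} [AddCommMonoid M] [Module k M]

/-- Invariance of the Casimir element under A: both sides expand to ∑ λ(v_i b u_j) u_i ⊗ v_j. -/
theorem sum_mul_dualU (Φ : A →ₗ[k] A →ₗ[k] M) (b : A) :
    ∑ j, Φ (b * dualU (k := k) j) (dualV F j) = ∑ j, Φ (dualU (k := k) j) (dualV F j * b) := by
  have h1 : ∀ j, Φ (b * dualU (k := k) j) (dualV F j) =
      ∑ i, lam F (dualV F i * b * dualU (k := k) j) • Φ (dualU (k := k) i) (dualV F j) := by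
    intro j
    conv_lhs => rw [← sum_lam_smul_dualU F (b * dualU (k := k) j)]
    simp [LinearMap.sum_apply, mul_assoc]
  simp_rw [h1]
  rw [Finset.sum_comm]
  refine Finset.sum_congr rfl fun i _ => ?_
  conv_rhs => rw [← sum_lam_smul_dualV F (dualV F i * b)]
  simp

variable {ν : A ≃ₐ[k] A} (hν : IsNakayama F ν)

include hν

omit [FiniteDimensional k A] in
theorem lam_mul_nakayama (a b : A) : lam F (a * ν b) = lam F (b * a) := by
  rw [← form_eq_lam, ← form_eq_lam, hν b a]

/-- Moving a factor across the inside of the Casimir element costs a twist, since λ(v_i u_j ν(c)) =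
λ(c v_i u_j). -/
theorem sum_dualU_mul (Φ : A →ₗ[k] A →ₗ[k] M) (c : A) :
    ∑ j, Φ (dualU (k := k) j * ν c) (dualV F j) = ∑ j, Φ (dualU (k := k) j) (c * dualV F j) := by
  have h1 : ∀ j, Φ (dualU (k := k) j * ν c) (dualV F j) =
      ∑ i, lam F (c * dualV F i * dualU (k := k) j) • Φ (dualU (k := k) i) (dualV F j) := by
    intro j
    conv_lhs => rw [← sum_lam_smul_dualU F (dualU (k := k) j * ν c)]
    simp_rw [← mul_assoc, lam_mul_nakayama F hν]
    simp [LinearMap.sum_apply, mul_assoc]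
  simp_rw [h1]
  rw [Finset.sum_comm]
  refine Finset.sum_congr rfl fun i _ => ?_
  conv_rhs => rw [← sum_lam_smul_dualV F (c * dualV F i)]
  simp

/-- Both sides expand to ∑ λ(v_i v_j) u_i ⊗ u_j. Using this flip twice shows that the Casimir
element is fixed by ν ⊗ ν. -/
theorem sum_dualV_dualU (Φ : A →ₗ[k] A →ₗ[k] M) :
    ∑ j, Φ (dualV F j) (dualU (k := k) j) = ∑ j, Φ (dualU (k := k) j) (ν (dualV F j)) := by
  have h1 : ∀ j, Φ (dualV F j) (dualU (k := k) j) =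
      ∑ i, lam F (dualV F i * dualV F j) • Φ (dualU (k := k) i) (dualU (k := k) j) := by
    intro j
    conv_lhs => rw [← sum_lam_smul_dualU F (dualV F j)]
    simp [LinearMap.sum_apply]
  simp_rw [h1]
  rw [Finset.sum_comm]
  refine Finset.sum_congr rfl fun i _ => ?_
  conv_rhs => rw [← sum_lam_smul_dualU F (ν (dualV F i))]
  simp_rw [lam_mul_nakayama F hν]
  simp

theorem sum_nakayama_dualU_dualV (Φ : A →ₗ[k] A →ₗ[k] M) :
    ∑ j, Φ (ν (dualU (k := k) j)) (ν (dualV F j)) = ∑ j, Φ (dualU (k := k) j) (dualV F j) := by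
  have h1 := sum_dualV_dualU F hν Φ.flip
  have h2 := sum_dualV_dualU F hν (Φ ∘ₗ ν.toLinearMap)
  simp only [LinearMap.flip_apply, LinearMap.comp_apply, AlgEquiv.toLinearMap_apply] at h1 h2
  rw [h1, h2]

end FrobeniusBasis

/-! ### Acyclicity of the bar bimodules; θ in positive degrees -/

section Contraction

variable {k : Type u} {A : Type v} [Field k] [Ring A] [Algebra k A]

theorem lmul_add {r : ℕ} (a b : A) (x : Bar k A r) : lmul (a + b) x = lmul a x + lmul b x := by
  induction x using TensorProduct.induction_on with
  | zero => simp
  | add x y hx hy => simp only [map_add, hx, hy]; abel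
  | tmul c t => simp [add_mul, TensorProduct.add_tmul]

theorem lmul_smul {r : ℕ} (c : k) (a : A) (x : Bar k A r) : lmul (c • a) x = c • lmul a x := by
  induction x using TensorProduct.induction_on with
  | zero => simp
  | add x y hx hy => simp only [map_add, smul_add, hx, hy]
  | tmul b t => simp [TensorProduct.smul_tmul']

/-- The first letter enters through an arbitrary representative a instead of the chosen one; this is
what allows the dual basis elements v_j themselves to be inserted below. -/
theorem delta_cons_cons {m p : ℕ} (f : Cochain k A (m + 1) p) (a : A) (b : ABar k A)
    (w : TP k A m) :
    delta k A (m + 1) p f (cons (m + 1) (proj k A a ⊗ₜ cons m (b ⊗ₜ w))) =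
      lmul a (f (cons m (b ⊗ₜ w))) - f (cons m (proj k A (a * sec k A b) ⊗ₜ w))
        - f (cons m (proj k A a ⊗ₜ inner k A m (cons m (b ⊗ₜ w))))
        + (-1 : k) ^ (m + 2) •
          deltaLast k A f (cons (m + 1) (proj k A a ⊗ₜ cons m (b ⊗ₜ w))) := by
  rw [delta_apply, deltaFirst_cons, inner_cons_cons]
  obtain ⟨c, hc⟩ := exists_eq_sec_add (k := k) a
  have h1 : lmul a (f (cons m (b ⊗ₜ w))) =
      lmul (sec k A (proj k A a)) (f (cons m (b ⊗ₜ w))) + c • f (cons m (b ⊗ₜ w)) := by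
    conv_lhs => rw [hc]
    rw [lmul_add, lmul_smul, lmul_one]
  have h2 : proj k A (a * sec k A b) =
      proj k A (sec k A (proj k A a) * sec k A b) + c • b := by
    conv_lhs => rw [hc]
    rw [add_mul, smul_mul_assoc, one_mul, map_add, map_smul, proj_sec]
  rw [h1, h2]
  simp only [TensorProduct.add_tmul, map_add, map_smul, ← TensorProduct.smul_tmul']
  module

variable [FiniteDimensional k A] (F : FrobeniusForm k A)

/-- The map `a ⊗ t ↦ λ(a) ⊗ t` on `Bar_p(A)`. -/
def evalLeft {p : ℕ} : Bar k A p →ₗ[k] Bar k A p :=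
  LinearMap.rTensor _ ((LinearMap.toSpanSingleton k A 1) ∘ₗ lam F)

omit [FiniteDimensional k A] in
theorem evalLeft_tmul {p : ℕ} (a : A) (t : TP k A p ⊗[k] A) :
    evalLeft F (a ⊗ₜ[k] t) = (lam F a • (1 : A)) ⊗ₜ[k] t := by simp [evalLeft]

omit [FiniteDimensional k A] in
theorem evalLeft_rmul {p : ℕ} (b : A) (x : Bar k A p) :
    evalLeft F (rmul b x) = rmul b (evalLeft F x) := by
  induction x using TensorProduct.induction_on with
  | zero => simp
  | add x y hx hy => simp only [map_add, hx, hy]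
  | tmul a t => simp [evalLeft_tmul]

theorem sum_lmul_evalLeft {p : ℕ} (x : Bar k A p) :
    ∑ j, lmul (dualU (k := k) j) (evalLeft F (lmul (dualV F j) x)) = x := by
  induction x using TensorProduct.induction_on with
  | zero => simp
  | add x y hx hy => simp only [map_add, Finset.sum_add_distrib, hx, hy]
  | tmul a t =>
    simp only [lmul_tmul, evalLeft_tmul, mul_smul_comm, mul_one]
    rw [← TensorProduct.sum_tmul, sum_lam_smul_dualU]

/-- A contraction of the Hochschild complex with coefficients in `Bar_p(A)`. -/
def contract {m p : ℕ} (f : Cochain k A (m + 1) p) : Cochain k A m p :=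
  ∑ j, lmul (dualU (k := k) j) ∘ₗ evalLeft F ∘ₗ f ∘ₗ (cons m).toLinearMap ∘ₗ
    TensorProduct.mk k _ _ (proj k A (dualV F j))

theorem contract_apply {m p : ℕ} (f : Cochain k A (m + 1) p) (w : TP k A m) :
    contract F f w = ∑ j, lmul (dualU (k := k) j)
      (evalLeft F (f (cons m (proj k A (dualV F j) ⊗ₜ w)))) := by
  rw [contract, LinearMap.sum_apply]; rfl

theorem deltaLast_contract {m p : ℕ} (f : Cochain k A (m + 1) p) (w : TP k A (m + 1)) :
    deltaLast k A (contract F f) w = ∑ j, lmul (dualU (k := k) j)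
      (evalLeft F (deltaLast k A f (cons (m + 1) (proj k A (dualV F j) ⊗ₜ w)))) := by
  induction w using snoc_induction with
  | h0 => simp
  | hadd x y hx hy =>
    simp only [map_add, TensorProduct.tmul_add, Finset.sum_add_distrib, hx, hy]
  | hc w c =>
    rw [deltaLast_snoc, contract_apply, map_sum]
    refine Finset.sum_congr rfl fun j _ => ?_
    rw [cons_snoc, deltaLast_snoc, evalLeft_rmul, lmul_rmul]

/-- The contraction feeds v_j in as an additional first letter, applies λ to the left factor of the
value and multiplies by u_j. The first term of δf at (v_j, b, …) sums to f by dual basis expansion;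
all other terms cancel against those of δ(`contract` f). -/
theorem delta_contract {m p : ℕ} (f : Cochain k A (m + 1) p) :
    delta k A m p (contract F f) + contract F (delta k A (m + 1) p f) = f := by
  refine LinearMap.ext fun w => ?_
  induction w using cons_induction with
  | h0 => simp
  | hadd x y hx hy => rw [map_add, hx, hy, map_add]
  | hc b w =>
    rw [LinearMap.add_apply, contract_apply F (delta k A (m + 1) p f), delta_apply, deltaFirst_cons,
      deltaLast_contract, contract_apply, contract_apply]
    simp_rw [delta_cons_cons, map_add, map_sub, Finset.sum_add_distrib, Finset.sum_sub_distrib,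
      map_smul, ← Finset.smul_sum]
    -- Invariance of the Casimir element matches the leading term of δ(`contract` f) with the term
    -- of `contract` (δf) that merges v_j and b.
    have h1 : lmul (sec k A b) (∑ j, lmul (dualU (k := k) j)
        (evalLeft F (f (cons m (proj k A (dualV F j) ⊗ₜ w))))) =
        ∑ j, lmul (dualU (k := k) j)
          (evalLeft F (f (cons m (proj k A (dualV F j * sec k A b) ⊗ₜ w)))) := by
      rw [map_sum]
      simp_rw [← lmul_mul]
      exact sum_mul_dualU F (M := Bar k A p) (LinearMap.mk₂ k
        (fun x y => lmul x (evalLeft F (f (cons m (proj k A y ⊗ₜ w)))))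
        (fun x y z => lmul_add _ _ _) (fun c x z => lmul_smul _ _ _)
        (fun x y z => by simp only [map_add, TensorProduct.add_tmul])
        (fun c x z => by simp only [map_smul, ← TensorProduct.smul_tmul'])) (sec k A b)
    rw [h1, sum_lmul_evalLeft]
    module

/-- Hochschild cohomology with coefficients in `Bar_p(A)` vanishes in positive degrees. -/
theorem delta_contract_of_cocycle {m p : ℕ} {f : Cochain k A (m + 1) p}
    (hf : delta k A (m + 1) p f = 0) : delta k A m p (contract F f) = f := by
  have h := delta_contract F f
  rw [hf] at h
  have h0 : contract F (0 : Cochain k A (m + 2) p) = 0 :=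
    LinearMap.ext fun w => by rw [contract_apply]; simp
  rw [h0] at h
  refine Eq.trans ?_ h
  module

-- Surjectivity of θ onto positive degrees. As a cochain in the bar bimodule, f is the coboundary of
-- its contraction; d of that contraction is a cocycle, and θ of it may be computed with the
-- contraction as lift.
include F in
theorem exists_theta_sub_mem {l p : ℕ} {f : Cochain k A (l + 1) (p + 1)}
    (hf : f ∈ extZ k A (l + 1) (p + 1)) :
    ∃ g ∈ extZ k A l p, theta l p g - f ∈ extB k A (l + 1) (p + 1) := by
  have h := delta_contract_of_cocycle F hf.2
  have hg : d k A p ∘ₗ contract F f ∈ extZ k A l p := by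
    refine ⟨d_comp_mem _, ?_⟩
    refine LinearMap.mem_ker.2 ?_
    rw [delta_d_comp, h]
    exact d_comp_eq_zero hf.1
  refine ⟨_, hg, ?_⟩
  have := theta_sub_delta_mem hg rfl
  rwa [h] at this

-- The exactness argument for the kernel of θ: if δ of the canonical lift is also δ of an Ω-valued
-- cochain, their difference is a lift that is a cocycle.
omit [FiniteDimensional k A] in
theorem exists_of_theta_mem_extB {l p : ℕ} {f : Cochain k A l p} (hf : f ∈ extZ k A l p)
    (h : theta l p f ∈ extB k A (l + 1) (p + 1)) :
    ∃ e : Cochain k A l (p + 1), delta k A l (p + 1) e = 0 ∧ d k A p ∘ₗ e = f := by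
  obtain ⟨h', hh', e⟩ := h
  refine ⟨barLift f - h', ?_, ?_⟩
  · have := map_sub (delta k A l (p + 1)) (barLift f) h'
    rw [this, delta_barLift hf, e]
    exact sub_self (theta l p f)
  · rw [LinearMap.comp_sub, d_comp_barLift hf.1, d_comp_eq_zero hh']
    exact sub_zero f

-- Injectivity of θ in positive degrees: the cocycle lift e is δ of its contraction, so f = d ∘ e is
-- δ of d ∘ `contract` e.
include F in
theorem mem_extB_of_theta_mem_extB {l p : ℕ} {f : Cochain k A (l + 1) p}
    (hf : f ∈ extZ k A (l + 1) p) (h : theta (l + 1) p f ∈ extB k A (l + 2) (p + 1)) :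
    f ∈ extB k A (l + 1) p := by
  obtain ⟨e, he, rfl⟩ := exists_of_theta_mem_extB hf h
  refine ⟨d k A p ∘ₗ contract F e, d_comp_mem _, ?_⟩
  rw [delta_d_comp, delta_contract_of_cocycle F he]

end Contraction

/-! ### Twisted chains as invariants of Bar_r(A) -/

section Invariants

variable {k : Type u} {A : Type v} [Field k] [Ring A] [Algebra k A] [FiniteDimensional k A]
  (F : FrobeniusForm k A) (ν : A ≃ₐ[k] A)

/-- The map `a₀ ⊗ w ↦ ∑ u_j ν(a₀) ⊗ w ⊗ v_j`. -/
def gam (r : ℕ) : Chain k A r →ₗ[k] Bar k A r :=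
  ∑ j, TensorProduct.map (LinearMap.mulLeft k (dualU (k := k) j) ∘ₗ ν.toLinearMap)
    ((TensorProduct.mk k (TP k A r) A).flip (dualV F j))

theorem gam_tmul {r : ℕ} (a : A) (w : TP k A r) :
    gam F ν r (a ⊗ₜ w) = ∑ j, (dualU (k := k) j * ν a) ⊗ₜ[k] (w ⊗ₜ[k] dualV F j) := by
  simp [gam, LinearMap.sum_apply]

theorem casimir_tmul {r : ℕ} (a : A) (w : TP k A r) :
    casimir F ν r (a ⊗ₜ w) =
      ∑ j, (dualU (k := k) j * ν a) ⊗ₜ[k] snoc r (w ⊗ₜ proj k A (dualV F j)) := by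
  simp [casimir]

theorem piR_gam {r : ℕ} (x : Chain k A r) : piR r (gam F ν r x) = casimir F ν r x := by
  have hadd : ∀ x y, casimir F ν r (x + y) = casimir F ν r x + casimir F ν r y := fun x y => by
    simp [casimir, Finset.sum_add_distrib]
  induction x using TensorProduct.induction_on with
  | zero => simp [casimir]
  | add x y hx hy => rw [map_add, map_add, hx, hy, hadd]
  | tmul a w => rw [gam_tmul, casimir_tmul, map_sum]; simp

/-- The bilinear map `(x, y) ↦ x a ⊗ w ⊗ y`. -/
def sandwich {r : ℕ} (a : A) (w : TP k A r) : A →ₗ[k] A →ₗ[k] Bar k A r :=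
  (TensorProduct.mk k A (TP k A r ⊗[k] A)).compl₁₂ (LinearMap.mulRight k a) (TensorProduct.mk k _ _ w)

omit [FiniteDimensional k A] in
@[simp]
theorem sandwich_apply {r : ℕ} (a : A) (w : TP k A r) (x y : A) :
    sandwich a w x y = (x * a) ⊗ₜ[k] (w ⊗ₜ[k] y) := rfl

theorem lmul_gam {r : ℕ} (b : A) (x : Chain k A r) :
    lmul b (gam F ν r x) = rmul b (gam F ν r x) := by
  induction x using TensorProduct.induction_on with
  | zero => simp
  | add x y hx hy => simp only [map_add, hx, hy]
  | tmul a w =>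
    rw [gam_tmul, map_sum, map_sum]
    simpa [mul_assoc] using sum_mul_dualU F (sandwich (ν a) w) b

/-- The left inverse of `gam`. -/
def gamInv (r : ℕ) : Bar k A r →ₗ[k] Chain k A r :=
  TensorProduct.map ν.symm.toLinearMap
    ((TensorProduct.rid k _).toLinearMap ∘ₗ LinearMap.lTensor (TP k A r) (lam F))

omit [FiniteDimensional k A] in
theorem gamInv_tmul {r : ℕ} (a b : A) (w : TP k A r) :
    gamInv F ν r (a ⊗ₜ (w ⊗ₜ b)) = ν.symm a ⊗ₜ[k] (lam F b • w) := by simp [gamInv]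

theorem gamInv_gam {r : ℕ} (x : Chain k A r) : gamInv F ν r (gam F ν r x) = x := by
  induction x using TensorProduct.induction_on with
  | zero => simp
  | add x y hx hy => simp only [map_add, hx, hy]
  | tmul a w =>
    rw [gam_tmul, map_sum]
    simp_rw [gamInv_tmul, ← TensorProduct.smul_tmul, ← map_smul, ← smul_mul_assoc]
    rw [← TensorProduct.sum_tmul, ← map_sum, ← Finset.sum_mul]
    have := sum_lam_smul_dualU F 1
    simp only [mul_one] at this
    rw [this]
    simp

/-- On any x the composite is a sum of terms in which u_j multiplies x from the left and v_j
replaces the last factor. For invariant x the u_j may act from the right instead, and dual basis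
expansion restores the last factor. -/
theorem gam_gamInv {r : ℕ} {x : Bar k A r} (hx : ∀ b, lmul b x = rmul b x) :
    gam F ν r (gamInv F ν r x) = x := by
  have h1 : ∀ y : Bar k A r, gam F ν r (gamInv F ν r y) =
      ∑ j, LinearMap.lTensor A (LinearMap.lTensor (TP k A r)
        ((LinearMap.toSpanSingleton k A (dualV F j)) ∘ₗ lam F)) (lmul (dualU (k := k) j) y) := by
    intro y
    induction y using bar_induction with
    | h0 => simp
    | hadd x y hx hy => simp only [map_add, Finset.sum_add_distrib, hx, hy]
    | hc a w b =>
      rw [gamInv_tmul, gam_tmul]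
      simp [TensorProduct.smul_tmul]
  rw [h1]
  simp_rw [hx]
  clear hx
  induction x using bar_induction with
  | h0 => simp
  | hadd x y hx hy => simp only [map_add, Finset.sum_add_distrib, hx, hy]
  | hc a w b =>
    simp only [rmul_tmul, rmulTail_tmul, LinearMap.lTensor_tmul, LinearMap.comp_apply,
      LinearMap.toSpanSingleton_apply]
    rw [← TensorProduct.tmul_sum, ← TensorProduct.tmul_sum, sum_lam_smul_dualV]

variable {ν} (hν : IsNakayama F ν)

omit [FiniteDimensional k A] in
theorem bd_tmul {σ : A ≃ₐ[k] A} {r : ℕ} (a : A) (w : TP k A (r + 1)) :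
    bd σ r (a ⊗ₜ w) = LinearMap.rTensor (TP k A r)
      (LinearMap.mul' k A ∘ₗ LinearMap.lTensor A (σ.toLinearMap ∘ₗ sec k A))
      ((TensorProduct.assoc k A (ABar k A) (TP k A r)).symm (a ⊗ₜ (cons r).symm w))
      + a ⊗ₜ inner k A r w + (-1 : k) ^ (r + 1) • LinearMap.rTensor (TP k A r) (mulR k A)
        ((TensorProduct.assoc k (ABar k A) A (TP k A r)).symm
          (TensorProduct.comm k (Chain k A r) (ABar k A)
            ((TensorProduct.assoc k A (TP k A r) (ABar k A)).symm (a ⊗ₜ (snoc r).symm w)))) := by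
  simp [bd]

include hν

/-- The first face gives u_j ν(a)c = u_j ν(aν⁻¹(c)), and in the last face c v_j becomes u_j ν(c) by
`sum_dualU_mul`. This is why the coefficients are twisted by ν⁻¹. -/
theorem d_gam {r : ℕ} (x : Chain k A (r + 1)) :
    d k A r (gam F ν (r + 1) x) = gam F ν r (bd ν.symm r x) := by
  induction x using TensorProduct.induction_on with
  | zero => simp
  | add x y hx hy => simp only [map_add, hx, hy]
  | tmul a w =>
    rw [gam_tmul, map_sum, bd_tmul]
    simp_rw [d_tmul]
    rw [Finset.sum_add_distrib, Finset.sum_add_distrib, map_add, map_add, map_smul,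
      ← Finset.smul_sum]
    congr 1
    · congr 1
      · induction w using cons_induction with
        | h0 => simp
        | hadd x y hx hy =>
          simp only [map_add, TensorProduct.tmul_add, TensorProduct.add_tmul,
            Finset.sum_add_distrib, hx, hy]
        | hc c w => simp [gam_tmul, mul_assoc]
      · rw [gam_tmul]
    · congr 1
      induction w using snoc_induction with
      | h0 => simp
      | hadd x y hx hy =>
        simp only [map_add, TensorProduct.tmul_add, TensorProduct.add_tmul,
          Finset.sum_add_distrib, hx, hy]
      | hc w c =>
        have := sum_dualU_mul F hν (sandwich (ν a) w) (sec k A c)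
        simp only [sandwich_apply, mul_assoc] at this
        simp [gam_tmul, mulR, this]

/-- The ν-invariance of the Casimir element gives ∑ u_j ν(a) v_j = ν(∑ u_j a v_j). The cycle
condition in degree -1 of the complete complex is thus membership in Ω̄¹(A). -/
theorem aug_gam (x : Chain k A 0) : aug (gam F ν 0 x) = ν (mu F x) := by
  induction x using TensorProduct.induction_on with
  | zero => simp
  | add x y hx hy => simp only [map_add, hx, hy]
  | tmul a w =>
    obtain ⟨c, rfl⟩ := exists_smul_emptyWord w
    have h := sum_nakayama_dualU_dualV F hν
      ((LinearMap.mul k A).compl₁₂ (LinearMap.mulRight k (ν a)) LinearMap.id)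
    simp only [LinearMap.compl₁₂_apply, LinearMap.mulRight_apply, LinearMap.id_apply,
      LinearMap.mul_apply'] at h
    rw [gam_tmul, map_sum]
    simp_rw [← TensorProduct.smul_tmul', TensorProduct.tmul_smul, map_smul, aug_tmul]
    rw [← Finset.smul_sum, ← h]
    simp [mu, Finset.smul_sum, emptyWord]

theorem gam_mem_Omega_iff {r : ℕ} (x : Chain k A r) :
    gam F ν r x ∈ Omega k A r ↔ x ∈ hatZ F ν r := by
  cases r with
  | zero =>
    rw [mem_Omega_zero_iff, aug_gam F hν, hatZ, LinearMap.mem_ker]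
    exact map_eq_zero_iff ν ν.injective
  | succ r =>
    rw [mem_Omega_succ_iff, d_gam F hν, hatZ, LinearMap.mem_ker]
    exact map_eq_zero_iff _ (Function.LeftInverse.injective (gamInv_gam F ν))

end Invariants

/-! ### The ring A ⊗ T(Ā) ⊗ A, its differential and gluing -/

section Forms

variable {k : Type u} {A : Type v} [Field k] [Ring A] [Algebra k A]

variable (k A) in
/-- `A ⊗ T(Ā) ⊗ A`, the sum of all `Bar_r(A)`, as a ring. -/
def Forms : Type (max u v) := A ⊗[k] (WordAlg k A ⊗[k] A)

instance instRingForms : Ring (Forms k A) := inferInstanceAs (Ring (A ⊗[k] (WordAlg k A ⊗[k] A)))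

instance instAlgebraForms : Algebra k (Forms k A) :=
  inferInstanceAs (Algebra k (A ⊗[k] (WordAlg k A ⊗[k] A)))

variable (k A) in
/-- `Forms k A` as a tensor product. -/
def formsEquiv : Forms k A ≃ₗ[k] A ⊗[k] (WordAlg k A ⊗[k] A) :=
  LinearEquiv.refl k (A ⊗[k] (WordAlg k A ⊗[k] A))

/-- The linear map on `T(Ā)` with given components. -/
def wordLift {X : Type*} [AddCommMonoid X] [Module k X] (φ : ∀ n, TP k A n →ₗ[k] X) :
    WordAlg k A →ₗ[k] X :=
  DirectSum.toModule k ℕ X φ ∘ₗ TensorAlgebra.toDirectSum.toLinearMap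

theorem toDirectSum_toWord {n : ℕ} (w : TP k A n) :
    TensorAlgebra.toDirectSum (toWord w) = DirectSum.lof k ℕ (fun n => TP k A n) n w := by
  induction w using PiTensorProduct.induction_on with
  | smul_tprod c a =>
    rw [map_smul, map_smul, map_smul]
    simp only [toWord, TensorPower.toTensorAlgebra_tprod,
      TensorAlgebra.toDirectSum_tensorPower_tprod, DirectSum.lof_eq_of]
  | add x y hx hy => rw [map_add, map_add, map_add, hx, hy]

@[simp]
theorem wordLift_toWord {X : Type*} [AddCommMonoid X] [Module k X] (φ : ∀ n, TP k A n →ₗ[k] X)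
    {n : ℕ} (w : TP k A n) : wordLift φ (toWord w) = φ n w := by
  rw [wordLift, LinearMap.comp_apply, AlgHom.toLinearMap_apply, toDirectSum_toWord,
    DirectSum.toModule_lof]

theorem word_induction {p : WordAlg k A → Prop} (h0 : p 0)
    (hadd : ∀ x y, p x → p y → p (x + y)) (hw : ∀ n (w : TP k A n), p (toWord w)) (u) : p u := by
  rw [← TensorAlgebra.ofDirectSum_toDirectSum u]
  generalize TensorAlgebra.toDirectSum u = x
  induction x using DirectSum.induction_on with
  | zero => rwa [map_zero]
  | add x y hx hy => rw [map_add]; exact hadd _ _ hx hy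
  | of n w =>
    rw [← DirectSum.lof_eq_of k, ← toDirectSum_toWord, TensorAlgebra.ofDirectSum_toDirectSum]
    exact hw n w

/-- The left copy of `A`. -/
def al : A →ₗ[k] Forms k A :=
  (formsEquiv k A).symm.toLinearMap ∘ₗ (TensorProduct.mk k A (WordAlg k A ⊗[k] A)).flip 1

/-- The elements `1 ⊗ u ⊗ b`. -/
def jt : WordAlg k A →ₗ[k] A →ₗ[k] Forms k A :=
  (TensorProduct.mk k (WordAlg k A) A).compr₂
    ((formsEquiv k A).symm.toLinearMap ∘ₗ TensorProduct.mk k A (WordAlg k A ⊗[k] A) 1)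

theorem formsEquiv_al_mul_jt (a b : A) (u : WordAlg k A) :
    formsEquiv k A (al a * jt u b) = a ⊗ₜ[k] (u ⊗ₜ[k] b) := by
  exact (by simp : (a ⊗ₜ[k] (1 ⊗ₜ[k] 1) * 1 ⊗ₜ[k] (u ⊗ₜ[k] b) :
    A ⊗[k] (WordAlg k A ⊗[k] A)) = a ⊗ₜ[k] (u ⊗ₜ[k] b))

theorem formsEquiv_symm_tmul (a b : A) (u : WordAlg k A) :
    (formsEquiv k A).symm (a ⊗ₜ[k] (u ⊗ₜ[k] b)) = al a * jt u b := by
  rw [← formsEquiv_al_mul_jt, LinearEquiv.symm_apply_apply]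

theorem al_mul (a b : A) : (al (a * b) : Forms k A) = al a * al b := by
  exact (by simp : ((a * b) ⊗ₜ[k] 1 : A ⊗[k] (WordAlg k A ⊗[k] A)) = a ⊗ₜ[k] 1 * b ⊗ₜ[k] 1)

theorem al_one : (al 1 : Forms k A) = 1 := rfl

theorem jt_one_one : (jt 1 1 : Forms k A) = 1 := rfl

theorem jt_mul_jt (u v : WordAlg k A) (a b : A) : jt u a * jt v b = jt (u * v) (a * b) := by
  exact (by simp : (1 ⊗ₜ[k] (u ⊗ₜ[k] a) * 1 ⊗ₜ[k] (v ⊗ₜ[k] b) : A ⊗[k] (WordAlg k A ⊗[k] A)) =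
    1 ⊗ₜ[k] ((u * v) ⊗ₜ[k] (a * b)))

theorem forms_jt_induction {p : Forms k A → Prop} (h0 : p 0)
    (hadd : ∀ x y, p x → p y → p (x + y)) (hc : ∀ a u b, p (al a * jt u b)) (x) : p x := by
  rw [← (formsEquiv k A).symm_apply_apply x]
  generalize formsEquiv k A x = x
  induction x using TensorProduct.induction_on with
  | zero => rwa [map_zero]
  | add x y hx hy => rw [map_add]; exact hadd _ _ hx hy
  | tmul a t =>
    induction t using TensorProduct.induction_on with
    | zero => rwa [TensorProduct.tmul_zero, map_zero]
    | add x y hx hy => rw [TensorProduct.tmul_add, map_add]; exact hadd _ _ hx hy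
    | tmul w b => rw [formsEquiv_symm_tmul]; exact hc a w b

/-- The extension of `φ` to a map which commutes with left and right multiplications by `A`. -/
def ext (φ : WordAlg k A →ₗ[k] Forms k A) : Forms k A →ₗ[k] Forms k A :=
  LinearMap.mul' k _ ∘ₗ TensorProduct.map al (LinearMap.mul' k _ ∘ₗ TensorProduct.map φ (jt 1)) ∘ₗ
    (formsEquiv k A).toLinearMap

theorem ext_al_mul_jt (φ : WordAlg k A →ₗ[k] Forms k A) (a b : A) (u : WordAlg k A) :
    ext φ (al a * jt u b) = al a * (φ u * jt 1 b) := by simp [ext, formsEquiv_al_mul_jt]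

theorem ext_jt (φ : WordAlg k A →ₗ[k] Forms k A) (b : A) (u : WordAlg k A) :
    ext φ (jt u b) = φ u * jt 1 b := by
  simpa [al_one] using ext_al_mul_jt φ 1 b u

theorem ext_al_mul (φ : WordAlg k A →ₗ[k] Forms k A) (a : A) (y : Forms k A) :
    ext φ (al a * y) = al a * ext φ y := by
  induction y using forms_jt_induction with
  | h0 => simp
  | hadd x y hx hy => simp only [mul_add, map_add, hx, hy]
  | hc b u c => rw [← mul_assoc, ← al_mul, ext_al_mul_jt, ext_al_mul_jt, al_mul, mul_assoc]

theorem ext_mul_jt (φ : WordAlg k A →ₗ[k] Forms k A) (b : A) (y : Forms k A) :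
    ext φ (y * jt 1 b) = ext φ y * jt 1 b := by
  induction y using forms_jt_induction with
  | h0 => simp
  | hadd x y hx hy => simp only [add_mul, map_add, hx, hy]
  | hc a u c =>
    rw [mul_assoc, jt_mul_jt, ext_al_mul_jt, ext_al_mul_jt, mul_one, ← one_mul (1 : WordAlg k A),
      ← jt_mul_jt, one_mul]
    simp only [mul_assoc]

/-- The map `a ⊗ u ⊗ b ↦ 1 ⊗ āu ⊗ b`. -/
def sh : Forms k A →ₗ[k] Forms k A :=
  (formsEquiv k A).symm.toLinearMap ∘ₗ TensorProduct.mk k A _ 1 ∘ₗ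
    LinearMap.rTensor A (LinearMap.mul' k _ ∘ₗ LinearMap.rTensor _ (lett k A ∘ₗ proj k A)) ∘ₗ
    (TensorProduct.assoc k A (WordAlg k A) A).symm.toLinearMap ∘ₗ (formsEquiv k A).toLinearMap

theorem sh_al_mul_jt (a b : A) (u : WordAlg k A) :
    sh (al a * jt u b) = jt (lett k A (proj k A a) * u) b := by
  simp [sh, formsEquiv_al_mul_jt, formsEquiv_symm_tmul, al_one]

theorem sh_mul_jt (y : Forms k A) (u : WordAlg k A) (b : A) : sh (y * jt u b) = sh y * jt u b := by
  induction y using forms_jt_induction with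
  | h0 => simp
  | hadd x y hx hy => simp only [add_mul, map_add, hx, hy]
  | hc a v c => rw [mul_assoc, jt_mul_jt, sh_al_mul_jt, sh_al_mul_jt, jt_mul_jt, mul_assoc]

/-- The image of `sh` consists of elements without left factor in `A`. -/
theorem sh_induction {p : Forms k A → Prop} (h0 : p 0)
    (hadd : ∀ x y, p x → p y → p (x + y))
    (hc : ∀ c u b, p (jt (lett k A c * u) b)) (y) : p (sh y) := by
  induction y using forms_jt_induction with
  | h0 => rwa [map_zero]
  | hadd x y hx hy => rw [map_add]; exact hadd _ _ hx hy
  | hc a u b => rw [sh_al_mul_jt]; exact hc _ _ _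

theorem sh_mul_sh (y z : Forms k A) : sh (y * sh z) = sh y * sh z := by
  refine sh_induction (p := fun x => sh (y * x) = sh y * x) (by simp)
    (fun x y hx hy => by simp only [mul_add, map_add, hx, hy]) (fun c u b => sh_mul_jt _ _ _) z

/-- The counit of `T(Ā)`. -/
abbrev cou : WordAlg k A →ₐ[k] k := TensorAlgebra.algebraMapInv

theorem cou_lett_mul (c : ABar k A) (u : WordAlg k A) : cou (lett k A c * u) = 0 := by
  simp [TensorAlgebra.algebraMapInv]

theorem cou_toWord_succ {n : ℕ} (w : TP k A (n + 1)) : cou (toWord w) = 0 := by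
  induction w using cons_induction with
  | h0 => simp
  | hadd x y hx hy => simp only [map_add, hx, hy, add_zero]
  | hc c w => rw [toWord_cons, cou_lett_mul]

/-- The map `a ⊗ u ⊗ b ↦ ε(u) ab`. -/
def eaugA : Forms k A →ₗ[k] A :=
  LinearMap.mul' k A ∘ₗ LinearMap.lTensor A ((TensorProduct.lid k A).toLinearMap ∘ₗ
    LinearMap.rTensor A cou.toLinearMap) ∘ₗ (formsEquiv k A).toLinearMap

theorem eaugA_al_mul_jt (a b : A) (u : WordAlg k A) :
    eaugA (al a * jt u b) = cou u • (a * b) := by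
  simp [eaugA, formsEquiv_al_mul_jt]

theorem eaugA_jt (u : WordAlg k A) (b : A) : eaugA (jt u b) = cou u • b := by
  simpa [al_one] using eaugA_al_mul_jt 1 b u

theorem eaugA_al_mul (a : A) (y : Forms k A) : eaugA (al a * y) = a * eaugA y := by
  induction y using forms_jt_induction with
  | h0 => simp
  | hadd x y hx hy => simp only [mul_add, map_add, hx, hy]
  | hc b u c => rw [← mul_assoc, ← al_mul, eaugA_al_mul_jt, eaugA_al_mul_jt, mul_smul_comm, mul_assoc]

theorem eaugA_sh (y : Forms k A) : eaugA (sh y) = 0 := by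
  refine sh_induction (p := fun x => eaugA x = 0) (map_zero _)
    (fun x y hx hy => by rw [map_add, hx, hy, add_zero]) (fun c u b => ?_) y
  rw [eaugA_jt, cou_lett_mul, zero_smul]

theorem eaugA_mul_sh (y z : Forms k A) : eaugA (y * sh z) = 0 := by
  refine sh_induction (p := fun x => eaugA (y * x) = 0) (by simp)
    (fun x y hx hy => by rw [mul_add, map_add, hx, hy, add_zero]) (fun c u b => ?_) z
  induction y using forms_jt_induction with
  | h0 => simp
  | hadd x y hx hy => rw [add_mul, map_add, hx, hy, add_zero]
  | hc a v d =>
    rw [mul_assoc, jt_mul_jt, eaugA_al_mul_jt, map_mul, cou_lett_mul, mul_zero, zero_smul]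

/-- The embedding of `Bar_r(A)`. -/
def embB {r : ℕ} : Bar k A r →ₗ[k] Forms k A :=
  (formsEquiv k A).symm.toLinearMap ∘ₗ LinearMap.lTensor A (LinearMap.rTensor A toWord)

@[simp]
theorem embB_tmul {r : ℕ} (a b : A) (w : TP k A r) :
    embB (a ⊗ₜ (w ⊗ₜ b)) = al a * jt (toWord w) b := by
  simp [embB, formsEquiv_symm_tmul]

theorem embB_lmul {r : ℕ} (a : A) (x : Bar k A r) : embB (lmul a x) = al a * embB x := by
  induction x using bar_induction with
  | h0 => simp
  | hadd x y hx hy => simp only [mul_add, map_add, hx, hy]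
  | hc b w c => simp [al_mul, mul_assoc]

theorem embB_rmul {r : ℕ} (b : A) (x : Bar k A r) : embB (rmul b x) = embB x * jt 1 b := by
  induction x using bar_induction with
  | h0 => simp
  | hadd x y hx hy => simp only [add_mul, map_add, hx, hy]
  | hc a w c => simp [mul_assoc, jt_mul_jt]

theorem embB_barLeft {r : ℕ} (x : Bar k A r) : embB (1 ⊗ₜ barLeft r x) = sh (embB x) := by
  induction x using bar_induction with
  | h0 => simp
  | hadd x y hx hy => simp only [TensorProduct.tmul_add, map_add, hx, hy]
  | hc a w b => rw [barLeft_tmul, embB_tmul, embB_tmul, sh_al_mul_jt, al_one, one_mul, toWord_cons]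

theorem forms_embB_induction {p : Forms k A → Prop}
    (hadd : ∀ x y, p x → p y → p (x + y)) (hc : ∀ r (x : Bar k A r), p (embB x)) (y) : p y := by
  have h0 : p 0 := by simpa using hc 0 0
  induction y using forms_jt_induction with
  | h0 => exact h0
  | hadd x y hx hy => exact hadd _ _ hx hy
  | hc a u b =>
    induction u using word_induction with
    | h0 => simpa using h0
    | hadd x y hx hy =>
      rw [map_add, LinearMap.add_apply, mul_add]; exact hadd _ _ hx hy
    | hw n w => rw [← embB_tmul]; exact hc _ _

variable (k A) in
/-- The components of the bar differential on words. -/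
def dWord : (n : ℕ) → TP k A n →ₗ[k] Forms k A
  | 0 => 0
  | r + 1 => embB ∘ₗ d k A r ∘ₗ TensorProduct.mk k A _ 1 ∘ₗ (TensorProduct.mk k _ A).flip 1

/-- The bar differential, extended by zero in degree zero. -/
def dF : Forms k A →ₗ[k] Forms k A := ext (wordLift (dWord k A))

theorem dF_al_mul (a : A) (y : Forms k A) : dF (al a * y) = al a * dF y := ext_al_mul _ a y

theorem dF_mul_jt (b : A) (y : Forms k A) : dF (y * jt 1 b) = dF y * jt 1 b := ext_mul_jt _ b y

theorem dF_embB_zero (x : Bar k A 0) : dF (embB x) = 0 := by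
  induction x using bar_induction with
  | h0 => simp
  | hadd x y hx hy => simp only [map_add, hx, hy, add_zero]
  | hc a w b => rw [embB_tmul, dF, ext_al_mul_jt, wordLift_toWord]; simp [dWord]

theorem dF_embB {r : ℕ} (x : Bar k A (r + 1)) : dF (embB x) = embB (d k A r x) := by
  induction x using bar_induction with
  | h0 => simp
  | hadd x y hx hy => simp only [map_add, hx, hy]
  | hc a w b =>
    rw [embB_tmul, dF, ext_al_mul_jt, wordLift_toWord]
    simp only [dWord, LinearMap.comp_apply, TensorProduct.mk_apply, LinearMap.flip_apply]
    rw [← embB_rmul, ← embB_lmul, ← d_rmul, ← d_lmul]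
    simp

theorem dF_jt_one (b : A) : dF (jt 1 b : Forms k A) = 0 := by
  have : (jt 1 b : Forms k A) = embB (1 ⊗ₜ ((emptyWord : TP k A 0) ⊗ₜ b)) := by
    rw [embB_tmul, al_one, one_mul, toWord_emptyWord]
  rw [this, dF_embB_zero]

theorem eaugA_embB_zero (x : Bar k A 0) : eaugA (embB x) = aug x := by
  induction x using bar_zero_induction with
  | h0 => simp
  | hadd x y hx hy => simp only [map_add, hx, hy]
  | hc a b => rw [embB_tmul, eaugA_al_mul_jt, toWord_emptyWord, map_one, one_smul, aug_tmul]

theorem eaugA_embB_succ {r : ℕ} (x : Bar k A (r + 1)) : eaugA (embB x) = 0 := by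
  induction x using bar_induction with
  | h0 => simp
  | hadd x y hx hy => simp only [map_add, hx, hy, add_zero]
  | hc a w b => rw [embB_tmul, eaugA_al_mul_jt, cou_toWord_succ, zero_smul]

/-- The recursion for the bar differential. -/
theorem dF_sh (y : Forms k A) : dF (sh y) = y - sh (dF y) - jt 1 (eaugA y) := by
  induction y using forms_embB_induction with
  | hadd x y hx hy => simp only [map_add, hx, hy]; abel
  | hc r x =>
    rw [← embB_barLeft, dF_embB]
    cases r with
    | zero =>
      rw [d_zero_barLeft, map_sub, lmul_one, dF_embB_zero, eaugA_embB_zero, map_zero, sub_zero,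
        embB_tmul, al_one, one_mul, toWord_emptyWord]
    | succ r =>
      rw [d_succ_barLeft, map_sub, lmul_one, dF_embB, eaugA_embB_succ, map_zero, sub_zero,
        embB_barLeft]

/-- The map `a ⊗ v ⊗ c ↦ (a ⊗ v ⊗ 1) s(c t)`. -/
def glue (t : Forms k A) : Forms k A →ₗ[k] Forms k A :=
  LinearMap.mul' k _ ∘ₗ TensorProduct.map al (LinearMap.mul' k _ ∘ₗ
    TensorProduct.map (jt.flip 1) (sh ∘ₗ LinearMap.mulRight k t ∘ₗ al)) ∘ₗ
    (formsEquiv k A).toLinearMap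

theorem glue_tmul (t : Forms k A) (a c : A) (v : WordAlg k A) :
    glue t (al a * jt v c) = al a * (jt v 1 * sh (al c * t)) := by
  simp [glue, formsEquiv_al_mul_jt]

theorem glue_jt (t : Forms k A) (c : A) (v : WordAlg k A) :
    glue t (jt v c) = jt v 1 * sh (al c * t) := by
  simpa [al_one] using glue_tmul t 1 c v

theorem glue_al_mul (t y : Forms k A) (a : A) : glue t (al a * y) = al a * glue t y := by
  induction y using forms_jt_induction with
  | h0 => simp
  | hadd x y hx hy => simp only [mul_add, map_add, hx, hy]
  | hc b u c => rw [← mul_assoc, ← al_mul, glue_tmul, glue_tmul, al_mul, mul_assoc]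

theorem glue_sh (t y : Forms k A) : glue t (sh y) = sh (glue t y) := by
  induction y using forms_jt_induction with
  | h0 => simp
  | hadd x y hx hy => simp only [map_add, hx, hy]
  | hc b u c =>
    rw [sh_al_mul_jt, glue_tmul, glue_jt, ← mul_assoc (al b), sh_mul_sh, sh_al_mul_jt]

theorem eaugA_glue (t y : Forms k A) : eaugA (glue t y) = 0 := by
  induction y using forms_jt_induction with
  | h0 => simp
  | hadd x y hx hy => simp only [map_add, hx, hy, add_zero]
  | hc b u c => rw [glue_tmul, ← mul_assoc, eaugA_mul_sh]

set_option maxHeartbeats 1000000 in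
/-- The bar differential of a glued element. -/
theorem dF_glue {r : ℕ} (u : WordAlg k A) (b : A) (x : Bar k A r) :
    dF (glue (jt u b) (embB x)) = glue (jt u b) (dF (embB x)) + al (eaugA (embB x)) * jt u b
      - (-1 : k) ^ r • glue (dF (jt u b)) (embB x)
      - ((-1 : k) ^ r * cou u) • (embB x * jt 1 b) := by
  induction r with
  | zero =>
    induction x using bar_zero_induction with
    | h0 => simp
    | hadd x y hx hy => simp only [map_add, add_mul, smul_add, hx, hy]; abel
    | hc a c =>
      rw [dF_embB_zero, embB_tmul, toWord_emptyWord, glue_tmul, glue_tmul, jt_one_one, one_mul,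
        one_mul, dF_al_mul, dF_sh, dF_al_mul, eaugA_al_mul, eaugA_al_mul]
      have h1 : eaugA (jt u b) = cou u • b := eaugA_jt u b
      have h2 : eaugA (jt 1 c : Forms k A) = c := by rw [eaugA_jt]; simp
      rw [h1, h2, mul_sub, mul_sub, ← mul_assoc, ← al_mul, mul_assoc (al a) (jt 1 c), jt_mul_jt,
        mul_smul_comm, map_smul, mul_smul_comm, map_zero, one_mul]
      module
  | succ r ih =>
    induction x using bar_succ_induction with
    | h0 => simp
    | hadd x y hx hy => simp only [map_add, add_mul, smul_add, hx, hy]; abel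
    | hc a x =>
      -- A generator of positive degree is a · `sh` (x); left multiplication and `sh` both pass
      -- through `glue`, so the recursion `dF_sh` lowers the degree.
      have h1 : (a ⊗ₜ[k] barLeft r x : Bar k A (r + 1)) = lmul a (1 ⊗ₜ barLeft r x) := by simp
      rw [h1, embB_lmul, embB_barLeft, glue_al_mul, dF_al_mul, dF_al_mul, glue_al_mul, glue_al_mul,
        mul_assoc (al a), eaugA_al_mul, eaugA_sh, glue_sh, glue_sh, dF_sh, dF_sh, ih, eaugA_glue]
      have h2 : glue (jt u b) (jt 1 (eaugA (embB x))) = sh (al (eaugA (embB x)) * jt u b) := by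
        rw [glue_jt, jt_one_one, one_mul]
      have h3 : ∀ x y z : Forms k A, glue (jt u b) (x - y - z) =
          glue (jt u b) x - glue (jt u b) y - glue (jt u b) z := fun x y z => by
        rw [map_sub, map_sub]
      have h4 : ∀ (x y z w : Forms k A) (c e : k), sh (x + y - c • z - e • w) =
          sh x + sh y - c • sh z - e • sh w := fun x y z w c e => by
        rw [map_sub, map_sub, map_add, map_smul, map_smul]
      rw [h3, h2, glue_sh, h4, sh_mul_jt (embB x)]
      generalize glue (jt u b) (embB x) = g1
      generalize sh (glue (jt u b) (dF (embB x))) = g2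
      generalize sh (al (eaugA (embB x)) * jt u b) = g3
      generalize sh (glue (dF (jt u b)) (embB x)) = g4
      generalize sh (embB x) = g5
      simp only [mul_zero, map_zero, zero_mul, mul_sub, mul_add, mul_smul_comm, mul_assoc, pow_succ]
      module

end Forms

/-! ### Applying a cochain to the first letters or at all positions -/

section FrontOperators

variable {k : Type u} {A : Type v} [Field k] [Ring A] [Algebra k A]

/-- The map on `T(Ā)` which splits off `m` letters and applies `Φ`; it is zero on shorter words. -/
def front {X : Type*} [AddCommMonoid X] [Module k X] {m : ℕ}
    (Φ : TP k A m →ₗ[k] WordAlg k A →ₗ[k] X) : WordAlg k A →ₗ[k] X :=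
  wordLift fun N => if h : m ≤ N then TensorProduct.lift (Φ.compl₂ toWord) ∘ₗ
    (conc (a := m) (b := N - m) (by omega)).symm.toLinearMap else 0

theorem front_mul {X : Type*} [AddCommMonoid X] [Module k X] {m : ℕ}
    (Φ : TP k A m →ₗ[k] WordAlg k A →ₗ[k] X) (w : TP k A m) (u : WordAlg k A) :
    front Φ (toWord w * u) = Φ w u := by
  induction u using word_induction with
  | h0 => simp
  | hadd x y hx hy => simp only [mul_add, map_add, hx, hy]
  | hw n v =>
    rw [← toWord_conc rfl, front, wordLift_toWord, dif_pos (by omega)]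
    have key : ∀ (j : ℕ) (h : m + j = m + n), (TensorProduct.lift (Φ.compl₂ toWord) ∘ₗ
        (conc (a := m) (b := j) h).symm.toLinearMap) (conc rfl (w ⊗ₜ v)) = Φ w (toWord v) := by
      intro j h
      obtain rfl : j = n := by omega
      simp
    exact key _ _

theorem front_short {X : Type*} [AddCommMonoid X] [Module k X] {m N : ℕ}
    (Φ : TP k A m →ₗ[k] WordAlg k A →ₗ[k] X) (h : N < m) (w : TP k A N) :
    front Φ (toWord w) = 0 := by
  rw [front, wordLift_toWord, dif_neg (by omega), LinearMap.zero_apply]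

theorem word_front_induction (m : ℕ) {p : WordAlg k A → Prop} (h0 : p 0)
    (hadd : ∀ x y, p x → p y → p (x + y)) (hs : ∀ N < m, ∀ w : TP k A N, p (toWord w))
    (hl : ∀ (w : TP k A m) u, p (toWord w * u)) (u) : p u := by
  induction u using word_induction with
  | h0 => exact h0
  | hadd x y hx hy => exact hadd x y hx hy
  | hw n w =>
    rcases lt_or_ge n m with h | h
    · exact hs n h w
    · induction w using conc_induction (show m + (n - m) = n by omega) with
      | h0 => simpa using h0
      | hadd x y hx hy => rw [map_add]; exact hadd _ _ hx hy
      | hc x y => rw [toWord_conc]; exact hl _ _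

/-- The embedding of `A ⊗ Ā^{⊗p}`. -/
def embW {p : ℕ} : A ⊗[k] TP k A p →ₗ[k] Forms k A := embB ∘ₗ close k A p

theorem embW_tmul {p : ℕ} (a : A) (w : TP k A p) :
    embW (a ⊗ₜ w) = al a * jt (toWord w) 1 := by simp [embW]

theorem embW_injective {p : ℕ} : Function.Injective (embW : A ⊗[k] TP k A p → Forms k A) := by
  have h1 : (embW : A ⊗[k] TP k A p →ₗ[k] Forms k A) = (formsEquiv k A).symm.toLinearMap ∘ₗ
      LinearMap.lTensor A ((TensorProduct.mk k (WordAlg k A) A).flip 1 ∘ₗ toWord) := by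
    ext a w
    simp [embW_tmul, formsEquiv_symm_tmul]
  rw [h1, LinearMap.coe_comp]
  refine Function.Injective.comp (LinearEquiv.injective _) ?_
  rcases subsingleton_or_nontrivial A with hA | hA
  · intro x y _
    have : ∀ z : A ⊗[k] TP k A p, z = 0 := fun z => by
      induction z with
      | zero => rfl
      | add x y hx hy => rw [hx, hy, add_zero]
      | tmul a w => rw [Subsingleton.elim a 0, TensorProduct.zero_tmul]
    rw [this x, this y]
  · refine Module.Flat.lTensor_preserves_injective_linearMap _ ?_
    rw [LinearMap.coe_comp]
    refine Function.Injective.comp ?_ toWord_injective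
    have h2 : ((TensorProduct.mk k (WordAlg k A) A).flip 1) =
        (LinearMap.lTensor (WordAlg k A) (LinearMap.toSpanSingleton k A 1)) ∘ₗ
          (TensorProduct.rid k (WordAlg k A)).symm.toLinearMap := by
      ext; simp
    rw [h2, LinearMap.coe_comp]
    refine Function.Injective.comp ?_ (LinearEquiv.injective _)
    refine Module.Flat.lTensor_preserves_injective_linearMap _ ?_
    intro x y hxy
    exact smul_left_injective k (one_ne_zero (α := A)) hxy

/-- The map `a ⊗ w ↦ ā ⊗ w`. -/
def barW {p : ℕ} : A ⊗[k] TP k A p →ₗ[k] TP k A (p + 1) :=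
  (cons p).toLinearMap ∘ₗ LinearMap.rTensor (TP k A p) (proj k A)

theorem barW_tmul {p : ℕ} (a : A) (w : TP k A p) : barW (a ⊗ₜ w) = cons p (proj k A a ⊗ₜ w) := by
  simp [barW]

theorem sh_embW {p : ℕ} (y : A ⊗[k] TP k A p) : sh (embW y) = jt (toWord (barW y)) 1 := by
  induction y with
  | zero => simp
  | add x y hx hy => simp only [map_add, LinearMap.add_apply, hx, hy]
  | tmul a w => rw [embW_tmul, barW_tmul, sh_al_mul_jt, toWord_cons]

theorem eaugA_embW_mul {p : ℕ} (y : A ⊗[k] TP k A (p + 1)) (u : WordAlg k A) (b : A) :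
    eaugA (embW y * jt u b) = 0 := by
  induction y with
  | zero => simp
  | add x y hx hy => simp only [map_add, add_mul, hx, hy, add_zero]
  | tmul a w =>
    rw [embW_tmul, mul_assoc, jt_mul_jt, eaugA_al_mul_jt, map_mul, cou_toWord_succ, zero_mul,
      zero_smul]

variable {m P : ℕ}

/-- The operator which applies `F` to the first `m` letters. -/
def opM (F : TP k A m →ₗ[k] A ⊗[k] TP k A P) : Forms k A →ₗ[k] Forms k A :=
  ext (front ((LinearMap.mul k (Forms k A)).compl₁₂ (embW ∘ₗ F) (jt.flip 1)))

theorem opM_al_mul (F : TP k A m →ₗ[k] A ⊗[k] TP k A P) (a : A) (y : Forms k A) :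
    opM F (al a * y) = al a * opM F y := ext_al_mul _ a y

theorem opM_mul_jt_one (F : TP k A m →ₗ[k] A ⊗[k] TP k A P) (b : A) (y : Forms k A) :
    opM F (y * jt 1 b) = opM F y * jt 1 b := ext_mul_jt _ b y

theorem opM_jt (F : TP k A m →ₗ[k] A ⊗[k] TP k A P) (w : TP k A m) (u : WordAlg k A) (b : A) :
    opM F (jt (toWord w * u) b) = embW (F w) * jt u b := by
  rw [opM, ext_jt, front_mul]
  simp [mul_assoc, jt_mul_jt]

theorem opM_jt_word (F : TP k A m →ₗ[k] A ⊗[k] TP k A P) (w : TP k A m) (b : A) :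
    opM F (jt (toWord w) b) = embW (F w) * jt 1 b := by
  rw [← opM_jt, mul_one]

theorem opM_short (F : TP k A m →ₗ[k] A ⊗[k] TP k A P) {N : ℕ} (h : N < m) (w : TP k A N) (b : A) :
    opM F (jt (toWord w) b) = 0 := by
  rw [opM, ext_jt, front_short _ h, zero_mul]

theorem opM_jt_mul_sh (F : TP k A m →ₗ[k] A ⊗[k] TP k A P) (w : TP k A m) (z : Forms k A) :
    opM F (jt (toWord w) 1 * sh z) = embW (F w) * sh z := by
  refine sh_induction (p := fun x => opM F (jt (toWord w) 1 * x) = embW (F w) * x) (by simp)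
    (fun x y hx hy => by simp only [mul_add, map_add, hx, hy]) (fun c u b => ?_) z
  rw [jt_mul_jt, opM_jt, one_mul]

theorem eaugA_opM (F : TP k A m →ₗ[k] A ⊗[k] TP k A (P + 1)) (y : Forms k A) :
    eaugA (opM F y) = 0 := by
  induction y using forms_jt_induction with
  | h0 => simp
  | hadd x y hx hy => simp only [map_add, hx, hy, add_zero]
  | hc a u b =>
    rw [opM_al_mul, eaugA_al_mul]
    have : eaugA (opM F (jt u b)) = 0 := by
      induction u using word_front_induction m with
      | h0 => simp
      | hadd x y hx hy => simp only [map_add, LinearMap.add_apply, hx, hy, add_zero]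
      | hs N h w => rw [opM_short F h, map_zero]
      | hl w u => rw [opM_jt, eaugA_embW_mul]
    rw [this, mul_zero]

/-- Applying `F` to the first `m` letters, with values in `T(Ā)`. -/
def opB (F : TP k A m →ₗ[k] A ⊗[k] TP k A P) : WordAlg k A →ₗ[k] WordAlg k A :=
  front ((LinearMap.mul k (WordAlg k A)).comp (toWord ∘ₗ barW ∘ₗ F))

theorem opB_mul (F : TP k A m →ₗ[k] A ⊗[k] TP k A P) (w : TP k A m) (u : WordAlg k A) :
    opB F (toWord w * u) = toWord (barW (F w)) * u := by
  rw [opB, front_mul]; rfl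

theorem opB_word (F : TP k A m →ₗ[k] A ⊗[k] TP k A P) (w : TP k A m) :
    opB F (toWord w) = toWord (barW (F w)) := by
  rw [← mul_one (toWord w), opB_mul, mul_one]

theorem opB_short (F : TP k A m →ₗ[k] A ⊗[k] TP k A P) {N : ℕ} (h : N < m) (w : TP k A N) :
    opB F (toWord w) = 0 := front_short _ h _

theorem sh_opM_jt (F : TP k A m →ₗ[k] A ⊗[k] TP k A P) (u : WordAlg k A) (b : A) :
    sh (opM F (jt u b)) = jt (opB F u) b := by
  induction u using word_front_induction m with
  | h0 => simp
  | hadd x y hx hy => simp only [map_add, LinearMap.add_apply, hx, hy]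
  | hs N h w => rw [opM_short F h, opB_short F h]; simp
  | hl w u => rw [opM_jt, opB_mul, sh_mul_jt, sh_embW, jt_mul_jt, one_mul]

theorem cou_opB (F : TP k A m →ₗ[k] A ⊗[k] TP k A P) (u : WordAlg k A) : cou (opB F u) = 0 := by
  induction u using word_front_induction m with
  | h0 => simp
  | hadd x y hx hy => simp only [map_add, hx, hy, add_zero]
  | hs N h w => rw [opB_short F h, map_zero]
  | hl w u => rw [opB_mul, map_mul, cou_toWord_succ, zero_mul]

/-- The components of `opL`. -/
def opLWord (e : k) (F : TP k A m →ₗ[k] A ⊗[k] TP k A P) : (n : ℕ) → TP k A n →ₗ[k] WordAlg k A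
  | 0 => opB F ∘ₗ toWord
  | n + 1 => opB F ∘ₗ toWord + e • (LinearMap.mul' k _ ∘ₗ
      TensorProduct.map (lett k A) (opLWord e F n) ∘ₗ (cons n).symm.toLinearMap)

/-- The sum over all positions of the applications of `F`, with the sign `e` for each letter which
precedes. -/
def opL (e : k) (F : TP k A m →ₗ[k] A ⊗[k] TP k A P) : WordAlg k A →ₗ[k] WordAlg k A :=
  wordLift (opLWord e F)

theorem opL_zero (e : k) (F : TP k A m →ₗ[k] A ⊗[k] TP k A P) (w : TP k A 0) :
    opL e F (toWord w) = opB F (toWord w) := by rw [opL, wordLift_toWord]; rfl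

theorem opL_one (e : k) (F : TP k A m →ₗ[k] A ⊗[k] TP k A P) : opL e F 1 = opB F 1 := by
  rw [← toWord_emptyWord, opL_zero]

theorem opL_lett_mul (e : k) (F : TP k A m →ₗ[k] A ⊗[k] TP k A P) (c : ABar k A)
    (u : WordAlg k A) :
    opL e F (lett k A c * u) = opB F (lett k A c * u) + e • (lett k A c * opL e F u) := by
  induction u using word_induction with
  | h0 => simp
  | hadd x y hx hy => simp only [mul_add, map_add, smul_add, hx, hy]; abel
  | hw n w =>
    rw [← toWord_cons, opL, wordLift_toWord, wordLift_toWord]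
    simp [opLWord]

theorem opL_short (e : k) (F : TP k A m →ₗ[k] A ⊗[k] TP k A P) {N : ℕ} (h : N < m)
    (w : TP k A N) : opL e F (toWord w) = 0 := by
  induction N with
  | zero => rw [opL_zero, opB_short F h]
  | succ N ih =>
    induction w using cons_induction with
    | h0 => simp
    | hadd x y hx hy => simp only [map_add, hx, hy, add_zero]
    | hc c w =>
      rw [toWord_cons, opL_lett_mul, ← toWord_cons, opB_short F h, ih (by omega), mul_zero,
        smul_zero, add_zero]

theorem opL_word (e : k) (F : TP k A m →ₗ[k] A ⊗[k] TP k A P) (w : TP k A m) :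
    opL e F (toWord w) = toWord (barW (F w)) := by
  rw [← opB_word]
  cases m with
  | zero => exact opL_zero e F w
  | succ m =>
    induction w using cons_induction with
    | h0 => simp
    | hadd x y hx hy => simp only [map_add, hx, hy]
    | hc c w =>
      rw [toWord_cons, opL_lett_mul, opL_short e F (by omega), mul_zero, smul_zero, add_zero]

theorem opL_mem_range (e : k) (F : TP k A m →ₗ[k] A ⊗[k] TP k A P) {j N : ℕ} (h : j + m = N)
    (w : TP k A N) :
    opL e F (toWord w) ∈ LinearMap.range (toWord : TP k A (j + (P + 1)) →ₗ[k] WordAlg k A) := by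
  induction j generalizing N with
  | zero =>
    obtain rfl : m = N := by omega
    rw [opL_word]
    exact ⟨TensorPower.cast k _ (Nat.zero_add _).symm (barW (F w)), by simp⟩
  | succ j ih =>
    obtain rfl : N = (j + m) + 1 := by omega
    induction w using cons_induction with
    | h0 => simp
    | hadd x y hx hy => rw [map_add, map_add]; exact add_mem hx hy
    | hc c w =>
      rw [toWord_cons, opL_lett_mul]
      refine add_mem ?_ (Submodule.smul_mem _ _ ?_)
      · rw [← toWord_cons]
        generalize cons _ (c ⊗ₜ w) = w'
        induction w' using conc_induction (show m + (j + 1) = j + m + 1 by omega) with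
        | h0 => simp
        | hadd x y hx hy => rw [map_add, map_add]; exact add_mem hx hy
        | hc x y =>
          rw [toWord_conc, opB_mul]
          exact ⟨conc (by omega) (barW (F x) ⊗ₜ y), by simp⟩
      · obtain ⟨v, hv⟩ := ih rfl w
        rw [← hv]
        have h2 : j + (P + 1) + 1 = j + 1 + (P + 1) := by omega
        exact ⟨TensorPower.cast k _ h2 (cons _ (c ⊗ₜ v)), by simp⟩

theorem cou_opL (e : k) (F : TP k A m →ₗ[k] A ⊗[k] TP k A P) (u : WordAlg k A) :
    cou (opL e F u) = 0 := by
  induction u using word_induction with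
  | h0 => simp
  | hadd x y hx hy => simp only [map_add, hx, hy, add_zero]
  | hw n w =>
    cases n with
    | zero => rw [opL_zero, cou_opB]
    | succ n =>
      induction w using cons_induction with
      | h0 => simp
      | hadd x y hx hy => simp only [map_add, hx, hy, add_zero]
      | hc c w =>
        rw [toWord_cons, opL_lett_mul, map_add, cou_opB, map_smul, cou_lett_mul, smul_zero,
          add_zero]

/-- The operator `opL` on forms. -/
def opLam (e : k) (F : TP k A m →ₗ[k] A ⊗[k] TP k A P) : Forms k A →ₗ[k] Forms k A :=
  ext (jt.flip 1 ∘ₗ opL e F)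

theorem opLam_al_mul (e : k) (F : TP k A m →ₗ[k] A ⊗[k] TP k A P) (a : A) (y : Forms k A) :
    opLam e F (al a * y) = al a * opLam e F y := ext_al_mul _ a y

theorem opLam_mul_jt_one (e : k) (F : TP k A m →ₗ[k] A ⊗[k] TP k A P) (b : A) (y : Forms k A) :
    opLam e F (y * jt 1 b) = opLam e F y * jt 1 b := ext_mul_jt _ b y

theorem opLam_jt (e : k) (F : TP k A m →ₗ[k] A ⊗[k] TP k A P) (u : WordAlg k A) (b : A) :
    opLam e F (jt u b) = jt (opL e F u) b := by
  rw [opLam, ext_jt]; simp [jt_mul_jt]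

theorem opLam_sh (e : k) (F : TP k A m →ₗ[k] A ⊗[k] TP k A P) (y : Forms k A) :
    opLam e F (sh y) = sh (opM F (sh y)) + e • sh (opLam e F y) := by
  induction y using forms_jt_induction with
  | h0 => simp
  | hadd x y hx hy => simp only [map_add, smul_add, hx, hy]; abel
  | hc a u b =>
    rw [opLam_al_mul, opLam_jt, sh_al_mul_jt, sh_al_mul_jt, opLam_jt, sh_opM_jt, opL_lett_mul,
      map_add, LinearMap.add_apply, map_smul, LinearMap.smul_apply]

theorem opLam_embB_short (e : k) (F : TP k A m →ₗ[k] A ⊗[k] TP k A P) {r : ℕ} (h : r < m)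
    (x : Bar k A r) : opLam e F (embB x) = 0 := by
  induction x using bar_induction with
  | h0 => simp
  | hadd x y hx hy => simp only [map_add, hx, hy, add_zero]
  | hc a w b => rw [embB_tmul, opLam_al_mul, opLam_jt, opL_short e F h]; simp

theorem eaugA_opLam (e : k) (F : TP k A m →ₗ[k] A ⊗[k] TP k A P) (y : Forms k A) :
    eaugA (opLam e F y) = 0 := by
  induction y using forms_jt_induction with
  | h0 => simp
  | hadd x y hx hy => simp only [map_add, hx, hy, add_zero]
  | hc a u b =>
    rw [opLam_al_mul, opLam_jt, eaugA_al_mul_jt, cou_opL, zero_smul]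

/-! ### Commutation with the bar differential -/

theorem glue_jt_embB {r : ℕ} (u : WordAlg k A) (b : A) (x : Bar k A r) :
    glue (jt u b) (embB x) = embW (piR r x) * jt u b := by
  induction x using bar_induction with
  | h0 => simp
  | hadd x y hx hy => simp only [map_add, add_mul, hx, hy]
  | hc a w c =>
    rw [embB_tmul, glue_tmul, piR_tmul, embW_tmul, sh_al_mul_jt, toWord_snoc, mul_assoc, jt_mul_jt,
      jt_mul_jt, mul_assoc]

theorem glue_sh_embB {r : ℕ} (z : Forms k A) (x : Bar k A r) :
    glue (sh z) (embB x) = embW (piR r x) * sh z := by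
  induction x using bar_induction with
  | h0 => simp
  | hadd x y hx hy => simp only [map_add, add_mul, hx, hy]
  | hc a w c =>
    have h : sh (al c : Forms k A) = jt (lett k A (proj k A c)) 1 := by
      have := sh_al_mul_jt (k := k) c 1 1
      rwa [jt_one_one, mul_one, mul_one] at this
    rw [embB_tmul, glue_tmul, piR_tmul, embW_tmul, sh_mul_sh, h, toWord_snoc, ← mul_assoc,
      ← mul_assoc, mul_assoc (al a), jt_mul_jt, one_mul]

theorem glue_embB_rmul {r : ℕ} (t : Forms k A) (c : A) (x : Bar k A r) :
    glue t (embB (rmul c x)) = glue (al c * t) (embB x) := by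
  induction x using bar_induction with
  | h0 => simp
  | hadd x y hx hy => simp only [map_add, hx, hy]
  | hc a w b =>
    rw [rmul_tmul, rmulTail_tmul, embB_tmul, embB_tmul, glue_tmul, glue_tmul, al_mul, mul_assoc]

theorem glue_sub (s t y : Forms k A) : glue (s - t) y = glue s y - glue t y := by
  induction y using forms_jt_induction with
  | h0 => simp
  | hadd x y hx hy => simp only [map_add, hx, hy]; abel
  | hc a u b => rw [glue_tmul, glue_tmul, glue_tmul, mul_sub, map_sub, mul_sub, mul_sub]

theorem glue_smul (c : k) (t y : Forms k A) : glue (c • t) y = c • glue t y := by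
  induction y using forms_jt_induction with
  | h0 => simp
  | hadd x y hx hy => simp only [map_add, hx, hy, smul_add]
  | hc a u b =>
    rw [glue_tmul, glue_tmul, mul_smul_comm, map_smul, mul_smul_comm, mul_smul_comm]

theorem opM_glue_embB {r p : ℕ} (f : Cochain k A (r + 1) p) (u : WordAlg k A) (b : A)
    (x : Bar k A r) : opM (piR p ∘ₗ f) (glue (jt u b) (embB x)) =
      glue (jt u b) (embB (hat f (close k A (r + 1) (piR r x)))) := by
  induction x using bar_induction with
  | h0 => simp
  | hadd x y hx hy => simp only [map_add, hx, hy]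
  | hc a w c =>
    rw [glue_jt_embB, piR_tmul, close_tmul, hat_tmul, rmul_one, embB_lmul, glue_al_mul,
      glue_jt_embB, embW_tmul, mul_assoc, jt_mul_jt, opM_al_mul, opM_jt, one_mul,
      LinearMap.comp_apply]

variable {p : ℕ}

theorem dF_embB_of_mem {x : Bar k A p} (hx : x ∈ Omega k A p) : dF (embB x) = 0 := by
  cases p with
  | zero => exact dF_embB_zero x
  | succ p => rw [dF_embB, (mem_Omega_succ_iff x).1 hx, map_zero]

theorem eaugA_embB_of_mem {x : Bar k A p} (hx : x ∈ Omega k A p) : eaugA (embB x) = 0 := by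
  cases p with
  | zero => rw [eaugA_embB_zero, (mem_Omega_zero_iff x).1 hx]
  | succ p => exact eaugA_embB_succ x

/-- The faces inside the first m + 1 letters produce δf except for its last term f(w)c; adding and
subtracting that term gives the right side. The augmentation contributes only for m = 0, where it
replaces the missing face. -/
theorem opM_dF_first (f : Cochain k A m p) (w : TP k A m) (c : ABar k A) (u : WordAlg k A) (b : A) :
    opM (piR p ∘ₗ f) (glue (jt u b) (dF (embB (1 ⊗ₜ[k] (w ⊗ₜ[k] sec k A c)))) +
        al (eaugA (embB (1 ⊗ₜ[k] (w ⊗ₜ[k] sec k A c)))) * jt u b) =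
      glue (jt u b) (embB (delta k A m p f (snoc m (w ⊗ₜ c)))) +
        (-1 : k) ^ m • glue (jt u b) (embB (rmul (sec k A c) (f w))) := by
  have h1 : close k A (m + 1) (piR m (1 ⊗ₜ[k] (w ⊗ₜ[k] sec k A c))) =
      1 ⊗ₜ (snoc m (w ⊗ₜ c) ⊗ₜ 1) := by rw [piR_tmul, close_tmul, proj_sec]
  have h2 : hat f (1 ⊗ₜ[k] (w ⊗ₜ[k] sec k A c)) = rmul (sec k A c) (f w) := by
    rw [hat_tmul, lmul_one]
  rw [delta_eq_hat, ← h2, ← h1]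
  generalize (1 : A) ⊗ₜ[k] (w ⊗ₜ[k] sec k A c) = x
  cases m with
  | zero =>
    have h3 : opM (piR p ∘ₗ f) (al (eaugA (embB x)) * jt u b) =
        glue (jt u b) (embB (hat f (aug x ⊗ₜ (emptyWord ⊗ₜ 1)))) := by
      rw [eaugA_embB_zero, hat_tmul, rmul_one, embB_lmul, glue_al_mul, glue_jt_embB, opM_al_mul]
      have := opM_jt (piR p ∘ₗ f) emptyWord u b
      rw [toWord_emptyWord, one_mul] at this
      rw [this, LinearMap.comp_apply]
    rw [dF_embB_zero, map_zero, zero_add, h3, d_close_piR_zero, map_sub, map_sub, map_sub]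
    module
  | succ r =>
    rw [dF_embB, eaugA_embB_succ, map_zero, zero_mul, add_zero, opM_glue_embB, d_close_piR_succ,
      map_add, map_add, map_add, map_smul, map_smul, map_smul, pow_succ]
    module

set_option maxHeartbeats 1000000 in
/-- The graded commutator of `opM` with the bar differential. -/
theorem dF_opM {f : Cochain k A m p} (hf : f ∈ omegaCochains k A m p) (w : TP k A (m + 1))
    (u : WordAlg k A) (b : A) :
    dF (opM (piR p ∘ₗ f) (jt (toWord w * u) b)) +
        (-1 : k) ^ (p + m) • opM (piR p ∘ₗ f) (dF (jt (toWord w * u) b)) =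
      (-1 : k) ^ (p + m) • opM (piR p ∘ₗ delta k A m p f) (jt (toWord w * u) b) := by
  rw [opM_jt, LinearMap.comp_apply]
  induction w using snoc_induction with
  | h0 => simp
  | hadd x y hx hy =>
    simp only [map_add, add_mul, LinearMap.add_apply, smul_add] at hx hy ⊢
    rw [← hx, ← hy]; abel
  | hc w c =>
    have h1 : jt (toWord (snoc m (w ⊗ₜ c)) * u) b =
        glue (jt u b) (embB (1 ⊗ₜ[k] (w ⊗ₜ[k] sec k A c))) := by
      rw [embB_tmul, glue_tmul, al_one, one_mul, sh_al_mul_jt, proj_sec, jt_mul_jt, toWord_snoc,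
        mul_assoc, one_mul]
    -- As f(w) lies in Ω, both its differential and its augmentation vanish, so only faces that
    -- involve the letters after w remain.
    have h2 : dF (opM (piR p ∘ₗ f) (jt (toWord (snoc m (w ⊗ₜ c)) * u) b)) =
        -((-1 : k) ^ p • (glue (jt u b) (embB (rmul (sec k A c) (f w)))
          - embW (piR p (f w)) * sh (al (sec k A c) * dF (jt u b))
          - cou u • (embW (piR p (f w)) * jt 1 (sec k A c * b)))) := by
      have h3 : dF (jt (lett k A c * u) b) = al (sec k A c) * jt u b
          - sh (al (sec k A c) * dF (jt u b)) - cou u • jt 1 (sec k A c * b) := by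
        have := dF_sh (al (sec k A c) * jt u b)
        rw [sh_al_mul_jt, proj_sec] at this
        rw [this, dF_al_mul, eaugA_al_mul_jt, map_smul]
      rw [toWord_snoc, mul_assoc, opM_jt, LinearMap.comp_apply, ← glue_jt_embB, dF_glue,
        dF_embB_of_mem (hf w), eaugA_embB_of_mem (hf w), cou_lett_mul, h3, glue_sub, glue_sub,
        glue_smul, glue_sh_embB, glue_jt_embB, glue_embB_rmul]
      simp only [map_zero, zero_mul, mul_zero, zero_smul]
      module
    -- The same faces occur here with the opposite relative sign and cancel in the graded
    -- commutator; what is left is `opM` of δf.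
    have h4 : opM (piR p ∘ₗ f) (dF (jt (toWord (snoc m (w ⊗ₜ c)) * u) b)) =
        glue (jt u b) (embB (delta k A m p f (snoc m (w ⊗ₜ c)))) +
          (-1 : k) ^ m • (glue (jt u b) (embB (rmul (sec k A c) (f w)))
          - embW (piR p (f w)) * sh (al (sec k A c) * dF (jt u b))
          - cou u • (embW (piR p (f w)) * jt 1 (sec k A c * b))) := by
      rw [h1, dF_glue, map_sub, map_sub, opM_dF_first, map_smul, map_smul, embB_tmul, al_one,
        one_mul, glue_jt, opM_jt_mul_sh, jt_mul_jt, mul_one, opM_jt_word, LinearMap.comp_apply]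
      module
    rw [h2, h4, glue_jt_embB u b (delta k A m p f _)]
    have h5 : (-1 : k) ^ (p + m) * (-1) ^ m = (-1) ^ p := by
      rw [pow_add, mul_assoc, ← mul_pow]; simp
    rw [smul_add, smul_smul, h5]
    abel

end FrontOperators

/-! ### The Leibniz rule for the operator bracket -/

section Leibniz

variable {k : Type u} {A : Type v} [Field k] [Ring A] [Algebra k A] {m n p q : ℕ}

theorem forms_mul_neg (x y : Forms k A) : x * -y = -(x * y) := map_neg (LinearMap.mulLeft k x) y

/-- The defect of the commutation of `opLam` with the bar differential. -/
def opK {P P' : ℕ} (e : k) (F : TP k A m →ₗ[k] A ⊗[k] TP k A P)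
    (F' : TP k A (m + 1) →ₗ[k] A ⊗[k] TP k A P') : Forms k A →ₗ[k] Forms k A :=
  dF ∘ₗ opLam e F - e • (opLam e F ∘ₗ dF) - opM F + e • opLam (-e) F'

theorem opK_apply {P P' : ℕ} (e : k) (F : TP k A m →ₗ[k] A ⊗[k] TP k A P)
    (F' : TP k A (m + 1) →ₗ[k] A ⊗[k] TP k A P') (y : Forms k A) :
    opK e F F' y = dF (opLam e F y) - e • opLam e F (dF y) - opM F y + e • opLam (-e) F' y := rfl

theorem opK_al_mul {P P' : ℕ} (e : k) (F : TP k A m →ₗ[k] A ⊗[k] TP k A P)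
    (F' : TP k A (m + 1) →ₗ[k] A ⊗[k] TP k A P') (a : A) (y : Forms k A) :
    opK e F F' (al a * y) = al a * opK e F F' y := by
  rw [opK_apply, opK_apply, opLam_al_mul, opLam_al_mul, opM_al_mul, dF_al_mul, dF_al_mul,
    opLam_al_mul, mul_add, mul_sub, mul_sub, mul_smul_comm, mul_smul_comm]

/-- `F'` is the Hochschild differential of `F`, expressed through the commutator with the bar
differential. -/
def IsDelta {P P' : ℕ} (e : k) (F : TP k A m →ₗ[k] A ⊗[k] TP k A P)
    (F' : TP k A (m + 1) →ₗ[k] A ⊗[k] TP k A P') : Prop :=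
  ∀ N (_ : m + 1 ≤ N) (w : TP k A N) (b : A),
    dF (opM F (jt (toWord w) b)) + e • opM F (dF (jt (toWord w) b)) = e • opM F' (jt (toWord w) b)

theorem isDelta_delta {f : Cochain k A m p} (hf : f ∈ omegaCochains k A m p) :
    IsDelta ((-1 : k) ^ (p + m)) (piR p ∘ₗ f) (piR p ∘ₗ delta k A m p f) := by
  intro N h w b
  induction w using conc_induction (show m + 1 + (N - (m + 1)) = N by omega) with
  | h0 => simp
  | hadd x y hx hy =>
    simp only [map_add, LinearMap.add_apply, smul_add] at hx hy ⊢
    rw [← hx, ← hy]; abel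
  | hc x y => rw [toWord_conc, dF_opM hf]

section Defect

variable {P P' : ℕ} {e : k} {F : TP k A m →ₗ[k] A ⊗[k] TP k A (P + 1)}
  {F' : TP k A (m + 1) →ₗ[k] A ⊗[k] TP k A P'} (hF : IsDelta e F F')

include hF

/-- The recursions of `dF` and `opLam` along `sh`, together with the relation for F on the longer
word, cancel every term at the front; there remains the same defect one letter further inside. -/
theorem opK_sh {N : ℕ} (hN : m ≤ N) (c : ABar k A) (w : TP k A N) (b : A) :
    opK e F F' (jt (lett k A c * toWord w) b) =
      -e • sh (al (sec k A c) * opK e F F' (jt (toWord w) b)) := by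
  rw [← opK_al_mul]
  have h1 : jt (lett k A c * toWord w) b = sh (al (sec k A c) * jt (toWord w) b) := by
    rw [sh_al_mul_jt, proj_sec]
  have h2 := hF (N + 1) (by omega) (cons N (c ⊗ₜ w)) b
  rw [toWord_cons, h1] at h2
  rw [h1]
  generalize al (sec k A c) * jt (toWord w) b = y at *
  have h3 : sh (opM F (jt 1 (eaugA y))) = opLam e F (jt 1 (eaugA y)) := by
    rw [sh_opM_jt, opLam_jt, opL_one]
  rw [dF_sh, map_sub, map_sub] at h2
  have h4 := congrArg sh h2
  rw [map_add, map_smul, map_smul, map_sub, map_sub, h3] at h4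
  have h5 := eq_sub_of_add_eq h4
  rw [opK_apply, opK_apply, opLam_sh, opLam_sh, map_add dF, map_smul dF, dF_sh, dF_sh, dF_sh,
    eaugA_opM, eaugA_opLam, h5, map_sub (opLam e F), map_sub (opLam e F), opLam_sh,
    map_add sh, map_sub sh, map_sub sh, map_smul sh, map_smul sh]
  simp only [map_zero]
  module

omit hF in
theorem opK_word (w : TP k A m) (b : A) :
    opK e F F' (jt (toWord w) b) = -sh (dF (embW (F w) * jt 1 b)) := by
  have h1 : opLam e F (jt (toWord w) b) = sh (opM F (jt (toWord w) b)) := by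
    rw [sh_opM_jt, opLam_jt, opL_word, opB_word]
  have h2 : opLam e F (dF (jt (toWord w) b)) = 0 := by
    have h : jt (toWord w) b = embB (1 ⊗ₜ (w ⊗ₜ b)) := by rw [embB_tmul, al_one, one_mul]
    rw [h]
    cases m with
    | zero => rw [dF_embB_zero, map_zero]
    | succ r => rw [dF_embB, opLam_embB_short e F (Nat.lt_succ_self r)]
  have h3 : opLam (-e) F' (jt (toWord w) b) = 0 := by
    rw [opLam_jt, opL_short _ _ (Nat.lt_succ_self m)]; simp
  rw [opK_apply, h1, h2, h3, dF_sh, eaugA_opM, ← opM_jt_word]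
  simp only [map_zero, smul_zero]
  abel

/-- By `opK_sh` the defect passes the leading letters up to sign, so it comes only from applying F
to the last m letters. -/
theorem opK_append {j : ℕ} (v : TP k A j) (w : TP k A m) (b : A) :
    opK e F F' (jt (toWord v * toWord w) b) =
      -((-e) ^ j • (jt (toWord v) 1 * sh (dF (embW (F w) * jt 1 b)))) := by
  induction j with
  | zero =>
    obtain ⟨c, rfl⟩ := exists_smul_emptyWord v
    rw [map_smul, toWord_emptyWord, smul_mul_assoc, one_mul, map_smul, map_smul,
      LinearMap.smul_apply, LinearMap.smul_apply, map_smul, opK_word, jt_one_one, pow_zero, one_smul,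
      smul_mul_assoc, one_mul, smul_neg]
  | succ j ih =>
    induction v using cons_induction with
    | h0 => simp
    | hadd x y hx hy =>
      simp only [map_add, add_mul, LinearMap.add_apply, smul_add, neg_add, hx, hy]
    | hc c v =>
      have h := opK_sh hF (show m ≤ j + m by omega) c (conc rfl (v ⊗ₜ w)) b
      rw [toWord_conc] at h
      rw [toWord_cons, mul_assoc, h, ih, forms_mul_neg, mul_smul_comm, map_neg, map_smul, ← mul_assoc,
        sh_mul_sh, sh_al_mul_jt, proj_sec, smul_neg, smul_smul, pow_succ']

theorem opK_embW_mul {P₂ : ℕ} (y : A ⊗[k] TP k A P₂) (w : TP k A m) (b : A) :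
    opK e F F' (embW y * jt (toWord w) b) =
      -((-e) ^ P₂ • (embW y * sh (dF (embW (F w) * jt 1 b)))) := by
  induction y with
  | zero => simp
  | add x y hx hy => simp only [map_add, add_mul, smul_add, neg_add, hx, hy]
  | tmul a v =>
    rw [embW_tmul, mul_assoc, jt_mul_jt, one_mul, opK_al_mul, opK_append hF, forms_mul_neg,
      mul_smul_comm, mul_assoc]

/-- On words of length n + m, `opM` H acts on the first n letters and the defect on the last m, so
the two commute up to sign. -/
theorem opM_opK {P₂ N : ℕ} (H : TP k A n →ₗ[k] A ⊗[k] TP k A P₂) {c : k} (h : n + m = N)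
    (hc : (-e) ^ n = c * (-e) ^ P₂) (w : TP k A N) (b : A) :
    opM H (opK e F F' (jt (toWord w) b)) = c • opK e F F' (opM H (jt (toWord w) b)) := by
  induction w using conc_induction h with
  | h0 => simp
  | hadd x y hx hy => simp only [map_add, LinearMap.add_apply, smul_add, hx, hy]
  | hc x y =>
    rw [toWord_conc, opK_append hF, map_neg, map_smul, opM_jt_mul_sh, opM_jt, opK_embW_mul hF,
      smul_neg, smul_smul, hc]

end Defect

/-- The operator underlying the bracket. -/
def brOp {P Q : ℕ} (e : k) (F : TP k A m →ₗ[k] A ⊗[k] TP k A P) (e' : k)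
    (G : TP k A n →ₗ[k] A ⊗[k] TP k A Q) (η : k) : Forms k A →ₗ[k] Forms k A :=
  opM F ∘ₗ opLam e' G + e • (opLam e F ∘ₗ opM G)
    - η • (opM G ∘ₗ opLam e F + e' • (opLam e' G ∘ₗ opM F))

theorem brOp_apply {P Q : ℕ} (e : k) (F : TP k A m →ₗ[k] A ⊗[k] TP k A P) (e' : k)
    (G : TP k A n →ₗ[k] A ⊗[k] TP k A Q) (η : k) (y : Forms k A) :
    brOp e F e' G η y = opM F (opLam e' G y) + e • opLam e F (opM G y)
      - η • (opM G (opLam e F y) + e' • opLam e' G (opM F y)) := rfl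

theorem brOp_al_mul {P Q : ℕ} (e : k) (F : TP k A m →ₗ[k] A ⊗[k] TP k A P) (e' : k)
    (G : TP k A n →ₗ[k] A ⊗[k] TP k A Q) (η : k) (a : A) (y : Forms k A) :
    brOp e F e' G η (al a * y) = al a * brOp e F e' G η y := by
  simp only [brOp_apply, opM_al_mul, opLam_al_mul, mul_sub, mul_add, mul_smul_comm]

theorem brOp_mul_jt_one {P Q : ℕ} (e : k) (F : TP k A m →ₗ[k] A ⊗[k] TP k A P) (e' : k)
    (G : TP k A n →ₗ[k] A ⊗[k] TP k A Q) (η : k) (b : A) (y : Forms k A) :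
    brOp e F e' G η (y * jt 1 b) = brOp e F e' G η y * jt 1 b := by
  simp only [brOp_apply, opM_mul_jt_one, opLam_mul_jt_one, sub_mul, add_mul, smul_mul_assoc]

theorem dF_opM_opLam {P Q P' Q' : ℕ} {e e' : k} {F : TP k A m →ₗ[k] A ⊗[k] TP k A (P + 1)}
    {F' : TP k A (m + 1) →ₗ[k] A ⊗[k] TP k A P'} {G : TP k A n →ₗ[k] A ⊗[k] TP k A (Q + 1)}
    {G' : TP k A (n + 1) →ₗ[k] A ⊗[k] TP k A Q'} (hF : IsDelta e F F') {N : ℕ} (h : m + n = N)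
    (w : TP k A N) (b : A) :
    dF (opM F (opLam e' G (jt (toWord w) b))) =
      e • opM F' (opLam e' G (jt (toWord w) b))
        - e • (opM F (opK e' G G' (jt (toWord w) b))
          + e' • opM F (opLam e' G (dF (jt (toWord w) b)))
          + opM F (opM G (jt (toWord w) b)) - e' • opM F (opLam (-e') G' (jt (toWord w) b))) := by
  obtain ⟨v, hv⟩ := opL_mem_range e' G h w
  have h1 : opLam e' G (jt (toWord w) b) = jt (toWord v) b := by rw [opLam_jt, hv]
  have h2 := hF _ (by omega) v b
  rw [← h1] at h2
  have h3 : dF (opLam e' G (jt (toWord w) b)) = opK e' G G' (jt (toWord w) b)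
      + e' • opLam e' G (dF (jt (toWord w) b)) + opM G (jt (toWord w) b)
      - e' • opLam (-e') G' (jt (toWord w) b) := by rw [opK_apply]; abel
  rw [h3, map_sub, map_add, map_add, map_smul, map_smul] at h2
  exact eq_sub_of_add_eq h2

theorem dF_opLam_opM {P Q P' Q' : ℕ} {e e' : k} {F : TP k A m →ₗ[k] A ⊗[k] TP k A (P + 1)}
    {F' : TP k A (m + 1) →ₗ[k] A ⊗[k] TP k A P'} {G : TP k A n →ₗ[k] A ⊗[k] TP k A (Q + 1)}
    {G' : TP k A (n + 1) →ₗ[k] A ⊗[k] TP k A Q'} (hG : IsDelta e' G G') {N : ℕ} (h : n + 1 ≤ N)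
    (w : TP k A N) (b : A) :
    dF (opLam e F (opM G (jt (toWord w) b))) =
      opK e F F' (opM G (jt (toWord w) b))
        + e • (e' • opLam e F (opM G' (jt (toWord w) b))
          - e' • opLam e F (opM G (dF (jt (toWord w) b))))
        + opM F (opM G (jt (toWord w) b)) - e • opLam (-e) F' (opM G (jt (toWord w) b)) := by
  have h2 := eq_sub_of_add_eq (hG _ h w b)
  have h3 : ∀ y, dF (opLam e F y) = opK e F F' y + e • opLam e F (dF y) + opM F y
      - e • opLam (-e) F' y := fun y => by rw [opK_apply]; abel
  rw [h3, h2, map_sub, map_smul, map_smul]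

set_option maxHeartbeats 1600000 in
/-- The Leibniz rule. -/
theorem dF_brOp {P Q P' Q' : ℕ} {e e' η : k} {F : TP k A m →ₗ[k] A ⊗[k] TP k A (P + 1)}
    {F' : TP k A (m + 1) →ₗ[k] A ⊗[k] TP k A P'} {G : TP k A n →ₗ[k] A ⊗[k] TP k A (Q + 1)}
    {G' : TP k A (n + 1) →ₗ[k] A ⊗[k] TP k A Q'} (hF : IsDelta e F F') (hG : IsDelta e' G G')
    (hm : 1 ≤ m) (hn : 1 ≤ n) (he : e = 1 ∨ e = -1) (he' : e' = 1 ∨ e' = -1)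
    (hη : η = 1 ∨ η = -1) (h1 : (-e') ^ m = -(e * e' * η) * (-e') ^ (P + 1))
    (h2 : (-e) ^ n = -(e * e' * η) * (-e) ^ (Q + 1)) {N : ℕ} (h : m + n = N)
    (w : TP k A N) (b : A) :
    dF (brOp e F e' G η (jt (toWord w) b)) + (e * e') • brOp e F e' G η (dF (jt (toWord w) b)) =
      (e * e') • brOp e F (-e') G' (η * e) (jt (toWord w) b)
        + e • brOp (-e) F' e' G (η * e') (jt (toWord w) b) := by
  -- These words have the critical length: each defect term occurs once before and once after a
  -- front operator, and h1, h2 provide the signs for which the two occurrences cancel.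
  have c1 := opM_opK hG F (c := -(e * e' * η)) h h1 w b
  have c2 := opM_opK hF G (c := -(e * e' * η)) (by omega) h2 w b
  have d1 := dF_opM_opLam (e' := e') (G := G) (G' := G') hF h w b
  have d2 := dF_opM_opLam (e' := e) (G := F) (G' := F') hG (show n + m = N by omega) w b
  have d3 := dF_opLam_opM (e := e) (F := F) (F' := F') hG (show n + 1 ≤ N by omega) w b
  have d4 := dF_opLam_opM (e := e') (F := G) (F' := G') hF (show m + 1 ≤ N by omega) w b
  simp only [brOp_apply]
  rw [map_sub dF, map_smul dF, map_add dF, map_add dF, map_smul dF, map_smul dF, d1, d2, d3, d4, c1,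
    c2]
  generalize opM F' (opLam e' G (jt (toWord w) b)) = a1
  generalize opM G' (opLam e F (jt (toWord w) b)) = a2
  generalize opM F (opLam e' G (dF (jt (toWord w) b))) = a3
  generalize opM G (opLam e F (dF (jt (toWord w) b))) = a4
  generalize opM F (opM G (jt (toWord w) b)) = a5
  generalize opM G (opM F (jt (toWord w) b)) = a6
  generalize opM F (opLam (-e') G' (jt (toWord w) b)) = a7
  generalize opM G (opLam (-e) F' (jt (toWord w) b)) = a8
  generalize opK e F F' (opM G (jt (toWord w) b)) = a9
  generalize opK e' G G' (opM F (jt (toWord w) b)) = a10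
  generalize opLam e F (opM G' (jt (toWord w) b)) = a11
  generalize opLam e' G (opM F' (jt (toWord w) b)) = a12
  generalize opLam e F (opM G (dF (jt (toWord w) b))) = a13
  generalize opLam e' G (opM F (dF (jt (toWord w) b))) = a14
  generalize opLam (-e) F' (opM G (jt (toWord w) b)) = a15
  generalize opLam (-e') G' (opM F (jt (toWord w) b)) = a16
  clear c1 c2 d1 d2 d3 d4 h1 h2 hF hG
  -- What remains is linear in the sixteen abbreviated terms and is checked for each of the eight
  -- choices of signs.
  rcases he with rfl | rfl <;> rcases he' with rfl | rfl <;> rcases hη with rfl | rfl <;> module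

end Leibniz

/-! ### The operator bracket and an additional last letter -/

section BracketSnoc

variable {k : Type u} {A : Type v} [Field k] [Ring A] [Algebra k A] {m n P Q : ℕ}

theorem opM_mul_jt_word (F : TP k A m →ₗ[k] A ⊗[k] TP k A P) {N : ℕ} (h : m ≤ N) (w : TP k A N)
    (u : WordAlg k A) (b : A) :
    opM F (jt (toWord w * u) b) = opM F (jt (toWord w) 1) * jt u b := by
  induction w using conc_induction (show m + (N - m) = N by omega) with
  | h0 => simp
  | hadd x y hx hy => simp only [map_add, add_mul, LinearMap.add_apply, hx, hy]
  | hc x y =>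
    rw [toWord_conc, mul_assoc, opM_jt, opM_jt, mul_assoc (embW (F x)), jt_mul_jt, one_mul]

/-- An additional last letter creates exactly one new position, the one in which G covers the last n
+ 1 letters. -/
theorem opL_snoc (e : k) (G : TP k A (n + 1) →ₗ[k] A ⊗[k] TP k A Q) {j : ℕ} (v : TP k A j)
    (w : TP k A n) (c : ABar k A) :
    opL e G (toWord v * toWord w * lett k A c) = opL e G (toWord v * toWord w) * lett k A c
      + e ^ j • (toWord v * toWord (barW (G (snoc n (w ⊗ₜ c))))) := by
  induction j with
  | zero =>
    obtain ⟨r, rfl⟩ := exists_smul_emptyWord v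
    rw [map_smul, toWord_emptyWord]
    simp only [smul_mul_assoc, one_mul, map_smul, pow_zero, one_smul]
    rw [← toWord_snoc, opL_word, opL_short _ _ (Nat.lt_succ_self n)]
    simp
  | succ j ih =>
    induction v using cons_induction with
    | h0 => simp
    | hadd x y hx hy =>
      simp only [map_add, add_mul, smul_add, hx, hy]; abel
    | hc a v =>
      have h1 : opB G (toWord (cons j (a ⊗ₜ v)) * toWord w * lett k A c) =
          opB G (toWord (cons j (a ⊗ₜ v)) * toWord w) * lett k A c := by
        rw [← toWord_conc rfl]
        generalize conc rfl (cons j (a ⊗ₜ v) ⊗ₜ w) = x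
        induction x using conc_induction (show n + 1 + j = j + 1 + n by omega) with
        | h0 => simp
        | hadd x y hx hy => simp only [map_add, add_mul, hx, hy]
        | hc x y => rw [toWord_conc, mul_assoc, opB_mul, opB_mul, mul_assoc]
      rw [toWord_cons] at h1 ⊢
      simp only [mul_assoc] at h1 ih ⊢
      rw [opL_lett_mul, opL_lett_mul, h1, ih, add_mul, mul_add, smul_add, mul_smul_comm, smul_smul,
        ← pow_succ', smul_mul_assoc, add_assoc, mul_assoc]

/-- `F ⊗ Ḡ`. -/
def opT {N : ℕ} (F : TP k A m →ₗ[k] A ⊗[k] TP k A P) (G : TP k A n →ₗ[k] A ⊗[k] TP k A Q)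
    (h : m + n = N) : TP k A N →ₗ[k] Forms k A :=
  LinearMap.mul' k _ ∘ₗ TensorProduct.map (embW ∘ₗ F) (jt.flip 1 ∘ₗ toWord ∘ₗ barW ∘ₗ G) ∘ₗ
    (conc h).symm.toLinearMap

theorem opT_conc {N : ℕ} (F : TP k A m →ₗ[k] A ⊗[k] TP k A P)
    (G : TP k A n →ₗ[k] A ⊗[k] TP k A Q) (h : m + n = N) (v : TP k A m) (w : TP k A n) :
    opT F G h (conc h (v ⊗ₜ w)) = embW (F v) * jt (toWord (barW (G w))) 1 := by
  simp [opT]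

/-- At the new position G acts strictly behind the letters used by F, so the extra term is the
tensor product of the two maps. -/
theorem opM_opLam_snoc (e' : k) (F : TP k A m →ₗ[k] A ⊗[k] TP k A P)
    (G : TP k A (n + 1) →ₗ[k] A ⊗[k] TP k A Q) {N : ℕ} (h : m + n = N) (hm : 1 ≤ m) (w : TP k A N)
    (c : ABar k A) :
    opM F (opLam e' G (jt (toWord w * lett k A c) 1)) =
      opM F (opLam e' G (jt (toWord w) 1)) * jt (lett k A c) 1
        + e' ^ m • opT F G (show m + (n + 1) = N + 1 by omega) (snoc N (w ⊗ₜ c)) := by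
  induction w using conc_induction h with
  | h0 => simp
  | hadd x y hx hy =>
    simp only [map_add, add_mul, TensorProduct.add_tmul, LinearMap.add_apply, smul_add, hx, hy]
    abel
  | hc v w =>
    have h1 : snoc N (conc h (v ⊗ₜ w) ⊗ₜ c) =
        conc (show m + (n + 1) = N + 1 by omega) (v ⊗ₜ snoc n (w ⊗ₜ c)) :=
      toWord_injective (by simp [mul_assoc])
    obtain ⟨j, rfl⟩ : ∃ j, m = j + 1 := ⟨m - 1, by omega⟩
    obtain ⟨x, hx⟩ := opL_mem_range e' G (show j + (n + 1) = N by omega) (conc h (v ⊗ₜ w))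
    rw [h1, opT_conc, opLam_jt, opLam_jt, ← hx, ← opM_mul_jt_word F (by omega), hx, toWord_conc,
      opL_snoc, map_add, LinearMap.add_apply, map_add, map_smul, LinearMap.smul_apply, map_smul,
      opM_jt]

theorem opLam_embW_mul_snoc (e : k) (F : TP k A (m + 1) →ₗ[k] A ⊗[k] TP k A P)
    (y : A ⊗[k] TP k A Q) (w : TP k A m) (c : ABar k A) :
    opLam e F (embW y * jt (toWord w * lett k A c) 1) =
      opLam e F (embW y * jt (toWord w) 1) * jt (lett k A c) 1
        + e ^ Q • (embW y * jt (toWord (barW (F (snoc m (w ⊗ₜ c))))) 1) := by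
  induction y with
  | zero => simp
  | add x y hx hy =>
    simp only [map_add, add_mul, smul_add, hx, hy]; abel
  | tmul a v =>
    rw [embW_tmul, mul_assoc, mul_assoc, mul_assoc, jt_mul_jt, jt_mul_jt, jt_mul_jt, opLam_al_mul,
      opLam_al_mul, opLam_jt, opLam_jt, one_mul, ← mul_assoc (toWord v), opL_snoc, map_add,
      LinearMap.add_apply, mul_add, map_smul, LinearMap.smul_apply, mul_smul_comm, mul_assoc (al a),
      jt_mul_jt, one_mul]

theorem opLam_opM_snoc (e : k) (F : TP k A (m + 1) →ₗ[k] A ⊗[k] TP k A P)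
    (G : TP k A n →ₗ[k] A ⊗[k] TP k A Q) {N : ℕ} (h : n + m = N) (w : TP k A N)
    (c : ABar k A) :
    opLam e F (opM G (jt (toWord w * lett k A c) 1)) =
      opLam e F (opM G (jt (toWord w) 1)) * jt (lett k A c) 1
        + e ^ Q • opT G F (show n + (m + 1) = N + 1 by omega) (snoc N (w ⊗ₜ c)) := by
  induction w using conc_induction h with
  | h0 => simp
  | hadd x y hx hy =>
    simp only [map_add, add_mul, TensorProduct.add_tmul, LinearMap.add_apply, smul_add, hx, hy]
    abel
  | hc v w =>
    have h1 : snoc N (conc h (v ⊗ₜ w) ⊗ₜ c) =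
        conc (show n + (m + 1) = N + 1 by omega) (v ⊗ₜ snoc m (w ⊗ₜ c)) :=
      toWord_injective (by simp [mul_assoc])
    rw [h1, opT_conc, toWord_conc, mul_assoc, opM_jt, opM_jt, opLam_embW_mul_snoc]

/-- The bracket commutes with the addition of a last letter. -/
theorem brOp_snoc {e e' η : k} {F : TP k A (m + 1) →ₗ[k] A ⊗[k] TP k A P}
    {G : TP k A (n + 1) →ₗ[k] A ⊗[k] TP k A Q} (h1 : e' ^ (m + 1) = η * (e' * e' ^ P))
    (h2 : e * e ^ Q = η * e ^ (n + 1)) {N : ℕ} (h : m + n + 1 = N) (w : TP k A N) (c : ABar k A) :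
    brOp e F e' G η (jt (toWord w * lett k A c) 1) =
      brOp e F e' G η (jt (toWord w) 1) * jt (lett k A c) 1 := by
  rw [brOp_apply, brOp_apply, opM_opLam_snoc e' F G (show m + 1 + n = N by omega) (by omega),
    opM_opLam_snoc e G F (show n + 1 + m = N by omega) (by omega),
    opLam_opM_snoc e F G (show n + 1 + m = N by omega),
    opLam_opM_snoc e' G F (show m + 1 + n = N by omega)]
  -- The extra terms are `opT` F G and `opT` G F, each of them twice; h1 and h2 say that the
  -- coefficients are opposite.
  simp only [sub_mul, add_mul, smul_mul_assoc, smul_add, smul_smul, h1, h2]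
  module

/-- `F ⊗ id`. -/
theorem opB_extR (F : TP k A m →ₗ[k] A ⊗[k] TP k A P) (u : WordAlg k A) (c : ABar k A) :
    opB (extR F 1 rfl rfl) (u * lett k A c) = opB F u * lett k A c := by
  have hb : ∀ (y : A ⊗[k] TP k A P) (d : ABar k A),
      toWord (barW (LinearMap.lTensor A ((snoc P).toLinearMap ∘ₗ (TensorProduct.mk k _ _).flip d) y))
        = toWord (barW y) * lett k A d := by
    intro y d
    induction y with
    | zero => simp
    | add x y hx hy => simp only [map_add, add_mul, hx, hy]
    | tmul a w => simp [barW_tmul, mul_assoc]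
  induction u using word_front_induction m with
  | h0 => simp
  | hadd x y hx hy => simp only [map_add, add_mul, hx, hy]
  | hs N h w => rw [← toWord_snoc, opB_short _ (by omega), opB_short F h, zero_mul]
  | hl w u =>
    rw [opB_mul]
    induction u using word_induction generalizing c with
    | h0 => simp
    | hadd x y hx hy => simp only [mul_add, add_mul, map_add, hx, hy]
    | hw j v =>
      cases j with
      | zero =>
        obtain ⟨r, rfl⟩ := exists_smul_emptyWord v
        simp only [map_smul, toWord_emptyWord, mul_smul_comm, smul_mul_assoc, mul_one]
        rw [← toWord_snoc, opB_word, extR_snoc, hb]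
      | succ j =>
        induction v using cons_induction with
        | h0 => simp
        | hadd x y hx hy => simp only [map_add, mul_add, add_mul, hx, hy]
        | hc d v =>
          rw [toWord_cons, ← mul_assoc, ← toWord_snoc, mul_assoc, opB_mul, extR_snoc, hb]
          simp only [mul_assoc]

theorem opM_extR (F : TP k A m →ₗ[k] A ⊗[k] TP k A P) (w : TP k A (m + 1)) (u : WordAlg k A)
    (b : A) : opM (extR F 1 rfl rfl) (jt (toWord w * u) b) = opM F (jt (toWord w * u) b) := by
  rw [opM_jt]
  induction w using snoc_induction with
  | h0 => simp
  | hadd x y hx hy => simp only [map_add, add_mul, LinearMap.add_apply, hx, hy]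
  | hc w c =>
    rw [extR_snoc, toWord_snoc, mul_assoc, opM_jt]
    generalize F w = y
    induction y with
    | zero => simp
    | add x y hx hy => simp only [map_add, add_mul, hx, hy]
    | tmul a v =>
      rw [LinearMap.lTensor_tmul, embW_tmul, embW_tmul]
      simp [mul_assoc, jt_mul_jt]

theorem opM_extR_word (F : TP k A m →ₗ[k] A ⊗[k] TP k A P) {N : ℕ} (h : m + 1 ≤ N) (w : TP k A N)
    (b : A) : opM (extR F 1 rfl rfl) (jt (toWord w) b) = opM F (jt (toWord w) b) := by
  induction w using conc_induction (show m + 1 + (N - (m + 1)) = N by omega) with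
  | h0 => simp
  | hadd x y hx hy => simp only [map_add, LinearMap.add_apply, hx, hy]
  | hc x y => rw [toWord_conc, opM_extR]

theorem opL_extR (e : k) (F : TP k A m →ₗ[k] A ⊗[k] TP k A P) (u : WordAlg k A) (c : ABar k A) :
    opL e (extR F 1 rfl rfl) (u * lett k A c) = opL e F u * lett k A c := by
  induction u using word_induction with
  | h0 => simp
  | hadd x y hx hy => simp only [add_mul, map_add, hx, hy]
  | hw n w =>
    induction n with
    | zero =>
      obtain ⟨r, rfl⟩ := exists_smul_emptyWord w
      have h : opL e (extR F 1 rfl rfl) 1 = 0 := by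
        rw [← toWord_emptyWord, opL_short _ _ (Nat.succ_pos m)]
      have h2 := opL_lett_mul e (extR F 1 rfl rfl) c 1
      rw [h, mul_zero, smul_zero, add_zero, mul_one] at h2
      have h3 := opB_extR F 1 c
      rw [one_mul] at h3
      rw [map_smul, toWord_emptyWord, smul_mul_assoc, one_mul, map_smul, map_smul, h2, h3, opL_one,
        smul_mul_assoc]
    | succ n ih =>
      induction w using cons_induction with
      | h0 => simp
      | hadd x y hx hy => simp only [map_add, add_mul, hx, hy]
      | hc a w =>
        have h := opB_extR F (toWord (cons n (a ⊗ₜ w))) c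
        rw [toWord_cons] at h ⊢
        rw [mul_assoc, opL_lett_mul, ih, opL_lett_mul, ← mul_assoc (lett k A a), h, add_mul,
          smul_mul_assoc, mul_assoc]

/-- The bracket with `F ⊗ id`. -/
theorem brOp_extR {e e' η : k} {F : TP k A (m + 1) →ₗ[k] A ⊗[k] TP k A P}
    {G : TP k A (n + 1) →ₗ[k] A ⊗[k] TP k A Q} (h1 : e' ^ (m + 1) = η * (e' * e' ^ P))
    {N : ℕ} (h : m + n + 1 = N) (w : TP k A N) (c : ABar k A) :
    brOp e (extR F 1 rfl rfl) e' G η (jt (toWord w * lett k A c) 1) =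
      brOp e F e' G η (jt (toWord w) 1) * jt (lett k A c) 1 := by
  have hM : ∀ N' (_ : n + 1 ≤ N') (w' : TP k A N'), opM G (jt (toWord w' * lett k A c) 1) =
      opM G (jt (toWord w') 1) * jt (lett k A c) 1 := fun N' hN' w' => opM_mul_jt_word G hN' w' _ 1
  have hL : ∀ y : Forms k A, opLam e (extR F 1 rfl rfl) (y * jt (lett k A c) 1) =
      opLam e F y * jt (lett k A c) 1 := by
    intro y
    induction y using forms_jt_induction with
    | h0 => simp
    | hadd x y hx hy => simp only [add_mul, map_add, hx, hy]
    | hc a u b =>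
      rw [mul_assoc, jt_mul_jt, mul_one, opLam_al_mul, opLam_al_mul, opLam_jt, opLam_jt, opL_extR,
        mul_assoc, jt_mul_jt, mul_one]
  have e1 : opM (extR F 1 rfl rfl) (opLam e' G (jt (toWord w * lett k A c) 1)) =
      opM F (opLam e' G (jt (toWord w * lett k A c) 1)) := by
    obtain ⟨v, hv⟩ := opL_mem_range e' G (show m + 1 + (n + 1) = N + 1 by omega) (snoc N (w ⊗ₜ c))
    rw [← toWord_snoc, opLam_jt, ← hv, opM_extR_word F (by omega)]
  have e2 : opM G (opLam e (extR F 1 rfl rfl) (jt (toWord w * lett k A c) 1)) =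
      opM G (opLam e F (jt (toWord w) 1)) * jt (lett k A c) 1 := by
    obtain ⟨v, hv⟩ := opL_mem_range e F (show n + (m + 1) = N by omega) w
    rw [opLam_jt, opLam_jt, opL_extR, ← hv, hM _ (by omega)]
  have e3 : opM (extR F 1 rfl rfl) (jt (toWord w * lett k A c) 1) =
      opM F (jt (toWord w * lett k A c) 1) := by
    rw [← toWord_snoc, opM_extR_word F (by omega)]
  rw [brOp_apply, brOp_apply, e1, e2, e3, hM _ (by omega), hL,
    opM_opLam_snoc e' F G (show m + 1 + n = N by omega) (by omega),
    opLam_opM_snoc e' G F (show m + 1 + n = N by omega)]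
  simp only [sub_mul, add_mul, smul_mul_assoc, smul_add, smul_smul, h1]
  module

end BracketSnoc

/-! ### Circle products as operators, and the Leibniz rule for cochains -/

section BracketFormula

variable {k : Type u} {A : Type v} [Field k] [Ring A] [Algebra k A]

theorem negOnePow_smul {M : Type*} [AddCommGroup M] [Module k M] {z : ℤ} {n : ℕ}
    (h : Even (z - n)) (x : M) : z.negOnePow • x = (-1 : k) ^ n • x := by
  have h1 : z.negOnePow = (n : ℤ).negOnePow := Int.negOnePow_eq_iff _ _ |>.2 h
  rw [h1]
  rcases Nat.even_or_odd n with hn | hn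
  · rw [Int.negOnePow_even _ (by exact_mod_cast hn), hn.neg_one_pow, one_smul, one_smul]
  · rw [Int.negOnePow_odd _ (by exact_mod_cast hn), hn.neg_one_pow, neg_smul, one_smul,
      Units.neg_smul, one_smul]

variable {m n p q L N : ℕ}

theorem embW_extR (F : TP k A m →ₗ[k] A ⊗[k] TP k A p) {N M : ℕ} (hN : m + q = N) (hM : p + q = M)
    (w : TP k A N) : embW (extR F q hN hM w) = opM F (jt (toWord w) 1) := by
  induction w using conc_induction hN with
  | h0 => simp
  | hadd x y hx hy => simp only [map_add, LinearMap.add_apply, hx, hy]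
  | hc v w =>
    rw [toWord_conc, opM_jt]
    simp only [extR, LinearMap.comp_apply, LinearEquiv.coe_coe, LinearEquiv.symm_apply_apply,
      LinearMap.rTensor_tmul]
    generalize F v = y
    induction y with
    | zero => simp
    | add x y hx hy => simp only [map_add, TensorProduct.add_tmul, add_mul, hx, hy]
    | tmul a x => simp [embW_tmul, mul_assoc, jt_mul_jt]

theorem opL_sum (e : k) (F : TP k A m →ₗ[k] A ⊗[k] TP k A p) {j N M : ℕ} (h : j + m = N)
    (hM : j + (p + 1) = M) (w : TP k A N) :
    opL e F (toWord w) = ∑ i : Fin (j + 1), e ^ (i : ℕ) • toWord (mid (barW ∘ₗ F) i (j - i)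
      (by have := i.isLt; omega) (by have := i.isLt; omega) w : TP k A M) := by
  have h0 : ∀ (j : ℕ) (N M : ℕ) (h : m + j = N) (hN : 0 + m + j = N) (hM : 0 + (p + 1) + j = M)
      (w : TP k A N), opB F (toWord w) = toWord (mid (barW ∘ₗ F) 0 j hN hM w) := by
    intro j N M h hN hM w
    induction w using conc_induction h with
    | h0 => simp
    | hadd x y hx hy => simp only [map_add, hx, hy]
    | hc v w =>
      rw [toWord_conc, opB_mul, mid_zero_conc _ _ _ _ _ (by omega), toWord_conc,
        LinearMap.comp_apply]
  induction j generalizing N M with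
  | zero =>
    obtain rfl : m = N := by omega
    have := h0 0 m M rfl (by omega) (by omega) w
    simp [opL_word, ← opB_word, this]
  | succ j ih =>
    obtain rfl : N = j + m + 1 := by omega
    obtain rfl : M = j + (p + 1) + 1 := by omega
    rw [Fin.sum_univ_succ]
    induction w using cons_induction with
    | h0 => simp
    | hadd x y hx hy =>
      simp only [map_add, smul_add, Finset.sum_add_distrib] at hx hy ⊢
      rw [hx, hy]; abel
    | hc c w =>
      rw [toWord_cons, opL_lett_mul, ih rfl rfl w, ← toWord_cons,
        h0 (j + 1) _ _ (by omega) (by omega) (show 0 + (p + 1) + (j + 1) = j + (p + 1) + 1 by omega)]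
      simp only [Fin.val_zero, pow_zero, one_smul, Nat.sub_zero]
      congr 1
      rw [Finset.mul_sum, Finset.smul_sum]
      refine Finset.sum_congr rfl fun i _ => ?_
      have h2 : ∀ (l l' : ℕ) (_ : l = l') (hN : (i : ℕ) + 1 + m + l = j + m + 1)
          (hM : (i : ℕ) + 1 + (p + 1) + l = j + (p + 1) + 1) (hN' : (i : ℕ) + m + l' = j + m)
          (hM' : (i : ℕ) + (p + 1) + l' = j + (p + 1)),
          mid (barW ∘ₗ F) (i + 1) l hN hM (cons _ (c ⊗ₜ w)) =
            cons _ (c ⊗ₜ mid (barW ∘ₗ F) i l' hN' hM' w) := by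
        rintro l _ rfl hN hM hN' hM'
        rw [mid_succ_cons]
      simp only [Fin.val_succ]
      rw [h2 _ (j - i) (by have := i.isLt; omega), toWord_cons, mul_smul_comm, smul_smul, pow_succ']

theorem opLam_embW (e : k) (F : TP k A m →ₗ[k] A ⊗[k] TP k A p) {j N M : ℕ} (h : j + m = N)
    (hM : j + (p + 1) = M) (y : A ⊗[k] TP k A N) :
    opLam e F (embW y) = ∑ i : Fin (j + 1), e ^ (i : ℕ) • embW (LinearMap.lTensor A
      (mid (barW ∘ₗ F) i (j - i) (by have := i.isLt; omega) (by have := i.isLt; omega) :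
        TP k A N →ₗ[k] TP k A M) y) := by
  induction y with
  | zero => simp
  | add x y hx hy =>
    simp only [map_add, smul_add, Finset.sum_add_distrib, hx, hy]
  | tmul a w =>
    simp only [embW_tmul, LinearMap.lTensor_tmul]
    rw [opLam_al_mul, opLam_jt, opL_sum e F h hM]
    simp only [map_sum, LinearMap.sum_apply, map_smul, LinearMap.smul_apply, Finset.mul_sum,
      mul_smul_comm]

theorem piR_bulletPos (hL : m + n + 1 = L) (hN : p + q + 1 = N)
    (f : Cochain k A (m + 1) p) (g : Cochain k A (n + 1) q) (i : Fin (m + 1)) (w : TP k A L) :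
    piR N (bulletPos hL hN f g i w) = (-1 : k) ^ (N + 1) •
      extR (N := m + 1 + (q + 1)) (piR p ∘ₗ f) (q + 1) rfl (by omega)
        (mid (barW ∘ₗ piR q ∘ₗ g) i (m - i) (by have := i.isLt; omega) (by have := i.isLt; omega) w)
    := piR_d_close _

theorem piR_bulletNeg (hL : m + n + 1 = L) (hN : p + q + 1 = N)
    (f : Cochain k A (m + 1) p) (g : Cochain k A (n + 1) q) (i : Fin (q + 1)) (w : TP k A L) :
    piR N (bulletNeg hL hN f g i w) = (-1 : k) ^ (N + 1) •
      LinearMap.lTensor A (mid (N := q + 1 + m) (barW ∘ₗ piR p ∘ₗ f) i (q - i)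
      (by have := i.isLt; omega) (by have := i.isLt; omega)) (extR (piR q ∘ₗ g) m (by omega) rfl w)
    := piR_d_close _

theorem neg_one_pow_mul_self (n : ℕ) : (-1 : k) ^ n * (-1) ^ n = 1 := by
  rw [← mul_pow]; simp

theorem neg_one_pow_eq_of {a b c : ℕ} (h : a = b + 2 * c) : (-1 : k) ^ a = (-1) ^ b := by
  rw [h, pow_add, pow_mul]; simp

theorem bullet_eq (hL : m + n + 1 = L) (hN : p + q + 1 = N)
    (f : Cochain k A (m + 1) p) (g : Cochain k A (n + 1) q) :
    bullet hL hN f g = ∑ i : Fin (m + 1), ((-1 : k) ^ (N + 1) *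
      ((-1 : k) ^ (q + (n + 1))) ^ (i : ℕ)) • bulletPos hL hN f g i +
      ∑ i : Fin (q + 1), ((-1 : k) ^ (N + 1) * ((-1 : k) ^ (p + (m + 1)) *
        ((-1 : k) ^ (p + (m + 1))) ^ (i : ℕ))) • bulletNeg hL hN f g i := by
  unfold bullet
  refine congrArg₂ (· + ·) (Finset.sum_congr rfl fun i _ => ?_) (Finset.sum_congr rfl fun i _ => ?_)
  · rw [← pow_mul, ← pow_add]
    refine negOnePow_smul (M := Cochain k A L N) ?_ _
    subst hN
    refine ⟨-(i : ℕ) * (n + 1), ?_⟩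
    push_cast; ring
  · rw [← pow_mul, ← pow_add, ← pow_add]
    refine negOnePow_smul (M := Cochain k A L N) ?_ _
    subst hN
    refine ⟨-((i : ℕ) + 1) * (p + 1), ?_⟩
    push_cast; ring

/-- The signs of the circle products are powers of one fixed sign per letter passed, so the sum over
∙_i is `opM` after `opLam` and the sum over ∙_{-i} is `opLam` after `opM`. The common sign is
absorbed by `piR_d_close`. -/
theorem embW_piR_bullet (hL : m + n + 1 = L) (hN : p + q + 1 = N)
    (f : Cochain k A (m + 1) p) (g : Cochain k A (n + 1) q) (w : TP k A L) :
    embW (piR N (bullet hL hN f g w)) =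
      opM (piR p ∘ₗ f) (opLam ((-1 : k) ^ (q + (n + 1))) (piR q ∘ₗ g) (jt (toWord w) 1)) +
      (-1 : k) ^ (p + (m + 1)) • opLam ((-1 : k) ^ (p + (m + 1))) (piR p ∘ₗ f)
        (opM (piR q ∘ₗ g) (jt (toWord w) 1)) := by
  rw [bullet_eq, LinearMap.add_apply, LinearMap.sum_apply, LinearMap.sum_apply, map_add, map_add]
  simp only [LinearMap.smul_apply, map_sum, map_smul]
  congr 1
  · rw [opLam_jt, opL_sum _ _ (show m + (n + 1) = L by omega)
      (show m + (q + 1 + 1) = m + 1 + (q + 1) by omega)]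
    simp only [map_sum, LinearMap.sum_apply, map_smul, LinearMap.smul_apply]
    refine Finset.sum_congr rfl fun i _ => ?_
    rw [piR_bulletPos, map_smul, smul_smul, embW_extR]
    congr 1
    rw [mul_right_comm, neg_one_pow_mul_self, one_mul]
  · rw [← embW_extR (q := m) (piR q ∘ₗ g) (show n + 1 + m = L by omega) rfl,
      opLam_embW _ _ (show q + (m + 1) = q + 1 + m by omega)
      (show q + (p + 1 + 1) = N + 1 by omega), Finset.smul_sum]
    refine Finset.sum_congr rfl fun i _ => ?_
    rw [piR_bulletNeg, map_smul, smul_smul, smul_smul]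
    congr 1
    rw [mul_right_comm, neg_one_pow_mul_self, one_mul]

/-- The operator of the bracket of two cochains. -/
def brC (f : Cochain k A (m + 1) p) (g : Cochain k A (n + 1) q) : Forms k A →ₗ[k] Forms k A :=
  brOp ((-1 : k) ^ (p + (m + 1))) (piR p ∘ₗ f) ((-1 : k) ^ (q + (n + 1))) (piR q ∘ₗ g)
    ((-1 : k) ^ ((p + (m + 1)) * (q + (n + 1))))

theorem bracketSg_eq (hL : m + n + 1 = L) (hN : p + q + 1 = N)
    (f : Cochain k A (m + 1) p) (g : Cochain k A (n + 1) q) :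
    bracketSg hL hN f g = bullet hL hN f g +
      (-(-1 : k) ^ ((p + (m + 1)) * (q + (n + 1)))) •
        bullet (show n + m + 1 = L by omega) (show q + p + 1 = N by omega) g f := by
  unfold bracketSg
  dsimp only
  have h := negOnePow_smul (k := k) (M := Cochain k A L N)
    (z := ((m + 1 : ℤ) - (p + 1) - 1) * ((n + 1 : ℤ) - (q + 1) - 1))
    (n := (p + (m + 1)) * (q + (n + 1)))
    ⟨-((p + 1) * n + (q + 1) * m), by push_cast; ring⟩
    (bullet (show n + m + 1 = L by omega) (show q + p + 1 = N by omega) g f)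
  rw [h]
  module

/-- With `omegaCochains_ext`, this reduces identities between brackets of cochains to identities
between operators on forms. -/
theorem embW_piR_bracketSg (hL : m + n + 1 = L) (hN : p + q + 1 = N)
    (f : Cochain k A (m + 1) p) (g : Cochain k A (n + 1) q) (w : TP k A L) :
    embW (piR N (bracketSg hL hN f g w)) = brC f g (jt (toWord w) 1) := by
  rw [bracketSg_eq, LinearMap.add_apply, LinearMap.smul_apply, map_add, map_add, map_smul, map_smul,
    embW_piR_bullet, embW_piR_bullet, brC, brOp_apply]
  module

theorem bracketSg_mem (hL : m + n + 1 = L) (hN : p + q + 1 = N)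
    (f : Cochain k A (m + 1) p) (g : Cochain k A (n + 1) q) :
    bracketSg hL hN f g ∈ omegaCochains k A L N := by
  have hb : ∀ {m n p q : ℕ} (hL : m + n + 1 = L) (hN : p + q + 1 = N)
      (f : Cochain k A (m + 1) p) (g : Cochain k A (n + 1) q),
      bullet hL hN f g ∈ omegaCochains k A L N := by
    intro m n p q hL hN f g
    rw [bullet_eq]
    exact add_mem (sum_mem fun i _ => Submodule.smul_mem _ _ (d_comp_mem _))
      (sum_mem fun i _ => Submodule.smul_mem _ _ (d_comp_mem _))
  rw [bracketSg_eq]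
  exact add_mem (hb _ _ _ _) (Submodule.smul_mem _ _ (hb _ _ _ _))

theorem omegaCochains_ext {x y : Cochain k A L N} (hx : x ∈ omegaCochains k A L N)
    (hy : y ∈ omegaCochains k A L N)
    (h : ∀ w, embW (piR N (x w)) = embW (piR N (y w))) : x = y :=
  LinearMap.ext fun w => Omega_ext (hx w) (hy w) (embW_injective (h w))

theorem brC_snoc (hL : m + n + 1 = L) (f : Cochain k A (m + 1) p) (g : Cochain k A (n + 1) q)
    (w : TP k A L) (c : ABar k A) :
    brC f g (jt (toWord w * lett k A c) 1) =
      brC f g (jt (toWord w) 1) * jt (lett k A c) 1 := by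
  have h1 : ((-1 : k) ^ (q + (n + 1))) ^ (m + 1) = (-1) ^ ((p + (m + 1)) * (q + (n + 1))) *
      ((-1) ^ (q + (n + 1)) * ((-1) ^ (q + (n + 1))) ^ (p + 1)) := by
    rw [← pow_mul, ← pow_mul, ← pow_add, ← pow_add]
    exact (neg_one_pow_eq_of (c := (q + (n + 1)) * (p + 1)) (by ring)).symm
  have h2 : (-1 : k) ^ (p + (m + 1)) * ((-1) ^ (p + (m + 1))) ^ (q + 1) =
      (-1) ^ ((p + (m + 1)) * (q + (n + 1))) * ((-1) ^ (p + (m + 1))) ^ (n + 1) := by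
    rw [← pow_mul, ← pow_mul, ← pow_add, ← pow_add]
    exact (neg_one_pow_eq_of (c := (p + (m + 1)) * n) (by ring)).symm
  exact brOp_snoc h1 h2 hL w c

theorem bracketSg_snoc (hL : m + n + 1 = L) (hN : p + q + 1 = N)
    (f : Cochain k A (m + 1) p) (g : Cochain k A (n + 1) q) (w : TP k A L) (c : ABar k A) :
    brC f g (jt (toWord (snoc L (w ⊗ₜ c))) 1) =
      opM (piR N ∘ₗ bracketSg hL hN f g) (jt (toWord (snoc L (w ⊗ₜ c))) 1) := by
  rw [toWord_snoc, opM_jt, LinearMap.comp_apply, embW_piR_bracketSg, brC_snoc hL]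

theorem brC_delta_right (f : Cochain k A (m + 1) p) (g : Cochain k A (n + 1) q) :
    brOp ((-1 : k) ^ (p + (m + 1))) (piR p ∘ₗ f) (-(-1 : k) ^ (q + (n + 1)))
      (piR q ∘ₗ delta k A (n + 1) q g)
      ((-1 : k) ^ ((p + (m + 1)) * (q + (n + 1))) * (-1 : k) ^ (p + (m + 1))) =
      brC f (delta k A (n + 1) q g) := by
  have h1 : -(-1 : k) ^ (q + (n + 1)) = (-1) ^ (q + (n + 1 + 1)) := by ring
  have h2 : (-1 : k) ^ ((p + (m + 1)) * (q + (n + 1))) * (-1 : k) ^ (p + (m + 1)) =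
      (-1) ^ ((p + (m + 1)) * (q + (n + 1 + 1))) := by rw [← pow_add]; congr 1
  rw [h1, h2, brC]

theorem brC_delta_left (f : Cochain k A (m + 1) p) (g : Cochain k A (n + 1) q) :
    brOp (-(-1 : k) ^ (p + (m + 1))) (piR p ∘ₗ delta k A (m + 1) p f) ((-1 : k) ^ (q + (n + 1)))
      (piR q ∘ₗ g)
      ((-1 : k) ^ ((p + (m + 1)) * (q + (n + 1))) * (-1 : k) ^ (q + (n + 1))) =
      brC (delta k A (m + 1) p f) g := by
  have h1 : -(-1 : k) ^ (p + (m + 1)) = (-1) ^ (p + (m + 1 + 1)) := by ring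
  have h2 : (-1 : k) ^ ((p + (m + 1)) * (q + (n + 1))) * (-1 : k) ^ (q + (n + 1)) =
      (-1) ^ ((p + (m + 1 + 1)) * (q + (n + 1))) := by rw [← pow_add]; congr 1; ring
  rw [h1, h2, brC]

theorem dF_brC (hL : m + n + 1 = L) {f : Cochain k A (m + 1) p} {g : Cochain k A (n + 1) q}
    (hf : f ∈ omegaCochains k A (m + 1) p) (hg : g ∈ omegaCochains k A (n + 1) q)
    (w : TP k A (L + 1)) :
    dF (brC f g (jt (toWord w) 1)) + ((-1 : k) ^ (p + (m + 1)) * (-1 : k) ^ (q + (n + 1))) •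
        brC f g (dF (jt (toWord w) 1)) =
      ((-1 : k) ^ (p + (m + 1)) * (-1 : k) ^ (q + (n + 1))) •
          brC f (delta k A (n + 1) q g) (jt (toWord w) 1)
        + (-1 : k) ^ (p + (m + 1)) • brC (delta k A (m + 1) p f) g (jt (toWord w) 1) := by
  rw [← brC_delta_right, ← brC_delta_left]
  refine dF_brOp (isDelta_delta hf) (isDelta_delta hg) (by omega) (by omega)
    (neg_one_pow_eq_or k _) (neg_one_pow_eq_or k _) (neg_one_pow_eq_or k _) ?_ ?_
    (show m + 1 + (n + 1) = L + 1 by omega) w 1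
  · have h1 : ∀ x y z : k, -(x * y * z) = (-1) ^ 1 * (x * y * z) := fun x y z => by ring
    have h2 : -(-1 : k) ^ (q + (n + 1)) = (-1) ^ (q + (n + 1) + 1) := by ring
    rw [h1, h2]
    simp only [← pow_mul, ← pow_add]
    exact (neg_one_pow_eq_of (c := (q + (n + 1) + 1) * (p + 1)) (by ring)).symm
  · have h1 : ∀ x y z : k, -(x * y * z) = (-1) ^ 1 * (x * y * z) := fun x y z => by ring
    have h2 : -(-1 : k) ^ (p + (m + 1)) = (-1) ^ (p + (m + 1) + 1) := by ring
    rw [h1, h2]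
    simp only [← pow_mul, ← pow_add]
    exact (neg_one_pow_eq_of (c := (p + (m + 1) + 1) * (q + 1)) (by ring)).symm

/-- The Leibniz rule for the bracket. -/
theorem delta_bracketSg (hL : m + n + 1 = L) (hN : p + q + 1 = N)
    {f : Cochain k A (m + 1) p} {g : Cochain k A (n + 1) q}
    (hf : f ∈ omegaCochains k A (m + 1) p) (hg : g ∈ omegaCochains k A (n + 1) q) :
    delta k A L N (bracketSg hL hN f g) =
      bracketSg (show m + (n + 1) + 1 = L + 1 by omega) hN f (delta k A (n + 1) q g) +
      (-1 : k) ^ (q + (n + 1)) •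
        bracketSg (show m + 1 + n + 1 = L + 1 by omega) hN (delta k A (m + 1) p f) g := by
  have hH := bracketSg_mem hL hN f g
  refine omegaCochains_ext (delta_mem_omegaCochains hH)
    (add_mem (bracketSg_mem _ _ _ _) (Submodule.smul_mem _ _ (bracketSg_mem _ _ _ _))) fun w => ?_
  have h1 := isDelta_delta hH (L + 1) le_rfl w 1
  -- The bracket cochain agrees with the operator bracket on words of its own length L by
  -- construction. Its commutator with d also needs agreement on words of length L + 1, which is the
  -- compatibility with a last letter.
  have h2 : opM (piR N ∘ₗ bracketSg hL hN f g) (jt (toWord w) 1) = brC f g (jt (toWord w) 1) := by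
    induction w using snoc_induction with
    | h0 => simp
    | hadd x y hx hy =>
      have hadd : ∀ T : Forms k A →ₗ[k] Forms k A, T (jt (toWord (x + y)) 1) =
          T (jt (toWord x) 1) + T (jt (toWord y) 1) := fun T => by
        simp only [map_add, LinearMap.add_apply]
      clear h1
      rw [hadd, hadd]
      have key : ∀ z : TP k A (L + 1), opM (piR N ∘ₗ bracketSg hL hN f g) (jt (toWord z) 1) =
          brC f g (jt (toWord z) 1) := fun z => by
        induction z using snoc_induction with
        | h0 => simp
        | hadd x y hx hy => simp only [map_add, LinearMap.add_apply, hx, hy]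
        | hc w c => rw [bracketSg_snoc hL hN]
      rw [key, key]
    | hc w c => rw [bracketSg_snoc hL hN]
  have h3 : opM (piR N ∘ₗ bracketSg hL hN f g) (dF (jt (toWord w) 1)) =
      brC f g (dF (jt (toWord w) 1)) := by
    have h : jt (toWord w) 1 = embB (1 ⊗ₜ (w ⊗ₜ 1)) := by rw [embB_tmul, al_one, one_mul]
    rw [h, dF_embB]
    generalize d k A L (1 ⊗ₜ (w ⊗ₜ 1)) = x
    induction x using bar_induction with
    | h0 => simp
    | hadd x y hx hy => simp only [map_add, hx, hy]
    | hc a w b =>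
      have h5 : al a * jt (toWord w) b = al a * (jt (toWord w) 1 * jt 1 b) := by
        rw [jt_mul_jt, mul_one, one_mul]
      rw [embB_tmul, h5, opM_al_mul, opM_mul_jt_one, brC, brOp_al_mul, brOp_mul_jt_one, ← brC,
        ← embW_piR_bracketSg hL hN, opM_jt_word, jt_one_one, mul_one, LinearMap.comp_apply]
  have h4 := dF_brC hL hf hg w
  have h6 : (-1 : k) ^ (N + L) = (-1) ^ (p + (m + 1)) * (-1) ^ (q + (n + 1)) := by
    rw [← pow_add]
    congr 1
    omega
  rw [h2, h3, opM_jt_word, jt_one_one, mul_one, LinearMap.comp_apply, h6, h4] at h1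
  rw [LinearMap.add_apply, LinearMap.smul_apply, map_add, map_add, map_smul, map_smul,
    embW_piR_bracketSg, embW_piR_bracketSg]
  have h7 := congrArg (fun x => ((-1 : k) ^ (p + (m + 1)) * (-1) ^ (q + (n + 1))) • x) h1
  simp only [smul_add, smul_smul] at h7
  have h8 : (-1 : k) ^ (p + (m + 1)) * (-1) ^ (q + (n + 1)) *
      ((-1) ^ (p + (m + 1)) * (-1) ^ (q + (n + 1))) = 1 := by
    rw [mul_mul_mul_comm, neg_one_pow_mul_self, neg_one_pow_mul_self, one_mul]
  have h9 : (-1 : k) ^ (p + (m + 1)) * (-1) ^ (q + (n + 1)) * (-1) ^ (p + (m + 1)) =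
      (-1) ^ (q + (n + 1)) := by
    rw [mul_right_comm, neg_one_pow_mul_self, one_mul]
  rw [h8, h9, one_smul, one_smul] at h7
  exact h7.symm

end BracketFormula

/-! ### Maps induced on subquotients -/

section SubquotApi

variable {k : Type u} [Field k]
  {V : Type*} [AddCommGroup V] [Module k V] {W : Type*} [AddCommGroup W] [Module k W]

/-- The projection from cycles to classes. -/
def clsL (Z B : Submodule k V) : Z →ₗ[k] Subquot Z B := Submodule.mkQ (B.submoduleOf Z)

theorem exists_cls {Z B : Submodule k V} (x : Subquot Z B) : ∃ z, ∃ hz : z ∈ Z, x = cls z hz := by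
  obtain ⟨z, rfl⟩ := Submodule.mkQ_surjective (B.submoduleOf Z) x
  exact ⟨z.1, z.2, rfl⟩

theorem cls_congr {Z B : Submodule k V} {x y : V} (h : x = y) (hx : x ∈ Z) (hy : y ∈ Z) :
    (cls x hx : Subquot Z B) = cls y hy := by
  subst h
  rfl

theorem cls_eq_zero {Z B : Submodule k V} {z : V} (hz : z ∈ Z) :
    (cls z hz : Subquot Z B) = 0 ↔ z ∈ B :=
  (Submodule.Quotient.mk_eq_zero (B.submoduleOf Z)).trans Submodule.mem_comap

theorem cls_eq_cls {Z B : Submodule k V} {x y : V} (hx : x ∈ Z) (hy : y ∈ Z) :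
    (cls x hx : Subquot Z B) = cls y hy ↔ x - y ∈ B :=
  (Submodule.Quotient.eq (B.submoduleOf Z)).trans Submodule.mem_comap

/-- The map induced by a linear map. -/
def subMap {Z B : Submodule k V} {Z' B' : Submodule k W} (f : V →ₗ[k] W)
    (hZ : ∀ z ∈ Z, f z ∈ Z') (hB : ∀ z ∈ Z, z ∈ B → f z ∈ B') :
    Subquot Z B →ₗ[k] Subquot Z' B' :=
  Submodule.mapQ (B.submoduleOf Z) (B'.submoduleOf Z') (f.restrict hZ) fun z hz => hB z.1 z.2 hz

theorem subMap_cls {Z B : Submodule k V} {Z' B' : Submodule k W} (f : V →ₗ[k] W)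
    (hZ : ∀ z ∈ Z, f z ∈ Z') (hB : ∀ z ∈ Z, z ∈ B → f z ∈ B') (z : V) (hz : z ∈ Z) :
    subMap f hZ hB (cls z hz) = (cls (f z) (hZ z hz) : Subquot Z' B') := rfl

/-- The isomorphism induced by a linear map. -/
def subEquiv {Z B : Submodule k V} {Z' B' : Submodule k W} (f : V →ₗ[k] W)
    (hZ : ∀ z ∈ Z, f z ∈ Z') (hB : ∀ z ∈ Z, z ∈ B → f z ∈ B') (hi : ∀ z ∈ Z, f z ∈ B' → z ∈ B)
    (hs : ∀ y ∈ Z', ∃ z ∈ Z, f z - y ∈ B') : Subquot Z B ≃ₗ[k] Subquot Z' B' :=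
  LinearEquiv.ofBijective (subMap f hZ hB) <| by
    refine ⟨(injective_iff_map_eq_zero _).2 fun x hx => ?_, fun y => ?_⟩
    · obtain ⟨z, hz, rfl⟩ := exists_cls x
      rw [subMap_cls, cls_eq_zero] at hx
      exact (cls_eq_zero hz).2 (hi z hz hx)
    · obtain ⟨y, hy, rfl⟩ := exists_cls y
      obtain ⟨z, hz, h⟩ := hs y hy
      exact ⟨cls z hz, (cls_eq_cls (hZ z hz) hy).2 h⟩

theorem subEquiv_induces {Z B : Submodule k V} {Z' B' : Submodule k W} (f : V →ₗ[k] W)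
    (hZ : ∀ z ∈ Z, f z ∈ Z') (hB : ∀ z ∈ Z, z ∈ B → f z ∈ B') (hi : ∀ z ∈ Z, f z ∈ B' → z ∈ B)
    (hs : ∀ y ∈ Z', ∃ z ∈ Z, f z - y ∈ B') : Induces (subEquiv f hZ hB hi hs).toLinearMap f :=
  fun z hz => ⟨hZ z hz, rfl⟩

variable {V' : Type*} [AddCommGroup V'] [Module k V']

/-- The bilinear map induced by a bilinear map. -/
def subMap₂ {Z B : Submodule k V} {Z₂ B₂ : Submodule k V'} {Z' B' : Submodule k W}
    (f : V →ₗ[k] V' →ₗ[k] W) (hZ : ∀ x ∈ Z, ∀ y ∈ Z₂, f x y ∈ Z')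
    (hl : ∀ x ∈ Z, x ∈ B → ∀ y ∈ Z₂, f x y ∈ B')
    (hr : ∀ x ∈ Z, ∀ y ∈ Z₂, y ∈ B₂ → f x y ∈ B') :
    Subquot Z B →ₗ[k] Subquot Z₂ B₂ →ₗ[k] Subquot Z' B' :=
  Submodule.liftQ (B.submoduleOf Z)
    { toFun := fun x => subMap (f x.1) (hZ x.1 x.2) (hr x.1 x.2)
      map_add' := fun x x' => LinearMap.ext fun y => by
        obtain ⟨y, hy, rfl⟩ := exists_cls y
        refine (cls_eq_cls _ (add_mem (hZ _ x.2 _ hy) (hZ _ x'.2 _ hy))).2 ?_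
        simp
      map_smul' := fun c x => LinearMap.ext fun y => by
        obtain ⟨y, hy, rfl⟩ := exists_cls y
        refine (cls_eq_cls _ (Submodule.smul_mem _ c (hZ _ x.2 _ hy))).2 ?_
        simp }
    fun x hx => LinearMap.mem_ker.2 <| LinearMap.ext fun y => by
      obtain ⟨y, hy, rfl⟩ := exists_cls y
      exact (cls_eq_zero _).2 (hl x.1 x.2 hx y hy)

theorem subMap₂_induces {Z B : Submodule k V} {Z₂ B₂ : Submodule k V'} {Z' B' : Submodule k W}
    (f : V →ₗ[k] V' →ₗ[k] W) (hZ : ∀ x ∈ Z, ∀ y ∈ Z₂, f x y ∈ Z')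
    (hl : ∀ x ∈ Z, x ∈ B → ∀ y ∈ Z₂, f x y ∈ B')
    (hr : ∀ x ∈ Z, ∀ y ∈ Z₂, y ∈ B₂ → f x y ∈ B') :
    Induces₂ (subMap₂ f hZ hl hr : Subquot Z B →ₗ[k] Subquot Z₂ B₂ →ₗ[k] Subquot Z' B')
      fun x y => f x y := fun x hx y hy => ⟨hZ x hx y hy, rfl⟩

end SubquotApi

/-! ### The bracket on Ext groups and its compatibility with θ -/

section BracketExt

variable {k : Type u} {A : Type v} [Field k] [Ring A] [Algebra k A] {m n p q L N : ℕ}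

/-- The bracket as a bilinear map. -/
def bracketL (hL : m + n + 1 = L) (hN : p + q + 1 = N) :
    Cochain k A (m + 1) p →ₗ[k] Cochain k A (n + 1) q →ₗ[k] Cochain k A L N :=
  have hb1 : ∀ {m n p q : ℕ} (hL : m + n + 1 = L) (hN : p + q + 1 = N)
      (f f' : Cochain k A (m + 1) p) (g : Cochain k A (n + 1) q),
      bullet hL hN (f + f') g = bullet hL hN f g + bullet hL hN f' g := by
    intro m n p q hL hN f f' g
    simp only [bullet_eq, bulletPos, bulletNeg, extR, mid, piB, LinearMap.comp_add,
      LinearMap.add_comp, LinearMap.rTensor_add, LinearMap.lTensor_add, smul_add,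
      Finset.sum_add_distrib]
    abel
  have hb2 : ∀ {m n p q : ℕ} (hL : m + n + 1 = L) (hN : p + q + 1 = N)
      (f : Cochain k A (m + 1) p) (g g' : Cochain k A (n + 1) q),
      bullet hL hN f (g + g') = bullet hL hN f g + bullet hL hN f g' := by
    intro m n p q hL hN f g g'
    simp only [bullet_eq, bulletPos, bulletNeg, extR, mid, piB, LinearMap.comp_add,
      LinearMap.add_comp, LinearMap.rTensor_add, LinearMap.lTensor_add, smul_add,
      Finset.sum_add_distrib]
    abel
  have hs1 : ∀ {m n p q : ℕ} (hL : m + n + 1 = L) (hN : p + q + 1 = N)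
      (c : k) (f : Cochain k A (m + 1) p) (g : Cochain k A (n + 1) q),
      bullet hL hN (c • f) g = c • bullet hL hN f g := by
    intro m n p q hL hN c f g
    simp only [bullet_eq, bulletPos, bulletNeg, extR, mid, piB, LinearMap.comp_smul,
      LinearMap.smul_comp, LinearMap.rTensor_smul, LinearMap.lTensor_smul, smul_add,
      Finset.smul_sum, smul_comm c]
  have hs2 : ∀ {m n p q : ℕ} (hL : m + n + 1 = L) (hN : p + q + 1 = N)
      (c : k) (f : Cochain k A (m + 1) p) (g : Cochain k A (n + 1) q),
      bullet hL hN f (c • g) = c • bullet hL hN f g := by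
    intro m n p q hL hN c f g
    simp only [bullet_eq, bulletPos, bulletNeg, extR, mid, piB, LinearMap.comp_smul,
      LinearMap.smul_comp, LinearMap.rTensor_smul, LinearMap.lTensor_smul, smul_add,
      Finset.smul_sum, smul_comm c]
  LinearMap.mk₂ k (fun f g => bracketSg hL hN f g)
    (fun f f' g => by simp only [bracketSg_eq, hb1, hb2]; module)
    (fun c f g => by simp only [bracketSg_eq, hs1, hs2]; module)
    (fun f g g' => by simp only [bracketSg_eq, hb1, hb2]; module)
    (fun c f g => by simp only [bracketSg_eq, hs1, hs2]; module)

theorem bracketL_apply (hL : m + n + 1 = L) (hN : p + q + 1 = N) (f : Cochain k A (m + 1) p)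
    (g : Cochain k A (n + 1) q) : bracketL hL hN f g = bracketSg hL hN f g := rfl

theorem bracketSg_swap (hL : m + n + 1 = L) (hN : p + q + 1 = N) (f : Cochain k A (m + 1) p)
    (g : Cochain k A (n + 1) q) : bracketSg hL hN f g =
      (-(-1 : k) ^ ((p + (m + 1)) * (q + (n + 1)))) •
        bracketSg (show n + m + 1 = L by omega) (show q + p + 1 = N by omega) g f := by
  rw [bracketSg_eq, bracketSg_eq, mul_comm (q + (n + 1)), smul_add, smul_smul, neg_mul_neg,
    neg_one_pow_mul_self, one_smul, add_comm]

theorem bracketSg_mem_extZ (hL : m + n + 1 = L) (hN : p + q + 1 = N)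
    {f : Cochain k A (m + 1) p} {g : Cochain k A (n + 1) q} (hf : f ∈ extZ k A (m + 1) p)
    (hg : g ∈ extZ k A (n + 1) q) : bracketSg hL hN f g ∈ extZ k A L N := by
  refine ⟨bracketSg_mem hL hN f g, LinearMap.mem_ker.2 ?_⟩
  rw [delta_bracketSg hL hN hf.1 hg.1, LinearMap.mem_ker.1 hf.2, LinearMap.mem_ker.1 hg.2,
    ← bracketL_apply, ← bracketL_apply, map_zero, map_zero, LinearMap.zero_apply, smul_zero,
    add_zero]

/-- The cochain with `π^{(r)} ∘ susp f = π^{(r)} f ⊗ id`. -/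
def susp (f : Cochain k A m p) : Cochain k A (m + 1) (p + 1) :=
  (-1 : k) ^ p • (d k A (p + 1) ∘ₗ close k A (p + 2) ∘ₗ extR (piR p ∘ₗ f) 1 rfl rfl)

theorem theta_eq_susp (f : Cochain k A m p) : theta m p f = (-1 : k) ^ (m + p) • susp f := by
  rw [theta, susp, smul_smul, pow_add, mul_assoc, neg_one_pow_mul_self, mul_one]

theorem piR_comp_susp (f : Cochain k A m p) :
    piR (p + 1) ∘ₗ susp f = extR (piR p ∘ₗ f) 1 rfl rfl :=
  LinearMap.ext fun w => by
    simp only [susp, LinearMap.comp_apply, LinearMap.smul_apply, map_smul]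
    rw [piR_d_close, smul_smul, ← pow_add, neg_one_pow_eq_of (b := 0) (c := p + 1) (by ring),
      pow_zero, one_smul]

theorem susp_mem (f : Cochain k A m p) : susp f ∈ omegaCochains k A (m + 1) (p + 1) :=
  Submodule.smul_mem _ _ (d_comp_mem _)

/-- The π^{(r)}-part of `susp` f is that of f tensored with an identity on one letter, so
`brOp_extR` compares the two brackets. -/
theorem bracketSg_susp (hL : m + n + 1 = L) (hN : p + q + 1 = N) (f : Cochain k A (m + 1) p)
    (g : Cochain k A (n + 1) q) :
    bracketSg (show m + 1 + n + 1 = L + 1 by omega) (show p + 1 + q + 1 = N + 1 by omega)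
      (susp f) g = susp (bracketSg hL hN f g) := by
  refine omegaCochains_ext (bracketSg_mem _ _ _ _) (susp_mem _) fun w => ?_
  have h1 : brC (susp f) g = brOp ((-1 : k) ^ (p + (m + 1))) (extR (piR p ∘ₗ f) 1 rfl rfl)
      ((-1 : k) ^ (q + (n + 1))) (piR q ∘ₗ g) ((-1 : k) ^ ((p + (m + 1)) * (q + (n + 1)))) := by
    rw [brC, piR_comp_susp, neg_one_pow_eq_of (a := p + 1 + (m + 1 + 1)) (b := p + (m + 1)) (c := 1)
      (by ring), neg_one_pow_eq_of (a := (p + 1 + (m + 1 + 1)) * (q + (n + 1)))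
      (b := (p + (m + 1)) * (q + (n + 1))) (c := q + (n + 1)) (by ring)]
  have h2 : ((-1 : k) ^ (q + (n + 1))) ^ (m + 1) = (-1) ^ ((p + (m + 1)) * (q + (n + 1))) *
      ((-1) ^ (q + (n + 1)) * ((-1) ^ (q + (n + 1))) ^ (p + 1)) := by
    rw [← pow_mul, ← pow_mul, ← pow_add, ← pow_add]
    exact (neg_one_pow_eq_of (c := (q + (n + 1)) * (p + 1)) (by ring)).symm
  rw [embW_piR_bracketSg, ← LinearMap.comp_apply (piR (N + 1)), piR_comp_susp, embW_extR, h1]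
  induction w using snoc_induction with
  | h0 => simp
  | hadd x y hx hy => simp only [map_add, LinearMap.add_apply, hx, hy]
  | hc w c =>
    rw [toWord_snoc, brOp_extR h2 hL, opM_jt, LinearMap.comp_apply, embW_piR_bracketSg, brC]

theorem bracketSg_theta (hL : m + n + 1 = L) (hN : p + q + 1 = N) (f : Cochain k A (m + 1) p)
    (g : Cochain k A (n + 1) q) :
    bracketSg (show m + 1 + n + 1 = L + 1 by omega) (show p + 1 + q + 1 = N + 1 by omega)
      (theta (m + 1) p f) g = (-1 : k) ^ (q + (n + 1)) • theta L N (bracketSg hL hN f g) := by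
  rw [theta_eq_susp, theta_eq_susp, ← bracketL_apply, map_smul, LinearMap.smul_apply,
    bracketL_apply, bracketSg_susp hL hN, smul_smul, ← pow_add]
  congr 1
  exact (neg_one_pow_eq_of (c := q + (n + 1)) (by omega)).symm

variable [FiniteDimensional k A] (F : FrobeniusForm k A)

include F

/-- In degree at least two, f = δh and the Leibniz rule applies to h. In degree one h has degree
zero and no bracket with it is defined; f is then replaced by θ(f), and injectivity of θ in positive
degrees leads back. -/
theorem bracketSg_mem_extB_left (hL : m + n + 1 = L) (hN : p + q + 1 = N)
    {f : Cochain k A (m + 1) p} {g : Cochain k A (n + 1) q} (hf : f ∈ extB k A (m + 1) p)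
    (hg : g ∈ extZ k A (n + 1) q) : bracketSg hL hN f g ∈ extB k A L N := by
  have key : ∀ {m p L N : ℕ} (hL : m + 1 + n + 1 = L) (hN : p + q + 1 = N)
      {f : Cochain k A (m + 2) p} (_ : f ∈ extB k A (m + 2) p),
      bracketSg hL hN f g ∈ extB k A L N := by
    intro m p L N hL hN f hf
    obtain ⟨L, rfl⟩ : ∃ L', L = L' + 1 := ⟨m + n + 1, by omega⟩
    obtain ⟨h, hh, rfl⟩ := hf
    refine ⟨(-1 : k) ^ (q + (n + 1)) • bracketSg (show m + n + 1 = L by omega) hN h g,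
      Submodule.smul_mem _ _ (bracketSg_mem _ _ _ _), ?_⟩
    rw [map_smul, delta_bracketSg _ hN hh hg.1, LinearMap.mem_ker.1 hg.2, ← bracketL_apply, map_zero,
      zero_add, smul_smul, neg_one_pow_mul_self, one_smul]
  cases m with
  | succ m => exact key hL hN hf
  | zero =>
    obtain ⟨L, rfl⟩ : ∃ L', L = L' + 1 := ⟨n, by omega⟩
    refine mem_extB_of_theta_mem_extB F (bracketSg_mem_extZ hL hN (extB_le_extZ hf) hg) ?_
    have h := key (show 0 + 1 + n + 1 = L + 1 + 1 by omega) (show p + 1 + q + 1 = N + 1 by omega)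
      (theta_mem_extB hf)
    rw [bracketSg_theta hL hN] at h
    have h2 := Submodule.smul_mem _ ((-1 : k) ^ (q + (n + 1))) h
    rwa [smul_smul, neg_one_pow_mul_self, one_smul] at h2

theorem bracketSg_mem_extB_right (hL : m + n + 1 = L) (hN : p + q + 1 = N)
    {f : Cochain k A (m + 1) p} {g : Cochain k A (n + 1) q} (hf : f ∈ extZ k A (m + 1) p)
    (hg : g ∈ extB k A (n + 1) q) : bracketSg hL hN f g ∈ extB k A L N := by
  rw [bracketSg_swap]
  exact Submodule.smul_mem _ _ (bracketSg_mem_extB_left F _ _ hg hf)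

end BracketExt

/-! ### The isomorphism κ -/

section Kappa

variable {k : Type u} {A : Type v} [Field k] [Ring A] [Algebra k A]

/-- The connecting homomorphism on cochains, as a linear map. -/
def thetaL (l p : ℕ) : Cochain k A l p →ₗ[k] Cochain k A (l + 1) (p + 1) where
  toFun := theta l p
  map_add' f g := by
    simp only [theta, extR, LinearMap.comp_add, LinearMap.add_comp, LinearMap.rTensor_add, smul_add]
  map_smul' c f := by
    simp only [theta, extR, LinearMap.comp_smul, LinearMap.smul_comp, LinearMap.rTensor_smul,
      smul_comm c, RingHom.id_apply]

theorem thetaL_apply {l p : ℕ} (f : Cochain k A l p) : thetaL l p f = theta l p f := rfl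

/-- The `0`-cochain with a given value. -/
def constC (p : ℕ) : Bar k A p →ₗ[k] Cochain k A 0 p :=
  LinearMap.smulRightₗ (R := k) (PiTensorProduct.isEmptyEquiv (Fin 0)).toLinearMap

theorem constC_emptyWord {p : ℕ} (m : Bar k A p) : constC p m emptyWord = m := by
  simp [constC, emptyWord]

theorem eq_constC {p : ℕ} (f : Cochain k A 0 p) : f = constC p (f emptyWord) :=
  LinearMap.ext fun w => by
    obtain ⟨c, rfl⟩ := exists_smul_emptyWord w
    rw [map_smul, map_smul, constC_emptyWord]

theorem constC_mem_omegaCochains {p : ℕ} {m : Bar k A p} :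
    constC p m ∈ omegaCochains k A 0 p ↔ m ∈ Omega k A p := by
  refine ⟨fun h => constC_emptyWord m ▸ h emptyWord, fun h w => ?_⟩
  obtain ⟨c, rfl⟩ := exists_smul_emptyWord w
  rw [map_smul, constC_emptyWord]
  exact Submodule.smul_mem _ c h

theorem cons_emptyWord (c : ABar k A) :
    cons 0 (c ⊗ₜ emptyWord) = snoc 0 ((emptyWord : TP k A 0) ⊗ₜ c) :=
  toWord_injective (by rw [toWord_cons, toWord_snoc, toWord_emptyWord, mul_one, one_mul])

theorem snoc_emptyWord (c : ABar k A) : snoc 0 ((emptyWord : TP k A 0) ⊗ₜ c) = letter c :=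
  toWord_injective (by rw [toWord_snoc, toWord_emptyWord, one_mul, toWord_letter])

theorem delta_constC_snoc {p : ℕ} (m : Bar k A p) (c : ABar k A) :
    delta k A 0 p (constC p m) (snoc 0 (emptyWord ⊗ₜ c)) =
      lmul (sec k A c) m - rmul (sec k A c) m := by
  rw [delta_apply, deltaLast_snoc, ← cons_emptyWord, deltaFirst_cons, inner_zero,
    LinearMap.zero_apply, map_zero, constC_emptyWord]
  module

theorem delta_constC_eq_zero {p : ℕ} {m : Bar k A p} :
    delta k A 0 p (constC p m) = 0 ↔ ∀ b, lmul b m = rmul b m := by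
  constructor
  · intro h b
    obtain ⟨c, hb⟩ := exists_eq_sec_add (k := k) b
    have h1 := delta_constC_snoc m (proj k A b)
    rw [h, LinearMap.zero_apply] at h1
    have h2 : rmul b m = rmul (sec k A (proj k A b)) m + c • m := by
      conv_lhs => rw [hb]
      clear h h1
      induction m using bar_induction with
      | h0 => simp
      | hadd x y hx hy => rw [map_add, map_add, hx, hy]; module
      | hc a w b' =>
        rw [rmul_tmul, rmul_tmul, rmulTail_tmul, rmulTail_tmul, mul_add, mul_smul_comm, mul_one,
          TensorProduct.tmul_add, TensorProduct.tmul_add, TensorProduct.tmul_smul,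
          TensorProduct.tmul_smul]
    rw [h2, ← sub_eq_zero.1 h1.symm]
    conv_lhs => rw [hb, lmul_add, lmul_smul, lmul_one]
  · intro h
    refine LinearMap.ext fun w => ?_
    obtain ⟨c, rfl⟩ := letter.surjective w
    rw [← snoc_emptyWord, delta_constC_snoc, h, sub_self, LinearMap.zero_apply]

theorem extR_constC {p : ℕ} (G : TP k A 0 →ₗ[k] A ⊗[k] TP k A p) :
    extR G 1 rfl rfl = appendR rfl (G emptyWord) :=
  LinearMap.ext fun w => by
    obtain ⟨c, rfl⟩ := letter.surjective w
    rw [← snoc_emptyWord, extR_snoc]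
    generalize G emptyWord = y
    induction y using TensorProduct.induction_on with
    | zero => simp [appendR]
    | add x y hx hy =>
      rw [map_add, hx, hy]
      simp only [appendR, map_add, LinearMap.comp_apply, LinearMap.add_apply]
    | tmul a v =>
      rw [snoc_emptyWord]
      simp only [appendR, LinearMap.comp_apply, TensorProduct.mk_apply, LinearEquiv.coe_coe,
        TensorProduct.assoc_tmul, LinearMap.lTensor_tmul, LinearMap.flip_apply]
      congr 1

variable [FiniteDimensional k A] (F : FrobeniusForm k A) (ν : A ≃ₐ[k] A)

/-- A chain gives an invariant of Bar_r(A) via the Casimir element, viewed as a 0-cochain; the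
formula for κ is the connecting homomorphism applied to it. -/
theorem kappa_eq_theta {r : ℕ} (x : Chain k A r) :
    kappa F ν r 1 x = theta 0 r (constC r (gam F ν r x)) := by
  rw [theta, extR_constC, LinearMap.comp_apply, constC_emptyWord, piR_gam, pow_zero, one_smul, kappa]

variable {ν} (hν : IsNakayama F ν)

include hν

theorem constC_gam_mem_extZ {r : ℕ} {x : Chain k A r} (hx : x ∈ hatZ F ν r) :
    constC r (gam F ν r x) ∈ extZ k A 0 r :=
  mem_extZ.2 ⟨constC_mem_omegaCochains.2 ((gam_mem_Omega_iff F hν x).2 hx),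
    delta_constC_eq_zero.2 fun b => lmul_gam F ν b x⟩

theorem constC_comp_d {r : ℕ} (y : Chain k A (r + 1)) :
    d k A r ∘ₗ constC (r + 1) (gam F ν (r + 1) y) = constC r (gam F ν r (bd ν.symm r y)) := by
  rw [eq_constC (d k A r ∘ₗ _), LinearMap.comp_apply, constC_emptyWord, d_gam F hν]

/-- The isomorphism `κ`. -/
def kappaEquiv (r : ℕ) : HatHH F ν r ≃ₗ[k] ExtOmega k A 1 (r + 1) :=
  subEquiv (thetaL 0 r ∘ₗ constC r ∘ₗ gam F ν r)
    (fun x hx => theta_mem_extZ (constC_gam_mem_extZ F hν hx))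
    (fun x hx hB => by
      obtain ⟨y, rfl⟩ := hB
      -- For a boundary the invariant lifts to the invariant of y, whose coboundary is zero, so θ
      -- computed with this lift is zero in Ext.
      have h := theta_sub_delta_mem (constC_gam_mem_extZ F hν hx) (constC_comp_d F hν y)
      rw [delta_constC_eq_zero.2 fun b => lmul_gam F ν b y] at h
      have h0 := sub_zero (theta 0 r (constC r (gam F ν r (bd ν.symm r y))))
      exact Eq.subst (motive := fun y => y ∈ extB k A 1 (r + 1)) h0 h)
    (fun x hx h => by
      -- If θ vanishes, the invariant of x has an invariant lift; the chain corresponding to this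
      -- lift has boundary x.
      obtain ⟨e, he, hde⟩ := exists_of_theta_mem_extB (constC_gam_mem_extZ F hν hx) h
      rw [eq_constC e] at he
      refine ⟨gamInv F ν (r + 1) (e emptyWord), ?_⟩
      rw [← gamInv_gam F ν (bd _ _ _), ← d_gam F hν, gam_gamInv F ν (delta_constC_eq_zero.1 he),
        ← LinearMap.comp_apply (d k A r), hde, constC_emptyWord, gamInv_gam])
    (fun f hf => by
      obtain ⟨g, hg, h⟩ := exists_theta_sub_mem F hf
      rw [eq_constC g] at hg h
      have hi := gam_gamInv F ν (delta_constC_eq_zero.1 (mem_extZ.1 hg).2)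
      refine ⟨gamInv F ν r (g emptyWord), ?_, ?_⟩
      · rw [← gam_mem_Omega_iff F hν, hi]
        exact constC_mem_omegaCochains.1 hg.1
      · rw [LinearMap.comp_apply, LinearMap.comp_apply, hi]
        exact h)

theorem kappaEquiv_induces (r : ℕ) :
    Induces (kappaEquiv F hν r).toLinearMap (kappa F ν r 1) := by
  rw [show kappa F ν r 1 = ⇑(thetaL 0 r ∘ₗ constC r ∘ₗ gam F ν r) from
    funext fun x => kappa_eq_theta F ν x]
  exact subEquiv_induces _ _ _ _ _

end Kappa

/-! ### Extending functionals from cycles to all cochains -/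

section Extension

theorem add_succ_add_succ_succ (r s : ℕ) : r + 1 + (s + 1) + 1 = r + s + 2 + 1 := by ring

variable {k : Type u} [Field k] {V W X : Type*} [AddCommGroup V] [Module k V] [AddCommGroup W]
  [Module k W] [AddCommGroup X] [Module k X]

/-- Over a field a map given on classes of cycles extends to the whole space. The colimit is built
inside the direct sum of all cochains, so functionals on it need values outside the cocycles as
well. -/
theorem exists_extend_cls {Z : Submodule k V} {Z' B' : Submodule k W} (f : V →ₗ[k] W)
    (hZ : ∀ z ∈ Z, f z ∈ Z') (T : Subquot Z' B' →ₗ[k] X) :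
    ∃ Ψ : V →ₗ[k] X, ∀ z (hz : z ∈ Z), Ψ z = T (cls (f z) (hZ z hz)) := by
  obtain ⟨Ψ, h⟩ := LinearMap.exists_extend (T ∘ₗ clsL Z' B' ∘ₗ f.restrict hZ)
  exact ⟨Ψ, fun z hz => LinearMap.congr_fun h ⟨z, hz⟩⟩

omit [AddCommGroup X] [Module k X] [AddCommGroup W] [Module k W] in
theorem sub_mem_symm {B : Submodule k V} {x y : V} (h : x - y ∈ B) : y - x ∈ B :=
  neg_sub x y ▸ neg_mem h

omit [AddCommGroup X] [Module k X] [AddCommGroup W] [Module k W] in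
theorem sub_mem_trans {B : Submodule k V} {x y z : V} (h : x - y ∈ B) (h' : y - z ∈ B) :
    x - z ∈ B :=
  sub_add_sub_cancel x y z ▸ add_mem h h'

omit [AddCommGroup X] [Module k X] [AddCommGroup W] [Module k W] in
theorem sub_mem_of_smul {B : Submodule k V} {x y x' y' : V} {c : k} (h : x - y ∈ B)
    (hx : x' = c • x) (hy : y' = c • y) : x' - y' ∈ B := by
  rw [hx, hy, ← smul_sub]
  exact Submodule.smul_mem _ _ h

theorem exists_directSum_lift {C : ℕ → Type*} [∀ l, AddCommMonoid (C l)] [∀ l, Module k (C l)]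
    (Ψ : ∀ l, C l →ₗ[k] X) :
    ∃ T : DirectSum ℕ C →ₗ[k] X, ∀ l f, T (DirectSum.lof k ℕ C l f) = Ψ l f :=
  ⟨DirectSum.toModule k ℕ _ Ψ, fun l f => DirectSum.toModule_lof k l f⟩

end Extension

/-! ### The colimit, and its bracket at all positive levels -/

section TateColimit

variable {k : Type u} {A : Type v} [Field k] [Ring A] [Algebra k A]

theorem inc_mem_tateZ {r l : ℕ} {f : Cochain k A l (r + l)} (hf : f ∈ extZ k A l (r + l)) :
    inc r l f ∈ tateZ k A r :=
  Submodule.mem_iSup_of_mem l ⟨f, hf, rfl⟩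

theorem inc_mem_tateB {r l : ℕ} {f : Cochain k A l (r + l)} (hf : f ∈ extB k A l (r + l)) :
    inc r l f ∈ tateB k A r :=
  Submodule.mem_sup_left (Submodule.mem_iSup_of_mem l ⟨f, hf, rfl⟩)

theorem inc_sub_inc_phi_mem {r l : ℕ} {f : Cochain k A l (r + l)} (hf : f ∈ extZ k A l (r + l)) :
    inc r l f - inc r (l + 1) (phi r l f) ∈ tateB k A r :=
  Submodule.mem_sup_right (Submodule.subset_span ⟨l, f, hf, rfl⟩)

theorem inc_sub_inc_mem {r l : ℕ} {f g : Cochain k A l (r + l)}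
    (h : f - g ∈ extB k A l (r + l)) : inc r l f - inc r l g ∈ tateB k A r := by
  rw [← map_sub (inc r l) f g]
  exact inc_mem_tateB h

/-- The transition map `φ`, as a linear map. -/
def phiL (r l : ℕ) : Cochain k A l (r + l) →ₗ[k] Cochain k A (l + 1) (r + (l + 1)) :=
  (if l = 0 then 1 else (-1 : k) ^ (r + 1)) • thetaL l (r + l)

theorem phiL_apply {r l : ℕ} (f : Cochain k A l (r + l)) : phiL r l f = phi r l f := rfl

theorem phi_succ {r l : ℕ} (f : Cochain k A (l + 1) (r + (l + 1))) :
    phi r (l + 1) f = (-1 : k) ^ (r + 1) • theta (l + 1) (r + (l + 1)) f := rfl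

theorem phi_mem_extZ {r l : ℕ} {f : Cochain k A l (r + l)} (hf : f ∈ extZ k A l (r + l)) :
    phi r l f ∈ extZ k A (l + 1) (r + (l + 1)) :=
  Submodule.smul_mem _ _ (theta_mem_extZ hf)

theorem phi_neg_one_pow_smul {r l : ℕ} (f : Cochain k A (l + 1) (r + (l + 1))) :
    phi r (l + 1) ((-1 : k) ^ (r + 1) • f) = theta (l + 1) (r + (l + 1)) f := by
  rw [phi_succ, ← thetaL_apply, map_smul, smul_smul, neg_one_pow_mul_self, one_smul, thetaL_apply]

theorem theta_smul {l p : ℕ} (c : k) (f : Cochain k A l p) :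
    theta l p (c • f) = c • theta l p f := map_smul (thetaL l p) c f

theorem bracketSg_smul_left {m p n q L N : ℕ} (hL : m + n + 1 = L) (hN : p + q + 1 = N) (c : k)
    (f : Cochain k A (m + 1) p) (g : Cochain k A (n + 1) q) :
    bracketSg hL hN (c • f) g = c • bracketSg hL hN f g := by
  rw [← bracketL_apply, map_smul, LinearMap.smul_apply, bracketL_apply]

theorem bracketSg_add_left {m p n q L N : ℕ} (hL : m + n + 1 = L) (hN : p + q + 1 = N)
    (f f' : Cochain k A (m + 1) p) (g : Cochain k A (n + 1) q) :
    bracketSg hL hN (f + f') g = bracketSg hL hN f g + bracketSg hL hN f' g := by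
  rw [← bracketL_apply, map_add, LinearMap.add_apply, bracketL_apply, bracketL_apply]

theorem inc_sub_inc_mem_of_add {r l : ℕ} {f g : Cochain k A l (r + l)}
    (h : f + (-1 : k) • g ∈ extB k A l (r + l)) : inc r l f - inc r l g ∈ tateB k A r := by
  have h' := inc_mem_tateB h
  rwa [map_add, map_smul, neg_one_smul, ← sub_eq_add_neg] at h'

variable [FiniteDimensional k A] (F : FrobeniusForm k A)

include F

/-- In positive levels the transition maps of the colimit are isomorphisms. -/
def phiEquiv (r l : ℕ) :
    ExtOmega k A (l + 1) (r + (l + 1)) ≃ₗ[k] ExtOmega k A (l + 2) (r + (l + 2)) :=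
  subEquiv (phiL r (l + 1)) (fun f hf => phi_mem_extZ hf)
    (fun f _ hB => Submodule.smul_mem _ _ (theta_mem_extB hB))
    (fun f hf h => by
      refine mem_extB_of_theta_mem_extB F hf ?_
      rw [← phi_neg_one_pow_smul, ← phiL_apply, map_smul]
      exact Submodule.smul_mem _ _ h)
    (fun f hf => by
      obtain ⟨g, hg, h⟩ := exists_theta_sub_mem F hf
      refine ⟨(-1 : k) ^ (r + 1) • g, Submodule.smul_mem _ _ hg, ?_⟩
      rw [phiL_apply, phi_neg_one_pow_smul]
      exact h)

/-- The composition of the inverse transition maps down to level one. -/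
def toLevelOne (r : ℕ) : ∀ l, ExtOmega k A (l + 1) (r + (l + 1)) →ₗ[k] ExtOmega k A 1 (r + 1)
  | 0 => LinearMap.id
  | l + 1 => toLevelOne r l ∘ₗ (phiEquiv F r l).symm.toLinearMap

theorem toLevelOne_phi {r l : ℕ} {f : Cochain k A (l + 1) (r + (l + 1))}
    (hf : f ∈ extZ k A (l + 1) (r + (l + 1))) :
    toLevelOne F r (l + 1) (cls (phi r (l + 1) f) (phi_mem_extZ hf)) =
      toLevelOne F r l (cls f hf) := by
  change toLevelOne F r l ((phiEquiv F r l).symm (phiEquiv F r l (cls f hf))) = _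
  rw [LinearEquiv.symm_apply_apply]

/-- A cochain of level l is first pushed to level l + 1 by φ and then brought down by the inverse
isomorphisms. This also covers level 0, where φ need not be injective. -/
theorem exists_toLevelOne (r l : ℕ) : ∃ Ψ : Cochain k A l (r + l) →ₗ[k] ExtOmega k A 1 (r + 1),
    ∀ f (hf : f ∈ extZ k A l (r + l)),
      Ψ f = toLevelOne F r l (cls (phi r l f) (phi_mem_extZ hf)) := by
  have h₁ := exists_extend_cls (V := Cochain k A l (r + l))
    (W := Cochain k A (l + 1) (r + (l + 1))) (X := ExtOmega k A 1 (r + 1))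
    (Z := extZ k A l (r + l)) (Z' := extZ k A (l + 1) (r + (l + 1)))
    (B' := extB k A (l + 1) (r + (l + 1)))
  have h₂ := h₁ (phiL r l)
  have h₃ : ∀ f ∈ extZ k A l (r + l), phiL r l f ∈ extZ k A (l + 1) (r + (l + 1)) :=
    fun f hf => phi_mem_extZ hf
  have h₄ := h₂ h₃
  have h₅ := h₄ (toLevelOne F r l)
  exact h₅

omit [FiniteDimensional k A] F in
theorem map_sub_eq_zero {r : ℕ} {M : Type*} [AddCommGroup M] [Module k M]
    (T : TateSum k A r →ₗ[k] M) {x y : TateSum k A r} (h : T y = T x) : T (x - y) = 0 := by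
  rw [map_sub T x y, h, sub_self]

omit [FiniteDimensional k A] F in
theorem tateB_le_ker {r : ℕ} {M : Type*} [AddCommGroup M] [Module k M]
    (T : TateSum k A r →ₗ[k] M) (hB : ∀ l, ∀ f ∈ extB k A l (r + l), T (inc r l f) = 0)
    (hphi : ∀ l, ∀ f ∈ extZ k A l (r + l), T (inc r (l + 1) (phi r l f)) = T (inc r l f)) :
    tateB k A r ≤ LinearMap.ker T := by
  unfold tateB
  refine sup_le (iSup_le fun l => ?_) (Submodule.span_le.2 ?_)
  · rintro _ ⟨f, hf, rfl⟩
    exact hB l f hf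
  · rintro _ ⟨l, f, hf, rfl⟩
    exact map_sub_eq_zero T (hphi l f hf)

theorem exists_tate_functional (r : ℕ) : ∃ T : TateSum k A r →ₗ[k] ExtOmega k A 1 (r + 1),
    ∀ l f (hf : f ∈ extZ k A l (r + l)),
      T (inc r l f) = toLevelOne F r l (cls (phi r l f) (phi_mem_extZ hf)) := by
  have h := exists_directSum_lift (k := k) (X := ExtOmega k A 1 (r + 1))
    (C := fun l => Cochain k A l (r + l))
  have h' := h fun l => (exists_toLevelOne F r l).choose
  obtain ⟨T, hT⟩ := h'
  exact ⟨T, fun l f hf => (hT l f).trans ((exists_toLevelOne F r l).choose_spec f hf)⟩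

theorem toLevelOne_injective (r l : ℕ) : Function.Injective (toLevelOne F r l) := by
  induction l with
  | zero => exact Function.injective_id
  | succ l ih => exact ih.comp (phiEquiv F r l).symm.injective

/-- The functional obtained from descent to level one kills all relations of the colimit and is
injective on the classes of any fixed positive level. -/
theorem mem_extB_of_inc_mem {r l : ℕ} {f : Cochain k A (l + 1) (r + (l + 1))}
    (hf : f ∈ extZ k A (l + 1) (r + (l + 1))) (h : inc r (l + 1) f ∈ tateB k A r) :
    f ∈ extB k A (l + 1) (r + (l + 1)) := by
  obtain ⟨T, hT⟩ := exists_tate_functional F r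
  have hB : ∀ l, ∀ f ∈ extB k A l (r + l), T (inc r l f) = 0 := by
    intro l f hf
    rw [hT l f (extB_le_extZ hf), (cls_eq_zero _).2, map_zero]
    exact Submodule.smul_mem _ _ (theta_mem_extB hf)
  have hphi : ∀ l, ∀ f ∈ extZ k A l (r + l), T (inc r (l + 1) (phi r l f)) = T (inc r l f) := by
    intro l f hf
    rw [hT l f hf, hT _ _ (phi_mem_extZ hf), toLevelOne_phi]
  have h₁ := tateB_le_ker T hB hphi h
  rw [LinearMap.mem_ker, hT (l + 1) f hf, toLevelOne_phi F hf,
    (injective_iff_map_eq_zero' _).1 (toLevelOne_injective F r l)] at h₁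
  exact (cls_eq_zero hf).1 h₁

-- The degree relation gives ρ + 1 + (r + 1) ≡ q + n + 1 modulo 2, so the signs in φ on both sides
-- absorb the sign with which the bracket commutes with θ.
omit [FiniteDimensional k A] F in
theorem bracketSg_theta_eq_phi {r l n q ρ : ℕ} (hL : l + 1 + n + 1 = l + n + 1 + 1)
    (hN : r + (l + 2) + q + 1 = ρ + (l + n + 1 + 1)) (hN' : r + (l + 1) + q + 1 = ρ + (l + n + 1))
    (f : Cochain k A (l + 1) (r + (l + 1))) (g : Cochain k A (n + 1) q) :
    bracketSg hL hN (theta (l + 1) (r + (l + 1)) f) g =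
      phi ρ (l + n + 1) (bracketSg rfl hN' ((-1 : k) ^ (r + 1) • f) g) := by
  have h := bracketSg_theta (rfl : l + n + 1 = l + n + 1) hN' f g
  rw [phi_succ, bracketSg_smul_left, theta_smul, smul_smul, ← pow_add]
  refine h.trans ?_
  congr 1
  exact (neg_one_pow_eq_of (c := r + 1) (by omega)).symm.trans
    (neg_one_pow_eq_of (a := ρ + 1 + (r + 1) + 2 * n) (c := n) rfl)

/-- Descent by one level at a time: θ is surjective, so f is θ of a cocycle up to a coboundary, and
the bracket respects both coboundaries and φ. The statement on brackets is carried along because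
representatives of classes in the colimit must be changed inside the bracket. -/
theorem exists_level_one {r l : ℕ} {f : Cochain k A (l + 1) (r + (l + 1))}
    (hf : f ∈ extZ k A (l + 1) (r + (l + 1))) :
    ∃ f₁ ∈ extZ k A 1 (r + 1), inc r (l + 1) f - inc r 1 f₁ ∈ tateB k A r ∧
      ∀ {n q ρ L L₁ : ℕ} (hL : l + n + 1 = L) (hL₁ : 0 + n + 1 = L₁)
        (hN : r + (l + 1) + q + 1 = ρ + L) (hN₁ : r + 1 + q + 1 = ρ + L₁)
        {g : Cochain k A (n + 1) q} (_ : g ∈ extZ k A (n + 1) q),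
        inc ρ L (bracketSg hL hN f g) - inc ρ L₁ (bracketSg hL₁ hN₁ f₁ g) ∈ tateB k A ρ := by
  induction l with
  | zero =>
    refine ⟨f, hf, ?_, ?_⟩
    · rw [sub_self]; exact zero_mem _
    · intro n q ρ L L₁ hL hL₁ hN hN₁ g hg
      obtain rfl : L = L₁ := by omega
      rw [sub_self]; exact zero_mem _
  | succ l ih =>
    obtain ⟨g', hg', h⟩ := exists_theta_sub_mem F (p := r + (l + 1)) hf
    obtain ⟨f₁, hf₁, h₁, h₂⟩ := ih (Submodule.smul_mem _ ((-1 : k) ^ (r + 1)) hg')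
    have hf' := Submodule.smul_mem _ ((-1 : k) ^ (r + 1)) hg'
    have hB := sub_mem_symm (inc_sub_inc_mem h)
    refine ⟨f₁, hf₁, ?_, ?_⟩
    · refine sub_mem_trans hB (sub_mem_trans (sub_mem_symm ?_) h₁)
      rw [← phi_neg_one_pow_smul]
      exact inc_sub_inc_phi_mem hf'
    · intro n q ρ L L₁ hL hL₁ hN hN₁ g hg
      obtain rfl : L = l + n + 1 + 1 := by omega
      have hN' : r + (l + 1) + q + 1 = ρ + (l + n + 1) := by omega
      have h' : theta (l + 1) (r + (l + 1)) g' + (-1 : k) • f ∈ extB k A (l + 2) (r + (l + 2)) := by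
        rwa [show theta (l + 1) (r + (l + 1)) g' + (-1 : k) • f =
          theta (l + 1) (r + (l + 1)) g' - f by module]
      have h₃ := bracketSg_mem_extB_left F hL hN h' hg
      rw [bracketSg_add_left, bracketSg_smul_left] at h₃
      have h₅ := h₂ rfl hL₁ hN' hN₁ hg
      refine sub_mem_trans (sub_mem_symm (inc_sub_inc_mem_of_add h₃)) (sub_mem_trans (sub_mem_symm ?_) h₅)
      rw [bracketSg_theta_eq_phi hL hN hN']
      exact inc_sub_inc_phi_mem (bracketSg_mem_extZ rfl hN' hf' hg)

theorem tateZ_le {r : ℕ} : tateZ k A r ≤ (extZ k A 1 (r + 1)).map (inc r 1) ⊔ tateB k A r := by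
  unfold tateZ
  refine iSup_le fun l => ?_
  rintro _ ⟨f, hf, rfl⟩
  cases l with
  | zero =>
    exact Submodule.mem_sup.2 ⟨_, ⟨_, phi_mem_extZ hf, rfl⟩, _, inc_sub_inc_phi_mem hf,
      add_sub_cancel _ _⟩
  | succ l =>
    obtain ⟨f₁, hf₁, h, -⟩ := exists_level_one F hf
    exact Submodule.mem_sup.2 ⟨_, ⟨_, hf₁, rfl⟩, _, h, add_sub_cancel _ _⟩

/-- The canonical isomorphism from level one to the colimit. -/
def iotaEquiv (r : ℕ) : ExtOmega k A 1 (r + 1) ≃ₗ[k] Tate k A r :=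
  subEquiv (inc r 1) (fun _ hf => inc_mem_tateZ hf) (fun _ _ hB => inc_mem_tateB hB)
    (fun f hf h => mem_extB_of_inc_mem F (l := 0) hf h) (fun y hy => by
      obtain ⟨_, ⟨f, hf, rfl⟩, b, hb, rfl⟩ := Submodule.mem_sup.1 (tateZ_le F hy)
      exact ⟨f, hf, sub_mem_symm ((add_sub_cancel_left (inc r 1 f) b).symm ▸ hb)⟩)

theorem iotaEquiv_induces (r : ℕ) : Induces (iotaEquiv F r).toLinearMap (inc r 1) :=
  subEquiv_induces _ _ _ _ _

/-- The bracket on the groups `Ext¹`. -/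
def sgBracket (r s : ℕ) : ExtOmega k A 1 (r + 1) →ₗ[k] ExtOmega k A 1 (s + 1) →ₗ[k]
    ExtOmega k A 1 (r + s + 2 + 1) :=
  subMap₂ (bracketL (m := 0) (n := 0) (p := r + 1) (q := s + 1) rfl (add_succ_add_succ_succ r s))
    (fun _ hx _ hy => bracketSg_mem_extZ _ _ hx hy)
    (fun _ _ hB _ hy => bracketSg_mem_extB_left F _ _ hB hy)
    (fun _ hx _ _ hB => bracketSg_mem_extB_right F _ _ hx hB)

theorem sgBracket_induces (r s : ℕ) : Induces₂ (sgBracket F r s)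
    (bracketSg (m := 0) (n := 0) (p := r + 1) (q := s + 1) rfl (add_succ_add_succ_succ r s)) :=
  subMap₂_induces _ _ _ _

/-- The bracket on the colimits. -/
def tateBracket (r s : ℕ) : Tate k A r →ₗ[k] Tate k A s →ₗ[k] Tate k A (r + s + 2) :=
  ((sgBracket F r s).compl₁₂ (iotaEquiv F r).symm.toLinearMap
    (iotaEquiv F s).symm.toLinearMap).compr₂ (iotaEquiv F (r + s + 2)).toLinearMap

theorem tateBracket_iota (r s : ℕ) (x : ExtOmega k A 1 (r + 1)) (y : ExtOmega k A 1 (s + 1)) :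
    iotaEquiv F (r + s + 2) (sgBracket F r s x y) =
      tateBracket F r s (iotaEquiv F r x) (iotaEquiv F s y) := by
  simp only [tateBracket, LinearMap.compr₂_apply, LinearMap.compl₁₂_apply, LinearEquiv.coe_coe,
    LinearEquiv.symm_apply_apply]

/-- The bracket on the colimit is transported from level one; here it is matched with the cochain
formula at arbitrary positive levels. The first argument descends by `exists_level_one`, the second
by the same result after graded antisymmetry is used twice. -/
theorem tateBracket_cls {r s l l' : ℕ} {f : Cochain k A (l + 1) (r + (l + 1))}
    {g : Cochain k A (l' + 1) (s + (l' + 1))} (hf : f ∈ extZ k A (l + 1) (r + (l + 1)))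
    (hg : g ∈ extZ k A (l' + 1) (s + (l' + 1)))
    (hN : r + (l + 1) + (s + (l' + 1)) + 1 = r + s + 2 + (l + l' + 1)) :
    tateBracket F r s (cls _ (inc_mem_tateZ hf)) (cls _ (inc_mem_tateZ hg)) =
      cls (inc (r + s + 2) (l + l' + 1) (bracketSg rfl hN f g))
        (inc_mem_tateZ (bracketSg_mem_extZ rfl hN hf hg)) := by
  obtain ⟨f₁, hf₁, h₁, h₂⟩ := exists_level_one F hf
  obtain ⟨g₁, hg₁, h₃, h₄⟩ := exists_level_one F hg
  have e₁ : (cls _ (inc_mem_tateZ hf) : Tate k A r) = iotaEquiv F r (cls f₁ hf₁) :=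
    (cls_eq_cls _ _).2 h₁
  have e₂ : (cls _ (inc_mem_tateZ hg) : Tate k A s) = iotaEquiv F s (cls g₁ hg₁) :=
    (cls_eq_cls _ _).2 h₃
  rw [e₁, e₂, ← tateBracket_iota]
  have hN₁ : r + 1 + (s + (l' + 1)) + 1 = r + s + 2 + (0 + l' + 1) := by omega
  have hN₂ := add_succ_add_succ_succ r s
  have hN₃ : s + (l' + 1) + (r + 1) + 1 = r + s + 2 + (0 + l' + 1) := by omega
  have h₅ := h₂ rfl (L₁ := 0 + l' + 1) rfl hN hN₁ hg
  have h₆ := h₄ (n := 0) (L := 0 + l' + 1) (L₁ := 1) (ρ := r + s + 2) (by omega) rfl hN₃ (by omega)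
    hf₁
  have e₃ := bracketSg_swap (show 0 + l' + 1 = 0 + l' + 1 from rfl) hN₁ f₁ g
  have e₄ := bracketSg_swap (show 0 + 0 + 1 = 1 from rfl) hN₂ f₁ g₁
  -- The antisymmetry signs at level l' + 1 and at level one agree, since p - m has the same parity
  -- at all levels.
  rw [neg_one_pow_eq_of (b := (r + 1 + (0 + 1)) * (s + 1 + (0 + 1))) (c := (r + 2) * l')
    (by ring)] at e₃
  have h₇ := sub_mem_of_smul h₆ ((congrArg (inc (r + s + 2) (0 + l' + 1)) e₃).trans (map_smul _ _ _))
    ((congrArg (inc (r + s + 2) 1) e₄).trans (map_smul _ _ _))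
  have h₈ : inc (r + s + 2) (l + l' + 1) (bracketSg rfl hN f g) -
      inc (r + s + 2) 1 (bracketSg (show 0 + 0 + 1 = 1 from rfl) hN₂ f₁ g₁) ∈
        tateB k A (r + s + 2) := sub_mem_trans h₅ h₇
  obtain ⟨h₉, e₅⟩ := sgBracket_induces F r s f₁ hf₁ g₁ hg₁
  obtain ⟨h₁₀, e₆⟩ := iotaEquiv_induces F (r + s + 2) _ h₉
  rw [e₅]
  refine Eq.trans e₆ ?_
  exact (cls_eq_cls _ _).2 (sub_mem_symm h₈)

end TateColimit

/-! ### Degree signs and splittings of words -/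

section SplitForms

variable {k : Type u} {A : Type v} [Field k] [Ring A] [Algebra k A]

theorem word_cons_induction {p : WordAlg k A → Prop} (h1 : ∀ c : k, p (c • 1))
    (hadd : ∀ x y, p x → p y → p (x + y)) (hc : ∀ c u, p u → p (lett k A c * u)) (u) : p u := by
  have h0 : p 0 := by simpa using h1 0
  induction u using word_induction with
  | h0 => exact h0
  | hadd x y hx hy => exact hadd _ _ hx hy
  | hw n w =>
    induction n with
    | zero =>
      obtain ⟨c, rfl⟩ := exists_smul_emptyWord w
      rw [map_smul, toWord_emptyWord]
      exact h1 c
    | succ n ih =>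
      induction w using cons_induction with
      | h0 => simpa using h0
      | hadd x y hx hy => rw [map_add]; exact hadd _ _ hx hy
      | hc c w => rw [toWord_cons]; exact hc _ _ (ih w)

/-- All forms arise from the elements 1 ⊗ 1 ⊗ b by left multiplications and `sh`. This is the
induction that fits the recursions for d, for gluing and for splittings, without any fixed degree.
-/
theorem forms_sh_induction {p : Forms k A → Prop}
    (hadd : ∀ x y, p x → p y → p (x + y)) (h1 : ∀ b, p (jt 1 b))
    (hal : ∀ a y, p y → p (al a * y)) (hsh : ∀ y, p y → p (sh y)) (y) : p y := by
  have h0 : p 0 := by simpa using h1 0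
  induction y using forms_jt_induction with
  | h0 => exact h0
  | hadd x y hx hy => exact hadd _ _ hx hy
  | hc a u b =>
    refine hal _ _ ?_
    induction u using word_cons_induction with
    | h1 c => rw [map_smul, LinearMap.smul_apply, ← map_smul]; exact h1 _
    | hadd x y hx hy => rw [map_add, LinearMap.add_apply]; exact hadd _ _ hx hy
    | hc c u hu =>
      have : jt (lett k A c * u) b = sh (al (sec k A c) * jt u b) := by
        rw [sh_al_mul_jt, proj_sec]
      rw [this]
      exact hsh _ (hal _ _ hu)

/-! ### The degree operators -/

/-- The endomorphism of `T(Ā)` which multiplies all letters by `e`. -/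
def gr (e : k) : WordAlg k A →ₐ[k] WordAlg k A := TensorAlgebra.lift k (e • lett k A)

theorem gr_lett (e : k) (c : ABar k A) : gr e (lett k A c) = e • lett k A c := by simp [gr]

theorem gr_toWord (e : k) {n : ℕ} (w : TP k A n) : gr e (toWord w) = e ^ n • toWord w := by
  induction n with
  | zero =>
    obtain ⟨c, rfl⟩ := exists_smul_emptyWord w
    simp
  | succ n ih =>
    induction w using cons_induction with
    | h0 => simp
    | hadd x y hx hy => simp only [map_add, smul_add, hx, hy]
    | hc c w => rw [toWord_cons, map_mul, gr_lett, ih, smul_mul_smul_comm, pow_succ']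

theorem gr_gr (e e' : k) (u : WordAlg k A) : gr e (gr e' u) = gr (e * e') u := by
  induction u using word_cons_induction with
  | h1 c => simp
  | hadd x y hx hy => simp only [map_add, hx, hy]
  | hc c u hu =>
    rw [map_mul, map_mul, map_mul, hu, gr_lett, gr_lett, map_smul, gr_lett, smul_smul, mul_comm e]

theorem gr_one_apply (u : WordAlg k A) : gr (1 : k) u = u := by
  induction u using word_cons_induction with
  | h1 c => simp
  | hadd x y hx hy => simp only [map_add, hx, hy]
  | hc c u hu => rw [map_mul, hu, gr_lett, one_smul]

/-- The endomorphism of the forms which multiplies all letters by `e`. -/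
def grF (e : k) : Forms k A →ₐ[k] Forms k A :=
  (Algebra.TensorProduct.map (AlgHom.id k A) (Algebra.TensorProduct.map (gr e) (AlgHom.id k A)) :
    A ⊗[k] (WordAlg k A ⊗[k] A) →ₐ[k] A ⊗[k] (WordAlg k A ⊗[k] A))

@[simp]
theorem grF_al (e : k) (a : A) : grF e (al a) = al a := by
  exact (by simp : Algebra.TensorProduct.map (AlgHom.id k A)
    (Algebra.TensorProduct.map (gr e) (AlgHom.id k A))
      (a ⊗ₜ[k] ((1 : WordAlg k A) ⊗ₜ[k] (1 : A))) = a ⊗ₜ[k] (1 ⊗ₜ[k] 1))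

@[simp]
theorem grF_jt (e : k) (u : WordAlg k A) (b : A) : grF e (jt u b) = jt (gr e u) b := by
  exact (by simp : Algebra.TensorProduct.map (AlgHom.id k A)
    (Algebra.TensorProduct.map (gr e) (AlgHom.id k A)) (1 ⊗ₜ[k] (u ⊗ₜ[k] b)) =
      1 ⊗ₜ[k] (gr e u ⊗ₜ[k] b))

@[simp]
theorem grF_jt_one (e : k) (b : A) : grF e (jt 1 b : Forms k A) = jt 1 b := by
  rw [grF_jt, map_one (gr e)]

theorem grF_sh (e : k) (y : Forms k A) : grF e (sh y) = e • sh (grF e y) := by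
  induction y using forms_jt_induction with
  | h0 => simp
  | hadd x y hx hy => simp only [map_add, smul_add, hx, hy]
  | hc a u b =>
    rw [sh_al_mul_jt, grF_jt, map_mul (gr e), gr_lett, smul_mul_assoc, map_smul,
      LinearMap.smul_apply, map_mul (grF e), grF_al, grF_jt, sh_al_mul_jt]

theorem grF_grF (e e' : k) (y : Forms k A) : grF e (grF e' y) = grF (e * e') y := by
  induction y using forms_jt_induction with
  | h0 => simp
  | hadd x y hx hy => simp only [map_add, hx, hy]
  | hc a u b => simp only [map_mul, grF_al, grF_jt, gr_gr]

theorem grF_one_apply (y : Forms k A) : grF (1 : k) y = y := by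
  induction y using forms_jt_induction with
  | h0 => simp
  | hadd x y hx hy => simp only [map_add, hx, hy]
  | hc a u b => simp only [map_mul, grF_al, grF_jt, gr_one_apply]

theorem eaugA_jt_one (b : A) : eaugA (jt 1 b : Forms k A) = b := by
  rw [eaugA_jt, map_one, one_smul]

theorem eaugA_grF (e : k) (y : Forms k A) : eaugA (grF e y) = eaugA y := by
  induction y using forms_sh_induction with
  | hadd x y hx hy => simp only [map_add, hx, hy]
  | h1 b => simp
  | hal a y hy => rw [map_mul, grF_al, eaugA_al_mul, eaugA_al_mul, hy]
  | hsh y hy => rw [grF_sh, map_smul, eaugA_sh, eaugA_sh, smul_zero]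

theorem dF_grF (e : k) (y : Forms k A) : dF (grF e y) = e • grF e (dF y) := by
  induction y using forms_sh_induction with
  | hadd x y hx hy => simp only [map_add, smul_add, hx, hy]
  | h1 b => simp [dF_jt_one]
  | hal a y hy => rw [map_mul, grF_al, dF_al_mul, dF_al_mul, hy, map_mul, grF_al, mul_smul_comm]
  | hsh y hy =>
    rw [grF_sh, map_smul, dF_sh, dF_sh, hy, map_sub, map_sub, grF_sh, eaugA_grF, grF_jt_one, map_smul]

/-- The bar differential of a glued element. -/
theorem dF_glue_form (t z : Forms k A) :
    dF (glue t z) = glue t (dF z) + al (eaugA z) * t - glue (dF t) (grF (-1) z)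
      - grF (-1) z * jt 1 (eaugA t) := by
  induction z using forms_sh_induction with
  | hadd x y hx hy => simp only [map_add, add_mul, hx, hy]; abel
  | h1 b =>
    rw [glue_jt, jt_one_one, one_mul, dF_sh, dF_al_mul, eaugA_al_mul, dF_jt_one, map_zero,
      eaugA_jt_one, grF_jt_one, glue_jt, jt_one_one, one_mul, jt_mul_jt, one_mul, zero_add]
  | hal a y hy =>
    rw [glue_al_mul, dF_al_mul, hy, dF_al_mul, glue_al_mul, eaugA_al_mul, al_mul, map_mul, grF_al,
      glue_al_mul, mul_sub, mul_sub, mul_add, mul_assoc, mul_assoc]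
  | hsh y hy =>
    rw [glue_sh, dF_sh, hy, eaugA_glue, dF_sh, eaugA_sh, grF_sh, map_zero, map_zero, zero_mul]
    have h3 : ∀ x y z : Forms k A, glue t (x - y - z) = glue t x - glue t y - glue t z :=
      fun x y z => by rw [map_sub, map_sub]
    have h4 : ∀ x y z w : Forms k A, sh (x + y - z - w) = sh x + sh y - sh z - sh w :=
      fun x y z w => by rw [map_sub, map_sub, map_add]
    have h5 : glue t (jt 1 (eaugA y)) = sh (al (eaugA y) * t) := by
      rw [glue_jt, jt_one_one, one_mul]
    rw [h3, h4, h5, glue_sh, map_smul, glue_sh, smul_mul_assoc, sh_mul_jt]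
    module

/-! ### Splitting words -/

/-- The extension of an automorphism to the tensor algebra. -/
def autW (σ : A ≃ₐ[k] A) : WordAlg k A →ₐ[k] WordAlg k A :=
  TensorAlgebra.lift k (lett k A ∘ₗ barMap σ)

theorem autW_lett (σ : A ≃ₐ[k] A) (c : ABar k A) :
    autW σ (lett k A c) = lett k A (barMap σ c) := by simp [autW]

theorem barMap_proj (σ : A ≃ₐ[k] A) (a : A) : barMap σ (proj k A a) = proj k A (σ a) := rfl

/-- The recursion step for `spl`. -/
def splStep (σ : A ≃ₐ[k] A) :
    ABar k A →ₗ[k] Module.End k (WordAlg k A × (WordAlg k A ⊗[k] WordAlg k A)) :=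
  LinearMap.mk₂ k (fun c p => (lett k A c * p.1, 1 ⊗ₜ (lett k A c * p.1) + TensorProduct.map
      (LinearMap.mulLeft k (lett k A (barMap σ c))) (gr (-1)).toLinearMap p.2))
    (fun x y p => by
      rw [Prod.mk_add_mk, map_add, add_mul, TensorProduct.tmul_add, map_add, map_add,
        show LinearMap.mulLeft k (lett k A (barMap σ x) + lett k A (barMap σ y)) = _ from
          map_add (LinearMap.mul k (WordAlg k A)) _ _, TensorProduct.map_add_left,
        LinearMap.add_apply, add_add_add_comm]; rfl)
    (fun c x p => by
      rw [Prod.smul_mk, map_smul, smul_mul_assoc, TensorProduct.tmul_smul, map_smul, map_smul,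
        show LinearMap.mulLeft k (c • lett k A (barMap σ x)) = _ from
          map_smul (LinearMap.mul k (WordAlg k A)) _ _, TensorProduct.map_smul_left,
        LinearMap.smul_apply, smul_add]; rfl)
    (fun x p q => by
      rw [Prod.fst_add, Prod.snd_add, Prod.mk_add_mk, mul_add, TensorProduct.tmul_add, map_add,
        add_add_add_comm])
    (fun c x p => by
      rw [Prod.smul_fst, Prod.smul_snd, Prod.smul_mk, mul_smul_comm, TensorProduct.tmul_smul,
        map_smul, smul_add])

theorem splStep_apply (σ : A ≃ₐ[k] A) (c : ABar k A)
    (p : WordAlg k A × (WordAlg k A ⊗[k] WordAlg k A)) :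
    splStep σ c p = (lett k A c * p.1, 1 ⊗ₜ (lett k A c * p.1) + TensorProduct.map
      (LinearMap.mulLeft k (lett k A (barMap σ c))) (gr (-1)).toLinearMap p.2) := rfl

/-- The signed sum over all splittings `w = w₁w₂` of `σ(w₁) ⊗ w₂`. -/
def spl (σ : A ≃ₐ[k] A) : WordAlg k A →ₗ[k] WordAlg k A ⊗[k] WordAlg k A :=
  LinearMap.snd k _ _ ∘ₗ
    LinearMap.applyₗ (R := k) ((1 : WordAlg k A), (1 : WordAlg k A) ⊗ₜ[k] (1 : WordAlg k A)) ∘ₗ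
    (TensorAlgebra.lift k (splStep σ)).toLinearMap

theorem spl_one (σ : A ≃ₐ[k] A) : spl σ (1 : WordAlg k A) = 1 ⊗ₜ 1 := by
  simp [spl]

/-- Either the first part is empty, or it contains the first letter; in the second case the sign of
the second part accumulates to (-1)^{|w₁||w₂|}. -/
theorem spl_lett_mul (σ : A ≃ₐ[k] A) (c : ABar k A) (u : WordAlg k A) :
    spl σ (lett k A c * u) = 1 ⊗ₜ (lett k A c * u) +
      TensorProduct.map (LinearMap.mulLeft k (lett k A (barMap σ c))) (gr (-1)).toLinearMap
        (spl σ u) := by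
  have h1 : ∀ u : WordAlg k A, (TensorAlgebra.lift k (splStep σ) u (1, 1 ⊗ₜ 1)).1 = u := by
    intro u
    induction u using word_cons_induction with
    | h1 c => simp
    | hadd x y hx hy => rw [map_add, LinearMap.add_apply, Prod.fst_add, hx, hy]
    | hc c u hu =>
      rw [map_mul, TensorAlgebra.lift_ι_apply, Module.End.mul_apply]
      rw [splStep_apply, hu]
  simp only [spl, LinearMap.comp_apply, AlgHom.toLinearMap_apply, map_mul,
    TensorAlgebra.lift_ι_apply, LinearMap.applyₗ_apply_apply, Module.End.mul_apply, splStep_apply,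
    LinearMap.snd_apply, h1]

end SplitForms

/-! ### Sums over all cuts of a form -/

section CyclicHomotopy

variable {k : Type u} {A : Type v} [Field k] [Ring A] [Algebra k A] (σ : A ≃ₐ[k] A)

/-- The splittings of the middle factor of a form `a ⊗ u ⊗ b`, as
`∑ (σ(a) ⊗ σ(u₁) ⊗ 1) ⊗ (1 ⊗ u₂ ⊗ b)`. -/
def splitF : Forms k A →ₗ[k] Forms k A ⊗[k] Forms k A :=
  TensorProduct.map ((formsEquiv k A).symm.toLinearMap ∘ₗ
        LinearMap.lTensor A ((TensorProduct.mk k (WordAlg k A) A).flip 1))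
      ((formsEquiv k A).symm.toLinearMap ∘ₗ TensorProduct.mk k A _ 1) ∘ₗ
    (TensorProduct.assoc k A (WordAlg k A) (WordAlg k A ⊗[k] A)).symm.toLinearMap ∘ₗ
    LinearMap.lTensor A (TensorProduct.assoc k (WordAlg k A) (WordAlg k A) A).toLinearMap ∘ₗ
    TensorProduct.map σ.toLinearMap (LinearMap.rTensor A (spl σ)) ∘ₗ (formsEquiv k A).toLinearMap

theorem splitF_al_mul_jt (a b : A) (u : WordAlg k A) :
    splitF σ (al a * jt u b) =
      TensorProduct.map (LinearMap.mulLeft k (al (σ a)) ∘ₗ jt.flip 1) (jt.flip b) (spl σ u) := by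
  simp only [splitF, LinearMap.comp_apply, LinearEquiv.coe_coe, formsEquiv_al_mul_jt, TensorProduct.map_tmul, LinearMap.rTensor_tmul]
  generalize spl σ u = z
  induction z with
  | zero => simp
  | add x y hx hy => simp only [TensorProduct.add_tmul, TensorProduct.tmul_add, map_add, hx, hy]
  | tmul x y => simp [formsEquiv_symm_tmul, al_one]

theorem splitF_jt_one (b : A) : splitF σ (jt 1 b : Forms k A) = 1 ⊗ₜ jt 1 b := by
  have h := splitF_al_mul_jt (k := k) σ 1 b 1
  rw [al_one, one_mul] at h
  rw [h, spl_one]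
  simp [al_one, jt_one_one]

theorem splitF_al_mul (a : A) (y : Forms k A) :
    splitF σ (al a * y) = LinearMap.rTensor _ (LinearMap.mulLeft k (al (σ a))) (splitF σ y) := by
  induction y using forms_jt_induction with
  | h0 => simp
  | hadd x y hx hy => simp only [mul_add, map_add, hx, hy]
  | hc b u c =>
    rw [← mul_assoc, ← al_mul, splitF_al_mul_jt, splitF_al_mul_jt, map_mul σ, al_mul]
    generalize spl σ u = z
    induction z with
    | zero => simp
    | add x y hx hy => rw [map_add, map_add, map_add, hx, hy]
    | tmul x y => simp

theorem splitF_sh (y : Forms k A) :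
    splitF σ (sh y) = 1 ⊗ₜ sh y + TensorProduct.map sh (grF (-1)).toLinearMap (splitF σ y) := by
  induction y using forms_jt_induction with
  | h0 => simp
  | hadd x y hx hy =>
    rw [map_add, map_add, hx, hy, TensorProduct.tmul_add, map_add, map_add, add_add_add_comm]
  | hc a u b =>
    rw [sh_al_mul_jt]
    have h := splitF_al_mul_jt σ 1 b (lett k A (proj k A a) * u)
    rw [al_one, one_mul] at h
    rw [h, spl_lett_mul, map_add, splitF_al_mul_jt, barMap_proj]
    congr 1
    · simp [al_one, jt_one_one]
    · generalize spl σ u = z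
      induction z with
      | zero => simp
      | add x y hx hy => rw [map_add, map_add, map_add, map_add, hx, hy]
      | tmul x y =>
        simp only [TensorProduct.map_tmul, LinearMap.comp_apply, LinearMap.mulLeft_apply,
          AlgHom.toLinearMap_apply, LinearMap.flip_apply, map_one σ, al_one, one_mul, grF_jt,
          sh_al_mul_jt]

variable {M : Type*} [AddCommGroup M] [Module k M]

/-- The sum over all splittings of the middle factor of a form. -/
def cyc (G : Forms k A →ₗ[k] Forms k A →ₗ[k] M) : Forms k A →ₗ[k] M :=
  TensorProduct.lift G ∘ₗ splitF σ

theorem cyc_jt_one (G : Forms k A →ₗ[k] Forms k A →ₗ[k] M) (b : A) :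
    cyc σ G (jt 1 b) = G 1 (jt 1 b) := by
  rw [cyc, LinearMap.comp_apply, splitF_jt_one, TensorProduct.lift.tmul]

theorem cyc_al_mul (G : Forms k A →ₗ[k] Forms k A →ₗ[k] M) (a : A) (y : Forms k A) :
    cyc σ G (al a * y) = cyc σ (G ∘ₗ LinearMap.mulLeft k (al (σ a))) y := by
  rw [cyc, cyc, LinearMap.comp_apply, LinearMap.comp_apply, splitF_al_mul]
  generalize splitF σ y = z
  induction z with
  | zero => simp
  | add x y hx hy => rw [map_add, map_add, map_add, hx, hy]
  | tmul x y => simp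

theorem cyc_sh (G : Forms k A →ₗ[k] Forms k A →ₗ[k] M) (y : Forms k A) :
    cyc σ G (sh y) = G 1 (sh y) + cyc σ (G.compl₁₂ sh (grF (-1)).toLinearMap) y := by
  rw [cyc, cyc, LinearMap.comp_apply, LinearMap.comp_apply, splitF_sh, map_add,
    TensorProduct.lift.tmul]
  congr 1
  generalize splitF σ y = z
  induction z with
  | zero => simp
  | add x y hx hy => rw [map_add, map_add, map_add, hx, hy]
  | tmul x y => simp

theorem cyc_add (G G' : Forms k A →ₗ[k] Forms k A →ₗ[k] M) (y : Forms k A) :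
    cyc σ (G + G') y = cyc σ G y + cyc σ G' y := by
  rw [cyc, cyc, cyc, LinearMap.comp_apply, LinearMap.comp_apply, LinearMap.comp_apply]
  generalize splitF σ y = z
  induction z with
  | zero => simp
  | add x y hx hy => rw [map_add, map_add, map_add, hx, hy]; abel
  | tmul x y => simp

theorem cyc_smul (c : k) (G : Forms k A →ₗ[k] Forms k A →ₗ[k] M) (y : Forms k A) :
    cyc σ (c • G) y = c • cyc σ G y := by
  rw [cyc, cyc, LinearMap.comp_apply, LinearMap.comp_apply]
  generalize splitF σ y = z
  induction z with
  | zero => simp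
  | add x y hx hy => rw [map_add, map_add, hx, hy, smul_add]
  | tmul x y => simp

theorem cyc_comp {N : Type*} [AddCommGroup N] [Module k N] (f : M →ₗ[k] N)
    (G : Forms k A →ₗ[k] Forms k A →ₗ[k] M) (y : Forms k A) :
    f (cyc σ G y) = cyc σ (G.compr₂ f) y := by
  rw [cyc, cyc, LinearMap.comp_apply, LinearMap.comp_apply]
  generalize splitF σ y = z
  induction z with
  | zero => simp
  | add x y hx hy => rw [map_add, map_add, map_add, hx, hy]
  | tmul x y => simp

/-- Bilinear maps which are balanced over `A`, up to the twist by `σ`. -/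
def Balanced (G : Forms k A →ₗ[k] Forms k A →ₗ[k] M) : Prop :=
  ∀ a t f, G (t * jt 1 (σ a)) f = G t (al a * f)

variable {σ}

/-- Only the cut with empty first part survives the augmentation of the first factor, and
balancedness returns σ(a) to the second factor. -/
theorem cyc_counit {G : Forms k A →ₗ[k] Forms k A →ₗ[k] M} (hG : Balanced σ G) (y : Forms k A) :
    cyc σ (G ∘ₗ jt 1 ∘ₗ eaugA) y = G 1 y := by
  -- The additional element c collects the factors σ(a) that the induction moves to the left.
  have key : ∀ c : A, cyc σ (G ∘ₗ LinearMap.mulLeft k (jt 1 c) ∘ₗ jt 1 ∘ₗ eaugA) y =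
      G (jt 1 c) y := by
    induction y using forms_sh_induction with
    | hadd x y hx hy => intro c; rw [map_add, map_add, hx, hy]
    | h1 b =>
      intro c
      rw [cyc_jt_one]
      simp [← jt_one_one, eaugA_jt, jt_mul_jt]
    | hal a y hy =>
      intro c
      rw [cyc_al_mul, ← hG, jt_mul_jt, one_mul, ← hy]
      congr 1
      congr 1
      refine LinearMap.ext fun t => ?_
      simp [eaugA_al_mul, jt_mul_jt, mul_assoc]
    | hsh y hy =>
      intro c
      rw [cyc_sh]
      have h1 : (G ∘ₗ LinearMap.mulLeft k (jt 1 c) ∘ₗ jt 1 ∘ₗ eaugA).compl₁₂ sh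
          (grF (-1)).toLinearMap = 0 := by
        refine LinearMap.ext fun t => LinearMap.ext fun f => ?_
        simp [eaugA_sh]
      have h2 : cyc σ (0 : Forms k A →ₗ[k] Forms k A →ₗ[k] M) y = 0 := by
        rw [← zero_smul k (0 : Forms k A →ₗ[k] Forms k A →ₗ[k] M), cyc_smul, zero_smul]
      rw [h1, h2, add_zero]
      simp [← jt_one_one, eaugA_jt, jt_mul_jt]
  have h := key 1
  rw [jt_one_one] at h
  rw [← h]
  congr 1
  refine congrArg _ (LinearMap.ext fun t => ?_)
  simp

/-- The sum over all splittings, as a homotopy. -/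
theorem cyc_homotopy {G : Forms k A →ₗ[k] Forms k A →ₗ[k] M} (hG : Balanced σ G) (y : Forms k A) :
    cyc σ (G.compl₂ ((grF (-1)).toLinearMap ∘ₗ dF)) y + cyc σ (G ∘ₗ dF) y =
      cyc σ (G.compl₂ (grF (-1)).toLinearMap) (dF y) := by
  induction y using forms_sh_induction generalizing G with
  | hadd x y hx hy => rw [map_add, map_add, map_add, map_add, ← hx hG, ← hy hG]; abel
  | h1 b =>
    rw [cyc_jt_one, cyc_jt_one]
    have : dF (1 : Forms k A) = 0 := dF_jt_one 1
    simp [dF_jt_one, this]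
  | hal a y hy =>
    have hG' : Balanced σ (G ∘ₗ LinearMap.mulLeft k (al (σ a))) := fun b t f => by
      rw [LinearMap.comp_apply, LinearMap.comp_apply, ← hG, LinearMap.mulLeft_apply,
        LinearMap.mulLeft_apply, mul_assoc]
    have h := hy hG'
    rw [cyc_al_mul, cyc_al_mul, dF_al_mul, cyc_al_mul]
    have h1 : G ∘ₗ LinearMap.mulLeft k (al (σ a)) ∘ₗ dF =
        (G ∘ₗ dF) ∘ₗ LinearMap.mulLeft k (al (σ a)) := by
      refine LinearMap.ext fun t => ?_
      simp [dF_al_mul]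
    rw [LinearMap.comp_assoc, h1] at h
    exact h
  | hsh y hy =>
    have hG' : Balanced σ (G.compl₁₂ sh (grF (-1)).toLinearMap) := fun b t f => by
      simp only [LinearMap.compl₁₂_apply, AlgHom.toLinearMap_apply]
      rw [map_mul (grF (-1)), grF_al, ← hG, sh_mul_jt]
    have hGg : Balanced σ (G.compl₂ (grF (-1)).toLinearMap) := fun b t f => by
      simp only [LinearMap.compl₂_apply, AlgHom.toLinearMap_apply]
      rw [map_mul (grF (-1)), grF_al, ← hG]
    have h0 : dF (1 : Forms k A) = 0 := dF_jt_one 1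
    have ha : (G.compl₂ ((grF (-1)).toLinearMap ∘ₗ dF)).compl₁₂ sh (grF (-1)).toLinearMap =
        (-1 : k) • (G.compl₁₂ sh (grF (-1)).toLinearMap).compl₂ ((grF (-1)).toLinearMap ∘ₗ dF) := by
      refine LinearMap.ext fun t => LinearMap.ext fun f => ?_
      simp [dF_grF]
    have hb : (G ∘ₗ dF).compl₁₂ sh (grF (-1)).toLinearMap = G.compl₂ (grF (-1)).toLinearMap +
        (-1 : k) • ((G.compl₁₂ sh (grF (-1)).toLinearMap) ∘ₗ dF) +
        (-1 : k) • (G.compl₂ (grF (-1)).toLinearMap ∘ₗ jt 1 ∘ₗ eaugA) := by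
      refine LinearMap.ext fun t => LinearMap.ext fun f => ?_
      simp [dF_sh, sub_eq_add_neg]
    have hc : (G.compl₂ (grF (-1)).toLinearMap).compl₁₂ sh (grF (-1)).toLinearMap =
        (G.compl₁₂ sh (grF (-1)).toLinearMap).compl₂ (grF (-1)).toLinearMap := rfl
    -- The augmentation term that `dF_sh` produces in the first factor is evaluated by `cyc_counit`;
    -- it cancels the terms coming from the cut at the very beginning.
    rw [cyc_sh, cyc_sh, ha, hb, cyc_add, cyc_add, cyc_smul, cyc_smul, cyc_smul, cyc_counit hGg]
    conv_rhs => rw [dF_sh]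
    rw [map_sub, map_sub, cyc_sh, cyc_jt_one, hc, ← hy hG']
    simp only [LinearMap.compl₂_apply, LinearMap.comp_apply, AlgHom.toLinearMap_apply, h0, map_zero,
      LinearMap.zero_apply, dF_sh, map_sub]
    module

end CyclicHomotopy

/-! ### Closing forms cyclically, and sums over rotations -/

section Closing

variable {k : Type u} {A : Type v} [Field k] [Ring A] [Algebra k A] (σ : A ≃ₐ[k] A)

theorem glue_add (s t y : Forms k A) : glue (s + t) y = glue s y + glue t y := by
  rw [← sub_neg_eq_add, glue_sub, ← neg_one_smul k t, glue_smul]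
  module

/-- The map `glue` as a bilinear map. -/
def glueB : Forms k A →ₗ[k] Forms k A →ₗ[k] Forms k A :=
  LinearMap.mk₂ k (fun t y => glue t y) glue_add glue_smul (fun _ => map_add _) (fun _ _ => map_smul _ _)

theorem glueB_apply (t y : Forms k A) : glueB t y = glue t y := rfl

theorem glue_mul_jt_one (t y : Forms k A) (b : A) : glue (t * jt 1 b) y = glue t y * jt 1 b := by
  induction y using forms_jt_induction with
  | h0 => simp
  | hadd x y hx hy => simp only [map_add, add_mul, hx, hy]
  | hc a u c => rw [glue_tmul, glue_tmul, ← mul_assoc (al c), sh_mul_jt, mul_assoc, mul_assoc]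

theorem glue_al_mul_left (t y : Forms k A) (c : A) : glue (al c * t) y = glue t (y * jt 1 c) := by
  induction y using forms_jt_induction with
  | h0 => simp
  | hadd x y hx hy => simp only [map_add, add_mul, hx, hy]
  | hc a u b => rw [mul_assoc, jt_mul_jt, mul_one, glue_tmul, glue_tmul, al_mul, mul_assoc]

/-- Closing a form to a chain: `a ⊗ u ⊗ b ↦ bσ(a) ⊗ u`. -/
def clo : Forms k A →ₗ[k] A ⊗[k] WordAlg k A :=
  LinearMap.rTensor (WordAlg k A)
      (LinearMap.mul' k A ∘ₗ (TensorProduct.comm k A A).toLinearMap ∘ₗ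
        LinearMap.rTensor A σ.toLinearMap) ∘ₗ
    (TensorProduct.assoc k A A (WordAlg k A)).symm.toLinearMap ∘ₗ
    LinearMap.lTensor A (TensorProduct.comm k (WordAlg k A) A).toLinearMap ∘ₗ
    (formsEquiv k A).toLinearMap

theorem clo_al_mul_jt (a b : A) (u : WordAlg k A) : clo σ (al a * jt u b) = (b * σ a) ⊗ₜ u := by
  simp [clo, formsEquiv_al_mul_jt]

theorem clo_jt (b : A) (u : WordAlg k A) : clo σ (jt u b) = b ⊗ₜ u := by
  have h := clo_al_mul_jt σ 1 b u
  rwa [al_one, one_mul, map_one, mul_one] at h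

theorem clo_al_mul (a : A) (y : Forms k A) : clo σ (al a * y) = clo σ (y * jt 1 (σ a)) := by
  induction y using forms_jt_induction with
  | h0 => simp
  | hadd x y hx hy => simp only [mul_add, add_mul, map_add, hx, hy]
  | hc b u c =>
    rw [← mul_assoc, ← al_mul, clo_al_mul_jt, mul_assoc, jt_mul_jt, mul_one, clo_al_mul_jt,
      map_mul, mul_assoc]

/-- The form `1 ⊗ u ⊗ b` for a chain `b ⊗ u`. -/
def opn : A ⊗[k] WordAlg k A →ₗ[k] Forms k A :=
  (formsEquiv k A).symm.toLinearMap ∘ₗ TensorProduct.mk k A _ 1 ∘ₗ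
    (TensorProduct.comm k A (WordAlg k A)).toLinearMap

theorem opn_tmul (b : A) (u : WordAlg k A) : opn (b ⊗ₜ u) = jt u b := by
  simp [opn, formsEquiv_symm_tmul, al_one]

theorem clo_opn (z : A ⊗[k] WordAlg k A) : clo σ (opn z) = z := by
  induction z with
  | zero => simp
  | add x y hx hy => rw [map_add, map_add, hx, hy]
  | tmul b u => rw [opn_tmul, clo_jt]

/-- Maps which are invariant under cyclic permutation of the outer factors factor through the
closing map. -/
theorem apply_opn_clo {M : Type*} [AddCommGroup M] [Module k M] (f : Forms k A →ₗ[k] M)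
    (hf : ∀ a y, f (al a * y) = f (y * jt 1 (σ a))) (y : Forms k A) :
    f (opn (clo σ y)) = f y := by
  induction y using forms_jt_induction with
  | h0 => simp
  | hadd x y hx hy => simp only [map_add, hx, hy]
  | hc a u b => rw [clo_al_mul_jt, opn_tmul, hf, jt_mul_jt, mul_one]

theorem clo_dF_opn_clo (y : Forms k A) : clo σ (dF (opn (clo σ y))) = clo σ (dF y) :=
  apply_opn_clo σ (clo σ ∘ₗ dF) (fun a y => by
    rw [LinearMap.comp_apply, LinearMap.comp_apply, dF_al_mul, clo_al_mul, dF_mul_jt]) y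

/-- The sum over all rotations of a form, with `Θ` applied. -/
def rot (Θ : Forms k A →ₗ[k] Forms k A) : Forms k A →ₗ[k] Forms k A :=
  cyc σ (glueB.compl₂ (Θ ∘ₗ (grF (-1)).toLinearMap))

theorem cyc_mul_jt {M : Type*} [AddCommGroup M] [Module k M]
    (G : Forms k A →ₗ[k] Forms k A →ₗ[k] M) (b : A) (y : Forms k A) :
    cyc σ G (y * jt 1 b) = cyc σ (G.compl₂ (LinearMap.mulRight k (jt 1 b))) y := by
  induction y using forms_jt_induction with
  | h0 => simp
  | hadd x y hx hy => simp only [add_mul, map_add, hx, hy]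
  | hc a u c =>
    rw [mul_assoc, jt_mul_jt, mul_one, cyc, cyc, LinearMap.comp_apply, LinearMap.comp_apply,
      splitF_al_mul_jt, splitF_al_mul_jt]
    generalize spl σ u = z
    induction z with
    | zero => simp
    | add x y hx hy => rw [map_add, map_add, map_add, map_add, hx, hy]
    | tmul x y => simp [jt_mul_jt]

theorem clo_rot_al_mul {Θ : Forms k A →ₗ[k] Forms k A}
    (hr : ∀ b y, Θ (y * jt 1 b) = Θ y * jt 1 b) (a : A) (y : Forms k A) :
    rot σ Θ (al a * y) = rot σ Θ (y * jt 1 (σ a)) := by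
  rw [rot, cyc_al_mul, cyc_mul_jt]
  congr 1
  congr 1
  refine LinearMap.ext fun t => LinearMap.ext fun f => ?_
  simp only [LinearMap.comp_apply, LinearMap.compl₂_apply, LinearMap.mulLeft_apply,
    LinearMap.mulRight_apply, glueB_apply, AlgHom.toLinearMap_apply]
  rw [glue_al_mul_left, map_mul (grF (-1)), grF_jt_one, hr]

-- If Θ has graded commutator Ξ with d, the sum over rotations of Θ has the sum over rotations of Ξ
-- as commutator, up to the terms of the two extreme cuts. Closing is needed so that the outer
-- factors may be exchanged. For Θ = id this is the homotopy formula of the Connes operator, for Θ =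
-- `insL` it relates that operator to insertions.
set_option maxHeartbeats 1000000 in
theorem clo_dF_rot {Θ Ξ : Forms k A →ₗ[k] Forms k A} {e : k}
    (hl : ∀ a y, Θ (al a * y) = al a * Θ y)
    (hg : ∀ y, grF (-1) (Θ (grF (-1) y)) = e • Θ y)
    (hd : ∀ y, dF (Θ y) = e • Θ (dF y) + Ξ y) (y : Forms k A) :
    clo σ (dF (rot σ Θ y)) + e • clo σ (rot σ Θ (dF y)) =
      clo σ (rot σ Ξ y)
        + clo σ (cyc σ (((LinearMap.mul k (Forms k A)).flip).compl₂
            (al ∘ₗ eaugA ∘ₗ Θ ∘ₗ (grF (-1)).toLinearMap)) y) - e • clo σ (Θ y) := by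
  have hG : Balanced σ ((glueB.compl₂ Θ).compr₂ (clo σ)) := fun a t f => by
    simp only [LinearMap.compl₂_apply, LinearMap.compr₂_apply, glueB_apply]
    rw [glue_mul_jt_one, ← clo_al_mul, hl, glue_al_mul]
  have hG2 : Balanced σ (((LinearMap.mul k (Forms k A)).flip.compl₂ Θ).compr₂ (clo σ)) :=
    fun a t f => by
      simp only [LinearMap.compl₂_apply, LinearMap.compr₂_apply, LinearMap.flip_apply,
        LinearMap.mul_apply']
      rw [← mul_assoc, ← clo_al_mul, hl, mul_assoc]
  have h1 := cyc_homotopy hG y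
  have h2 := cyc_counit hG2 y
  -- Each glued summand is differentiated by `dF_glue_form`. The two internal differentials are
  -- collected by `cyc_homotopy`, and the augmentation of the first factor by `cyc_counit`.
  have h3 : (glueB.compl₂ (Θ ∘ₗ (grF (-1)).toLinearMap)).compr₂ (clo σ ∘ₗ dF) =
      (-e) • (((glueB.compl₂ Θ).compr₂ (clo σ)).compl₂ ((grF (-1)).toLinearMap ∘ₗ dF)
        + ((glueB.compl₂ Θ).compr₂ (clo σ)) ∘ₗ dF
        + (((LinearMap.mul k (Forms k A)).flip.compl₂ Θ).compr₂ (clo σ)) ∘ₗ jt 1 ∘ₗ eaugA)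
      + ((glueB.compl₂ (Ξ ∘ₗ (grF (-1)).toLinearMap)).compr₂ (clo σ)
        + (((LinearMap.mul k (Forms k A)).flip).compl₂
            (al ∘ₗ eaugA ∘ₗ Θ ∘ₗ (grF (-1)).toLinearMap)).compr₂ (clo σ)) := by
    refine LinearMap.ext fun t => LinearMap.ext fun f => ?_
    simp only [LinearMap.compl₂_apply, LinearMap.compr₂_apply, LinearMap.add_apply,
      LinearMap.smul_apply, LinearMap.comp_apply, glueB_apply, LinearMap.flip_apply,
      LinearMap.mul_apply', AlgHom.toLinearMap_apply]
    rw [dF_glue_form, hd, hg, dF_grF, map_smul Θ, map_sub, map_sub, map_add, map_add, map_add,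
      map_smul, map_smul, map_smul, map_smul, map_smul, smul_mul_assoc, map_smul, map_smul]
    module
  have h4 : clo σ (rot σ Θ (dF y)) =
      cyc σ (((glueB.compl₂ Θ).compr₂ (clo σ)).compl₂ (grF (-1)).toLinearMap) (dF y) :=
    cyc_comp σ (clo σ) (glueB.compl₂ (Θ ∘ₗ (grF (-1)).toLinearMap)) (dF y)
  have h5 : clo σ (dF (rot σ Θ y)) = _ :=
    cyc_comp σ (clo σ ∘ₗ dF) (glueB.compl₂ (Θ ∘ₗ (grF (-1)).toLinearMap)) y
  have h6 : clo σ (rot σ Ξ y) = _ :=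
    cyc_comp σ (clo σ) (glueB.compl₂ (Ξ ∘ₗ (grF (-1)).toLinearMap)) y
  have h7 := cyc_comp σ (clo σ) (((LinearMap.mul k (Forms k A)).flip).compl₂
            (al ∘ₗ eaugA ∘ₗ Θ ∘ₗ (grF (-1)).toLinearMap)) y
  have h8 : (((LinearMap.mul k (Forms k A)).flip.compl₂ Θ).compr₂ (clo σ)) 1 y = clo σ (Θ y) := by
    simp only [LinearMap.compl₂_apply, LinearMap.compr₂_apply, LinearMap.flip_apply,
      LinearMap.mul_apply', mul_one]
  rw [h3, cyc_add, cyc_smul, cyc_add, cyc_add, h2, h8, cyc_add, ← h6, ← h7] at h5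
  rw [h5, h4, ← h1]
  module

end Closing

/-! ### Twisted chains as closed forms; the Connes operator -/

section ChainsAsForms

variable {k : Type u} {A : Type v} [Field k] [Ring A] [Algebra k A]

theorem chain_induction {r : ℕ} {p : Chain k A r → Prop} (h0 : p 0)
    (hadd : ∀ x y, p x → p y → p (x + y)) (hc : ∀ a w, p (a ⊗ₜ w)) (x) : p x := by
  induction x using TensorProduct.induction_on with
  | zero => exact h0
  | add x y hx hy => exact hadd _ _ hx hy
  | tmul a w => exact hc a w

/-- The embedding of the chains into `A ⊗ T(Ā)`. -/
def embC {r : ℕ} : Chain k A r →ₗ[k] A ⊗[k] WordAlg k A := LinearMap.lTensor A toWord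

@[simp]
theorem embC_tmul {r : ℕ} (a : A) (w : TP k A r) : embC (a ⊗ₜ w) = a ⊗ₜ toWord w := by
  simp [embC]

/-- The form `1 ⊗ w ⊗ a` for a chain `a ⊗ w`. -/
def chF {r : ℕ} : Chain k A r →ₗ[k] Forms k A := opn ∘ₗ embC

@[simp]
theorem chF_tmul {r : ℕ} (a : A) (w : TP k A r) : chF (a ⊗ₜ w) = jt (toWord w) a := by
  rw [chF, LinearMap.comp_apply, embC_tmul, opn_tmul]

theorem opn_embC {r : ℕ} (x : Chain k A r) : opn (embC x) = chF x := rfl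

theorem chF_eq_embB {r : ℕ} (a : A) (w : TP k A r) :
    chF (a ⊗ₜ w) = embB (1 ⊗ₜ (w ⊗ₜ a)) := by
  rw [chF_tmul, embB_tmul, al_one, one_mul]

theorem aw_induction {p : A ⊗[k] WordAlg k A → Prop}
    (hadd : ∀ x y, p x → p y → p (x + y)) (hc : ∀ r (x : Chain k A r), p (embC x)) (y) : p y := by
  have h0 : p 0 := by simpa using hc 0 0
  induction y using TensorProduct.induction_on with
  | zero => exact h0
  | add x y hx hy => exact hadd _ _ hx hy
  | tmul a u =>
    induction u using word_induction with
    | h0 => rwa [TensorProduct.tmul_zero]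
    | hadd x y hx hy => rw [TensorProduct.tmul_add]; exact hadd _ _ hx hy
    | hw n w => rw [← embC_tmul]; exact hc _ _

variable (k A) in
/-- The component of degree `n`. -/
def comp (n : ℕ) : A ⊗[k] WordAlg k A →ₗ[k] Chain k A n :=
  LinearMap.lTensor A (wordLift fun m =>
    if h : m = n then (TensorPower.cast k (ABar k A) h).toLinearMap else 0)

theorem comp_embC {n : ℕ} (x : Chain k A n) : comp k A n (embC x) = x := by
  induction x using chain_induction with
  | h0 => simp
  | hadd x y hx hy => rw [map_add, map_add, hx, hy]
  | hc a w => simp [comp]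

theorem comp_embC_of_ne {m n : ℕ} (h : m ≠ n) (x : Chain k A m) : comp k A n (embC x) = 0 := by
  induction x using chain_induction with
  | h0 => simp
  | hadd x y hx hy => rw [map_add, map_add, hx, hy, add_zero]
  | hc a w => simp [comp, h]

theorem embC_injective {n : ℕ} : Function.Injective (embC : Chain k A n → _) :=
  Function.LeftInverse.injective comp_embC

variable (σ : A ≃ₐ[k] A)

theorem clo_chF {r : ℕ} (x : Chain k A r) : clo σ (chF x) = embC x := clo_opn σ _

theorem dF_chF_zero (x : Chain k A 0) : dF (chF x) = 0 := by
  induction x using chain_induction with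
  | h0 => simp
  | hadd x y hx hy => rw [map_add, map_add, hx, hy, add_zero]
  | hc a w => rw [chF_eq_embB, dF_embB_zero]

theorem clo_embB {r : ℕ} (a b : A) (w : TP k A r) :
    clo σ (embB (a ⊗ₜ (w ⊗ₜ b))) = embC ((b * σ a) ⊗ₜ w) := by
  rw [embB_tmul, clo_al_mul_jt, embC_tmul]

theorem clo_dF_chF {r : ℕ} (x : Chain k A (r + 1)) :
    clo σ (dF (chF x)) = embC (bd σ r x) := by
  induction x using chain_induction with
  | h0 => simp
  | hadd x y hx hy => simp only [map_add, hx, hy]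
  | hc a w =>
    rw [chF_eq_embB, dF_embB, d_tmul, bd_tmul, map_add, map_add, map_add, map_add, map_add, map_add,
      map_smul, map_smul, map_smul]
    congr 1
    · congr 1
      · induction w using cons_induction with
        | h0 => simp
        | hadd x y hx hy =>
          simp only [map_add, TensorProduct.tmul_add, TensorProduct.add_tmul, hx, hy]
        | hc c w => rw [dFirst_tmul, clo_embB]; simp
      · rw [clo_embB, map_one, mul_one]
    · congr 1
      induction w using snoc_induction with
      | h0 => simp
      | hadd x y hx hy =>
        simp only [map_add, TensorProduct.tmul_add, TensorProduct.add_tmul, hx, hy]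
      | hc w c => rw [dLast_tmul, clo_embB]; simp [mulR]

theorem comp_clo_dF_opn {n : ℕ} (Z : A ⊗[k] WordAlg k A) :
    comp k A n (clo σ (dF (opn Z))) = bd σ n (comp k A (n + 1) Z) := by
  induction Z using aw_induction with
  | hadd x y hx hy => simp only [map_add, hx, hy]
  | hc r x =>
    rw [opn_embC]
    cases r with
    | zero => rw [dF_chF_zero, comp_embC_of_ne (by omega)]; simp only [map_zero]
    | succ r =>
      rw [clo_dF_chF]
      by_cases h : r = n
      · subst h
        rw [comp_embC, comp_embC]
      · rw [comp_embC_of_ne h, comp_embC_of_ne (by omega), map_zero]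

/-- The form need not be homogeneous: its closed component of degree n + 1 is a preimage of c. -/
theorem mem_range_bd {n : ℕ} {c : Chain k A n} {Y : Forms k A}
    (h : embC c = clo σ (dF Y)) : c ∈ LinearMap.range (bd σ n) := by
  refine ⟨comp k A (n + 1) (clo σ Y), ?_⟩
  rw [← comp_clo_dF_opn, clo_dF_opn_clo, ← h, comp_embC]

/-! ### The Connes operator -/

/-- The automorphism of the chains induced by `σ`. -/
def autC (r : ℕ) : Chain k A r →ₗ[k] Chain k A r :=
  TensorProduct.map σ.toLinearMap (PiTensorProduct.map fun _ => barMap σ)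

theorem toWord_map {n : ℕ} (w : TP k A n) :
    toWord (PiTensorProduct.map (fun _ => barMap σ) w) = autW σ (toWord w) := by
  induction w using PiTensorProduct.induction_on with
  | smul_tprod c a =>
    simp only [map_smul, PiTensorProduct.map_tprod, toWord, TensorPower.toTensorAlgebra_tprod,
      TensorAlgebra.tprod_apply, map_list_prod, List.map_ofFn, Function.comp_def]
    congr 2
    refine congrArg _ (funext fun i => ?_)
    rw [← autW_lett]
  | add x y hx hy => simp only [map_add, hx, hy]

/-- The splitting of a word after `a` letters. -/
def splAt {a b n : ℕ} (h : a + b = n) : TP k A n →ₗ[k] WordAlg k A ⊗[k] WordAlg k A :=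
  TensorProduct.map ((autW σ).toLinearMap ∘ₗ toWord) toWord ∘ₗ (conc h).symm.toLinearMap

theorem splAt_conc {a b n : ℕ} (h : a + b = n) (x : TP k A a) (y : TP k A b) :
    splAt σ h (conc h (x ⊗ₜ y)) = autW σ (toWord x) ⊗ₜ toWord y := by simp [splAt]

theorem spl_toWord {n : ℕ} (w : TP k A n) :
    spl σ (toWord w) = ∑ j : Fin (n + 1), (-1 : k) ^ ((j : ℕ) * (n - j)) •
      splAt σ (show (j : ℕ) + (n - j) = n by have := j.isLt; omega) w := by
  induction n with
  | zero =>
    obtain ⟨c, rfl⟩ := exists_smul_emptyWord w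
    have h := splAt_conc σ (show 0 + 0 = 0 from rfl) (emptyWord : TP k A 0) emptyWord
    have h2 : conc (show 0 + 0 = 0 from rfl) ((emptyWord : TP k A 0) ⊗ₜ emptyWord) = emptyWord :=
      toWord_injective (by simp)
    rw [h2] at h
    rw [map_smul, map_smul, toWord_emptyWord, spl_one, Fin.sum_univ_one, map_smul]
    have h3 : splAt σ (show 0 + (0 - 0) = 0 from rfl) (emptyWord : TP k A 0) = 1 ⊗ₜ 1 := by
      rw [toWord_emptyWord, map_one] at h
      exact h
    simpa using congrArg (fun z : WordAlg k A ⊗[k] WordAlg k A => c • z) h3.symm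
  | succ n ih =>
    induction w using cons_induction with
    | h0 => simp
    | hadd x y hx hy => simp only [map_add, smul_add, Finset.sum_add_distrib, hx, hy]
    | hc c w =>
      rw [toWord_cons, spl_lett_mul, ih, map_sum]
      conv_rhs => rw [Fin.sum_univ_succ]
      congr 1
      · have h : cons n (c ⊗ₜ w) = conc (show 0 + (n + 1) = n + 1 by omega)
            (emptyWord ⊗ₜ cons n (c ⊗ₜ w)) := toWord_injective (by simp)
        have h3 := splAt_conc σ (show 0 + (n + 1) = n + 1 by omega) emptyWord (cons n (c ⊗ₜ w))
        rw [← h, toWord_emptyWord, map_one, toWord_cons] at h3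
        simpa using h3.symm
      · refine Finset.sum_congr rfl fun j _ => ?_
        have hj := j.isLt
        have h : (j : ℕ) + (n - j) = n := by omega
        have h' : (j : ℕ) + 1 + (n - j) = n + 1 := by omega
        have key : TensorProduct.map (LinearMap.mulLeft k (lett k A (barMap σ c)))
            (gr (-1)).toLinearMap (splAt σ h w) =
              (-1 : k) ^ (n - j) • splAt σ h' (cons n (c ⊗ₜ w)) := by
          induction w using conc_induction h with
          | h0 => simp
          | hadd x y hx hy => simp only [map_add, TensorProduct.tmul_add, smul_add, hx, hy]
          | hc x y =>
            have h2 : cons n (c ⊗ₜ conc h (x ⊗ₜ y)) = conc h' (cons j (c ⊗ₜ x) ⊗ₜ y) :=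
              toWord_injective (by simp [mul_assoc])
            rw [h2, splAt_conc, splAt_conc, TensorProduct.map_tmul, toWord_cons, map_mul, autW_lett,
              AlgHom.toLinearMap_apply, gr_toWord, TensorProduct.tmul_smul,
              LinearMap.mulLeft_apply]
        rw [map_smul, key, smul_smul, ← pow_add]
        have h5 : n + 1 - (j.succ : ℕ) = n - j := by simp
        have h6 : ∀ m (hm : (j.succ : ℕ) + m = n + 1) , m = n - j →
            splAt σ hm (cons n (c ⊗ₜ w)) = splAt σ h' (cons n (c ⊗ₜ w)) := by
          rintro m hm rfl; rfl
        rw [h6 _ _ h5, h5]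
        congr 2
        rw [Fin.val_succ]; ring

theorem cyc_jt {M : Type*} [AddCommGroup M] [Module k M]
    (G : Forms k A →ₗ[k] Forms k A →ₗ[k] M) (u : WordAlg k A) (b : A) :
    cyc σ G (jt u b) = TensorProduct.lift (G.compl₁₂ (jt.flip 1) (jt.flip b)) (spl σ u) := by
  have h := splitF_al_mul_jt σ 1 b u
  rw [al_one, one_mul] at h
  rw [cyc, LinearMap.comp_apply, h]
  generalize spl σ u = z
  induction z with
  | zero => simp
  | add x y hx hy => simp only [map_add, hx, hy]
  | tmul x y => simp [al_one]

/-- Each cut a ⊗ u₁u₂ is rotated to u₂ ⊗ a ⊗ σ(u₁), which is one summand of the Connes operator. -/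
theorem clo_rot_id_chF {r : ℕ} (x : Chain k A r) :
    clo σ (rot σ LinearMap.id (chF x)) = embC (connes σ r x) := by
  induction x using chain_induction with
  | h0 => simp
  | hadd x y hx hy => simp only [map_add, hx, hy]
  | hc a w =>
    rw [chF_tmul, rot, cyc_jt, spl_toWord, map_sum, map_sum]
    simp only [connes, LinearMap.comp_apply, TensorProduct.mk_apply, LinearMap.sum_apply]
    rw [embC_tmul, map_sum, TensorProduct.tmul_sum]
    refine Finset.sum_congr rfl fun j _ => ?_
    have hj := j.isLt
    have h : (j : ℕ) + (r - j) = r := by omega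
    simp only [LinearMap.smul_apply, map_smul, TensorProduct.tmul_smul]
    have key : clo σ (TensorProduct.lift ((glueB.compl₂ (LinearMap.id ∘ₗ
          (grF (-1 : k)).toLinearMap)).compl₁₂ (jt.flip 1) (jt.flip a)) (splAt σ h w)) =
        (-1 : k) ^ (r - j) • (1 : A) ⊗ₜ[k] toWord (((conc (a := r - j) (b := j + 1)
          (show r - j + (j + 1) = r + 1 by omega)).toLinearMap ∘ₗ
        (TensorProduct.comm k (TP k A (j + 1)) (TP k A (r - j))).toLinearMap ∘ₗ
        LinearMap.rTensor (TP k A (r - j)) ((cons (j : ℕ)).toLinearMap ∘ₗ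
          TensorProduct.map (proj k A) (PiTensorProduct.map fun _ => barMap σ)) ∘ₗ
        (TensorProduct.assoc k A (TP k A j) (TP k A (r - j))).symm.toLinearMap ∘ₗ
        LinearMap.lTensor A (conc h).symm.toLinearMap) (a ⊗ₜ w)) := by
      induction w using conc_induction h with
      | h0 => simp
      | hadd x y hx hy =>
        simp only [map_add, TensorProduct.tmul_add, smul_add, hx, hy]
      | hc x y =>
        rw [splAt_conc]
        simp only [TensorProduct.lift.tmul, LinearMap.compl₁₂_apply, LinearMap.compl₂_apply,
          LinearMap.flip_apply, LinearMap.comp_apply, LinearMap.id_apply, AlgHom.toLinearMap_apply,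
          glueB_apply, grF_jt, glue_jt, sh_al_mul_jt, jt_mul_jt, clo_jt, gr_toWord,
          LinearEquiv.coe_coe, LinearMap.lTensor_tmul, LinearEquiv.symm_apply_apply,
          TensorProduct.assoc_symm_tmul, LinearMap.rTensor_tmul, TensorProduct.map_tmul,
          TensorProduct.comm_tmul, toWord_conc, toWord_cons, toWord_map, one_mul, smul_mul_assoc,
          TensorProduct.tmul_smul]
    rw [key, smul_smul, ← pow_add]
    congr 1
    -- As j(j + 1) is even, (j + 1)r ≡ j(r - j) + (r - j) modulo 2: the sign of the splitting times
    -- the degree sign of the second part.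
    obtain ⟨q, hq⟩ := Nat.even_mul_succ_self (j : ℕ)
    have h1 : ∀ i m : ℕ, i * (i + 1) = q + q → r = i + m → (i + 1) * r = i * m + m + 2 * q := by
      rintro i m hi rfl; nlinarith
    exact (neg_one_pow_eq_of (h1 j (r - j) hq h.symm)).symm

theorem cou_gr (e : k) (u : WordAlg k A) : cou (gr e u) = cou u := by
  induction u using word_cons_induction with
  | h1 c => simp
  | hadd x y hx hy => simp only [map_add, hx, hy]
  | hc c u hu => rw [map_mul, gr_lett, smul_mul_assoc, map_smul, cou_lett_mul, smul_zero, cou_lett_mul]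

theorem spl_counit (u : WordAlg k A) :
    TensorProduct.rid k _ (LinearMap.lTensor _ cou.toLinearMap (spl σ u)) = autW σ u := by
  induction u using word_cons_induction with
  | h1 c => rw [map_smul, map_smul, map_smul, map_smul, spl_one]; simp
  | hadd x y hx hy => simp only [map_add, hx, hy]
  | hc c u hu =>
    rw [spl_lett_mul, map_add, map_add, LinearMap.lTensor_tmul, AlgHom.toLinearMap_apply,
      cou_lett_mul, TensorProduct.tmul_zero, map_zero, zero_add, map_mul, autW_lett, ← hu]
    generalize spl σ u = z
    induction z with
    | zero => simp
    | add x y hx hy => simp only [map_add, mul_add, hx, hy]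
    | tmul x y =>
      simp [cou_gr]

theorem embC_autC {r : ℕ} (a : A) (w : TP k A r) :
    embC (autC σ r (a ⊗ₜ w)) = σ a ⊗ₜ autW σ (toWord w) := by
  simp [autC, toWord_map]

/-- For Θ = id the commutator is zero and only the extreme cuts remain: the empty second part gives
the image under σ, the empty first part the chain itself. -/
theorem clo_dF_rot_id {r : ℕ} (x : Chain k A r) :
    clo σ (dF (rot σ LinearMap.id (chF x))) + clo σ (rot σ LinearMap.id (dF (chF x))) =
      embC (autC σ r x) - embC x := by
  have h := clo_dF_rot σ (Θ := LinearMap.id) (Ξ := 0) (e := 1) (fun _ _ => rfl)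
    (fun y => by
      rw [LinearMap.id_apply, LinearMap.id_apply, grF_grF, neg_mul_neg, mul_one, grF_one_apply,
        one_smul])
    (fun y => by
      rw [LinearMap.id_apply, LinearMap.id_apply, one_smul, LinearMap.zero_apply, add_zero])
    (chF x)
  have h0 : rot σ (0 : Forms k A →ₗ[k] Forms k A) (chF x) = 0 := by
    have h1 : glueB.compl₂ ((0 : Forms k A →ₗ[k] Forms k A) ∘ₗ (grF (-1)).toLinearMap) =
        (0 : k) • glueB := by
      refine LinearMap.ext fun t => LinearMap.ext fun f => ?_
      simp
    rw [rot, h1, cyc_smul, zero_smul]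
  rw [one_smul, one_smul, h0, map_zero, zero_add, LinearMap.id_apply, clo_chF] at h
  rw [h]
  congr 1
  clear h h0
  induction x using chain_induction with
  | h0 => simp
  | hadd x y hx hy => simp only [map_add, hx, hy]
  | hc a w =>
    rw [chF_tmul, cyc_jt, embC_autC, ← spl_counit]
    generalize spl σ (toWord w) = z
    induction z with
    | zero => simp
    | add x y hx hy => simp only [map_add, TensorProduct.tmul_add, hx, hy]
    | tmul x y =>
      simp [eaugA_jt, clo_al_mul_jt, cou_gr]

theorem rot_opn_clo {Θ : Forms k A →ₗ[k] Forms k A}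
    (hr : ∀ b y, Θ (y * jt 1 b) = Θ y * jt 1 b) (y : Forms k A) :
    rot σ Θ (opn (clo σ y)) = rot σ Θ y :=
  apply_opn_clo σ (rot σ Θ) (clo_rot_al_mul σ hr) y

theorem bd_connes_zero (x : Chain k A 0) : bd σ 0 (connes σ 0 x) = autC σ 0 x - x := by
  apply embC_injective
  rw [map_sub, ← clo_dF_rot_id, dF_chF_zero, map_zero, map_zero, add_zero, ← clo_dF_chF, ← opn_embC,
    ← clo_rot_id_chF, clo_dF_opn_clo]

/-- `clo_dF_rot_id`, read on chains. The Connes operator is thus a homotopy from the identity to the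
action of σ, and it anticommutes with ∂ only on fixed chains. -/
theorem bd_connes_succ {r : ℕ} (x : Chain k A (r + 1)) :
    bd σ (r + 1) (connes σ (r + 1) x) + connes σ r (bd σ r x) = autC σ (r + 1) x - x := by
  apply embC_injective
  rw [map_sub, ← clo_dF_rot_id, map_add, ← clo_dF_chF, ← opn_embC, ← clo_rot_id_chF,
    clo_dF_opn_clo, ← clo_rot_id_chF σ (bd σ r x), ← opn_embC (bd σ r x), ← clo_dF_chF,
    rot_opn_clo σ fun _ _ => rfl]

end ChainsAsForms

/-! ### Insertion of the Casimir element of a chain -/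

section Insertion

variable {k : Type u} {A : Type v} [Field k] [Ring A] [Algebra k A] [FiniteDimensional k A]
  (F : FrobeniusForm k A) {ν : A ≃ₐ[k] A} (hν : IsNakayama F ν) {r s : ℕ}

variable (ν) in
/-- The cochain with value `casimir x`. -/
def casC (x : Chain k A r) : TP k A 0 →ₗ[k] A ⊗[k] TP k A (r + 1) :=
  piR r ∘ₗ constC r (gam F ν r x)

variable (ν) in
theorem casC_emptyWord (x : Chain k A r) : casC F ν x emptyWord = piR r (gam F ν r x) := by
  rw [casC, LinearMap.comp_apply, constC_emptyWord]

variable (ν) in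
/-- Multiplication by `casimir x` in the middle. -/
def insM (x : Chain k A r) : Forms k A →ₗ[k] Forms k A := opM (casC F ν x)

variable (ν) in
/-- The signed sum of all insertions of `casimir x` into the middle factor. -/
def insL (x : Chain k A r) : Forms k A →ₗ[k] Forms k A := opLam ((-1) ^ r) (casC F ν x)

variable (ν) in
/-- The insertion of `gam x` behind the middle factor. -/
def insN (x : Chain k A r) : Forms k A →ₗ[k] Forms k A :=
  ext (LinearMap.mulRight k (sh (embB (gam F ν r x))) ∘ₗ jt.flip 1 ∘ₗ
    (gr (-(-1) ^ r)).toLinearMap)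

variable (ν) in
theorem insM_jt (x : Chain k A r) (u : WordAlg k A) (b : A) :
    insM F ν x (jt u b) = embW (piR r (gam F ν r x)) * jt u b := by
  have h := opM_jt (casC F ν x) emptyWord u b
  rwa [toWord_emptyWord, one_mul, casC_emptyWord] at h

variable (ν) in
theorem insM_al_mul (x : Chain k A r) (a : A) (y : Forms k A) :
    insM F ν x (al a * y) = al a * insM F ν x y := opM_al_mul _ _ _

variable (ν) in
theorem insM_mul_jt_one (x : Chain k A r) (b : A) (y : Forms k A) :
    insM F ν x (y * jt 1 b) = insM F ν x y * jt 1 b := opM_mul_jt_one _ _ _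

variable (ν) in
theorem insM_chF (x : Chain k A r) (c : Chain k A s) :
    insM F ν x (chF c) = embW (piR r (gam F ν r x)) * chF c := by
  induction c using chain_induction with
  | h0 => simp
  | hadd x y hx hy => simp only [map_add, mul_add, hx, hy]
  | hc a w => rw [chF_tmul, insM_jt]

variable (ν) in
theorem insM_jt_mul_sh (x : Chain k A r) (u : WordAlg k A) (z : Forms k A) :
    insM F ν x (jt u 1 * sh z) = embW (piR r (gam F ν r x)) * (jt u 1 * sh z) := by
  refine sh_induction (p := fun y => insM F ν x (jt u 1 * y) =
    embW (piR r (gam F ν r x)) * (jt u 1 * y)) (by simp)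
    (fun x y hx hy => by simp only [map_add, mul_add, hx, hy]) (fun c v b => ?_) z
  rw [jt_mul_jt, insM_jt]

variable (ν) in
theorem insL_al_mul (x : Chain k A r) (a : A) (y : Forms k A) :
    insL F ν x (al a * y) = al a * insL F ν x y := opLam_al_mul _ _ _ _

variable (ν) in
theorem insL_mul_jt_one (x : Chain k A r) (b : A) (y : Forms k A) :
    insL F ν x (y * jt 1 b) = insL F ν x y * jt 1 b := opLam_mul_jt_one _ _ _ _

variable (ν) in
theorem insN_jt (x : Chain k A r) (u : WordAlg k A) (b : A) :
    insN F ν x (jt u b) =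
      jt (gr (-(-1) ^ r) u) 1 * sh (embB (gam F ν r x)) * jt 1 b := by
  rw [insN, ext_jt]; rfl

variable (ν) in
theorem insN_al_mul (x : Chain k A r) (a : A) (y : Forms k A) :
    insN F ν x (al a * y) = al a * insN F ν x y := ext_al_mul _ _ _

omit [FiniteDimensional k A] in
theorem opLam_zero_right {m P : ℕ} (e : k) (y : Forms k A) :
    opLam e (0 : TP k A m →ₗ[k] A ⊗[k] TP k A P) y = 0 := by
  have h1 : ∀ u, opB (0 : TP k A m →ₗ[k] A ⊗[k] TP k A P) u = 0 := fun u => by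
    induction u using word_front_induction m with
    | h0 => rw [map_zero]
    | hadd x y hx hy => rw [map_add, hx, hy, add_zero]
    | hs N hN w => rw [opB_short _ hN]
    | hl w u => rw [opB_mul, LinearMap.zero_apply, map_zero, map_zero, zero_mul]
  induction y using forms_jt_induction with
  | h0 => rw [map_zero]
  | hadd x y hx hy => rw [map_add, hx, hy, add_zero]
  | hc a u b =>
    rw [opLam_al_mul, opLam_jt]
    have h2 : opL e (0 : TP k A m →ₗ[k] A ⊗[k] TP k A P) u = 0 := by
      induction u using word_cons_induction with
      | h1 c => rw [map_smul, opL_one, h1, smul_zero]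
      | hadd x y hx hy => rw [map_add, hx, hy, add_zero]
      | hc c u hu => rw [opL_lett_mul, h1, hu, mul_zero, smul_zero, add_zero]
    rw [h2, map_zero, LinearMap.zero_apply, mul_zero]

variable (ν) in
theorem eaugA_insL (x : Chain k A r) (y : Forms k A) : eaugA (insL F ν x y) = 0 := eaugA_opLam _ _ _

variable (ν) in
theorem grF_insL (x : Chain k A r) (y : Forms k A) :
    grF (-1) (insL F ν x (grF (-1) y)) = (-1 : k) ^ r • insL F ν x y := by
  induction y using forms_jt_induction with
  | h0 => simp
  | hadd x y hx hy => simp only [map_add, smul_add, hx, hy]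
  | hc a u b =>
    induction u using word_induction with
    | h0 => simp
    | hadd x y hx hy =>
      simp only [map_add, smul_add, mul_add, LinearMap.add_apply] at hx hy ⊢
      rw [hx, hy]
    | hw n w =>
      obtain ⟨w', hw'⟩ := opL_mem_range ((-1) ^ r) (casC F ν x) (add_zero n) w
      rw [map_mul (grF (-1)), grF_al, grF_jt, insL_al_mul, insL_al_mul, map_mul (grF (-1)), grF_al,
        gr_toWord, map_smul, LinearMap.smul_apply, map_smul, map_smul, insL, opLam_jt, ← hw',
        grF_jt, gr_toWord, map_smul, LinearMap.smul_apply, smul_smul, ← mul_smul_comm,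
        ← pow_add]
      congr 2
      exact neg_one_pow_eq_of (show n + (n + (r + 1 + 1)) = r + 2 * (n + 1) by ring)

omit [FiniteDimensional k A] in
theorem dF_embW_piR {x : Bar k A r} (hx : x ∈ Omega k A r) :
    dF (embW (piR r x)) = (-1 : k) ^ (r + 1) • embB x := by
  rw [embW, LinearMap.comp_apply, dF_embB, d_close_piR hx, map_smul]

include hν

theorem isDelta_casC {x : Chain k A r} (hx : x ∈ hatZ F ν r) :
    IsDelta ((-1 : k) ^ r) (casC F ν x) (0 : TP k A 1 →ₗ[k] A ⊗[k] TP k A (r + 1)) := by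
  have h := isDelta_delta (constC_gam_mem_extZ F hν hx).1
  have h2 : delta k A 0 r (constC r (gam F ν r x)) = 0 :=
    LinearMap.mem_ker.1 (constC_gam_mem_extZ F hν hx).2
  rwa [h2, LinearMap.comp_zero, add_zero] at h

theorem gam_mem_Omega {x : Chain k A r} (hx : x ∈ hatZ F ν r) : gam F ν r x ∈ Omega k A r :=
  (gam_mem_Omega_iff F hν x).2 hx

/-- The inserted element is a 0-cocycle, so the general formula has no term from its coboundary;
there remain the insertion in front and, as the defect, the insertion behind. -/
theorem dF_insL {x : Chain k A r} (hx : x ∈ hatZ F ν r) (y : Forms k A) :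
    dF (insL F ν x y) = (-1 : k) ^ r • insL F ν x (dF y) +
      (insM F ν x + (-1 : k) ^ r • insN F ν x) y := by
  have h := isDelta_casC F hν hx
  have key : opK ((-1 : k) ^ r) (casC F ν x) (0 : TP k A 1 →ₗ[k] A ⊗[k] TP k A (r + 1)) y =
      (-1 : k) ^ r • insN F ν x y := by
    induction y using forms_jt_induction with
    | h0 => simp
    | hadd x y hx hy => simp only [map_add, smul_add, hx, hy]
    | hc a u b =>
      rw [opK_al_mul, insN_al_mul, ← mul_smul_comm]
      congr 1
      induction u using word_induction with
      | h0 => simp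
      | hadd x y hx hy => simp only [map_add, smul_add, LinearMap.add_apply, hx, hy]
      | hw n w =>
        have h1 := opK_append h w emptyWord b
        rw [toWord_emptyWord, mul_one] at h1
        rw [h1, insN_jt, gr_toWord, casC_emptyWord, dF_mul_jt, dF_embW_piR (gam_mem_Omega F hν hx),
          smul_mul_assoc, map_smul, sh_mul_jt, map_smul, LinearMap.smul_apply, smul_mul_assoc,
          smul_mul_assoc, mul_smul_comm, mul_assoc, pow_succ]
        module
  rw [opK_apply, opLam_zero_right] at key
  rw [LinearMap.add_apply, LinearMap.smul_apply, ← key, insL, insM]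
  module

end Insertion

/-! ### The ⋆-product as insertion in front or behind -/

section StarProduct

variable {k : Type u} {A : Type v} [Field k] [Ring A] [Algebra k A]

theorem appendR_add_left {a b n : ℕ} (h : a + b = n) (x y : A ⊗[k] TP k A a) :
    appendR h (x + y) = appendR h x + appendR h y := by
  simp only [appendR, map_add, LinearMap.comp_add]

theorem appendR_smul_left {a b n : ℕ} (h : a + b = n) (c : k) (x : A ⊗[k] TP k A a) :
    appendR h (c • x) = c • appendR h x := by
  simp only [appendR, map_smul, LinearMap.comp_smul]

variable [FiniteDimensional k A] (F : FrobeniusForm k A) (ν : A ≃ₐ[k] A) {r s n : ℕ}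

/-- The star product as a bilinear map. -/
def starB (h : r + s + 1 = n) : Chain k A r →ₗ[k] Chain k A s →ₗ[k] Chain k A n :=
  LinearMap.mk₂ k (star F ν h)
    (fun x y z => by simp only [star, map_add, Finset.sum_add_distrib])
    (fun c x z => by simp only [star, map_smul, Finset.smul_sum])
    (fun x y z => by
      simp only [star, map_add, appendR_add_left, LinearMap.add_apply, Finset.sum_add_distrib])
    (fun c x z => by
      simp only [star, map_smul, appendR_smul_left, LinearMap.smul_apply, Finset.smul_sum])

theorem starB_apply (h : r + s + 1 = n) (x : Chain k A r) (y : Chain k A s) :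
    starB F ν h x y = star F ν h x y := rfl

theorem star_tmul (h : r + s + 1 = n) (a b : A) (v : TP k A r) (w : TP k A s) :
    star F ν h (a ⊗ₜ v) (b ⊗ₜ w) = ∑ i, (dualV F i * b) ⊗ₜ
      conc (show s + (r + 1) = n by omega)
        (w ⊗ₜ cons r (proj k A (dualU (k := k) i * ν a) ⊗ₜ v)) := by
  simp [star, appendR]

theorem embC_star_tmul (h : r + s + 1 = n) (a b : A) (v : TP k A r) (w : TP k A s) :
    embC (star F ν h (a ⊗ₜ v) (b ⊗ₜ w)) = ∑ i, (dualV F i * b) ⊗ₜ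
      (toWord w * (lett k A (proj k A (dualU (k := k) i * ν a)) * toWord v)) := by
  rw [star_tmul, map_sum]
  refine Finset.sum_congr rfl fun i _ => ?_
  rw [embC_tmul, toWord_conc, toWord_cons]

theorem chF_star (h : r + s + 1 = n) (x : Chain k A r) (b : A) (w : TP k A s) :
    chF (star F ν h x (b ⊗ₜ w)) = jt (toWord w) 1 * sh (embB (gam F ν r x)) * jt 1 b := by
  rw [← starB_apply]
  induction x using chain_induction with
  | h0 => simp
  | hadd x y hx hy => simp only [map_add, LinearMap.add_apply, mul_add, add_mul, hx, hy]
  | hc a v =>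
    rw [starB_apply, star_tmul, map_sum, gam_tmul, map_sum, map_sum, Finset.mul_sum, Finset.sum_mul]
    refine Finset.sum_congr rfl fun i _ => ?_
    rw [chF_tmul, embB_tmul, sh_al_mul_jt, jt_mul_jt, jt_mul_jt, toWord_conc, toWord_cons, one_mul,
      mul_one]

theorem insN_chF (h : r + s + 1 = n) (x : Chain k A r) (c : Chain k A s) :
    insN F ν x (chF c) = (-(-1 : k) ^ r) ^ s • chF (star F ν h x c) := by
  rw [← starB_apply]
  induction c using chain_induction with
  | h0 => simp
  | hadd x y hx hy => simp only [map_add, smul_add, hx, hy]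
  | hc b w =>
    rw [chF_tmul, insN_jt, starB_apply, chF_star, gr_toWord, map_smul, LinearMap.smul_apply,
      smul_mul_assoc, smul_mul_assoc]

variable {ν} (hν : IsNakayama F ν)
include hν

/-- The values of a bilinear map on the Casimir element, with the first factor twisted. -/
theorem sum_nakayama_symm_dualU {M : Type*} [AddCommGroup M] [Module k M]
    (Φ : A →ₗ[k] A →ₗ[k] M) :
    ∑ j, Φ (ν.symm (dualU (k := k) j)) (dualV F j) = ∑ j, Φ (dualV F j) (dualU (k := k) j) := by
  have h1 := sum_nakayama_dualU_dualV F hν (Φ ∘ₗ ν.symm.toLinearMap)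
  have h2 := sum_dualV_dualU F hν Φ
  simp only [LinearMap.comp_apply, AlgEquiv.toLinearMap_apply, AlgEquiv.symm_apply_apply] at h1
  rw [h2, h1]

/-- Closing applies ν⁻¹ to the left leg of the Casimir element; the flip of the two legs and
`sum_dualU_mul` for the factor c then give the ⋆-product, with x as second argument. -/
theorem clo_insM_chF (h : s + r + 1 = n) (x : Chain k A r) (c : Chain k A s) :
    clo ν.symm (insM F ν x (chF c)) = embC (star F ν h c x) := by
  rw [insM_chF, ← starB_apply]
  induction x using chain_induction with
  | h0 => simp
  | hadd x y hx hy => simp only [map_add, add_mul, hx, hy]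
  | hc b v =>
    induction c using chain_induction with
    | h0 => simp
    | hadd x y hx hy => simp only [map_add, mul_add, LinearMap.add_apply, hx, hy]
    | hc c w =>
      let Φ : A →ₗ[k] A →ₗ[k] A ⊗[k] WordAlg k A :=
        (TensorProduct.mk k A (WordAlg k A)).compl₁₂ (LinearMap.mulRight k b)
          (LinearMap.mulLeft k (toWord v) ∘ₗ LinearMap.mulRight k (toWord w) ∘ₗ lett k A ∘ₗ proj k A)
      have hΦ : ∀ p q, Φ p q = (p * b) ⊗ₜ (toWord v * (lett k A (proj k A q) * toWord w)) :=
        fun p q => rfl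
      have h1 := sum_nakayama_symm_dualU F hν (Φ ∘ₗ LinearMap.mulLeft k c)
      have h2 := sum_dualU_mul F hν Φ.flip c
      simp only [LinearMap.comp_apply, LinearMap.mulLeft_apply, LinearMap.flip_apply] at h1 h2
      rw [starB_apply, embC_star_tmul, gam_tmul, map_sum, map_sum, Finset.sum_mul, map_sum]
      simp only [← hΦ]
      rw [h2, ← h1]
      refine Finset.sum_congr rfl fun i _ => ?_
      rw [piR_tmul, embW_tmul, chF_tmul, mul_assoc, jt_mul_jt, clo_al_mul_jt, toWord_snoc, hΦ,
        map_mul, AlgEquiv.symm_apply_apply, one_mul, mul_assoc, mul_assoc]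

end StarProduct

/-! ### Boundaries of insertions and of rotated insertions -/

section InsertionChains

variable {k : Type u} {A : Type v} [Field k] [Ring A] [Algebra k A] [FiniteDimensional k A]
  (F : FrobeniusForm k A) {ν : A ≃ₐ[k] A} {r s n : ℕ}

variable (ν) in
/-- The chain obtained from `c` by inserting `casimir x` in all positions. -/
def lamC (n : ℕ) (x : Chain k A r) (c : Chain k A s) : Chain k A n :=
  comp k A n (clo ν.symm (insL F ν x (chF c)))

variable (ν) in
theorem chF_lamC (h : r + s + 2 = n) (x : Chain k A r) (c : Chain k A s) :
    chF (lamC F ν n x c) = insL F ν x (chF c) := by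
  suffices ∃ z : Chain k A n, chF z = insL F ν x (chF c) by
    obtain ⟨z, hz⟩ := this
    rw [lamC, ← hz, clo_chF, comp_embC]
  induction c using chain_induction with
  | h0 => exact ⟨0, by simp⟩
  | hadd x y hx hy =>
    obtain ⟨z, hz⟩ := hx
    obtain ⟨z', hz'⟩ := hy
    exact ⟨z + z', by rw [map_add, map_add, map_add, hz, hz']⟩
  | hc a w =>
    obtain ⟨w', hw'⟩ := opL_mem_range ((-1) ^ r) (casC F ν x) (add_zero s) w
    obtain rfl : s + (r + 1 + 1) = n := by omega
    exact ⟨a ⊗ₜ w', by rw [chF_tmul, chF_tmul, insL, opLam_jt, hw']⟩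

variable (ν) in
theorem clo_insL_chF (h : r + s + 2 = n) (x : Chain k A r) (c : Chain k A s) :
    clo ν.symm (insL F ν x (chF c)) = embC (lamC F ν n x c) := by
  rw [← chF_lamC F ν h, clo_chF]

omit [FiniteDimensional k A] in
theorem clo_comp_al_mul (σ : A ≃ₐ[k] A) {Θ : Forms k A →ₗ[k] Forms k A}
    (hl : ∀ a y, Θ (al a * y) = al a * Θ y) (hr : ∀ b y, Θ (y * jt 1 b) = Θ y * jt 1 b)
    (y : Forms k A) : clo σ (Θ (opn (clo σ y))) = clo σ (Θ y) :=
  apply_opn_clo σ (clo σ ∘ₗ Θ) (fun a y => by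
    rw [LinearMap.comp_apply, LinearMap.comp_apply, hl, hr, clo_al_mul]) y

variable (hν : IsNakayama F ν)
include hν

/-- Up to boundaries, the star product is graded commutative on cycles. -/
theorem clo_dF_insL {x : Chain k A r} (hx : x ∈ hatZ F ν r) (h : s + r + 1 = n)
    {c : Chain k A s} (hc : clo ν.symm (dF (chF c)) = 0) :
    clo ν.symm (dF (insL F ν x (chF c))) = embC (star F ν h c x) +
      ((-1 : k) ^ r * (-(-1 : k) ^ r) ^ s) • embC (star F ν (by omega : r + s + 1 = n) x c) := by
  rw [dF_insL F hν hx, map_add, map_smul, ← clo_comp_al_mul ν.symm (insL_al_mul F ν x)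
    (insL_mul_jt_one F ν x) (dF (chF c)), hc, map_zero, map_zero, map_zero, smul_zero, zero_add,
    LinearMap.add_apply, LinearMap.smul_apply, map_add, map_smul, clo_insM_chF F hν h,
    insN_chF F ν (by omega : r + s + 1 = n), map_smul, clo_chF, smul_smul]

-- The insertion in front of the moving part ends up in front of the whole rotated word, so it
-- commutes with rotation; after closing, B(y) ⋆ x appears.
omit hν in
theorem rot_insM (σ : A ≃ₐ[k] A) (x : Chain k A r) (y : Forms k A) :
    rot σ (insM F ν x) y = insM F ν x (rot σ LinearMap.id y) := by
  rw [rot, rot, cyc_comp]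
  congr 1
  congr 1
  refine LinearMap.ext fun t => LinearMap.ext fun f => ?_
  simp only [LinearMap.compl₂_apply, LinearMap.compr₂_apply, glueB_apply, LinearMap.comp_apply,
    LinearMap.id_apply]
  generalize (grF (-1)).toLinearMap f = f
  induction f using forms_jt_induction with
  | h0 => simp
  | hadd x y hx hy => simp only [map_add, hx, hy]
  | hc a u b =>
    rw [insM_al_mul, insM_jt, glue_al_mul, glue_al_mul, insM_al_mul, glue_jt, insM_jt_mul_sh]
    congr 1
    generalize piR r (gam F ν r x) = z
    induction z with
    | zero => simp
    | add x y hx hy => simp only [map_add, add_mul, hx, hy]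
    | tmul p w =>
      rw [embW_tmul, mul_assoc, jt_mul_jt, one_mul, glue_tmul, mul_assoc, ← mul_assoc (jt _ _),
        jt_mul_jt, one_mul]

theorem clo_rot_insM (h : s + 1 + r + 1 = n) (x : Chain k A r) (y : Chain k A s) :
    clo ν.symm (rot ν.symm (insM F ν x) (chF y)) =
      embC (star F ν h (connes ν.symm s y) x) := by
  rw [rot_insM, ← clo_comp_al_mul ν.symm (insM_al_mul F ν x) (insM_mul_jt_one F ν x),
    clo_rot_id_chF, opn_embC, clo_insM_chF F hν h]

/-- The boundary which relates the insertions to the twisted Connes operator. -/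
theorem clo_dF_rot_insL {x : Chain k A r} (hx : x ∈ hatZ F ν r) (h : r + s + 2 = n)
    {y : Chain k A s} (hy : clo ν.symm (dF (chF y)) = 0) :
    clo ν.symm (dF (rot ν.symm (insL F ν x) (chF y))) =
      embC (star F ν (by omega : s + 1 + r + 1 = n) (connes ν.symm s y) x)
        + (-1 : k) ^ r • clo ν.symm (rot ν.symm (insN F ν x) (chF y))
        - (-1 : k) ^ r • embC (lamC F ν n x y) := by
  have h1 := clo_dF_rot ν.symm (insL_al_mul F ν x) (grF_insL F ν x) (dF_insL F hν hx) (chF y)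
  rw [← rot_opn_clo ν.symm (insL_mul_jt_one F ν x) (dF (chF y)), hy, map_zero, map_zero, map_zero,
    smul_zero, add_zero] at h1
  have h2 : ((LinearMap.mul k (Forms k A)).flip).compl₂
      (al ∘ₗ eaugA ∘ₗ insL F ν x ∘ₗ (grF (-1)).toLinearMap) =
        (0 : k) • (LinearMap.mul k (Forms k A)).flip := by
    refine LinearMap.ext fun t => LinearMap.ext fun f => ?_
    simp only [LinearMap.compl₂_apply, LinearMap.comp_apply, eaugA_insL, map_zero, zero_smul,
      LinearMap.zero_apply]
  have h3 : rot ν.symm (insM F ν x + (-1 : k) ^ r • insN F ν x) (chF y) =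
      rot ν.symm (insM F ν x) (chF y) + (-1 : k) ^ r • rot ν.symm (insN F ν x) (chF y) := by
    rw [rot, rot, rot, ← cyc_smul, ← cyc_add]
    congr 1
    congr 1
    refine LinearMap.ext fun t => LinearMap.ext fun f => ?_
    simp only [LinearMap.compl₂_apply, LinearMap.comp_apply, LinearMap.add_apply,
      LinearMap.smul_apply, map_add, map_smul]
  rw [h2, cyc_smul, zero_smul, map_zero, add_zero, clo_insL_chF F ν h, h3, map_add, map_smul,
    clo_rot_insM F hν] at h1
  exact h1

end InsertionChains

/-! ### The Connes operator on ⋆-products -/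

section ConnesStar

variable {k : Type u} {A : Type v} [Field k] [Ring A] [Algebra k A]

theorem spl_gr (σ : A ≃ₐ[k] A) (c : k) (u : WordAlg k A) :
    spl σ (gr c u) = TensorProduct.map (gr c).toLinearMap (gr c).toLinearMap (spl σ u) := by
  induction u using word_cons_induction with
  | h1 a => simp [spl_one]
  | hadd x y hx hy => simp only [map_add, hx, hy]
  | hc a u hu =>
    rw [map_mul (gr c), gr_lett, smul_mul_assoc, map_smul (spl σ), spl_lett_mul, spl_lett_mul, hu,
      map_add, smul_add]
    congr 1
    · simp [gr_lett]
    · generalize spl σ u = z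
      induction z with
      | zero => simp
      | add x y hx hy => simp only [map_add, smul_add, hx, hy]
      | tmul x y =>
        simp only [TensorProduct.map_tmul, AlgHom.toLinearMap_apply, LinearMap.mulLeft_apply,
          map_mul (gr c), gr_lett, gr_gr, smul_mul_assoc, TensorProduct.smul_tmul', mul_comm]

/-- The cyclic sum of a product of a word and a form without left factor. -/
theorem cyc_jt_mul_sh {M : Type*} [AddCommGroup M] [Module k M] (σ : A ≃ₐ[k] A) (q : k)
    {z : Forms k A} (hz : grF (-1) z = q • z) {j : ℕ} (w : TP k A j)
    (G : Forms k A →ₗ[k] Forms k A →ₗ[k] M) :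
    cyc σ G (jt (toWord w) 1 * sh z) =
      TensorProduct.lift (G.compl₁₂ (jt.flip 1 ∘ₗ (gr (-q)).toLinearMap)
        (LinearMap.mulRight k (sh z) ∘ₗ jt.flip 1)) (spl σ (toWord w)) +
      cyc σ (G.compl₁₂ (LinearMap.mulLeft k (jt (autW σ (toWord w)) 1) ∘ₗ sh)
        (grF ((-1) ^ (j + 1))).toLinearMap) z := by
  induction j generalizing G with
  | zero =>
    obtain ⟨c, rfl⟩ := exists_smul_emptyWord w
    have h : cyc σ (G.compl₁₂ (LinearMap.mulLeft k (jt (autW σ (c • 1)) 1) ∘ₗ sh)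
        (grF ((-1) ^ (0 + 1))).toLinearMap) z = c • cyc σ (G.compl₁₂ sh (grF (-1)).toLinearMap) z := by
      rw [← cyc_smul]
      refine congrArg (cyc σ · z) (LinearMap.ext fun t => LinearMap.ext fun f => ?_)
      simp [jt_one_one]
    rw [map_smul, toWord_emptyWord, h, map_smul, LinearMap.smul_apply, jt_one_one, smul_mul_assoc,
      one_mul, map_smul, cyc_sh, map_smul, spl_one, map_smul, smul_add]
    simp [jt_one_one]
  | succ j ih =>
    induction w using cons_induction with
    | h0 =>
      have h : cyc σ (G.compl₁₂ (LinearMap.mulLeft k (jt (autW σ 0) 1) ∘ₗ sh)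
          (grF ((-1) ^ (j + 1 + 1))).toLinearMap) z = (0 : k) • cyc σ G z := by
        rw [← cyc_smul]
        refine congrArg (cyc σ · z) (LinearMap.ext fun t => LinearMap.ext fun f => ?_)
        simp
      rw [map_zero, h]
      simp
    | hadd x y hx hy =>
      have h : cyc σ (G.compl₁₂ (LinearMap.mulLeft k (jt (autW σ (toWord x + toWord y)) 1) ∘ₗ sh)
          (grF ((-1) ^ (j + 1 + 1))).toLinearMap) z =
          cyc σ (G.compl₁₂ (LinearMap.mulLeft k (jt (autW σ (toWord x)) 1) ∘ₗ sh)
            (grF ((-1) ^ (j + 1 + 1))).toLinearMap) z +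
          cyc σ (G.compl₁₂ (LinearMap.mulLeft k (jt (autW σ (toWord y)) 1) ∘ₗ sh)
            (grF ((-1) ^ (j + 1 + 1))).toLinearMap) z := by
        rw [← cyc_add]
        refine congrArg (cyc σ · z) (LinearMap.ext fun t => LinearMap.ext fun f => ?_)
        simp [add_mul]
      rw [map_add, h, map_add, map_add, map_add, LinearMap.add_apply, add_mul, map_add, hx, hy]
      abel
    | hc c w =>
      have h1 : jt (lett k A c * toWord w) 1 * sh z =
          sh (al (sec k A c) * (jt (toWord w) 1 * sh z)) := by
        rw [← mul_assoc, sh_mul_sh, sh_al_mul_jt, proj_sec]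
      have h2 : lett k A (proj k A (σ (sec k A c))) = lett k A (barMap σ c) := by
        rw [← barMap_proj, proj_sec]
      rw [toWord_cons, h1, cyc_sh, cyc_al_mul, ih, ← h1, spl_lett_mul, map_add, ← add_assoc]
      congr 1
      · congr 1
        · simp [jt_one_one]
        · generalize spl σ (toWord w) = y
          induction y with
          | zero => simp
          | add x y hx hy => simp only [map_add, hx, hy]
          | tmul x y =>
            simp only [TensorProduct.lift.tmul, TensorProduct.map_tmul, LinearMap.compl₁₂_apply,
              LinearMap.comp_apply, LinearMap.mulLeft_apply, LinearMap.mulRight_apply,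
              AlgHom.toLinearMap_apply, LinearMap.flip_apply, map_mul (gr (-q)), gr_lett]
            rw [sh_al_mul_jt, h2, map_mul (grF (-1)), grF_sh, hz, grF_jt, smul_mul_assoc, map_smul,
              map_smul, LinearMap.smul_apply, map_smul, LinearMap.smul_apply, smul_smul,
              mul_smul_comm, map_smul, neg_one_mul]
      · refine congrArg (cyc σ · z) (LinearMap.ext fun t => LinearMap.ext fun f => ?_)
        simp only [LinearMap.compl₁₂_apply, LinearMap.comp_apply, LinearMap.mulLeft_apply,
          AlgHom.toLinearMap_apply]
        rw [← mul_assoc, sh_mul_sh, sh_al_mul_jt, h2, map_mul (autW σ), autW_lett, grF_grF, ← pow_succ']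

omit [Algebra k A] in
theorem neg_neg_one_pow_mul_self (r : ℕ) : (-(-1 : k) ^ r) * (-(-1 : k) ^ r) = 1 := by
  rw [neg_mul_neg, neg_one_pow_mul_self]

variable [FiniteDimensional k A] (F : FrobeniusForm k A) {ν : A ≃ₐ[k] A}
  (hν : IsNakayama F ν) {r s n : ℕ}

omit [FiniteDimensional k A] in
theorem grF_neg_one_embB (x : Bar k A r) : grF (-1) (embB x) = (-1 : k) ^ r • embB x := by
  induction x using bar_induction with
  | h0 => simp
  | hadd x y hx hy => simp only [map_add, smul_add, hx, hy]
  | hc a w b =>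
    rw [embB_tmul, map_mul (grF (-1)), grF_al, grF_jt, gr_toWord, map_smul, LinearMap.smul_apply,
      mul_smul_comm]

include hν in
/-- The Connes operator on star products. -/
theorem rot_id_star (h : r + s + 1 = n) (x : Chain k A r) (y : Chain k A s) :
    rot ν.symm LinearMap.id (chF (star F ν h x y)) =
      (-(-1 : k) ^ r) ^ (s + 1) • rot ν.symm (insN F ν x) (chF y) +
        rot ν.symm (insN F ν (autC ν.symm s y)) (chF x) := by
  have hadd : ∀ y y' : Chain k A s, rot ν.symm (insN F ν (autC ν.symm s (y + y'))) (chF x) =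
      rot ν.symm (insN F ν (autC ν.symm s y)) (chF x) +
        rot ν.symm (insN F ν (autC ν.symm s y')) (chF x) := fun y y' => by
    rw [rot, rot, rot, ← cyc_add]
    refine congrArg (cyc ν.symm · (chF x)) (LinearMap.ext fun t => LinearMap.ext fun f => ?_)
    simp only [LinearMap.compl₂_apply, LinearMap.comp_apply, LinearMap.add_apply, glueB_apply,
      ← map_add]
    congr 1
    generalize (grF (-1)).toLinearMap f = f
    induction f using forms_jt_induction with
    | h0 => simp
    | hadd x y hx hy => rw [map_add, hx, hy, map_add, map_add]; abel
    | hc a u b =>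
      simp only [insN_al_mul, insN_jt, map_add, mul_add, add_mul]
  rw [← starB_apply]
  induction y using chain_induction with
  | h0 =>
    have h0 := hadd 0 0
    rw [add_zero, left_eq_add] at h0
    rw [h0]
    simp
  | hadd y y' hy hy' => rw [hadd, map_add, map_add, map_add, hy, hy', map_add, map_add]; module
  | hc b w =>
    have hz : grF (-1) (embB (gam F ν r x) * jt 1 b) =
        (-1 : k) ^ r • (embB (gam F ν r x) * jt 1 b) := by
      rw [map_mul (grF (-1)), grF_neg_one_embB, grF_jt_one, smul_mul_assoc]
    rw [starB_apply, chF_star, mul_assoc, ← sh_mul_jt, rot, cyc_jt_mul_sh ν.symm _ hz]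
    -- Cuts inside w give rotations of y with x inserted. Cuts inside the part that comes from x
    -- give, after a flip of the Casimir element, rotations of x with the twist of y inserted.
    congr 1
    · have h1 : (-(-1 : k) ^ r) ^ (s + 1) • rot ν.symm (insN F ν x) (chF (b ⊗ₜ w)) =
          (-(-1 : k) ^ r) • rot ν.symm (insN F ν x)
            (jt (gr (-(-1 : k) ^ r) (toWord w)) b) := by
        rw [gr_toWord, map_smul, LinearMap.smul_apply, map_smul, smul_smul, chF_tmul, pow_succ']
      rw [h1, rot, cyc_jt, spl_gr]
      generalize spl ν.symm (toWord w) = y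
      induction y with
      | zero => simp
      | add x y hx hy => simp only [map_add, smul_add, hx, hy]
      | tmul v v' =>
        simp only [TensorProduct.lift.tmul, TensorProduct.map_tmul, LinearMap.compl₁₂_apply,
          LinearMap.compl₂_apply, LinearMap.id_apply,
          LinearMap.comp_apply, LinearMap.mulRight_apply,
          AlgHom.toLinearMap_apply, LinearMap.flip_apply, glueB_apply]
        rw [map_mul (grF (-1)), grF_sh, hz, grF_jt, grF_jt, insN_jt, gr_gr, gr_gr, map_smul,
          smul_smul, mul_smul_comm, map_smul, sh_mul_jt, ← mul_assoc]
        have h2 : -(-1 : k) ^ r * -1 * -(-1) ^ r = -1 := by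
          rw [mul_right_comm, neg_neg_one_pow_mul_self, one_mul]
        rw [h2, neg_one_mul]
    · clear hadd
      induction x using chain_induction with
      | h0 => simp
      | hadd x y hx hy =>
        have e1 : ∀ z : Chain k A r, grF (-1) (embB (gam F ν r z) * jt 1 b) =
            (-1 : k) ^ r • (embB (gam F ν r z) * jt 1 b) := fun z => by
          rw [map_mul (grF (-1)), grF_neg_one_embB, grF_jt_one, smul_mul_assoc]
        rw [map_add, map_add, add_mul, map_add, hx (e1 x), hy (e1 y), map_add, map_add]
      | hc a v =>
        clear hz
        rw [gam_tmul, map_sum, Finset.sum_mul, map_sum, chF_tmul, rot, cyc_jt]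
        have h1 : ∀ i, cyc ν.symm ((glueB.compl₂ (LinearMap.id ∘ₗ (grF (-1 : k)).toLinearMap)).compl₁₂
            (LinearMap.mulLeft k (jt (autW ν.symm (toWord w)) 1) ∘ₗ sh)
            (grF ((-1) ^ (s + 1))).toLinearMap)
              (embB ((dualU (k := k) i * ν a) ⊗ₜ[k] (v ⊗ₜ[k] dualV F i)) * jt 1 b) =
            TensorProduct.lift ((((glueB.compl₂ (LinearMap.id ∘ₗ (grF (-1 : k)).toLinearMap)).compl₁₂
            (LinearMap.mulLeft k (jt (autW ν.symm (toWord w)) 1) ∘ₗ sh)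
            (grF ((-1) ^ (s + 1))).toLinearMap) ∘ₗ
              LinearMap.mulLeft k (al (ν.symm (dualU (k := k) i) * a))).compl₁₂ (jt.flip 1)
                (jt.flip (dualV F i * b))) (spl ν.symm (toWord v)) := fun i => by
          rw [embB_tmul, mul_assoc, jt_mul_jt, mul_one, cyc_al_mul, cyc_jt, map_mul ν.symm,
            AlgEquiv.symm_apply_apply]
        simp only [h1]
        generalize spl ν.symm (toWord v) = y
        induction y with
        | zero => simp
        | add x y hx hy => simp only [map_add, Finset.sum_add_distrib, hx, hy]
        | tmul v v' =>
          let Φ : A →ₗ[k] A →ₗ[k] Forms k A :=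
            (((LinearMap.mul k (WordAlg k A)).compl₁₂
              (lett k A ∘ₗ proj k A ∘ₗ LinearMap.mulRight k b)
              (LinearMap.mulLeft k (autW ν.symm (toWord w)) ∘ₗ LinearMap.mulRight k v ∘ₗ
                lett k A ∘ₗ proj k A ∘ₗ LinearMap.mulRight k a)).compr₂
                (jt.flip 1 ∘ₗ LinearMap.mulLeft k (gr ((-1) ^ s) v'))).flip
          have hΦ : ∀ p q, Φ p q = jt (gr ((-1) ^ s) v' * (lett k A (proj k A (q * b)) *
              (autW ν.symm (toWord w) * (lett k A (proj k A (p * a)) * v)))) 1 := fun p q => rfl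
          have h2 := sum_nakayama_symm_dualU F hν Φ
          simp only [TensorProduct.lift.tmul, LinearMap.compl₁₂_apply,
            LinearMap.compl₂_apply, LinearMap.id_apply,
            LinearMap.comp_apply, LinearMap.mulLeft_apply,
            AlgHom.toLinearMap_apply, LinearMap.flip_apply, glueB_apply]
          have e2 : (-1 : k) * (-1) ^ (s + 1) = (-1) ^ s := by rw [pow_succ]; ring
          have e3 : -(-1 : k) ^ s * -1 = (-1) ^ s := by ring
          refine Eq.trans (Finset.sum_congr rfl fun i _ => ?_) (h2.trans ?_)
          · rw [sh_al_mul_jt, jt_mul_jt, one_mul, grF_grF, grF_jt, e2, glue_jt, sh_al_mul_jt,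
              jt_mul_jt, one_mul, hΦ]
          · have h3 : autC ν.symm s (b ⊗ₜ w) =
                ν.symm b ⊗ₜ PiTensorProduct.map (fun _ => barMap ν.symm) w := by simp [autC]
            rw [h3, grF_jt, insN_jt, gr_gr, e3, gam_tmul, map_sum, map_sum, Finset.mul_sum,
              Finset.sum_mul, map_sum]
            refine Finset.sum_congr rfl fun i _ => ?_
            rw [hΦ, embB_tmul, sh_al_mul_jt, jt_mul_jt, jt_mul_jt, glue_jt, sh_al_mul_jt, jt_mul_jt,
              toWord_map, AlgEquiv.apply_symm_apply, one_mul, mul_one, one_mul, mul_assoc,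
              mul_assoc]

end ConnesStar

/-! ### { , } and the commutator of insertions differ by a boundary -/

section BracketOnChains

variable {k : Type u} {A : Type v} [Field k] [Ring A] [Algebra k A] [FiniteDimensional k A]
  (F : FrobeniusForm k A) {ν : A ≃ₐ[k] A} {r s n : ℕ}

theorem clo_dF_chF_eq_zero {x : Chain k A r} (hx : x ∈ hatZ F ν r) :
    clo ν.symm (dF (chF x)) = 0 := by
  cases r with
  | zero => rw [dF_chF_zero, map_zero]
  | succ r =>
    have h : bd ν.symm r x = 0 := LinearMap.mem_ker.1 hx
    rw [clo_dF_chF, h, map_zero]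

theorem bd_connes_of_autC {y : Chain k A s} (hy : y ∈ hatZ F ν s) (ht : autC ν.symm s y = y) :
    bd ν.symm s (connes ν.symm s y) = 0 := by
  cases s with
  | zero => rw [bd_connes_zero, ht, sub_self]
  | succ s =>
    have h := bd_connes_succ ν.symm y
    have h2 : bd ν.symm s y = 0 := LinearMap.mem_ker.1 hy
    rwa [h2, map_zero, add_zero, ht, sub_self] at h

theorem bracketBV_eq_smul (x : Chain k A r) (y : Chain k A s) :
    bracketBV F ν x y = (-1 : k) ^ (r * s + 1) •
      ((-1 : k) ^ s • connes ν.symm (r + s + 1) (star F ν rfl x y)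
        + star F ν (by omega) (connes ν.symm r x) y
        + (-1 : k) ^ (s + 1) • star F ν (by omega) x (connes ν.symm s y)) := by
  rw [bracketBV, negOnePow_smul (k := k) (n := r * s + 1),
    negOnePow_smul (k := k) (n := s), negOnePow_smul (k := k) (n := s + 1)]
  · exact ⟨-(s + 1), by push_cast; ring⟩
  · exact ⟨-s, by ring⟩
  · exact ⟨-1, by push_cast; ring⟩

variable (ν) in
/-- The Gerstenhaber bracket of insertions. -/
def insBracket (n : ℕ) (x : Chain k A r) (y : Chain k A s) : Chain k A n :=
  (-1 : k) ^ r • lamC F ν n x y + (-(-1) ^ (r * s + s) : k) • lamC F ν n y x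

omit [Ring A] [Algebra k A] [FiniteDimensional k A] in
theorem neg_neg_one_pow_pow (r s : ℕ) : (-(-1 : k) ^ r) ^ s = (-1) ^ (r * s + s) := by
  have h : -(-1 : k) ^ r = (-1) ^ (r + 1) := by ring
  rw [h, ← pow_mul]
  congr 1
  ring

variable (hν : IsNakayama F ν)
include hν

/-- The boundaries of the two insertions are combinations of the same ⋆-products x ⋆ y and y ⋆ x by
`clo_dF_insL`, and the signs make them cancel. -/
theorem insBracket_mem_hatZ {x : Chain k A r} (hx : x ∈ hatZ F ν r) {y : Chain k A s}
    (hy : y ∈ hatZ F ν s) : insBracket F ν (r + s + 2) x y ∈ hatZ F ν (r + s + 2) := by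
  refine LinearMap.mem_ker.2 (embC_injective ?_)
  rw [← clo_dF_chF, map_zero, insBracket, map_add, map_smul, map_smul, map_add, map_smul, map_smul,
    map_add, map_smul, map_smul,
    chF_lamC F ν rfl, chF_lamC F ν (by omega),
    clo_dF_insL F hν hx (n := r + s + 1) (by omega) (clo_dF_chF_eq_zero F hy),
    clo_dF_insL F hν hy (n := r + s + 1) (by omega) (clo_dF_chF_eq_zero F hx)]
  rw [neg_neg_one_pow_pow, neg_neg_one_pow_pow, smul_add, smul_add, smul_smul, smul_smul,
    ← mul_assoc, ← mul_assoc, ← pow_add, neg_mul, neg_mul, ← pow_add, ← pow_add, ← pow_add]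
  have h1 : (-1 : k) ^ (r * s + s + s + (s * r + r)) = (-1) ^ r :=
    neg_one_pow_eq_of (show _ = r + 2 * (r * s + s) by ring)
  have h2 : (-1 : k) ^ (r + r + (r * s + s)) = (-1) ^ (r * s + s) :=
    neg_one_pow_eq_of (show _ = r * s + s + 2 * r by ring)
  rw [h1, h2]
  module

/-- The rotated insertions express B(y) ⋆ x and B(x) ⋆ y through insertions, B(x ⋆ y) is the sum of
the remaining rotated terms, and one commutation replaces B(y) ⋆ x by x ⋆ B(y). The condition on y
makes B(y) a cycle and removes the twist in `rot_id_star`. -/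
theorem bracketBV_sub_insBracket_mem {x : Chain k A r} (hx : x ∈ hatZ F ν r) {y : Chain k A s}
    (hy : y ∈ hatZ F ν s) (ht : autC ν.symm s y = y) :
    bracketBV F ν x y - insBracket F ν (r + s + 2) x y ∈
      LinearMap.range (bd ν.symm (r + s + 2)) := by
  have hc : clo ν.symm (dF (chF (connes ν.symm s y))) = 0 := by
    rw [clo_dF_chF, bd_connes_of_autC F hy ht, map_zero]
  have h1 := clo_dF_rot_insL F hν hx (n := r + s + 2) rfl (clo_dF_chF_eq_zero F hy)
  have h2 := clo_dF_rot_insL F hν hy (n := r + s + 2) (by omega) (clo_dF_chF_eq_zero F hx)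
  have h3 := clo_dF_insL F hν hx (n := r + s + 2) (by omega) hc
  have h4 : embC (connes ν.symm (r + s + 1) (star F ν rfl x y)) =
      (-(-1 : k) ^ r) ^ (s + 1) • clo ν.symm (rot ν.symm (insN F ν x) (chF y)) +
        clo ν.symm (rot ν.symm (insN F ν y) (chF x)) := by
    rw [← clo_rot_id_chF, rot_id_star F hν, ht, map_add, map_smul]
  -- The form has one summand for each of the three boundary formulas h1, h2, h3.
  refine mem_range_bd ν.symm (Y := rot ν.symm (insL F ν x) (chF y) +
    ((-1 : k) ^ (r * s + 1) • rot ν.symm (insL F ν y) (chF x) +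
      (-1 : k) • insL F ν x (chF (connes ν.symm s y)))) ?_
  have h5 : ∀ (f : Forms k A →ₗ[k] A ⊗[k] WordAlg k A) (a b : k) (t u v : Forms k A),
      f (t + (a • u + b • v)) = f t + (a • f u + b • f v) := fun f a b t u v => by
    simp only [map_add, map_smul]
  have h6 : ∀ (a b c e f : k) (t u v w z : Chain k A (r + s + 2)),
      embC (a • (b • t + u + c • v) - (e • w + f • z)) =
        a • (b • embC t + embC u + c • embC v) - (e • embC w + f • embC z) :=
    fun a b c e f t u v w z => by simp only [map_sub, map_add, map_smul]
  rw [← LinearMap.comp_apply, h5, LinearMap.comp_apply, LinearMap.comp_apply, LinearMap.comp_apply,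
    h1, h2, h3, bracketBV_eq_smul, insBracket, h6, h4, neg_neg_one_pow_pow]
  have e1 : (-1 : k) ^ (r * s + 1) * ((-1) ^ s * (-1) ^ (r * (s + 1) + (s + 1))) = (-1) ^ r := by
    rw [← pow_add, ← pow_add]
    exact neg_one_pow_eq_of (show _ = r + 2 * (r * s + s + 1) by ring)
  have e2 : (-1 : k) ^ r * (-1) ^ (r * (s + 1) + (s + 1)) = (-1) ^ (r * s) * (-1) ^ (s + 1) := by
    rw [← pow_add, ← pow_add]
    exact neg_one_pow_eq_of (show _ = _ + 2 * r by ring)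
  have e3 : (-1 : k) ^ (r * s + s) = (-1) ^ (r * s) * (-1) ^ s := pow_add _ _ _
  have e4 : (-1 : k) ^ (r * s + 1) = -(-1) ^ (r * s) := by rw [pow_succ]; ring
  rw [e2, e3]
  simp only [smul_add, smul_smul]
  rw [e1, e4]
  generalize clo ν.symm (rot ν.symm (insN F ν x) (chF y)) = z1
  generalize clo ν.symm (rot ν.symm (insN F ν y) (chF x)) = z2
  generalize embC (lamC F ν (r + s + 2) x y) = z3
  generalize embC (lamC F ν (r + s + 2) y x) = z4
  module

end BracketOnChains

/-! ### The bracket of κ-cochains -/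

section BracketKappa

variable {k : Type u} {A : Type v} [Field k] [Ring A] [Algebra k A] [FiniteDimensional k A]
  (F : FrobeniusForm k A) (ν : A ≃ₐ[k] A) {r s n : ℕ}

theorem opB_casC (x : Chain k A r) (u : WordAlg k A) :
    opB (casC F ν x) u = toWord (barW (piR r (gam F ν r x))) * u := by
  have h := opB_mul (casC F ν x) emptyWord u
  rwa [toWord_emptyWord, one_mul, casC_emptyWord] at h

theorem opL_casC_mul_lett (e : k) (x : Chain k A r) (u : WordAlg k A) (c : ABar k A) :
    opL e (casC F ν x) (u * lett k A c) = opL e (casC F ν x) u * lett k A c +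
      e • (gr e u * lett k A c * toWord (barW (piR r (gam F ν r x)))) := by
  induction u using word_cons_induction with
  | h1 a =>
    have h := opL_lett_mul e (casC F ν x) c 1
    rw [mul_one, opL_one, opB_casC, opB_casC, mul_one] at h
    rw [smul_mul_assoc, one_mul, map_smul, h, map_smul, opL_one, opB_casC, map_smul (gr e),
      map_one (gr e), mul_one]
    simp only [smul_mul_assoc, one_mul, smul_add, smul_comm a e]
  | hadd x y hx hy => simp only [add_mul, map_add, smul_add, hx, hy]; abel
  | hc a u hu =>
    rw [mul_assoc, opL_lett_mul, hu, opL_lett_mul, opB_casC, opB_casC, map_mul (gr e), gr_lett]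
    simp only [mul_add, add_mul, smul_add, smul_mul_assoc, mul_smul_comm, mul_assoc, add_assoc]

theorem lamC_tmul {s : ℕ} (x : Chain k A r) (b : A) (w : TP k A s) {w' : TP k A n}
    (hw' : toWord w' = opL ((-1) ^ r) (casC F ν x) (toWord w)) :
    lamC F ν n x (b ⊗ₜ w) = b ⊗ₜ w' := by
  rw [lamC, chF_tmul, insL, opLam_jt, ← hw', clo_jt, ← embC_tmul, comp_embC]

/-- Insertion into the word of the invariant of y uses all positions of y and one more, behind the
letter v_j; that last position gives the product of the two Casimir elements. -/
theorem insL_embW_gam (h : r + s + 2 = n) (x : Chain k A r) (y : Chain k A s) :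
    insL F ν x (embW (piR s (gam F ν s y))) = embW (piR n (gam F ν n (lamC F ν n x y))) +
      (-1 : k) ^ (r * s + r) • (embW (piR s (gam F ν s y)) * sh (embW (piR r (gam F ν r x)))) := by
  obtain rfl : s + (r + 1 + 1) = n := by omega
  induction y using chain_induction with
  | h0 => simp [lamC]
  | hadd y y' hy hy' =>
    have hl : lamC F ν (s + (r + 1 + 1)) x (y + y') =
        lamC F ν (s + (r + 1 + 1)) x y + lamC F ν (s + (r + 1 + 1)) x y' := by
      simp only [lamC, map_add]
    rw [hl]
    simp only [map_add, add_mul, smul_add, hy, hy']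
    abel
  | hc b w =>
    obtain ⟨w', hw'⟩ := opL_mem_range ((-1) ^ r) (casC F ν x) (add_zero s) w
    rw [lamC_tmul F ν x b w hw', gam_tmul, gam_tmul, sh_embW]
    simp only [map_sum, Finset.sum_mul, Finset.smul_sum]
    rw [← Finset.sum_add_distrib]
    refine Finset.sum_congr rfl fun i _ => ?_
    rw [piR_tmul, piR_tmul, embW_tmul, embW_tmul, insL_al_mul, insL, opLam_jt, toWord_snoc,
      opL_casC_mul_lett, ← hw', toWord_snoc, mul_assoc (al _) (jt _ _) (jt _ _), jt_mul_jt, one_mul,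
      map_add,
      LinearMap.add_apply, mul_add, map_smul, LinearMap.smul_apply, gr_toWord, smul_mul_assoc,
      smul_mul_assoc, map_smul, LinearMap.smul_apply, smul_smul, mul_smul_comm, ← pow_mul, ← pow_add,
      add_comm (r * s) r]

theorem piR_comp_kappa (x : Chain k A r) :
    piR (r + 1) ∘ₗ ((-1 : k) ^ r • kappa F ν r 1 x) = extR (casC F ν x) 1 rfl rfl := by
  refine LinearMap.ext fun w => ?_
  rw [kappa_eq_theta, theta, LinearMap.comp_apply, LinearMap.smul_apply, LinearMap.smul_apply,
    LinearMap.comp_apply, LinearMap.comp_apply, pow_zero, one_smul, map_smul, piR_d_close, smul_smul,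
    ← pow_add]
  have h : (-1 : k) ^ (r + (r + 1 + 1)) = (-1) ^ 0 := neg_one_pow_eq_of (c := r + 1) (by ring)
  rw [h, pow_zero, one_smul]
  rfl

theorem opLam_extR_mul_jt (e : k) (x : Chain k A r) {p : ℕ} (y : A ⊗[k] TP k A p) (c : ABar k A) :
    opLam e (extR (casC F ν x) 1 rfl rfl) (embW y * jt (lett k A c) 1) =
      opLam e (casC F ν x) (embW y) * jt (lett k A c) 1 := by
  induction y with
  | zero => simp
  | add x y hx hy => simp only [map_add, add_mul, hx, hy]
  | tmul a w =>
    rw [embW_tmul, mul_assoc, jt_mul_jt, one_mul, opLam_al_mul, opLam_al_mul, opLam_jt, opLam_jt,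
      opL_extR, mul_assoc, jt_mul_jt, one_mul]

theorem opM_extR_lett (x : Chain k A r) (c : ABar k A) :
    opM (extR (casC F ν x) 1 rfl rfl) (jt (lett k A c) 1) =
      embW (piR r (gam F ν r x)) * jt (lett k A c) 1 := by
  rw [← toWord_letter, opM_extR_word _ le_rfl]
  exact insM_jt F ν x _ _

theorem opM_opLam_extR (e : k) (x : Chain k A r) (y : Chain k A s) (c : ABar k A) :
    opM (extR (casC F ν x) 1 rfl rfl)
        (opLam e (extR (casC F ν y) 1 rfl rfl) (jt (lett k A c) 1)) =
      embW (piR r (gam F ν r x)) * sh (embW (piR s (gam F ν s y))) * jt (lett k A c) 1 := by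
  have h := opL_extR e (casC F ν y) 1 c
  rw [one_mul, opL_one, opB_casC, mul_one] at h
  rw [opLam_jt, h, ← toWord_snoc, opM_extR_word _ (by omega), sh_embW, mul_assoc, jt_mul_jt,
    ← toWord_snoc, one_mul]
  exact insM_jt F ν x _ _

/-- The bracket of the cochains of two chains. -/
theorem bracketSg_kappa (x : Chain k A r) (y : Chain k A s) :
    bracketSg (m := 0) (n := 0) rfl (add_succ_add_succ_succ r s) (kappa F ν r 1 x) (kappa F ν s 1 y) =
      kappa F ν (r + s + 2) 1 (insBracket F ν (r + s + 2) x y) := by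
  have hk : ∀ {t : ℕ} (z : Chain k A t), kappa F ν t 1 z ∈ omegaCochains k A 1 (t + 1) := fun z => by
    rw [kappa_eq_theta]; exact theta_mem_omegaCochains _
  refine omegaCochains_ext (bracketSg_mem _ _ _ _) (hk _) fun w => ?_
  obtain ⟨c, rfl⟩ := letter.surjective w
  have h1 : bracketSg (m := 0) (n := 0) rfl (add_succ_add_succ_succ r s) (kappa F ν r 1 x) (kappa F ν s 1 y) =
      ((-1 : k) ^ r * (-1) ^ s) • bracketSg (m := 0) (n := 0) rfl
        (add_succ_add_succ_succ r s)
        ((-1 : k) ^ r • kappa F ν r 1 x) ((-1 : k) ^ s • kappa F ν s 1 y) := by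
    rw [bracketSg_smul_left, ← bracketL_apply, ← bracketL_apply, map_smul, smul_smul, smul_smul,
      mul_right_comm ((-1 : k) ^ r), neg_one_pow_mul_self, one_mul, neg_one_pow_mul_self, one_smul]
  have h2 : ∀ {t : ℕ} (z : Chain k A t), embW (piR (t + 1) (kappa F ν t 1 z (letter c))) =
      (-1 : k) ^ t • (embW (piR t (gam F ν t z)) * jt (lett k A c) 1) := fun {t} z => by
    have h := LinearMap.congr_fun (piR_comp_kappa F ν z) (letter c)
    rw [LinearMap.comp_apply, LinearMap.smul_apply, map_smul] at h
    have h3 : embW (extR (casC F ν z) 1 rfl rfl (letter c)) =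
        embW (piR t (gam F ν t z)) * jt (lett k A c) 1 := by
      rw [embW_extR, toWord_letter]
      exact insM_jt F ν z _ _
    rw [← h3, ← h, map_smul, smul_smul, neg_one_pow_mul_self, one_smul]
  have e1 : ∀ t : ℕ, (-1 : k) ^ (t + 1 + (0 + 1)) = (-1) ^ t := fun t =>
    neg_one_pow_eq_of (c := 1) (by ring)
  have e2 : (-1 : k) ^ ((r + 1 + (0 + 1)) * (s + 1 + (0 + 1))) = (-1) ^ (r * s) :=
    neg_one_pow_eq_of (c := r + s + 2) (by ring)
  have hL := insL_embW_gam F ν (n := r + s + 2) rfl x y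
  have hL' := insL_embW_gam F ν (n := r + s + 2) (by omega) y x
  rw [h1, LinearMap.smul_apply, map_smul, map_smul, embW_piR_bracketSg, brC, piR_comp_kappa,
    piR_comp_kappa, brOp_apply, toWord_letter, opM_opLam_extR, opM_opLam_extR, opM_extR_lett, opM_extR_lett,
    opLam_extR_mul_jt, opLam_extR_mul_jt, e1, e1, e2, ← insL, ← insL, hL, hL', h2, insBracket,
    map_add, map_smul, map_smul, map_add, map_smul, map_smul, map_add, map_smul, map_smul]
  generalize embW (piR r (gam F ν r x)) * sh (embW (piR s (gam F ν s y))) = z1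
  generalize embW (piR s (gam F ν s y)) * sh (embW (piR r (gam F ν r x))) = z2
  generalize embW (piR (r + s + 2) (gam F ν (r + s + 2) (lamC F ν (r + s + 2) x y))) = z3
  generalize embW (piR (r + s + 2) (gam F ν (r + s + 2) (lamC F ν (r + s + 2) y x))) = z4
  have e3 : (-1 : k) ^ (r + s + 2) = (-1) ^ r * (-1) ^ s := by rw [pow_add, pow_add]; ring
  have e4 : (-1 : k) ^ (s * r + s) = (-1) ^ (r * s) * (-1) ^ s := by rw [pow_add, mul_comm s]
  have e5 : (-1 : k) ^ (r * s + s) = (-1) ^ (r * s) * (-1) ^ s := pow_add _ _ _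
  have e6 : (-1 : k) ^ (r * s + r) = (-1) ^ (r * s) * (-1) ^ r := pow_add _ _ _
  have e7 := neg_one_pow_mul_self (k := k) r
  have e8 := neg_one_pow_mul_self (k := k) s
  have e9 := neg_one_pow_mul_self (k := k) (r * s)
  rw [e3, e4, e5, e6]
  generalize (-1 : k) ^ r = a at *
  generalize (-1 : k) ^ s = b at *
  generalize (-1 : k) ^ (r * s) = d at *
  rw [← sub_eq_zero, ← smul_sub]
  simp only [← smul_mul_assoc, ← add_mul, ← sub_mul]
  -- The products z1 and z2 from the last positions cancel against those of the compositions `opM`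
  -- after `opLam`; z3 and z4 form the commutator of insertions.
  have key : z1 + a • (z3 + (d * a) • z2) - d • (z2 + b • (z4 + (d * b) • z1)) -
      (a • z3 + -(d * b) • z4) = 0 := by
    have k1 : d * (b * (d * b)) = 1 := by linear_combination e9 * b * b + e8
    have k2 : a * (d * a) = d := by linear_combination d * e7
    simp only [smul_add, smul_smul, k1, k2]
    module
  rw [key, smul_zero, zero_mul]

end BracketKappa

/-! ### B² = 0, and the action on eigentensors -/

section ConnesSquare

variable {k : Type u} {A : Type v} [Field k] [Ring A] [Algebra k A]

/-- Every summand of the Connes operator contains the class of a₀ as a letter, and 1 vanishes in Ā;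
B² = 0 follows. -/
theorem connes_one_tmul (σ : A ≃ₐ[k] A) {r : ℕ} (w : TP k A r) : connes σ r (1 ⊗ₜ w) = 0 := by
  have h1 : proj k A 1 = 0 :=
    (Submodule.Quotient.mk_eq_zero _).2 (Submodule.mem_span_singleton_self 1)
  have h2 : ∀ (a b : ℕ) (t : TP k A a ⊗[k] TP k A b), LinearMap.rTensor (TP k A b)
      ((cons a).toLinearMap ∘ₗ TensorProduct.map (proj k A)
        (PiTensorProduct.map fun _ => barMap σ))
      ((TensorProduct.assoc k A (TP k A a) (TP k A b)).symm ((1 : A) ⊗ₜ t)) = 0 := fun a b t => by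
    induction t using TensorProduct.induction_on with
    | zero => rw [TensorProduct.tmul_zero, map_zero, map_zero]
    | add x y hx hy => rw [TensorProduct.tmul_add, map_add, map_add, hx, hy, add_zero]
    | tmul x y =>
      rw [TensorProduct.assoc_symm_tmul, LinearMap.rTensor_tmul, LinearMap.comp_apply,
        TensorProduct.map_tmul, h1, TensorProduct.zero_tmul, map_zero, TensorProduct.zero_tmul]
  rw [connes, LinearMap.comp_apply, LinearMap.sum_apply, Finset.sum_eq_zero, map_zero]
  intro j _
  rw [LinearMap.smul_apply, LinearMap.comp_apply, LinearMap.comp_apply, LinearMap.comp_apply,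
    LinearMap.comp_apply, LinearMap.lTensor_tmul, LinearEquiv.coe_coe, LinearEquiv.coe_coe, LinearEquiv.coe_coe, h2,
    map_zero, map_zero, smul_zero]

theorem connes_connes (σ : A ≃ₐ[k] A) {r : ℕ} (x : Chain k A r) :
    connes σ (r + 1) (connes σ r x) = 0 :=
  connes_one_tmul σ _

theorem autC_tprod (σ : A ≃ₐ[k] A) {r : ℕ} {c₀ : k} {c : Fin r → k} {a₀ : A} {a : Fin r → A}
    (h₀ : σ a₀ = c₀ • a₀) (h : ∀ i, σ (a i) = c i • a i) :
    autC σ r (a₀ ⊗ₜ PiTensorProduct.tprod k fun i => proj k A (a i)) =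
      (c₀ * ∏ i, c i) • (a₀ ⊗ₜ PiTensorProduct.tprod k fun i => proj k A (a i)) := by
  rw [autC, TensorProduct.map_tmul, PiTensorProduct.map_tprod, AlgEquiv.toLinearMap_apply, h₀]
  simp only [barMap_proj, h, map_smul]
  rw [MultilinearMap.map_smul_univ, TensorProduct.smul_tmul_smul]

end ConnesSquare

/-! ### Equivariance under the automorphism induced by ν⁻¹ -/

section Weights

variable {k : Type u} {A : Type v} [Field k] [Ring A] [Algebra k A] [FiniteDimensional k A]
  (F : FrobeniusForm k A) {ν : A ≃ₐ[k] A} (hν : IsNakayama F ν) {r s n : ℕ}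
include hν

theorem range_bd_le_hatZ (r : ℕ) : LinearMap.range (bd ν.symm r) ≤ hatZ F ν r := by
  rintro _ ⟨y, rfl⟩
  rw [← gam_mem_Omega_iff F hν, ← d_gam F hν]
  exact d_mem_Omega _

theorem bd_bd (x : Chain k A (r + 2)) : bd ν.symm r (bd ν.symm (r + 1) x) = 0 :=
  LinearMap.mem_ker.1 (range_bd_le_hatZ F hν (r + 1) ⟨x, rfl⟩)

/-- Applying ∂ to the formula for ∂B + B∂ in two neighbouring degrees gives ∂B∂ both as ∂T - ∂ and
as T∂ - ∂. The same argument with B² = 0 shows that T commutes with B. -/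
theorem autC_bd (x : Chain k A (r + 1)) :
    autC ν.symm r (bd ν.symm r x) = bd ν.symm r (autC ν.symm (r + 1) x) := by
  have h := congrArg (bd ν.symm r) (bd_connes_succ ν.symm x)
  rw [map_add, bd_bd F hν, zero_add, map_sub] at h
  have h' : bd ν.symm r (connes ν.symm r (bd ν.symm r x)) =
      autC ν.symm r (bd ν.symm r x) - bd ν.symm r x := by
    cases r with
    | zero => exact bd_connes_zero _ _
    | succ r => rw [← bd_connes_succ, bd_bd F hν, map_zero, add_zero]
  exact sub_left_injective (h'.symm.trans h)

omit hν [FiniteDimensional k A] in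
theorem autC_connes (σ : A ≃ₐ[k] A) (x : Chain k A r) :
    autC σ (r + 1) (connes σ r x) = connes σ r (autC σ r x) := by
  have h := bd_connes_succ σ (connes σ r x)
  rw [connes_connes, map_zero, zero_add] at h
  refine sub_left_injective (h.symm.trans ?_)
  change _ = connes σ r (autC σ r x) - connes σ r x
  rw [← map_sub]
  cases r with
  | zero => rw [bd_connes_zero]
  | succ r => rw [← bd_connes_succ, map_add, connes_connes, add_zero]

omit hν in
theorem autC_sub_of_mem_hatZ {x : Chain k A r} (hx : x ∈ hatZ F ν r) :
    autC ν.symm r x - x = bd ν.symm r (connes ν.symm r x) := by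
  cases r with
  | zero => rw [bd_connes_zero]
  | succ r =>
    have h : bd ν.symm r x = 0 := LinearMap.mem_ker.1 hx
    rw [← bd_connes_succ, h, map_zero, add_zero]

theorem autC_mem_hatZ {x : Chain k A r} (hx : x ∈ hatZ F ν r) : autC ν.symm r x ∈ hatZ F ν r := by
  rw [← sub_add_cancel (autC ν.symm r x) x, autC_sub_of_mem_hatZ F hx]
  exact add_mem (range_bd_le_hatZ F hν r ⟨_, rfl⟩) hx

/-- The Casimir element is fixed by ν ⊗ ν, hence the ⋆-product is equivariant. -/
theorem autC_star (h : r + s + 1 = n) (x : Chain k A r) (y : Chain k A s) :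
    autC ν.symm n (star F ν h x y) = star F ν h (autC ν.symm r x) (autC ν.symm s y) := by
  induction x using chain_induction with
  | h0 =>
    rw [map_zero, ← starB_apply, ← starB_apply, map_zero, LinearMap.zero_apply,
      LinearMap.zero_apply, map_zero]
  | hadd x x' hx hx' =>
    rw [← starB_apply] at hx hx' ⊢
    rw [← starB_apply] at hx hx' ⊢
    rw [map_add, map_add, map_add, LinearMap.add_apply, LinearMap.add_apply, map_add, hx, hx']
  | hc a v =>
    induction y using chain_induction with
    | h0 => rw [map_zero, ← starB_apply, ← starB_apply, map_zero, map_zero, map_zero]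
    | hadd x x' hx hx' =>
      rw [← starB_apply] at hx hx' ⊢
      rw [← starB_apply] at hx hx' ⊢
      rw [map_add, map_add, map_add, map_add, hx, hx']
    | hc b w =>
      apply embC_injective
      let Φ : A →ₗ[k] A →ₗ[k] A ⊗[k] WordAlg k A := LinearMap.mk₂ k
        (fun x y => (y * ν.symm b) ⊗ₜ (autW ν.symm (toWord w) *
          (lett k A (proj k A (x * a)) * autW ν.symm (toWord v))))
        (fun x y z => by
          simp only [add_mul, mul_add, map_add, TensorProduct.tmul_add])
        (fun c x y => by
          simp only [smul_mul_assoc, mul_smul_comm, map_smul, TensorProduct.tmul_smul])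
        (fun x y z => by simp only [add_mul, TensorProduct.add_tmul])
        (fun c x y => by
          simp only [smul_mul_assoc, TensorProduct.smul_tmul'])
      have hΦ := sum_nakayama_dualU_dualV F hν (Φ.compl₁₂ ν.symm.toLinearMap ν.symm.toLinearMap)
      simp only [LinearMap.compl₁₂_apply, AlgEquiv.toLinearMap_apply,
        AlgEquiv.symm_apply_apply] at hΦ
      have e1 : embC (autC ν.symm n (star F ν h (a ⊗ₜ v) (b ⊗ₜ w))) =
          ∑ i, Φ (ν.symm (dualU (k := k) i)) (ν.symm (dualV F i)) := by
        rw [star_tmul, map_sum, map_sum]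
        refine Finset.sum_congr rfl fun i _ => ?_
        rw [embC_autC, toWord_conc, toWord_cons, map_mul, map_mul, map_mul, autW_lett, barMap_proj,
          map_mul, AlgEquiv.symm_apply_apply]
        rfl
      have e2 : embC (star F ν h (autC ν.symm r (a ⊗ₜ v)) (autC ν.symm s (b ⊗ₜ w))) =
          ∑ i, Φ (dualU (k := k) i) (dualV F i) := by
        rw [autC, autC, TensorProduct.map_tmul, TensorProduct.map_tmul, embC_star_tmul]
        refine Finset.sum_congr rfl fun i _ => ?_
        rw [toWord_map, toWord_map, AlgEquiv.toLinearMap_apply, AlgEquiv.toLinearMap_apply,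
          AlgEquiv.apply_symm_apply]
        rfl
      rw [e1, e2, hΦ]

theorem autC_bracketBV (x : Chain k A r) (y : Chain k A s) :
    autC ν.symm (r + s + 2) (bracketBV F ν x y) =
      bracketBV F ν (autC ν.symm r x) (autC ν.symm s y) := by
  rw [bracketBV_eq_smul, bracketBV_eq_smul, ← autC_connes, ← autC_connes, ← autC_star F hν,
    ← autC_star F hν, ← autC_star F hν, ← autC_connes, map_smul, map_add, map_add, map_smul,
    map_smul]

end Weights

/-! ### Weight one as a fixed space; the quasi-isomorphism -/

section WeightDecomposition

variable {k : Type u} {A : Type v} [Field k] [Ring A] [Algebra k A] {ν : A ≃ₐ[k] A}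

theorem symm_apply_of_mem_eigenspace {c : k} {a : A} (hc : c ≠ 0)
    (ha : a ∈ Module.End.eigenspace ν.toLinearMap c) : ν.symm a = c⁻¹ • a := by
  rw [AlgEquiv.symm_apply_eq, map_smul, ← AlgEquiv.toLinearMap_apply,
    Module.End.mem_eigenspace_iff.1 ha, smul_smul, inv_mul_cancel₀ hc, one_smul]

theorem weightOne_le (ν : A ≃ₐ[k] A) (r : ℕ) :
    weightOne ν r ≤ Module.End.eigenspace (autC ν.symm r) 1 := by
  refine Submodule.span_le.2 ?_
  rintro _ ⟨c₀, c, a₀, a, h₀, h, hc, rfl⟩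
  have hn : ∀ i, c i ≠ 0 := fun i =>
    Finset.prod_ne_zero_iff.1 (right_ne_zero_of_mul (hc ▸ one_ne_zero)) i (Finset.mem_univ i)
  rw [SetLike.mem_coe, Module.End.mem_eigenspace_iff,
    autC_tprod ν.symm (symm_apply_of_mem_eigenspace (left_ne_zero_of_mul (hc ▸ one_ne_zero)) h₀)
      fun i => symm_apply_of_mem_eigenspace (hn i) (h i),
    Finset.prod_inv_distrib, ← mul_inv, hc, inv_one]

variable (hdiag : ⨆ c : k, Module.End.eigenspace ν.toLinearMap c = ⊤)
include hdiag

theorem span_eigenvectors :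
    Submodule.span k {a : A | ∃ c : k, c ≠ 0 ∧ a ∈ Module.End.eigenspace ν.toLinearMap c} = ⊤ := by
  rw [eq_top_iff, ← hdiag]
  refine iSup_le fun c a ha => ?_
  by_cases hc : c = 0
  · have h := Module.End.mem_eigenspace_iff.1 ha
    rw [hc, zero_smul, AlgEquiv.toLinearMap_apply] at h
    rw [(map_eq_zero_iff ν ν.injective).1 h]
    exact zero_mem _
  · exact Submodule.subset_span ⟨c, hc, ha⟩

theorem span_eigentensors (r : ℕ) :
    Submodule.span k {w : TP k A r | ∃ (c : Fin r → k) (a : Fin r → A), (∀ i, c i ≠ 0) ∧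
      (∀ i, a i ∈ Module.End.eigenspace ν.toLinearMap (c i)) ∧
      w = PiTensorProduct.tprod k fun i => proj k A (a i)} = ⊤ := by
  have h := PiTensorProduct.submodule_span_eq_top (R := k) (ι := Fin r) (M := fun _ => ABar k A)
    (γ := fun _ => {a : A | ∃ c : k, c ≠ 0 ∧ a ∈ Module.End.eigenspace ν.toLinearMap c})
    (g := fun _ a => proj k A a.1) (fun _ => by
      rw [Set.range_comp' (proj k A) Subtype.val, Subtype.range_val, ← Submodule.map_span,
        span_eigenvectors hdiag, Submodule.map_top, Submodule.range_mkQ])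
  rw [eq_top_iff, ← h]
  refine Submodule.span_mono ?_
  rintro _ ⟨a, rfl⟩
  choose c hc ha using fun i => (a i).2
  exact ⟨c, fun i => (a i).1, hc, ha, rfl⟩

/-- Tensors of eigenvectors span since ν is diagonalizable; those with eigenvalues of product 1 have
weight one, the others lie in eigenspaces of T for the inverse product. -/
theorem weightOne_sup (r : ℕ) : weightOne ν r ⊔
    ⨆ (c : k) (_ : c ≠ 1), Module.End.eigenspace (autC ν.symm r) c = ⊤ := by
  generalize hT : weightOne ν r ⊔
    ⨆ (c : k) (_ : c ≠ 1), Module.End.eigenspace (autC ν.symm r) c = T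
  rw [eq_top_iff]
  rintro x -
  induction x using chain_induction with
  | h0 => exact zero_mem _
  | hadd x y hx hy => exact add_mem hx hy
  | hc a₀ w =>
    have hw : w ∈ (⊤ : Submodule k (TP k A r)) := Submodule.mem_top
    rw [← span_eigentensors hdiag r] at hw
    induction hw using Submodule.span_induction with
    | zero => rw [TensorProduct.tmul_zero]; exact zero_mem _
    | add x y _ _ hx hy => rw [TensorProduct.tmul_add]; exact add_mem hx hy
    | smul c x _ hx => rw [TensorProduct.tmul_smul]; exact Submodule.smul_mem _ _ hx
    | mem w hw =>
      obtain ⟨c, a, hc, ha, rfl⟩ := hw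
      have h₀ : a₀ ∈ (⊤ : Submodule k A) := Submodule.mem_top
      rw [← span_eigenvectors hdiag] at h₀
      induction h₀ using Submodule.span_induction with
      | zero => rw [TensorProduct.zero_tmul]; exact zero_mem _
      | add x y _ _ hx hy => rw [TensorProduct.add_tmul]; exact add_mem hx hy
      | smul c x _ hx => rw [← TensorProduct.smul_tmul']; exact Submodule.smul_mem _ _ hx
      | mem a₀ h₀ =>
        obtain ⟨c₀, hc₀, h₀⟩ := h₀
        rw [← hT]
        by_cases h : c₀ * ∏ i, c i = 1
        · exact Submodule.mem_sup_left (Submodule.subset_span ⟨c₀, c, a₀, a, h₀, ha, h, rfl⟩)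
        · refine Submodule.mem_sup_right (Submodule.mem_iSup_of_mem (c₀⁻¹ * ∏ i, (c i)⁻¹)
            (Submodule.mem_iSup_of_mem ?_ (Module.End.mem_eigenspace_iff.2
              (autC_tprod ν.symm (symm_apply_of_mem_eigenspace hc₀ h₀) fun i =>
                symm_apply_of_mem_eigenspace (hc i) (ha i)))))
          rwa [Finset.prod_inv_distrib, ← mul_inv, ne_eq, inv_eq_one]

omit hdiag in
theorem eq_zero_of_mem_eigenspaces {r : ℕ} {x : Chain k A r}
    (h₁ : x ∈ Module.End.eigenspace (autC ν.symm r) 1)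
    (h₂ : x ∈ ⨆ (c : k) (_ : c ≠ 1), Module.End.eigenspace (autC ν.symm r) c) : x = 0 :=
  Submodule.disjoint_def.1 (Module.End.eigenspaces_iSupIndep (autC ν.symm r) 1) x h₁ h₂

/-- By independence of eigenspaces, a fixed chain has no component in the other eigenspaces. This
turns the spanning-set definition into an equation that is stable under all equivariant operations.
-/
theorem weightOne_eq (r : ℕ) : weightOne ν r = Module.End.eigenspace (autC ν.symm r) 1 := by
  refine le_antisymm (weightOne_le ν r) fun x hx => ?_
  have h : x ∈ (⊤ : Submodule k (Chain k A r)) := Submodule.mem_top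
  rw [← weightOne_sup hdiag r] at h
  obtain ⟨y, hy, z, hz, rfl⟩ := Submodule.mem_sup.1 h
  have hz' := eq_zero_of_mem_eigenspaces (by
    simpa using sub_mem hx (weightOne_le ν r hy)) hz
  rwa [hz', add_zero]

variable [FiniteDimensional k A] (F : FrobeniusForm k A) (hν : IsNakayama F ν)
include hν

/-- T preserves cycles and is diagonalizable, so cycles decompose into eigencycles, and Tx - x = ∂Bx
on cycles. -/
theorem hatZ_le (r : ℕ) :
    hatZ F ν r ≤ weightOne ν r ⊓ hatZ F ν r ⊔ LinearMap.range (bd ν.symm r) := by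
  have htop : ⨆ c : k, Module.End.eigenspace (autC ν.symm r) c = ⊤ := by
    rw [eq_top_iff, ← weightOne_sup hdiag r]
    exact sup_le ((weightOne_le ν r).trans (le_iSup (Module.End.eigenspace (autC ν.symm r)) 1))
      (iSup_le fun c => iSup_le fun _ => le_iSup (Module.End.eigenspace (autC ν.symm r)) c)
  have h := Submodule.eq_iSup_inf_genEigenspace (p := hatZ F ν r) 1
    (fun _ hx => autC_mem_hatZ F hν hx) htop
  intro x hx
  rw [h] at hx
  refine (iSup_le fun c y hy => ?_ :
    ⨆ c, hatZ F ν r ⊓ Module.End.eigenspace (autC ν.symm r) c ≤ _) hx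
  by_cases hc : c = 1
  · rw [weightOne_eq hdiag]
    rw [hc] at hy
    exact Submodule.mem_sup_left ⟨hy.2, hy.1⟩
  -- For eigenvalue c ≠ 1 the formula reads (c - 1)y = ∂By, so y is a boundary.
  · refine Submodule.mem_sup_right ⟨(c - 1)⁻¹ • connes ν.symm r y, ?_⟩
    rw [map_smul, ← autC_sub_of_mem_hatZ F hy.1, Module.End.mem_eigenspace_iff.1 hy.2,
      ← one_smul k y, smul_smul, ← sub_smul, smul_smul, mul_one,
      inv_mul_cancel₀ (sub_ne_zero.2 hc)]

/-- Split a preimage into its weight-one part and a part in the other eigenspaces. The boundary of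
the latter lies in the other eigenspaces and, being a difference of fixed chains, is fixed as well,
so it vanishes. -/
theorem mem_map_weightOne {r : ℕ} {x : Chain k A r} (hx : x ∈ weightOne ν r)
    (h : x ∈ LinearMap.range (bd ν.symm r)) : x ∈ (weightOne ν (r + 1)).map (bd ν.symm r) := by
  obtain ⟨y, rfl⟩ := h
  have hy : y ∈ (⊤ : Submodule k (Chain k A (r + 1))) := Submodule.mem_top
  rw [← weightOne_sup hdiag (r + 1)] at hy
  obtain ⟨y₁, h₁, y₂, h₂, rfl⟩ := Submodule.mem_sup.1 hy
  have hmap : ∀ {c : k} {z : Chain k A (r + 1)},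
      z ∈ Module.End.eigenspace (autC ν.symm (r + 1)) c →
        bd ν.symm r z ∈ Module.End.eigenspace (autC ν.symm r) c := fun {c z} hz => by
    rw [Module.End.mem_eigenspace_iff, autC_bd F hν, Module.End.mem_eigenspace_iff.1 hz, map_smul]
  have h₃ : bd ν.symm r y₂ ∈ ⨆ (c : k) (_ : c ≠ 1), Module.End.eigenspace (autC ν.symm r) c := by
    refine (iSup_le fun c => iSup_le fun hc z hz => ?_ :
      ⨆ (c : k) (_ : c ≠ 1), Module.End.eigenspace (autC ν.symm (r + 1)) c ≤
        (⨆ (c : k) (_ : c ≠ 1), Module.End.eigenspace (autC ν.symm r) c).comap (bd ν.symm r)) h₂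
    exact Submodule.mem_iSup_of_mem c (Submodule.mem_iSup_of_mem hc (hmap hz))
  have h₄ : bd ν.symm r y₂ = 0 := by
    refine eq_zero_of_mem_eigenspaces ?_ h₃
    have h₅ := sub_mem (weightOne_le ν r hx) (hmap (weightOne_le ν (r + 1) h₁))
    rwa [map_add, add_sub_cancel_left] at h₅
  exact ⟨y₁, h₁, by rw [map_add, h₄, add_zero]⟩

/-- The inclusion of the weight-one subcomplex is a quasi-isomorphism. -/
def weightEquiv (r : ℕ) : HatHH1 F ν r ≃ₗ[k] HatHH F ν r :=
  subEquiv LinearMap.id (fun _ hx => hx.2)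
    (fun _ _ hB => by
      obtain ⟨y, -, rfl⟩ := hB
      exact ⟨y, rfl⟩)
    (fun _ hx h => mem_map_weightOne hdiag F hν hx.1 h)
    (fun y hy => by
      obtain ⟨z, hz, b, hb, rfl⟩ := Submodule.mem_sup.1 (hatZ_le hdiag F hν r hy)
      refine ⟨z, hz, ?_⟩
      rw [LinearMap.id_apply, sub_add_cancel_left]
      exact neg_mem hb)

theorem weightEquiv_induces (r : ℕ) :
    Induces (weightEquiv hdiag F hν r).toLinearMap (fun x => x) :=
  subEquiv_induces _ _ _ _ _

end WeightDecomposition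

/-! ### Descent of { , } to cohomology and the first square -/

section BracketOnWeightOne

variable {k : Type u} {A : Type v} [Field k] [Ring A] [Algebra k A] [FiniteDimensional k A]
  (F : FrobeniusForm k A) {ν : A ≃ₐ[k] A} (hν : IsNakayama F ν)
  {r s : ℕ} {x : Chain k A r} {y : Chain k A s}

/-- The bracket of chains as a bilinear map. -/
def bracketBVL (ν : A ≃ₐ[k] A) (r s : ℕ) :
    Chain k A r →ₗ[k] Chain k A s →ₗ[k] Chain k A (r + s + 2) :=
  (-1 : k) ^ (r * s + 1) •
    ((-1 : k) ^ s • (starB F ν rfl).compr₂ (connes ν.symm (r + s + 1))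
      + starB F ν (by omega) ∘ₗ connes ν.symm r
      + (-1 : k) ^ (s + 1) • (starB F ν (by omega)).compl₂ (connes ν.symm s))

theorem bracketBVL_apply (ν : A ≃ₐ[k] A) (x : Chain k A r) (y : Chain k A s) :
    bracketBVL F ν r s x y = bracketBV F ν x y := by
  rw [bracketBV_eq_smul]
  rfl

include hν

theorem kappa_mem_extZ (hx : x ∈ hatZ F ν r) : kappa F ν r 1 x ∈ extZ k A 1 (r + 1) :=
  (kappaEquiv_induces F hν r x hx).1

theorem kappa_mem_extB_iff (hx : x ∈ hatZ F ν r) :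
    kappa F ν r 1 x ∈ extB k A 1 (r + 1) ↔ x ∈ LinearMap.range (bd ν.symm r) := by
  obtain ⟨h, e⟩ := kappaEquiv_induces F hν r x hx
  have h1 := (kappaEquiv F hν r).map_eq_zero_iff (x := cls x hx)
  rw [← LinearEquiv.coe_coe, e] at h1
  exact (cls_eq_zero h).symm.trans (h1.trans (cls_eq_zero hx))

/-- The question is moved to Ext¹ by κ, which detects boundaries and carries this bracket to the
bracket of cochains, where coboundaries are already under control. -/
theorem insBracket_mem_range_left (hx : x ∈ LinearMap.range (bd ν.symm r))
    (hy : y ∈ hatZ F ν s) :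
    insBracket F ν (r + s + 2) x y ∈ LinearMap.range (bd ν.symm (r + s + 2)) := by
  have hx' := range_bd_le_hatZ F hν r hx
  rw [← kappa_mem_extB_iff F hν (insBracket_mem_hatZ F hν hx' hy), ← bracketSg_kappa]
  exact bracketSg_mem_extB_left F rfl _ ((kappa_mem_extB_iff F hν hx').2 hx)
    (kappa_mem_extZ F hν hy)

theorem insBracket_mem_range_right (hx : x ∈ hatZ F ν r)
    (hy : y ∈ LinearMap.range (bd ν.symm s)) :
    insBracket F ν (r + s + 2) x y ∈ LinearMap.range (bd ν.symm (r + s + 2)) := by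
  have hy' := range_bd_le_hatZ F hν s hy
  rw [← kappa_mem_extB_iff F hν (insBracket_mem_hatZ F hν hx hy'), ← bracketSg_kappa]
  exact bracketSg_mem_extB_right F rfl _ (kappa_mem_extZ F hν hx)
    ((kappa_mem_extB_iff F hν hy').2 hy)

variable (hdiag : ⨆ c : k, Module.End.eigenspace ν.toLinearMap c = ⊤)

omit hν [FiniteDimensional k A] in
theorem autC_of_mem_weightOne (hx : x ∈ weightOne ν r) : autC ν.symm r x = x := by
  rw [Module.End.mem_eigenspace_iff.1 (weightOne_le ν r hx), one_smul]

theorem bracketBV_sub_mem (hx : x ∈ weightOne ν r ⊓ hatZ F ν r)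
    (hy : y ∈ weightOne ν s ⊓ hatZ F ν s) : bracketBV F ν x y - insBracket F ν (r + s + 2) x y ∈
      LinearMap.range (bd ν.symm (r + s + 2)) :=
  bracketBV_sub_insBracket_mem F hν hx.2 hy.2 (autC_of_mem_weightOne hy.1)

include hdiag

/-- Weight one is preserved by equivariance; the cycle condition follows since the bracket is a
boundary plus a commutator of insertions. -/
theorem bracketBV_mem (hx : x ∈ weightOne ν r ⊓ hatZ F ν r)
    (hy : y ∈ weightOne ν s ⊓ hatZ F ν s) :
    bracketBV F ν x y ∈ weightOne ν (r + s + 2) ⊓ hatZ F ν (r + s + 2) := by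
  constructor
  · rw [weightOne_eq hdiag, SetLike.mem_coe, Module.End.mem_eigenspace_iff, autC_bracketBV F hν,
      autC_of_mem_weightOne hx.1, autC_of_mem_weightOne hy.1, one_smul]
  · have h := add_mem (range_bd_le_hatZ F hν _ (bracketBV_sub_mem F hν hx hy))
      (insBracket_mem_hatZ F hν hx.2 hy.2)
    rwa [sub_add_cancel] at h

theorem bracketBV_mem_map (hx : x ∈ weightOne ν r ⊓ hatZ F ν r)
    (hy : y ∈ weightOne ν s ⊓ hatZ F ν s)
    (h : insBracket F ν (r + s + 2) x y ∈ LinearMap.range (bd ν.symm (r + s + 2))) :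
    bracketBV F ν x y ∈ (weightOne ν (r + s + 2 + 1)).map (bd ν.symm (r + s + 2)) := by
  refine mem_map_weightOne hdiag F hν (bracketBV_mem F hν hdiag hx hy).1 ?_
  have h' := add_mem (bracketBV_sub_mem F hν hx hy) h
  rwa [sub_add_cancel] at h'

/-- The bracket on the cohomology of the weight-one subcomplex. -/
def weightBracket (r s : ℕ) :
    HatHH1 F ν r →ₗ[k] HatHH1 F ν s →ₗ[k] HatHH1 F ν (r + s + 2) :=
  subMap₂ (bracketBVL F ν r s)
    (fun x hx y hy => by
      rw [bracketBVL_apply]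
      exact bracketBV_mem F hν hdiag hx hy)
    (fun x hx hB y hy => by
      rw [bracketBVL_apply]
      refine bracketBV_mem_map F hν hdiag hx hy (insBracket_mem_range_left F hν ?_ hy.2)
      obtain ⟨z, -, rfl⟩ := hB
      exact ⟨z, rfl⟩)
    (fun x hx y hy hB => by
      rw [bracketBVL_apply]
      refine bracketBV_mem_map F hν hdiag hx hy (insBracket_mem_range_right F hν hx.2 ?_)
      obtain ⟨z, -, rfl⟩ := hB
      exact ⟨z, rfl⟩)

theorem weightBracket_induces (r s : ℕ) :
    Induces₂ (weightBracket F hν hdiag r s) (bracketBV F ν) := by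
  rw [show (bracketBV F ν : Chain k A r → Chain k A s → _) = fun x y => bracketBVL F ν r s x y from
    funext fun x => funext fun y => (bracketBVL_apply F ν x y).symm]
  exact subMap₂_induces _ _ _ _

theorem kappaEquiv_weightBracket (x : HatHH1 F ν r) (y : HatHH1 F ν s) :
    kappaEquiv F hν (r + s + 2) (weightEquiv hdiag F hν (r + s + 2)
        (weightBracket F hν hdiag r s x y)) =
      sgBracket F r s (kappaEquiv F hν r (weightEquiv hdiag F hν r x))
        (kappaEquiv F hν s (weightEquiv hdiag F hν s y)) := by
  obtain ⟨x, hx, rfl⟩ := exists_cls x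
  obtain ⟨y, hy, rfl⟩ := exists_cls y
  obtain ⟨h₁, e₁⟩ := weightBracket_induces F hν hdiag r s x hx y hy
  obtain ⟨h₂, e₂⟩ := kappaEquiv_induces F hν r x hx.2
  obtain ⟨h₃, e₃⟩ := kappaEquiv_induces F hν s y hy.2
  obtain ⟨h₄, e₄⟩ := sgBracket_induces F r s _ h₂ _ h₃
  have h₅ := insBracket_mem_hatZ F hν hx.2 hy.2
  obtain ⟨h₆, e₆⟩ := kappaEquiv_induces F hν (r + s + 2) _ h₅
  have e₇ : weightEquiv hdiag F hν (r + s + 2) (cls (bracketBV F ν x y) h₁) =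
      cls (insBracket F ν (r + s + 2) x y) h₅ :=
    (cls_eq_cls _ _).2 (bracketBV_sub_mem F hν hx hy)
  have e₈ : sgBracket F r s (cls _ h₂) (cls _ h₃) = cls _ h₆ :=
    e₄.trans (cls_congr (bracketSg_kappa F ν x y) _ _)
  refine (congrArg (fun z => kappaEquiv F hν (r + s + 2) (weightEquiv hdiag F hν (r + s + 2) z))
    e₁).trans ((congrArg (kappaEquiv F hν (r + s + 2)) e₇).trans (e₆.trans (e₈.symm.trans ?_)))
  exact congrArg₂ (fun a b => sgBracket F r s a b) e₂.symm e₃.symm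

end BracketOnWeightOne

end TateHochschild

end

/-! ### Assembly of the diagram -/

open TateHochschild in
theorem mainTheorem8 {k : Type*} {A : Type*} [Field k] [Ring A] [Algebra k A]
    [FiniteDimensional k A] (F : FrobeniusForm k A) (ν : A ≃ₐ[k] A) (hν : IsNakayama F ν)
    (hdiag : ⨆ c : k, Module.End.eigenspace ν.toLinearMap c = ⊤) :
    -- the vertical isomorphisms and the horizontal brackets, all induced by the cochain formulas
    ∃ (j : ∀ r, HatHH1 F ν r ≃ₗ[k] HatHH F ν r)
      (κ : ∀ r, HatHH F ν r ≃ₗ[k] ExtOmega k A 1 (r + 1))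
      (ι : ∀ r, ExtOmega k A 1 (r + 1) ≃ₗ[k] Tate k A r)
      (bv : ∀ r s, HatHH1 F ν r →ₗ[k] HatHH1 F ν s →ₗ[k] HatHH1 F ν (r + s + 2))
      (sg : ∀ r s, ExtOmega k A 1 (r + 1) →ₗ[k] ExtOmega k A 1 (s + 1) →ₗ[k]
        ExtOmega k A 1 (r + s + 2 + 1))
      (tate : ∀ r s, Tate k A r →ₗ[k] Tate k A s →ₗ[k] Tate k A (r + s + 2)),
      (∀ r, Induces (j r).toLinearMap (fun x => x)) ∧
      (∀ r, Induces (κ r).toLinearMap (kappa F ν r 1)) ∧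
      (∀ r, Induces (ι r).toLinearMap (inc r 1)) ∧
      (∀ r s, Induces₂ (bv r s) (bracketBV F ν)) ∧
      (∀ r s, Induces₂ (sg r s) (bracketSg (m := 0) (n := 0) rfl (by omega))) ∧
      (∀ r s l l' (f : Cochain k A (l + 1) (r + (l + 1))) (g : Cochain k A (l' + 1) (s + (l' + 1)))
        (hf : f ∈ extZ k A (l + 1) (r + (l + 1))) (hg : g ∈ extZ k A (l' + 1) (s + (l' + 1))),
        ∃ (hf' : inc r (l + 1) f ∈ tateZ k A r) (hg' : inc s (l' + 1) g ∈ tateZ k A s)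
          (hfg : inc (r + s + 2) (l + l' + 1) (bracketSg rfl (by omega) f g) ∈
            tateZ k A (r + s + 2)),
          tate r s (cls _ hf') (cls _ hg') = cls _ hfg) ∧
      -- commutativity of the diagram
      (∀ r s (x : HatHH1 F ν r) (y : HatHH1 F ν s),
        κ (r + s + 2) (j (r + s + 2) (bv r s x y)) = sg r s (κ r (j r x)) (κ s (j s y))) ∧
      (∀ r s (x : ExtOmega k A 1 (r + 1)) (y : ExtOmega k A 1 (s + 1)),
        ι (r + s + 2) (sg r s x y) = tate r s (ι r x) (ι s y)) := by
  exact ⟨fun r => weightEquiv hdiag F hν r, fun r => kappaEquiv F hν r, fun r => iotaEquiv F r,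
    fun r s => weightBracket F hν hdiag r s, fun r s => sgBracket F r s,
    fun r s => tateBracket F r s, weightEquiv_induces hdiag F hν, kappaEquiv_induces F hν,
    iotaEquiv_induces F, weightBracket_induces F hν hdiag, sgBracket_induces F,
    fun r s l l' f g hf hg => ⟨inc_mem_tateZ hf, inc_mem_tateZ hg,
      inc_mem_tateZ (bracketSg_mem_extZ rfl _ hf hg), tateBracket_cls F hf hg _⟩,
    fun r s => kappaEquiv_weightBracket F hν hdiag, fun r s => tateBracket_iota F r s⟩
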